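/- Let $\Lambda$ be a free $\mathbb Z$-module of finite rank and $J:\Lambda\times\Lambda\to\mathbb Z$ a bilinear form. Put $\mathfrak t=\mathbb R\otimes\Lambda$ and $T=\mathfrak t/\Lambda$, with quotient map $\exp:\mathfrak t\to T$; extend $J$ bilinearly to $\mathfrak t$ and write also $\exp(r)=e^{2\pi i r}\in U(1)$ for $r\in\mathbb R$. Let $pt/\!/U(1)$ be the one-object groupoid with automorphism group $U(1)$. Consider the following three Lie 2-groups, i.e. 2-group objects in the localized bicategory $\mathbf{Bibun}$ of Lie groupoids, bibundles and morphisms of bibundles. (1) The strict 2-group $(\mathcal T,\bullet,0)$ of the crossed module $\Lambda\times U(1)\to\mathfrak t$, $(m,z)\mapsto m$, where $x\in\mathfrak t$ acts by $(m,z)\mapsto(m,z\exp(J(m,x)))$. Its objects are the $x\in\mathfrak t$, its arrows are $x\xrightarrow{z}x+m$ with $m\in\Lambda$, $z\in U(1)$, composition multiplies the labels $z$ and adds the $m$, and $(x\xrightarrow{z}x+m)\bullet(y\xrightarrow{w}y+n)=(x+y\xrightarrow{zw\exp(J(m,y))}x+y+m+n)$. (2) The compact model: the Lie groupoid $\mathfrak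 T=T\times pt/\!/U(1)$ with the 2-group structure inherited from (1) along the weak equivalence $p:\mathcal T\to\mathfrak T$ induced by $\exp$; its multiplication is the bibundle composed from the zig-zag $\mathfrak T\times\mathfrak T\xleftarrow{\sim}\mathcal T\times\mathcal T\xrightarrow{\bullet}\mathcal T\xrightarrow{\sim}\mathfrak T$. (3) The 2-group of the multiplicative structure $(\mathbf L,\alpha)$ on the trivial bundle gerbe over $T$. Here $\mathbf L=(\mathbb C\times\mathfrak t\times\mathfrak t)/\!\sim$, $(z,x,y)\sim(z\exp(J(m,y)),x+m,y+n)$ for $m,n\in\Lambda$, is the hermitian line bundle over $T\times T$ with multipliers $\exp(J(m,y))$, and $\alpha:\mathbf L_{rs,t}\otimes\mathbf L_{r,s}\cong\mathbf L_{r,st}\otimes\mathbf L_{s,t}$ is the isomorphism $[a,x+y,z]\otimes[b,x,y]\mapsto[a,x,y+z]\otimes[b,y,z]$. The trivial gerbe corresponds to the groupoid $\mathcal I$ of pairs $(t,L)$ with $t\in T$ and $L$ a hermitian line, whose arrows $(t,L)\to(t,L')$ are the unitary isomorphisms $L\to L'$; it carries the monoidal structure $(s,L_1)\circledast(t,L_2)=(st,\mathbf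 L_{s,t}\otimes L_1\otimes L_2)$ with unit object $(1,\mathbb C)$, associativity encoded in $\alpha$, and unit isomorphisms given by $[z,0,y]\mapsto z$ and $[z,x,0]\mapsto z$. The underlying Lie groupoid is $T\times pt/\!/U(1)$, which is equivalent to $\mathcal I$ via $t\mapsto(t,\mathbb C)$, and its multiplication bibundle over $(s,t;r)$ consists of the arrows $(s,\mathbb C)\circledast(t,\mathbb C)\to(r,\mathbb C)$ of $\mathcal I$, i.e. it is the unit circle bundle of $\mathbf L$. Then each of (1), (2), (3), with the projection to $T$ and the inclusion of $pt/\!/U(1)$ as automorphisms of the unit object, is a central extension of Lie 2-groups of $T$ by $pt/\!/U(1)$, and the three extensions are equivalent, where an equivalence of extensions is an invertible 1-morphism of 2-groups which is compatible, up to isomorphism of 1-morphisms of 2-groups, with the inclusions of $pt/\!/U(1)$ and the projections to $T$. More precisely: (a) $p$ gives an equivalence of extensions from (1) to (2). (b) Let $F:\mathcal T\to\mathcal I$ be the functor $x\mapsto(\exp(x),\mathbb C)$, $(x\xrightarrow{z}x+m)\mapsto z$, let $\varepsilon=\mathrm{id}:(1,\mathbb C)\to F(0)$, and let $\phi_{x,y}:F(x)\circledast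 F(y)\to F(x\bullet y)$ be the trivialization $\mathbf L_{\exp(x),\exp(y)}\to\mathbb C$, $[z,x,y]\mapsto z$. Then $(F,\phi,\varepsilon)$ is a monoidal equivalence from $(\mathcal T,\bullet,0)$ to $(\mathcal I,\circledast,(1,\mathbb C))$, compatible with the projections to $T$ and with the inclusions of $pt/\!/U(1)$, and it gives an equivalence of extensions from (1) to (3). (c) The extensions (2) and (3) are equivalent. -/

import Mathlib

open CategoryTheory MonoidalCategory Diffeology
open scoped TensorProduct ContDiff Topology

noncomputable section

/-! ## Smooth spaces

Smoothness is expressed through plots.  Manifolds with smooth maps embed fully faithfully into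
diffeological spaces, and fibre products along submersions, products and quotients by free proper
discrete actions carry their usual smooth structure as diffeological spaces. -/

/-- The test spaces of a diffeology. -/
abbrev Euc (n : ℕ) : Type := EuclideanSpace ℝ (Fin n)

/-- The pulled back diffeology: `p` is a plot iff `f ∘ p` is a plot. -/
@[reducible] def inducedDiff {X Y : Type*} (f : X → Y) (d : DiffeologicalSpace Y) :
    DiffeologicalSpace X where
  plots n := {p | f ∘ p ∈ d.plots n}
  constant_plots x := d.constant_plots (f x)
  plot_reparam hp hf := d.plot_reparam hp hf
  locality hp := d.locality fun x => by
    obtain ⟨u, hu, hxu, h⟩ := hp x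
    exact ⟨u, hu, hxu, fun hf hf' => h hf hf'⟩

/-- The quotient (pushed forward) diffeology: the finest one such that `f` is smooth. -/
@[reducible] def coinducedDiff {X Y : Type*} (f : X → Y) (d : DiffeologicalSpace X) :
    DiffeologicalSpace Y :=
  DiffeologicalSpace.generateFrom {q | ∃ p ∈ d.plots q.1, q.2 = f ∘ p}

instance instProdDiff {X Y : Type*} [dX : DiffeologicalSpace X] [dY : DiffeologicalSpace Y] :
    DiffeologicalSpace (X × Y) :=
  inducedDiff Prod.fst dX ⊓ inducedDiff Prod.snd dY

instance : DiffeologicalSpace ℂ := NormedSpace.toDiffeology ℂ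

instance : DiffeologicalSpace Circle := inducedDiff (fun z : Circle => (z : ℂ)) inferInstance

/-- `X` is a smooth manifold (Hausdorff, second countable, without boundary, components of possibly
different dimensions): every point lies in a `D`-open subset that is diffeomorphic to some `ℝⁿ`. -/
def IsSmoothManifold (X : Type*) [DiffeologicalSpace X] : Prop :=
  @T2Space X dTopology ∧ @SecondCountableTopology X dTopology ∧
  ∀ x : X, ∃ (n : ℕ) (φ : Euc n → X), IsPlot φ ∧ Function.Injective φ ∧ x ∈ Set.range φ ∧
    IsOpen[dTopology] (Set.range φ) ∧
    ∀ (m : ℕ) (p : Euc m → X), IsPlot p → (∀ v, p v ∈ Set.range φ) →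
      ∃ c : Euc m → Euc n, ContDiff ℝ ∞ c ∧ p = φ ∘ c

/-- A smooth map with local smooth sections through every point of its source.
For manifolds these are the submersions. -/
def IsSubmersion {P M : Type*} [DiffeologicalSpace P] [DiffeologicalSpace M] (q : P → M) : Prop :=
  DSmooth q ∧ ∀ (n : ℕ) (c : Euc n → M) (v : Euc n) (b : P), IsPlot c → q b = c v →
    ∃ c' : Euc n → P, IsPlot c' ∧ c' v = b ∧ ∀ᶠ w in 𝓝 v, q (c' w) = c w

/-! ## Lie groupoids and bibundles -/

/-- The space of arrows of a category. -/
abbrev Arr (X : Type) [Category.{0} X] : Type := Σ x : X, Σ y : X, (x ⟶ y)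

/-- Smooth structures on the objects and on the arrows of a groupoid. -/
class SmoothStr (X : Type) [Groupoid.{0} X] where
  obj : DiffeologicalSpace X
  arr : DiffeologicalSpace (Arr X)

attribute [reducible, instance] SmoothStr.obj SmoothStr.arr

/-- A family of arrows, indexed by a test space, is smooth. -/
def SmoothArr {X : Type} [Groupoid.{0} X] [SmoothStr X] {n : ℕ} {x y : Euc n → X}
    (f : ∀ v, x v ⟶ y v) : Prop :=
  IsPlot (fun v => (⟨x v, y v, f v⟩ : Arr X))

/-- A Lie groupoid: objects and arrows form manifolds, source and target are submersions, and the
structure maps are smooth (composition is tested on smooth families of composable arrows). -/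
structure IsLieGroupoid (X : Type) [Groupoid.{0} X] [SmoothStr X] : Prop where
  obj_manifold : IsSmoothManifold X
  arr_manifold : IsSmoothManifold (Arr X)
  source : IsSubmersion (fun a : Arr X => a.1)
  target : IsSubmersion (fun a : Arr X => a.2.1)
  ident : DSmooth (fun x : X => (⟨x, x, 𝟙 x⟩ : Arr X))
  inverse : DSmooth (fun a : Arr X => (⟨a.2.1, a.1, Groupoid.inv a.2.2⟩ : Arr X))
  comp : ∀ (n : ℕ) (x y z : Euc n → X) (f : ∀ v, x v ⟶ y v) (g : ∀ v, y v ⟶ z v),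
    SmoothArr f → SmoothArr g → SmoothArr (fun v => f v ≫ g v)

instance instSmoothProd {X Y : Type} [Groupoid.{0} X] [Groupoid.{0} Y] [SmoothStr X] [SmoothStr Y] :
    SmoothStr (X × Y) where
  obj := inferInstance
  arr := inducedDiff
    (fun a : Arr (X × Y) =>
      (((⟨a.1.1, a.2.1.1, a.2.2.1⟩ : Arr X), (⟨a.1.2, a.2.1.2, a.2.2.2⟩ : Arr Y)) : Arr X × Arr Y))
    inferInstance

/-- A smooth space as a Lie groupoid with only identity arrows. -/
instance instSmoothDiscrete {M : Type} [d : DiffeologicalSpace M] : SmoothStr (Discrete M) where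
  obj := inducedDiff Discrete.as d
  arr := inducedDiff (fun a : Arr (Discrete M) => a.1.as) d

instance : DiffeologicalSpace PUnit.{1} := ⊤

/-- The groupoid `pt`. -/
abbrev Pt : Type := Discrete PUnit.{1}

/-- The unique object of `pt`. -/
abbrev pt : Pt := ⟨PUnit.unit⟩

/-- `pt // U(1)`: the groupoid with one object and automorphism group `U(1)`. -/
abbrev BU1 : Type := SingleObj Circle

instance : SmoothStr BU1 where
  obj := inducedDiff (fun _ => PUnit.unit) inferInstance
  arr := inducedDiff (fun a : Arr BU1 => (show Circle from a.2.2)) inferInstance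

/-- The data of a bibundle from `X` to `Y`: the fibres over pairs of objects, the actions of the
arrows of `X` from the left and of `Y` from the right, and a smooth structure on the total space. -/
structure Bibundle (X Y : Type) [Groupoid.{0} X] [Groupoid.{0} Y] where
  Fib : X → Y → Type
  act : ∀ {x x' : X} {y y' : Y}, (x' ⟶ x) → Fib x y → (y ⟶ y') → Fib x' y'
  smooth : DiffeologicalSpace (Σ x : X, Σ y : Y, Fib x y)

namespace Bibundle

variable {X Y : Type} [Groupoid.{0} X] [Groupoid.{0} Y] [SmoothStr X] [SmoothStr Y]

/-- The total space of a bibundle. -/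
abbrev Total (B : Bibundle X Y) : Type := Σ x : X, Σ y : Y, B.Fib x y

instance (B : Bibundle X Y) : DiffeologicalSpace B.Total := B.smooth

/-- A family of elements of a bibundle, indexed by a test space, is smooth. -/
def SmoothFam (B : Bibundle X Y) {n : ℕ} {x : Euc n → X} {y : Euc n → Y}
    (b : ∀ v, B.Fib (x v) (y v)) : Prop :=
  IsPlot (fun v => (⟨x v, y v, b v⟩ : B.Total))

/-- `B` is a bibundle from `X` to `Y`, that is, a 1-morphism in the localized bicategory `Bibun` of
Lie groupoids: there are smooth commuting actions, the left anchor is a surjective submersion, and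
the right action is principal with respect to it.  (If `X` and `Y` are Lie groupoids, this
makes the total space locally a fibre product of manifolds along submersions, hence a manifold.) -/
structure IsRightPrincipal (B : Bibundle X Y) : Prop where
  act_id : ∀ {x y} (b : B.Fib x y), B.act (𝟙 x) b (𝟙 y) = b
  act_act : ∀ {x x' x'' y y' y''} (f' : x'' ⟶ x') (f : x' ⟶ x) (b : B.Fib x y) (g : y ⟶ y')
    (g' : y' ⟶ y''), B.act f' (B.act f b g) g' = B.act (f' ≫ f) b (g ≫ g')
  act_smooth : ∀ (n : ℕ) (x x' : Euc n → X) (y y' : Euc n → Y) (f : ∀ v, x' v ⟶ x v)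
    (b : ∀ v, B.Fib (x v) (y v)) (g : ∀ v, y v ⟶ y' v),
    SmoothArr f → B.SmoothFam b → SmoothArr g → B.SmoothFam (fun v => B.act (f v) (b v) (g v))
  left_submersion : IsSubmersion (fun b : B.Total => b.1)
  left_surjective : ∀ x, ∃ y, Nonempty (B.Fib x y)
  right_smooth : DSmooth (fun b : B.Total => b.2.1)
  division : ∀ {x y y'} (b : B.Fib x y) (b' : B.Fib x y'), ∃! g : y ⟶ y', B.act (𝟙 x) b g = b'
  division_smooth : ∀ (n : ℕ) (x : Euc n → X) (y y' : Euc n → Y) (b : ∀ v, B.Fib (x v) (y v))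
    (g : ∀ v, y v ⟶ y' v), B.SmoothFam b → B.SmoothFam (fun v => B.act (𝟙 (x v)) (b v) (g v)) →
    SmoothArr g

/-- The bibundle takes values in the full subgroupoid of `Y` on the objects in `S`, and as a
bibundle from `X` to this subgroupoid it is also left principal, that is, weakly invertible. -/
structure IsLeftPrincipalOver (B : Bibundle X Y) (S : Set Y) : Prop where
  right_mem : ∀ {x y}, B.Fib x y → y ∈ S
  right_surjective : ∀ y ∈ S, ∃ x, Nonempty (B.Fib x y)
  right_submersion : ∀ (n : ℕ) (c : Euc n → Y) (v : Euc n) (b : B.Total), IsPlot c →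
    (∀ w, c w ∈ S) → b.2.1 = c v →
    ∃ c' : Euc n → B.Total, IsPlot c' ∧ c' v = b ∧ ∀ᶠ w in 𝓝 v, (c' w).2.1 = c w
  division : ∀ {x x' y} (b : B.Fib x y) (b' : B.Fib x' y), ∃! f : x ⟶ x', B.act f b' (𝟙 y) = b
  division_smooth : ∀ (n : ℕ) (x x' : Euc n → X) (y : Euc n → Y) (b' : ∀ v, B.Fib (x' v) (y v))
    (f : ∀ v, x v ⟶ x' v), B.SmoothFam b' → B.SmoothFam (fun v => B.act (f v) (b' v) (𝟙 (y v))) →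
    SmoothArr f

/-- A right principal bibundle with this property is an equivalence in `Bibun`. -/
def IsInvertible (B : Bibundle X Y) : Prop := B.IsLeftPrincipalOver Set.univ

/-- The bibundle associated to a pair of functors with a common target: its elements over `(x, y)`
are the arrows `F x ⟶ j y`.  For `j = 𝟭` this is the bibundle associated to the functor `F`. -/
def ofFunctors {C : Type*} [Category.{0} C] (F : X ⥤ C) (j : Y ⥤ C)
    (d : DiffeologicalSpace (Σ x : X, Σ y : Y, (F.obj x ⟶ j.obj y))) : Bibundle X Y where
  Fib x y := F.obj x ⟶ j.obj y
  act f b g := F.map f ≫ b ≫ j.map g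
  smooth := d

/-- The bibundle associated to a functor `F`, with the smooth structure of the fibre product of the
objects of `X` with the arrows of `Y`. -/
def ofFunctor (F : X ⥤ Y) : Bibundle X Y :=
  ofFunctors F (𝟭 Y)
    (inducedDiff (fun b => ((b.1, (⟨F.obj b.1, b.2.1, b.2.2⟩ : Arr Y)) : X × Arr Y)) inferInstance)

end Bibundle

/-! ## Lie 2-groups

A monoid object in `Bibun`.  2-morphisms between (composites of) bibundles are given by their graphs.
An element of the composite of `A : X ⇸ Y` and `B : Y ⇸ Z` over `(x, z)` is represented by a pair
`a ∈ A(x, y)`, `b ∈ B(y, z)`, where `(a g, b)` and `(a, g b)` represent the same element; a (smooth, equivariant) morphism between right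
principal bibundles is automatically invertible. -/

/-- The data of a monoid object in `Bibun` with underlying groupoid `X`.
* `assoc a b c d` means: the associator `μ ∘ (μ × 1) ⇒ μ ∘ (1 × μ)` sends the element represented
  by `(a, b)` to the element represented by `(c, d)`.
* `lunit e a f` means: the left unit isomorphism `μ ∘ (η × 1) ⇒ 1` sends the element represented by
  `(e, a)` to the element `f` of the identity bibundle; similarly for `runit`. -/
structure TwoGroupData (X : Type) [Groupoid.{0} X] [SmoothStr X] where
  mul : Bibundle (X × X) X
  unit : Bibundle Pt X
  assoc : ∀ {x y w u s v : X}, mul.Fib (x, y) u → mul.Fib (u, w) v → mul.Fib (y, w) s →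
    mul.Fib (x, s) v → Prop
  lunit : ∀ {i x y : X}, unit.Fib pt i → mul.Fib (i, x) y → (x ⟶ y) → Prop
  runit : ∀ {i x y : X}, unit.Fib pt i → mul.Fib (x, i) y → (x ⟶ y) → Prop

namespace TwoGroupData

variable {X : Type} [Groupoid.{0} X] [SmoothStr X]

/-- The bibundle `(pr₁, μ) : X × X ⇸ X × X`. -/
def shear (G : TwoGroupData X) : Bibundle (X × X) (X × X) where
  Fib p q := (p.1 ⟶ q.1) × G.mul.Fib p q.2
  act f b g := (f.1 ≫ b.1 ≫ g.1, G.mul.act f b.2 g.2)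
  smooth := inducedDiff
    (fun b => (((⟨b.1.1, b.2.1.1, b.2.2.1⟩ : Arr X),
      (⟨b.1, b.2.1.2, b.2.2.2⟩ : G.mul.Total)) : Arr X × G.mul.Total)) inferInstance

/-- `G` is a Lie 2-group: multiplication and unit are 1-morphisms in `Bibun`; associator and unit
constraints are (well defined, smooth, equivariant) 2-isomorphisms, which satisfy the pentagon and the
triangle axiom; and `(pr₁, μ)` is an equivalence, which expresses the existence of weak inverses. -/
structure IsLieTwoGroup (G : TwoGroupData X) : Prop where
  lie : IsLieGroupoid X
  mul_bibundle : G.mul.IsRightPrincipal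
  unit_bibundle : G.unit.IsRightPrincipal
  assoc_existsUnique : ∀ {x y w u s v : X} (a : G.mul.Fib (x, y) u) (b : G.mul.Fib (u, w) v)
    (c : G.mul.Fib (y, w) s), ∃! d : G.mul.Fib (x, s) v, G.assoc a b c d
  assoc_equivariant : ∀ {x y w u s v x' y' w' u' s' v' : X} (a : G.mul.Fib (x, y) u)
    (b : G.mul.Fib (u, w) v) (c : G.mul.Fib (y, w) s) (d : G.mul.Fib (x, s) v)
    (f : x' ⟶ x) (g : y' ⟶ y) (h : w' ⟶ w) (k : u ⟶ u') (l : s ⟶ s') (m : v ⟶ v'),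
    G.assoc a b c d →
    G.assoc (G.mul.act (x' := (x', y')) (f, g) a k)
      (G.mul.act (x' := (u', w')) (Groupoid.inv k, h) b m)
      (G.mul.act (x' := (y', w')) (g, h) c l)
      (G.mul.act (x' := (x', s')) (f, Groupoid.inv l) d m)
  assoc_smooth : ∀ (n : ℕ) (x y w u s v : Euc n → X) (a : ∀ t, G.mul.Fib (x t, y t) (u t))
    (b : ∀ t, G.mul.Fib (u t, w t) (v t)) (c : ∀ t, G.mul.Fib (y t, w t) (s t))
    (d : ∀ t, G.mul.Fib (x t, s t) (v t)), (∀ t, G.assoc (a t) (b t) (c t) (d t)) →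
    G.mul.SmoothFam (x := fun t => (x t, y t)) a → G.mul.SmoothFam (x := fun t => (u t, w t)) b →
    G.mul.SmoothFam (x := fun t => (y t, w t)) c → G.mul.SmoothFam (x := fun t => (x t, s t)) d
  lunit_existsUnique : ∀ {i x y : X} (e : G.unit.Fib pt i) (a : G.mul.Fib (i, x) y),
    ∃! f : x ⟶ y, G.lunit e a f
  lunit_equivariant : ∀ {i x y i' x' y' : X} (e : G.unit.Fib pt i) (a : G.mul.Fib (i, x) y)
    (f : x ⟶ y) (k : i ⟶ i') (g : x' ⟶ x) (h : y ⟶ y'), G.lunit e a f →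
    G.lunit (G.unit.act (𝟙 pt) e k) (G.mul.act (x' := (i', x')) (Groupoid.inv k, g) a h)
      (g ≫ f ≫ h)
  lunit_smooth : ∀ (n : ℕ) (i x y : Euc n → X) (e : ∀ t, G.unit.Fib pt (i t))
    (a : ∀ t, G.mul.Fib (i t, x t) (y t)) (f : ∀ t, x t ⟶ y t),
    (∀ t, G.lunit (e t) (a t) (f t)) → G.unit.SmoothFam (x := fun _ => pt) e →
    G.mul.SmoothFam (x := fun t => (i t, x t)) a → SmoothArr f
  runit_existsUnique : ∀ {i x y : X} (e : G.unit.Fib pt i) (a : G.mul.Fib (x, i) y),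
    ∃! f : x ⟶ y, G.runit e a f
  runit_equivariant : ∀ {i x y i' x' y' : X} (e : G.unit.Fib pt i) (a : G.mul.Fib (x, i) y)
    (f : x ⟶ y) (k : i ⟶ i') (g : x' ⟶ x) (h : y ⟶ y'), G.runit e a f →
    G.runit (G.unit.act (𝟙 pt) e k) (G.mul.act (x' := (x', i')) (g, Groupoid.inv k) a h)
      (g ≫ f ≫ h)
  runit_smooth : ∀ (n : ℕ) (i x y : Euc n → X) (e : ∀ t, G.unit.Fib pt (i t))
    (a : ∀ t, G.mul.Fib (x t, i t) (y t)) (f : ∀ t, x t ⟶ y t),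
    (∀ t, G.runit (e t) (a t) (f t)) → G.unit.SmoothFam (x := fun _ => pt) e →
    G.mul.SmoothFam (x := fun t => (x t, i t)) a → SmoothArr f
  pentagon : ∀ {x y z w p q r s g k : X} (a : G.mul.Fib (x, y) p) (b : G.mul.Fib (p, z) q)
    (c : G.mul.Fib (q, w) r) (d : G.mul.Fib (z, w) s) (f : G.mul.Fib (y, z) g)
    (h : G.mul.Fib (g, w) k) (b₁ : G.mul.Fib (p, s) r) (e : G.mul.Fib (y, s) k)
    (a₁ : G.mul.Fib (x, g) q) (e₁ e₂ : G.mul.Fib (x, k) r),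
    G.assoc b c d b₁ → G.assoc f h d e → G.assoc a b₁ e e₁ →
    G.assoc a b f a₁ → G.assoc a₁ c h e₂ → e₁ = e₂
  triangle : ∀ {i x y u v s : X} (e : G.unit.Fib pt i) (a : G.mul.Fib (x, i) u)
    (b : G.mul.Fib (u, y) v) (c : G.mul.Fib (i, y) s) (d : G.mul.Fib (x, s) v) (f : x ⟶ u)
    (g : y ⟶ s), G.assoc a b c d → G.runit e a f → G.lunit e c g →
    G.mul.act (x' := (x, y)) (f, 𝟙 y) b (𝟙 v) = G.mul.act (x' := (x, y)) (𝟙 x, g) d (𝟙 v)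
  invertible : G.shear.IsInvertible

/-- The data induced along a functor `j : X ⥤ M` by a monoidal structure on `M`: the elements of the
multiplication over `(x, y; z)` are the arrows `j x ⊗ j y ⟶ j z`. -/
def ofMonoidal {M : Type*} [Category.{0} M] [MonoidalCategoryStruct M] (j : X ⥤ M)
    (dmul : DiffeologicalSpace
      (Σ p : X × X, Σ z : X, (j.obj p.1 ⊗ j.obj p.2 ⟶ j.obj z)))
    (dunit : DiffeologicalSpace (Σ _ : Pt, Σ z : X, (𝟙_ M ⟶ j.obj z))) : TwoGroupData X where
  mul :=
    { Fib := fun p z => j.obj p.1 ⊗ j.obj p.2 ⟶ j.obj z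
      act := fun f b g => (j.map f.1 ⊗ₘ j.map f.2) ≫ b ≫ j.map g
      smooth := dmul }
  unit :=
    { Fib := fun _ z => 𝟙_ M ⟶ j.obj z
      act := fun _ b g => b ≫ j.map g
      smooth := dunit }
  assoc {x y w _ _ _} a b c d :=
    (a ⊗ₘ 𝟙 (j.obj w)) ≫ b =
      (α_ (j.obj x) (j.obj y) (j.obj w)).hom ≫ (𝟙 (j.obj x) ⊗ₘ c) ≫ d
  lunit {_ x _} e a f := (e ⊗ₘ 𝟙 (j.obj x)) ≫ a = (λ_ (j.obj x)).hom ≫ j.map f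
  runit {_ x _} e a f := (𝟙 (j.obj x) ⊗ₘ e) ≫ a = (ρ_ (j.obj x)).hom ≫ j.map f

/-- The data of a groupoid with a functorial multiplication. -/
def ofStrict (X : Type) [Groupoid.{0} X] [SmoothStr X] [MonoidalCategoryStruct X] :
    TwoGroupData X :=
  ofMonoidal (𝟭 X)
    (inducedDiff (fun b => ((b.1, (⟨b.1.1 ⊗ b.1.2, b.2.1, b.2.2⟩ : Arr X)) : (X × X) × Arr X))
      inferInstance)
    (inducedDiff (fun b => (⟨𝟙_ X, b.2.1, b.2.2⟩ : Arr X)) inferInstance)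

end TwoGroupData

/-- The data of a 1-morphism between monoid objects in `Bibun`.
* `φ a r p q b` means: the 2-isomorphism `F ∘ μ ⇒ μ ∘ (F × F)` sends the element represented by
  `(a, r)` to the element represented by `(p, q, b)`.
* `ε e p e'` means: the 2-isomorphism `F ∘ η ⇒ η` sends the element represented by `(e, p)` to `e'`. -/
structure TwoGroupHom {X Y : Type} [Groupoid.{0} X] [SmoothStr X] [Groupoid.{0} Y] [SmoothStr Y]
    (G : TwoGroupData X) (H : TwoGroupData Y) where
  bib : Bibundle X Y
  φ : ∀ {x y z : X} {x' y' z' : Y}, G.mul.Fib (x, y) z → bib.Fib z z' → bib.Fib x x' →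
    bib.Fib y y' → H.mul.Fib (x', y') z' → Prop
  ε : ∀ {i : X} {i' : Y}, G.unit.Fib pt i → bib.Fib i i' → H.unit.Fib pt i' → Prop

namespace TwoGroupHom

variable {X Y Z : Type} [Groupoid.{0} X] [SmoothStr X] [Groupoid.{0} Y] [SmoothStr Y]
  [Groupoid.{0} Z] [SmoothStr Z]
  {G : TwoGroupData X} {H : TwoGroupData Y} {K : TwoGroupData Z}

/-- `F` is a 1-morphism of 2-groups: `φ` and `ε` are (well defined, smooth, equivariant)
2-isomorphisms, compatible with the associativity and unit constraints. -/
structure IsHom (F : TwoGroupHom G H) : Prop where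
  bibundle : F.bib.IsRightPrincipal
  φ_existsUnique : ∀ {x y z : X} {x' y' z' : Y} (a : G.mul.Fib (x, y) z) (r : F.bib.Fib z z')
    (p : F.bib.Fib x x') (q : F.bib.Fib y y'), ∃! b : H.mul.Fib (x', y') z', F.φ a r p q b
  φ_equivariant : ∀ {x y z x₁ y₁ z₁ : X} {x' y' z' x₁' y₁' z₁' : Y} (a : G.mul.Fib (x, y) z)
    (r : F.bib.Fib z z') (p : F.bib.Fib x x') (q : F.bib.Fib y y') (b : H.mul.Fib (x', y') z')
    (f : x₁ ⟶ x) (g : y₁ ⟶ y) (h : z ⟶ z₁) (f' : x' ⟶ x₁') (g' : y' ⟶ y₁') (h' : z' ⟶ z₁'),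
    F.φ a r p q b →
    F.φ (G.mul.act (x' := (x₁, y₁)) (f, g) a h) (F.bib.act (Groupoid.inv h) r h')
      (F.bib.act f p f') (F.bib.act g q g')
      (H.mul.act (x' := (x₁', y₁')) (Groupoid.inv f', Groupoid.inv g') b h')
  φ_smooth : ∀ (n : ℕ) (x y z : Euc n → X) (x' y' z' : Euc n → Y)
    (a : ∀ t, G.mul.Fib (x t, y t) (z t)) (r : ∀ t, F.bib.Fib (z t) (z' t))
    (p : ∀ t, F.bib.Fib (x t) (x' t)) (q : ∀ t, F.bib.Fib (y t) (y' t))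
    (b : ∀ t, H.mul.Fib (x' t, y' t) (z' t)), (∀ t, F.φ (a t) (r t) (p t) (q t) (b t)) →
    G.mul.SmoothFam (x := fun t => (x t, y t)) a → F.bib.SmoothFam r → F.bib.SmoothFam p →
    F.bib.SmoothFam q → H.mul.SmoothFam (x := fun t => (x' t, y' t)) b
  ε_existsUnique : ∀ {i : X} {i' : Y} (e : G.unit.Fib pt i) (p : F.bib.Fib i i'),
    ∃! e' : H.unit.Fib pt i', F.ε e p e'
  ε_equivariant : ∀ {i i₁ : X} {i' i₁' : Y} (e : G.unit.Fib pt i) (p : F.bib.Fib i i')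
    (e' : H.unit.Fib pt i') (h : i ⟶ i₁) (h' : i' ⟶ i₁'), F.ε e p e' →
    F.ε (G.unit.act (𝟙 pt) e h) (F.bib.act (Groupoid.inv h) p h') (H.unit.act (𝟙 pt) e' h')
  ε_smooth : ∀ (n : ℕ) (i : Euc n → X) (i' : Euc n → Y) (e : ∀ t, G.unit.Fib pt (i t))
    (p : ∀ t, F.bib.Fib (i t) (i' t)) (e' : ∀ t, H.unit.Fib pt (i' t)),
    (∀ t, F.ε (e t) (p t) (e' t)) → G.unit.SmoothFam (x := fun _ => pt) e → F.bib.SmoothFam p →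
    H.unit.SmoothFam (x := fun _ => pt) e'
  assoc : ∀ {x y w u s v : X} {x' y' w' u' s' v' : Y} (a : G.mul.Fib (x, y) u)
    (b : G.mul.Fib (u, w) v) (c : G.mul.Fib (y, w) s) (d : G.mul.Fib (x, s) v)
    (p : F.bib.Fib x x') (q : F.bib.Fib y y') (r : F.bib.Fib w w') (k : F.bib.Fib u u')
    (m : F.bib.Fib s s') (l : F.bib.Fib v v') (a' : H.mul.Fib (x', y') u')
    (b' : H.mul.Fib (u', w') v') (c' : H.mul.Fib (y', w') s') (d' : H.mul.Fib (x', s') v'),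
    G.assoc a b c d → F.φ a k p q a' → F.φ b l k r b' → F.φ c m q r c' → F.φ d l p m d' →
    H.assoc a' b' c' d'
  lunit : ∀ {i x y : X} {i' x' y' : Y} (e : G.unit.Fib pt i) (a : G.mul.Fib (i, x) y) (f : x ⟶ y)
    (p : F.bib.Fib i i') (q : F.bib.Fib x x') (r : F.bib.Fib y y') (e' : H.unit.Fib pt i')
    (a' : H.mul.Fib (i', x') y') (f' : x' ⟶ y'),
    G.lunit e a f → F.ε e p e' → F.φ a r p q a' → H.lunit e' a' f' →
    F.bib.act f r (𝟙 y') = F.bib.act (𝟙 x) q f'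
  runit : ∀ {i x y : X} {i' x' y' : Y} (e : G.unit.Fib pt i) (a : G.mul.Fib (x, i) y) (f : x ⟶ y)
    (p : F.bib.Fib i i') (q : F.bib.Fib x x') (r : F.bib.Fib y y') (e' : H.unit.Fib pt i')
    (a' : H.mul.Fib (x', i') y') (f' : x' ⟶ y'),
    G.runit e a f → F.ε e p e' → F.φ a r q p a' → H.runit e' a' f' →
    F.bib.act f r (𝟙 y') = F.bib.act (𝟙 x) q f'

/-- `ψ` is (the graph of) an isomorphism `F' ∘ F ≅ K` of 1-morphisms of 2-groups; `ψ p q r` means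
that the element represented by `(p, q)` is sent to `r`. -/
structure IsCompIso (F : TwoGroupHom G H) (F' : TwoGroupHom H K) (F'' : TwoGroupHom G K)
    (ψ : ∀ {x : X} {y : Y} {z : Z}, F.bib.Fib x y → F'.bib.Fib y z → F''.bib.Fib x z → Prop) :
    Prop where
  existsUnique : ∀ {x y z} (p : F.bib.Fib x y) (q : F'.bib.Fib y z),
    ∃! r : F''.bib.Fib x z, ψ p q r
  equivariant : ∀ {x x₁ y y₁ z z₁} (p : F.bib.Fib x y) (q : F'.bib.Fib y z) (r : F''.bib.Fib x z)
    (f : x₁ ⟶ x) (g : y ⟶ y₁) (h : z ⟶ z₁), ψ p q r →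
    ψ (F.bib.act f p g) (F'.bib.act (Groupoid.inv g) q h) (F''.bib.act f r h)
  smooth : ∀ (n : ℕ) (x : Euc n → X) (y : Euc n → Y) (z : Euc n → Z)
    (p : ∀ t, F.bib.Fib (x t) (y t)) (q : ∀ t, F'.bib.Fib (y t) (z t))
    (r : ∀ t, F''.bib.Fib (x t) (z t)), (∀ t, ψ (p t) (q t) (r t)) →
    F.bib.SmoothFam p → F'.bib.SmoothFam q → F''.bib.SmoothFam r
  mul : ∀ {x₁ x₂ x₃ : X} {y₁ y₂ y₃ : Y} {z₁ z₂ z₃ : Z} (a : G.mul.Fib (x₁, x₂) x₃)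
    (b : H.mul.Fib (y₁, y₂) y₃) (c : K.mul.Fib (z₁, z₂) z₃)
    (p₁ : F.bib.Fib x₁ y₁) (p₂ : F.bib.Fib x₂ y₂) (p₃ : F.bib.Fib x₃ y₃)
    (q₁ : F'.bib.Fib y₁ z₁) (q₂ : F'.bib.Fib y₂ z₂) (q₃ : F'.bib.Fib y₃ z₃)
    (r₁ : F''.bib.Fib x₁ z₁) (r₂ : F''.bib.Fib x₂ z₂) (r₃ : F''.bib.Fib x₃ z₃),
    F.φ a p₃ p₁ p₂ b → F'.φ b q₃ q₁ q₂ c → ψ p₁ q₁ r₁ → ψ p₂ q₂ r₂ → ψ p₃ q₃ r₃ →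
    F''.φ a r₃ r₁ r₂ c
  unit : ∀ {i : X} {i' : Y} {i'' : Z} (e : G.unit.Fib pt i) (e' : H.unit.Fib pt i')
    (e'' : K.unit.Fib pt i'') (p : F.bib.Fib i i') (q : F'.bib.Fib i' i'') (r : F''.bib.Fib i i''),
    F.ε e p e' → F'.ε e' q e'' → ψ p q r → F''.ε e r e''

end TwoGroupHom

/-! ## Extensions -/

instance : MonoidalCategoryStruct BU1 where
  tensorObj _ _ := SingleObj.star Circle
  whiskerLeft _ _ _ f := f
  whiskerRight f _ := f
  tensorHom f g := (show Circle from f) * (show Circle from g)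
  tensorUnit := SingleObj.star Circle
  associator _ _ _ := Iso.refl _
  leftUnitor _ := Iso.refl _
  rightUnitor _ := Iso.refl _

/-- The abelian 2-group `pt // U(1)`. -/
def bu1 : TwoGroupData BU1 := TwoGroupData.ofStrict BU1

/-- A Lie group `T` (written additively), viewed as a 2-group with only identity arrows. -/
def discreteTwoGroup (T : Type) [AddCommGroup T] [DiffeologicalSpace T] :
    TwoGroupData (Discrete T) := TwoGroupData.ofStrict (Discrete T)

/-- The 1-morphism to a discrete 2-group given by a functor: all its 2-morphisms are unique. -/
def TwoGroupHom.toDiscrete {X T : Type} [Groupoid.{0} X] [SmoothStr X] [AddCommGroup T]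
    [DiffeologicalSpace T] (G : TwoGroupData X) (π : X ⥤ Discrete T) :
    TwoGroupHom G (discreteTwoGroup T) where
  bib := Bibundle.ofFunctor π
  φ _ _ _ _ _ := True
  ε _ _ _ := True

/-- The data of a sequence `pt // U(1) ⟶ X ⟶ T` of 2-groups. -/
structure ExtData (T : Type) [AddCommGroup T] [DiffeologicalSpace T] where
  X : Type
  [groupoid : Groupoid.{0} X]
  [smooth : SmoothStr X]
  G : TwoGroupData X
  incl : TwoGroupHom bu1 G
  proj : TwoGroupHom G (discreteTwoGroup T)

attribute [instance] ExtData.groupoid ExtData.smooth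

section Extensions

variable {T : Type} [AddCommGroup T] [DiffeologicalSpace T]

/-- The objects of `X` which are sent to the neutral element of `T`. -/
def ExtData.ker (E : ExtData T) : Set E.X := {x | Nonempty (E.proj.bib.Fib x ⟨0⟩)}

/-- `1 ⟶ pt // U(1) ⟶ X ⟶ T ⟶ 1` is a central extension of Lie 2-groups: `X ⟶ T` is a surjective
submersion, `pt // U(1)` is equivalent to its kernel, and the automorphisms coming from `U(1)` act
in the same way by left and by right multiplication. -/
structure ExtData.IsCentralExtension (E : ExtData T) : Prop where
  twoGroup : E.G.IsLieTwoGroup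
  incl_hom : E.incl.IsHom
  proj_hom : E.proj.IsHom
  proj_submersion : IsSubmersion (fun b : E.proj.bib.Total => b.2.1)
  proj_surjective : ∀ t, ∃ x, Nonempty (E.proj.bib.Fib x t)
  exact : E.incl.bib.IsLeftPrincipalOver E.ker
  central : ∀ {k x y : E.X} (z : SingleObj.star Circle ⟶ SingleObj.star Circle) (κ : k ⟶ k)
    (j : E.incl.bib.Fib (SingleObj.star Circle) k) (a : E.G.mul.Fib (k, x) y)
    (b : E.G.mul.Fib (x, k) y) (l r : y ⟶ y),
    E.incl.bib.act z j (𝟙 k) = E.incl.bib.act (𝟙 _) j κ →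
    E.G.mul.act (x' := (k, x)) (κ, 𝟙 x) a (𝟙 y) = E.G.mul.act (𝟙 _) a l →
    E.G.mul.act (x' := (x, k)) (𝟙 x, κ) b (𝟙 y) = E.G.mul.act (𝟙 _) b r → l = r

/-- `F` is an equivalence of extensions: a 1-morphism of 2-groups whose bibundle is invertible,
together with isomorphisms of 1-morphisms of 2-groups `F ∘ incl ≅ incl'` and `proj' ∘ F ≅ proj`. -/
structure ExtData.IsEquivalence (E E' : ExtData T) (F : TwoGroupHom E.G E'.G) : Prop where
  hom : F.IsHom
  invertible : F.bib.IsInvertible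
  incl : ∃ ψ : ∀ {x y z}, E.incl.bib.Fib x y → F.bib.Fib y z → E'.incl.bib.Fib x z → Prop,
    TwoGroupHom.IsCompIso E.incl F E'.incl ψ
  proj : ∃ ψ : ∀ {x y z}, F.bib.Fib x y → E'.proj.bib.Fib y z → E.proj.bib.Fib x z → Prop,
    TwoGroupHom.IsCompIso F E'.proj E.proj ψ

end Extensions

/-! ## Monoidal functors -/

/-- The given multiplication, unit and constraints make `C` a monoidal category. -/
def IsMonoidalCat (C : Type*) [Category.{0} C] [S : MonoidalCategoryStruct C] : Prop :=
  ∃ M : MonoidalCategory C, M.toMonoidalCategoryStruct = S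

/-- `(F, μ, ε)` is a monoidal equivalence between monoidal categories. -/
structure IsMonoidalEquivalence {C D : Type*} [Category.{0} C] [Category.{0} D]
    [MonoidalCategoryStruct C] [MonoidalCategoryStruct D] (F : C ⥤ D) (ε : 𝟙_ D ⟶ F.obj (𝟙_ C))
    (μ : ∀ x y : C, F.obj x ⊗ F.obj y ⟶ F.obj (x ⊗ y)) : Prop where
  source : IsMonoidalCat C
  target : IsMonoidalCat D
  equivalence : F.IsEquivalence
  ε_iso : IsIso ε
  μ_iso : ∀ x y, IsIso (μ x y)
  natural : ∀ {x x' y y' : C} (f : x ⟶ x') (g : y ⟶ y'),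
    (F.map f ⊗ₘ F.map g) ≫ μ x' y' = μ x y ≫ F.map (f ⊗ₘ g)
  assoc : ∀ x y z : C, (μ x y ⊗ₘ 𝟙 (F.obj z)) ≫ μ (x ⊗ y) z ≫ F.map (α_ x y z).hom =
    (α_ (F.obj x) (F.obj y) (F.obj z)).hom ≫ (𝟙 (F.obj x) ⊗ₘ μ y z) ≫ μ x (y ⊗ z)
  left_unit : ∀ x : C, (ε ⊗ₘ 𝟙 (F.obj x)) ≫ μ (𝟙_ C) x ≫ F.map (λ_ x).hom = (λ_ (F.obj x)).hom
  right_unit : ∀ x : C, (𝟙 (F.obj x) ⊗ₘ ε) ≫ μ x (𝟙_ C) ≫ F.map (ρ_ x).hom = (ρ_ (F.obj x)).hom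

/-- The 1-morphism induced by a functor `F : A ⥤ B` with `ε : 1 ⟶ F 1` and `μ : F - ⊗ F - ⟶ F (- ⊗ -)`
between the 2-groups which are modelled on `A` and `B` along `i : X ⥤ A` and `j : Y ⥤ B`.  The
elements of its bibundle over `(x, y)` are the arrows `F (i x) ⟶ j y`. -/
def TwoGroupHom.ofMonoidal {X Y : Type} [Groupoid.{0} X] [SmoothStr X] [Groupoid.{0} Y]
    [SmoothStr Y] {A B : Type*} [Category.{0} A] [MonoidalCategoryStruct A] [Category.{0} B]
    [MonoidalCategoryStruct B] (i : X ⥤ A) (j : Y ⥤ B) (F : A ⥤ B) (ε : 𝟙_ B ⟶ F.obj (𝟙_ A))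
    (μ : ∀ x y : A, F.obj x ⊗ F.obj y ⟶ F.obj (x ⊗ y))
    (d : DiffeologicalSpace (Σ x : X, Σ y : Y, (F.obj (i.obj x) ⟶ j.obj y)))
    {dm du dm' du'} :
    TwoGroupHom (TwoGroupData.ofMonoidal i dm du) (TwoGroupData.ofMonoidal j dm' du') where
  bib := Bibundle.ofFunctors (i ⋙ F) j d
  φ {x y _ _ _ _} a r p q b := (p ⊗ₘ q) ≫ b = μ (i.obj x) (i.obj y) ≫ F.map a ≫ r
  ε e p e' := ε ≫ F.map e ≫ p = e'

/-! ## Transport of a 2-group structure along a weak equivalence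

Let `p : A ⥤ X` be a weak equivalence of Lie groupoids (which need not have a smooth inverse).  A
multiplication on `A` induces the zig-zag `X × X ⟵ A × A ⟶ A ⟶ X`, which we compose as bibundles. -/

section Transport

variable {A X : Type} [Groupoid.{0} A] [SmoothStr A] [MonoidalCategoryStruct A]
  [Groupoid.{0} X] [SmoothStr X] (p : A ⥤ X)

/-- Representatives of the elements over `(s, t; r)` of the composed bibundle: an object `(x, y)` of
`A × A` with arrows `(s, t) ⟶ (p x, p y)` and `p (x ⊗ y) ⟶ r`. -/
structure ZigZag (s t r : X) where
  x : A
  y : A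
  f : s ⟶ p.obj x
  g : t ⟶ p.obj y
  k : p.obj (x ⊗ y) ⟶ r

/-- Representatives are identified along the arrows of `A × A`. -/
inductive ZigZag.Rel {s t r : X} : ZigZag p s t r → ZigZag p s t r → Prop
  | mk {x y x' y' : A} (f : s ⟶ p.obj x) (g : t ⟶ p.obj y) (h : x ⟶ x') (l : y ⟶ y')
      (k : p.obj (x' ⊗ y') ⟶ r) :
      Rel ⟨x, y, f, g, p.map (h ⊗ₘ l) ≫ k⟩ ⟨x', y', f ≫ p.map h, g ≫ p.map l, k⟩

/-- The element of the composed bibundle given by a representative. -/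
def zigzag {s t r : X} (x y : A) (f : s ⟶ p.obj x) (g : t ⟶ p.obj y) (k : p.obj (x ⊗ y) ⟶ r) :
    Quot (ZigZag.Rel p (s := s) (t := t) (r := r)) := Quot.mk _ ⟨x, y, f, g, k⟩

/-- The action of arrows of `X × X` and of `X` on representatives. -/
def ZigZag.act {s t r s' t' r' : X} (f : s' ⟶ s) (g : t' ⟶ t) (k : r ⟶ r') (a : ZigZag p s t r) :
    ZigZag p s' t' r' := ⟨a.x, a.y, f ≫ a.f, g ≫ a.g, a.k ≫ k⟩

/-- The multiplication on `X` induced by the zig-zag. -/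
def transportMul : Bibundle (X × X) X where
  Fib q r := Quot (ZigZag.Rel p (s := q.1) (t := q.2) (r := r))
  act f b k := Quot.map (ZigZag.act p f.1 f.2 k) (by
    rintro _ _ ⟨f', g', h, l, k'⟩
    simpa [ZigZag.act] using ZigZag.Rel.mk (p := p) (f.1 ≫ f') (f.2 ≫ g') h l (k' ≫ k)) b
  smooth := coinducedDiff
    (fun a : (Σ q : X × X, Σ r : X, ZigZag p q.1 q.2 r) => ⟨a.1, a.2.1, Quot.mk _ a.2.2⟩)
    (inducedDiff (fun a => (((a.2.2.x, a.2.2.y), (⟨_, _, a.2.2.f⟩ : Arr X),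
      (⟨_, _, a.2.2.g⟩ : Arr X), (⟨_, _, a.2.2.k⟩ : Arr X)) : (A × A) × Arr X × Arr X × Arr X))
      inferInstance)

/-- The 2-group structure on `X` inherited from `A` along `p : A ⥤ X`. -/
def TwoGroupData.transport : TwoGroupData X where
  mul := transportMul p
  unit :=
    { Fib := fun _ i => p.obj (𝟙_ A) ⟶ i
      act := fun _ e k => e ≫ k
      smooth := inducedDiff (fun b => (⟨_, b.2.1, b.2.2⟩ : Arr X)) inferInstance }
  assoc {s t w u r v} a b c d :=
    ∃ (x y z : A) (f : s ⟶ p.obj x) (g : t ⟶ p.obj y) (h : w ⟶ p.obj z)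
      (k : p.obj (x ⊗ y) ⟶ u) (l : p.obj ((x ⊗ y) ⊗ z) ⟶ v) (n : p.obj (y ⊗ z) ⟶ r),
      a = zigzag p x y f g k ∧ b = zigzag p (x ⊗ y) z (Groupoid.inv k) h l ∧
      c = zigzag p y z g h n ∧
      d = zigzag p x (y ⊗ z) f (Groupoid.inv n) (p.map (α_ x y z).inv ≫ l)
  lunit {_ s t} e a f :=
    ∃ (x : A) (g : s ⟶ p.obj x) (k : p.obj (𝟙_ A ⊗ x) ⟶ t),
      a = zigzag p (𝟙_ A) x (Groupoid.inv e) g k ∧ f = g ≫ p.map (λ_ x).inv ≫ k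
  runit {_ s t} e a f :=
    ∃ (x : A) (g : s ⟶ p.obj x) (k : p.obj (x ⊗ 𝟙_ A) ⟶ t),
      a = zigzag p x (𝟙_ A) g (Groupoid.inv e) k ∧ f = g ≫ p.map (ρ_ x).inv ≫ k

/-- The 1-morphism to the transported 2-group induced by a functor `F : C ⥤ A` with structure
isomorphisms `ε : 1 ⟶ F 1` and `μ : F - ⊗ F - ⟶ F (- ⊗ -)`, followed by `p : A ⥤ X`. -/
def TwoGroupHom.toTransport {C : Type} [Groupoid.{0} C] [SmoothStr C] [MonoidalCategoryStruct C]
    (F : C ⥤ A) (ε : 𝟙_ A ⟶ F.obj (𝟙_ C)) (μ : ∀ x y : C, F.obj x ⊗ F.obj y ⟶ F.obj (x ⊗ y)) :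
    TwoGroupHom (TwoGroupData.ofStrict C) (TwoGroupData.transport p) where
  bib := Bibundle.ofFunctor (F ⋙ p)
  φ {x y _ _ _ _} a r f g b :=
    b = zigzag p (F.obj x) (F.obj y) (Groupoid.inv f) (Groupoid.inv g)
      (p.map (μ x y ≫ F.map a) ≫ r)
  ε e f e' := e' = p.map (ε ≫ F.map e) ≫ f

end Transport

/-! ## Crossed modules -/

/-- A crossed module, with `G` acting on `H` from the right. -/
structure CrossedModule (G H : Type) [Group G] [Group H] where
  bd : H →* G
  act : G → H →* H
  act_one : ∀ h, act 1 h = h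
  act_mul : ∀ g g' h, act (g * g') h = act g' (act g h)
  bd_act : ∀ g h, bd (act g h) = g⁻¹ * bd h * g
  peiffer : ∀ k h, act (bd k) h = k⁻¹ * h * k

namespace CrossedModule

variable {G H : Type} [Group G] [Group H]

/-- The objects of the strict 2-group associated to a crossed module: the elements of `G`. -/
@[ext] structure TwoGp (c : CrossedModule G H) where
  val : G

variable {c : CrossedModule G H}

/-- An arrow `x ⟶ x * bd h` of the strict 2-group is given by `h ∈ H`. -/
@[ext] structure Hom (x y : c.TwoGp) where
  h : H
  eq : y.val = x.val * c.bd h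

instance : Groupoid.{0} c.TwoGp where
  Hom := Hom
  id x := ⟨1, by simp⟩
  comp f g := ⟨f.h * g.h, by rw [g.eq, f.eq, map_mul, mul_assoc]⟩
  id_comp f := Hom.ext (one_mul _)
  comp_id f := Hom.ext (mul_one _)
  assoc f g h := Hom.ext (mul_assoc _ _ _)
  inv f := ⟨f.h⁻¹, by rw [f.eq, map_inv, mul_inv_cancel_right]⟩
  inv_comp f := Hom.ext (inv_mul_cancel _)
  comp_inv f := Hom.ext (mul_inv_cancel _)

/-- The tensor product of arrows of the strict 2-group: the multiplication of `G ⋉ H`. -/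
def Hom.tensor {x x' y y' : c.TwoGp} (f : Hom x x') (g : Hom y y') :
    Hom (⟨x.val * y.val⟩ : c.TwoGp) ⟨x'.val * y'.val⟩ :=
  ⟨c.act y.val f.h * g.h, by rw [map_mul, c.bd_act, f.eq, g.eq]; group⟩

instance : MonoidalCategoryStruct c.TwoGp where
  tensorObj x y := ⟨x.val * y.val⟩
  whiskerLeft x _ _ f := Hom.tensor (𝟙 x : Hom x x) f
  whiskerRight f x := Hom.tensor f (𝟙 x : Hom x x)
  tensorHom f g := Hom.tensor f g
  tensorUnit := ⟨1⟩
  associator _ _ _ := eqToIso (TwoGp.ext (mul_assoc _ _ _))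
  leftUnitor _ := eqToIso (TwoGp.ext (one_mul _))
  rightUnitor _ := eqToIso (TwoGp.ext (mul_one _))

end CrossedModule

/-! ## The torus -/

section Torus

variable (Λ : Type) [AddCommGroup Λ]

/-- The Lie algebra `𝔱 = ℝ ⊗ Λ`. -/
abbrev LieT : Type := ℝ ⊗[ℤ] Λ

/-- The inclusion of `Λ` in `𝔱`. -/
def lattice : Λ →+ LieT Λ := (TensorProduct.mk ℤ ℝ Λ 1).toAddMonoidHom

/-- The torus `T = 𝔱 / Λ`, written additively. -/
abbrev Torus : Type := LieT Λ ⧸ (lattice Λ).range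

/-- The exponential map `𝔱 ⟶ T`. -/
def texp {Λ : Type} [AddCommGroup Λ] (x : LieT Λ) : Torus Λ := QuotientAddGroup.mk x

/-- The standard smooth structure of a finite dimensional real vector space: a map to it is smooth
iff its composition with each linear functional is. -/
instance : DiffeologicalSpace (LieT Λ) :=
  ⨅ ℓ : LieT Λ →ₗ[ℝ] ℝ, inducedDiff ℓ inferInstance

instance : DiffeologicalSpace (Torus Λ) := coinducedDiff texp inferInstance

/-- The discrete smooth structure on `Λ`: plots are locally constant. -/
@[reducible] def latticeDiff : DiffeologicalSpace Λ := ⊥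

end Torus

section Constructions

variable {Λ : Type} [AddCommGroup Λ] (J : LinearMap.BilinForm ℤ Λ)

/-- The multiplier `exp (J (m, y)) = e ^ (2 π i J (m, y)) ∈ U(1)`, where `J` is extended
bilinearly to `𝔱`. -/
def multiplier (m : Λ) (y : LieT Λ) : Circle :=
  Real.fourierChar (LinearMap.BilinForm.baseChange ℝ J (lattice Λ m) y)

lemma multiplier_zero_left (y : LieT Λ) : multiplier J 0 y = 1 := by
  simp [multiplier]

lemma multiplier_zero_right (m : Λ) : multiplier J m 0 = 1 := by
  simp [multiplier]

lemma multiplier_add_left (m n : Λ) (y : LieT Λ) :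
    multiplier J (m + n) y = multiplier J m y * multiplier J n y := by
  simp [multiplier, AddChar.map_add_eq_mul]

lemma multiplier_add_right (m : Λ) (x y : LieT Λ) :
    multiplier J m (x + y) = multiplier J m x * multiplier J m y := by
  simp [multiplier, AddChar.map_add_eq_mul]

lemma multiplier_lattice (m n : Λ) : multiplier J m (lattice Λ n) = 1 := by
  have : LinearMap.BilinForm.baseChange ℝ J (lattice Λ m) (lattice Λ n) = ((J m n : ℤ) : ℝ) := by
    simp [lattice, LinearMap.BilinForm.baseChange_tmul]
  rw [multiplier, this]
  ext
  rw [Real.fourierChar_apply]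
  have := Complex.exp_int_mul_two_pi_mul_I (J m n)
  rw [Circle.coe_one, ← this]
  congr 1
  push_cast
  ring

/-! ### First construction: the strict 2-group of a crossed module -/

/-- The crossed module `Λ × U(1) ⟶ 𝔱`, `(m, z) ↦ m`, where `x ∈ 𝔱` acts by
`(m, z) ↦ (m, z * exp (J (m, x)))`. -/
def crossedModule : CrossedModule (Multiplicative (LieT Λ)) (Multiplicative Λ × Circle) where
  bd := (AddMonoidHom.toMultiplicative (lattice Λ)).comp (MonoidHom.fst _ _)
  act x :=
    { toFun := fun h => (h.1, h.2 * multiplier J h.1.toAdd x.toAdd)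
      map_one' := by simp [multiplier_zero_left]
      map_mul' := fun h k => by
        ext1
        · rfl
        · simp [multiplier_add_left, mul_mul_mul_comm] }
  act_one h := by simp [multiplier_zero_right]
  act_mul g g' h := by simp [multiplier_add_right, mul_assoc]
  bd_act g h := by simp
  peiffer k h := by
    ext1
    · simp
    · have := multiplier_lattice J h.1.toAdd k.1.toAdd
      simp [this]

/-- The groupoid of the strict 2-group: objects `𝔱`, arrows `(x, m, z) : x ⟶ x + m`. -/
abbrev StrictT : Type := (crossedModule J).TwoGp

instance : SmoothStr (StrictT J) where
  obj := inducedDiff (fun x => x.val.toAdd) inferInstance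
  arr := inducedDiff (fun a => a.1.val.toAdd) inferInstance ⊓
    inducedDiff (fun a => (CrossedModule.Hom.h a.2.2).1.toAdd) (latticeDiff Λ) ⊓
    inducedDiff (fun a => (CrossedModule.Hom.h a.2.2).2) inferInstance

/-- The strict 2-group `(𝒯, •, 0)`. -/
def strictTwoGroup : TwoGroupData (StrictT J) := TwoGroupData.ofStrict (StrictT J)

/-- The inclusion of `pt // U(1)` as the automorphisms of the unit object `0` of `𝒯`. -/
def strictIncl : BU1 ⥤ StrictT J where
  obj _ := 𝟙_ (StrictT J)
  map z := (⟨(1, (show Circle from z)), by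
    rw [show (crossedModule J).bd (1, (show Circle from z)) = 1 from map_zero (lattice Λ), mul_one]⟩ :
    CrossedModule.Hom _ _)
  map_id _ := rfl
  map_comp _ _ := CrossedModule.Hom.ext (Prod.ext (one_mul _).symm (mul_comm (G := Circle) _ _))

/-! ### Second construction: the compact model -/

/-- The Lie groupoid `T × pt // U(1)`. -/
abbrev CompactT (Λ : Type) [AddCommGroup Λ] : Type := Discrete (Torus Λ) × BU1

/-- The object of `T × pt // U(1)` over `t ∈ T`. -/
abbrev CompactT.of (t : Torus Λ) : CompactT Λ := (⟨t⟩, SingleObj.star Circle)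

lemma texp_eq_of_hom {x y : StrictT J} (f : x ⟶ y) : texp x.val.toAdd = texp y.val.toAdd := by
  refine (QuotientAddGroup.eq).2 ⟨(CrossedModule.Hom.h f).1.toAdd, ?_⟩
  have : y.val.toAdd = x.val.toAdd + lattice Λ (CrossedModule.Hom.h f).1.toAdd :=
    congrArg Multiplicative.toAdd (CrossedModule.Hom.eq f)
  rw [this]
  abel

/-- The weak equivalence `𝒯 ≅ (𝔱 // Λ) × (pt // U(1)) ⟶ T × pt // U(1)` induced by `exp : 𝔱 ⟶ T`. -/
def compactProj : StrictT J ⥤ CompactT Λ where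
  obj x := CompactT.of (texp x.val.toAdd)
  map f := (Discrete.eqToHom (texp_eq_of_hom J f), (CrossedModule.Hom.h f).2)
  map_id _ := rfl
  map_comp _ _ := Prod.ext (Subsingleton.elim _ _) (mul_comm (G := Circle) _ _)

/-- The compact model: `T × pt // U(1)` with the 2-group structure inherited from `𝒯` along the
zig-zag `(T × pt // U(1))² ⟵ 𝒯 × 𝒯 ⟶ 𝒯 ⟶ T × pt // U(1)`. -/
def compactTwoGroup : TwoGroupData (CompactT Λ) := TwoGroupData.transport (compactProj J)

/-! ### Third construction: the multiplicative bundle gerbe -/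

/-- The equivalence relation `(z, x, y) ∼ (z * exp (J (m, y)), x + m, y + n)` on `ℂ × 𝔱 × 𝔱`. -/
def lineSetoid : Setoid (ℂ × LieT Λ × LieT Λ) where
  r a b := ∃ m n : Λ,
    b = (a.1 * multiplier J m a.2.2, a.2.1 + lattice Λ m, a.2.2 + lattice Λ n)
  iseqv :=
    { refl := fun a => ⟨0, 0, by simp [multiplier_zero_left]⟩
      symm := by
        rintro ⟨z, x, y⟩ _ ⟨m, n, rfl⟩
        refine ⟨-m, -n, ?_⟩
        have h : multiplier J m y * multiplier J (-m) (y + lattice Λ n) = 1 := by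
          rw [multiplier_add_right, multiplier_lattice, mul_one, ← multiplier_add_left,
            add_neg_cancel, multiplier_zero_left]
        have h' : (multiplier J m y : ℂ) * (multiplier J (-m) (y + lattice Λ n) : ℂ) = 1 := by
          rw [← Circle.coe_mul, h, Circle.coe_one]
        simp [mul_assoc, h']
      trans := by
        rintro ⟨z, x, y⟩ _ _ ⟨m, n, rfl⟩ ⟨m', n', rfl⟩
        refine ⟨m + m', n + n', ?_⟩
        simp [multiplier_add_left, multiplier_add_right, multiplier_lattice, mul_assoc, add_assoc] }

/-- The total space of the line bundle `𝐋` over `T × T` with multipliers `exp (J (m, y))`. -/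
def LineBundle : Type := Quotient (lineSetoid J)

/-- The point `[z, x, y]` of the line bundle. -/
def LineBundle.mk (z : ℂ) (x y : LieT Λ) : LineBundle J := Quotient.mk (lineSetoid J) (z, x, y)

instance : DiffeologicalSpace (LineBundle J) :=
  coinducedDiff (fun a : ℂ × LieT Λ × LieT Λ => LineBundle.mk J a.1 a.2.1 a.2.2) inferInstance

lemma texp_add_lattice (x : LieT Λ) (m : Λ) : texp (x + lattice Λ m) = texp x :=
  (QuotientAddGroup.eq).2 ⟨-m, by simp⟩

/-- The projection of the line bundle to `T × T`. -/
def LineBundle.proj (q : LineBundle J) : Torus Λ × Torus Λ :=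
  Quotient.lift (s := lineSetoid J)
    (fun a : ℂ × LieT Λ × LieT Λ => (texp a.2.1, texp a.2.2)) (by
    rintro ⟨z, x, y⟩ _ ⟨m, n, rfl⟩
    simp [texp_add_lattice]) q

/-- The fibre of the line bundle over `(s, t)`. -/
def LineFib (s t : Torus Λ) : Type := {q : LineBundle J // LineBundle.proj J q = (s, t)}

lemma exists_lattice_of_texp_eq {x x' : LieT Λ} (h : texp x = texp x') :
    ∃ m : Λ, x' = x + lattice Λ m := by
  obtain ⟨m, hm⟩ := (QuotientAddGroup.eq).1 h
  exact ⟨m, by rw [hm]; abel⟩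

/-- The parametrization `z ↦ [z, x, y]` of the fibre over `(exp x, exp y)`. -/
def frame {s t : Torus Λ} (x y : LieT Λ) (hx : texp x = s) (hy : texp y = t) :
    ℂ ≃ LineFib J s t :=
  Equiv.ofBijective (fun z => ⟨LineBundle.mk J z x y, by rw [← hx, ← hy]; rfl⟩) (by
    constructor
    · intro z z' h
      obtain ⟨m, n, h⟩ := Quotient.exact (s := lineSetoid J) (congrArg Subtype.val h)
      simp only [Prod.mk.injEq, left_eq_add] at h
      have : multiplier J m y = 1 := by simp [multiplier, h.2.1]
      rw [h.1, this, Circle.coe_one, mul_one]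
    · rintro ⟨q, hq⟩
      induction q using Quotient.inductionOn with
      | h a =>
        obtain ⟨z, x', y'⟩ := a
        have h1 : texp x' = texp x := (congrArg Prod.fst hq).trans hx.symm
        have h2 : texp y' = texp y := (congrArg Prod.snd hq).trans hy.symm
        obtain ⟨m, rfl⟩ := exists_lattice_of_texp_eq h1
        obtain ⟨n, rfl⟩ := exists_lattice_of_texp_eq h2
        exact ⟨z * multiplier J m y', Subtype.ext (Quotient.sound (s := lineSetoid J)
          (Setoid.symm' _ ⟨m, n, rfl⟩))⟩)

lemma frame_coe {s t : Torus Λ} (x y : LieT Λ) (hx : texp x = s) (hy : texp y = t) (z : ℂ) :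
    (frame J x y hx hy z).1 = LineBundle.mk J z x y := rfl

/-- A representative in `𝔱` of an element of `T`. -/
def rep (s : Torus Λ) : LieT Λ := Quotient.out s

lemma texp_rep (s : Torus Λ) : texp (rep s) = s := Quotient.out_eq s

/-- A coordinate on the fibre over `(s, t)`. -/
def fibCoord (s t : Torus Λ) : LineFib J s t ≃ ℂ :=
  (frame J (rep s) (rep t) (texp_rep s) (texp_rep t)).symm

/-- The fibres are hermitian lines: their structure is transported from `ℂ` along the frame of some
representatives; by `trivialization` below it does not depend on the representatives. -/
instance (s t : Torus Λ) : NormedAddCommGroup (LineFib J s t) :=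
  (fibCoord J s t).normedAddCommGroup

instance (s t : Torus Λ) : InnerProductSpace ℂ (LineFib J s t) where
  toNormedSpace := (fibCoord J s t).normedSpace ℂ
  inner a b := inner ℂ (fibCoord J s t a) (fibCoord J s t b)
  norm_sq_eq_re_inner a := norm_sq_eq_re_inner (𝕜 := ℂ) (fibCoord J s t a)
  conj_inner_symm a b := inner_conj_symm (𝕜 := ℂ) (fibCoord J s t a) (fibCoord J s t b)
  add_left a b c := by
    change inner ℂ (fibCoord J s t ((fibCoord J s t).symm (_ + _))) _ = _
    rw [Equiv.apply_symm_apply, inner_add_left]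
    rfl
  smul_left a b z := by
    change inner ℂ (fibCoord J s t ((fibCoord J s t).symm (_ • _))) _ = _
    rw [Equiv.apply_symm_apply, inner_smul_left]
    rfl

lemma frame_change {s t : Torus Λ} (x y x' y' : LieT Λ) (hx : texp x = s) (hy : texp y = t)
    (hx' : texp x' = s) (hy' : texp y' = t) :
    ∃ u : Circle, ∀ q, (frame J x' y' hx' hy').symm q = u * (frame J x y hx hy).symm q := by
  obtain ⟨m, rfl⟩ := exists_lattice_of_texp_eq (hx.trans hx'.symm)
  obtain ⟨n, rfl⟩ := exists_lattice_of_texp_eq (hy.trans hy'.symm)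
  refine ⟨multiplier J m y, fun q => ?_⟩
  obtain ⟨z, rfl⟩ := (frame J x y hx hy).surjective q
  rw [Equiv.symm_apply_apply, Equiv.symm_apply_eq]
  refine Subtype.ext (Quotient.sound (s := lineSetoid J) ⟨m, n, ?_⟩)
  simp [mul_comm]

/-- The trivialization of the line bundle over `𝔱 × 𝔱`: the unitary isomorphism `[z, x, y] ↦ z`
from the fibre over `(exp x, exp y)` to `ℂ`. -/
def trivialization {s t : Torus Λ} (x y : LieT Λ) (hx : texp x = s) (hy : texp y = t) :
    LineFib J s t ≃ₗᵢ[ℂ] ℂ where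
  toFun := (frame J x y hx hy).symm
  invFun := frame J x y hx hy
  left_inv := (frame J x y hx hy).apply_symm_apply
  right_inv := (frame J x y hx hy).symm_apply_apply
  map_add' a b := by
    obtain ⟨u, hu⟩ := frame_change J (rep s) (rep t) x y (texp_rep s) (texp_rep t) hx hy
    rw [hu, hu, hu, ← mul_add]
    exact congrArg _ ((fibCoord J s t).apply_symm_apply _)
  map_smul' c a := by
    obtain ⟨u, hu⟩ := frame_change J (rep s) (rep t) x y (texp_rep s) (texp_rep t) hx hy
    rw [hu, hu]
    refine (congrArg _ ((fibCoord J s t).apply_symm_apply _)).trans ?_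
    simp only [smul_eq_mul, RingHom.id_apply]
    exact mul_left_comm _ _ _
  norm_map' a := by
    obtain ⟨u, hu⟩ := frame_change J (rep s) (rep t) x y (texp_rep s) (texp_rep t) hx hy
    change ‖(frame J x y hx hy).symm a‖ = _
    rw [hu, norm_mul, Circle.norm_coe, one_mul]
    rfl

lemma trivialization_mk (x y : LieT Λ) (z : ℂ) :
    trivialization J x y rfl rfl ⟨LineBundle.mk J z x y, rfl⟩ = z :=
  (frame J x y rfl rfl).symm_apply_apply z

lemma trivialization_change (x y : LieT Λ) (m n : Λ) {s t : Torus Λ} (hx : texp x = s)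
    (hy : texp y = t) (hx' : texp (x + lattice Λ m) = s) (hy' : texp (y + lattice Λ n) = t)
    (q : LineFib J s t) :
    trivialization J (x + lattice Λ m) (y + lattice Λ n) hx' hy' q =
      multiplier J m y * trivialization J x y hx hy q := by
  obtain ⟨z, rfl⟩ := (trivialization J x y hx hy).symm.surjective q
  rw [LinearIsometryEquiv.apply_symm_apply]
  refine ((frame J _ _ hx' hy').symm_apply_eq).2 ?_
  refine Subtype.ext (Quotient.sound (s := lineSetoid J) ⟨m, n, ?_⟩)
  simp [mul_comm]

/-- A hermitian line. -/
structure HermLine where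
  carrier : Type
  [normed : NormedAddCommGroup carrier]
  [innerProd : InnerProductSpace ℂ carrier]
  finrank_eq : Module.finrank ℂ carrier = 1

attribute [instance] HermLine.normed HermLine.innerProd

namespace HermLine

/-- The standard hermitian line `ℂ`. -/
def std : HermLine := ⟨ℂ, by simp⟩

/-- The fibre of the line bundle over `(s, t)`, as a hermitian line. -/
def fib (s t : Torus Λ) : HermLine :=
  ⟨LineFib J s t, by
    rw [(trivialization J (rep s) (rep t) (texp_rep s) (texp_rep t)).toLinearEquiv.finrank_eq]
    simp⟩

/-- The tensor product of hermitian lines. -/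
def tensor (L M : HermLine) : HermLine :=
  ⟨L.carrier ⊗[ℂ] M.carrier, by rw [Module.finrank_tensorProduct, L.finrank_eq, M.finrank_eq]⟩

/-- The unitary isomorphisms between hermitian lines. -/
abbrev Unitary (L M : HermLine) : Type := L.carrier ≃ₗᵢ[ℂ] M.carrier

/-- `x ⊗ y`, as an element of the tensor product of hermitian lines. -/
def tmul {L M : HermLine} (x : L.carrier) (y : M.carrier) : (L.tensor M).carrier := x ⊗ₜ[ℂ] y

/-- The tensor product of unitary isomorphisms. -/
def tensorIso {L L' M M' : HermLine} (f : L.Unitary L') (g : M.Unitary M') :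
    (L.tensor M).Unitary (L'.tensor M') := TensorProduct.congrIsometry f g

/-- `(x ⊗ y) ⊗ z ↦ x ⊗ (y ⊗ z)`. -/
def assocIso (L M N : HermLine) : ((L.tensor M).tensor N).Unitary (L.tensor (M.tensor N)) :=
  TensorProduct.assocIsometry ℂ L.carrier M.carrier N.carrier

/-- `x ⊗ y ↦ y ⊗ x`. -/
def commIso (L M : HermLine) : (L.tensor M).Unitary (M.tensor L) :=
  TensorProduct.commIsometry ℂ L.carrier M.carrier

/-- `z ⊗ x ↦ z x`. -/
def lidIso (L : HermLine) : (std.tensor L).Unitary L := TensorProduct.lidIsometry ℂ L.carrier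

/-- `x ⊗ z ↦ z x`. -/
def ridIso (L : HermLine) : (L.tensor std).Unitary L := TensorProduct.ridIsometry ℂ L.carrier

/-- `p ⊗ ((q ⊗ (a ⊗ b)) ⊗ c) ↦ (p ⊗ q) ⊗ (a ⊗ (b ⊗ c))`. -/
def reassocLeft (A B C D E : HermLine) :
    (A.tensor ((B.tensor (C.tensor D)).tensor E)).Unitary
      ((A.tensor B).tensor (C.tensor (D.tensor E))) :=
  (tensorIso (.refl ℂ _) ((assocIso B (C.tensor D) E).trans
    (tensorIso (.refl ℂ _) (assocIso C D E)))).trans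
  (assocIso A B (C.tensor (D.tensor E))).symm

/-- `(p ⊗ q) ⊗ (a ⊗ d) ↦ p ⊗ (a ⊗ (q ⊗ d))`. -/
def reassocRight (A B C D : HermLine) :
    ((A.tensor B).tensor (C.tensor D)).Unitary (A.tensor (C.tensor (B.tensor D))) :=
  (assocIso A B (C.tensor D)).trans
  (tensorIso (.refl ℂ _)
    (((assocIso B C D).symm.trans (tensorIso (commIso B C) (.refl ℂ _))).trans
      (assocIso C B D)))

/-- Multiplication by `z ∈ U(1)` as a unitary automorphism of `ℂ`. -/
def unitMul (z : Circle) : std.Unitary std :=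
  show ℂ ≃ₗᵢ[ℂ] ℂ from
    { LinearEquiv.smulOfUnit (M := ℂ) (Circle.toUnits z) with
      norm_map' := fun x => by
        change ‖(z : ℂ) * x‖ = ‖x‖
        rw [norm_mul, Circle.norm_coe, one_mul] }

end HermLine

/-- The unitary isomorphism `[z, x, y] ↦ z` from the fibre over `(exp x, exp y)` to `ℂ`. -/
def fibTriv {s t : Torus Λ} (x y : LieT Λ) (hx : texp x = s) (hy : texp y = t) :
    (HermLine.fib J s t).Unitary HermLine.std := trivialization J x y hx hy

/-- The element `[z, x, y]` of the fibre over `(exp x, exp y)`. -/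
def fibMk {s t : Torus Λ} (z : ℂ) (x y : LieT Λ) (hx : texp x = s) (hy : texp y = t) :
    (HermLine.fib J s t).carrier :=
  show LineFib J s t from ⟨LineBundle.mk J z x y, by rw [← hx, ← hy]; rfl⟩

/-- The isomorphism `α : 𝐋_{r s, t} ⊗ 𝐋_{r, s} ≅ 𝐋_{r, s t} ⊗ 𝐋_{s, t}` given by the equality of the
multipliers of both sides: if `r, s, t` are the images of `x, y, z ∈ 𝔱`, then `α` sends
`[a, x + y, z] ⊗ [b, x, y]` to `[a, x, y + z] ⊗ [b, y, z]`.  It is defined through representatives;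
by `gerbeAlpha_mk` it is independent of them. -/
def gerbeAlpha (r s t : Torus Λ) :
    ((HermLine.fib J (r + s) t).tensor (HermLine.fib J r s)).Unitary
      ((HermLine.fib J r (s + t)).tensor (HermLine.fib J s t)) :=
  (HermLine.tensorIso
    (fibTriv J (rep r + rep s) (rep t)
      (congrArg₂ (· + ·) (texp_rep r) (texp_rep s)) (texp_rep t))
    (fibTriv J (rep r) (rep s) (texp_rep r) (texp_rep s))).trans
  (HermLine.tensorIso
    (fibTriv J (rep r) (rep s + rep t) (texp_rep r)
      (congrArg₂ (· + ·) (texp_rep s) (texp_rep t)))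
    (fibTriv J (rep s) (rep t) (texp_rep s) (texp_rep t))).symm

lemma fibTriv_mk {s t : Torus Λ} (x y : LieT Λ) (m n : Λ) (hx : texp x = s) (hy : texp y = t)
    (hx' : texp (x + lattice Λ m) = s) (hy' : texp (y + lattice Λ n) = t) (z : ℂ) :
    fibTriv J (x + lattice Λ m) (y + lattice Λ n) hx' hy' (fibMk J z x y hx hy) =
      (multiplier J m y * z : ℂ) :=
  (trivialization_change J x y m n hx hy hx' hy' _).trans
    (congrArg _ ((frame J x y hx hy).symm_apply_apply z))

/-- `α` is independent of the choice of representatives. -/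
lemma gerbeAlpha_mk (x y z : LieT Λ) (a b : ℂ) :
    gerbeAlpha J (texp x) (texp y) (texp z)
      (HermLine.tmul (fibMk J a (x + y) z rfl rfl) (fibMk J b x y rfl rfl)) =
      HermLine.tmul (fibMk J a x (y + z) rfl rfl) (fibMk J b y z rfl rfl) := by
  obtain ⟨k, hk⟩ := exists_lattice_of_texp_eq (texp_rep (texp x)).symm
  obtain ⟨l, hl⟩ := exists_lattice_of_texp_eq (texp_rep (texp y)).symm
  obtain ⟨m, hm⟩ := exists_lattice_of_texp_eq (texp_rep (texp z)).symm
  have hxy : rep (texp x) + rep (texp y) = (x + y) + lattice Λ (k + l) := by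
    rw [hk, hl, map_add]; abel
  have hyz : rep (texp y) + rep (texp z) = (y + z) + lattice Λ (l + m) := by
    rw [hl, hm, map_add]; abel
  have key : ∀ {s t : Torus Λ} (x x' y y' : LieT Λ) (m n : Λ) (hx : texp x = s) (hy : texp y = t)
      (hx' : texp x' = s) (hy' : texp y' = t) (_ : x' = x + lattice Λ m)
      (_ : y' = y + lattice Λ n) (z : ℂ),
      fibTriv J x' y' hx' hy' (fibMk J z x y hx hy) = (multiplier J m y * z : ℂ) := by
    rintro s t x _ y _ m n hx hy hx' hy' rfl rfl z
    exact fibTriv_mk J x y m n hx hy hx' hy' z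
  have h1 := key (x + y) _ z _ (k + l) m rfl rfl
    (congrArg₂ (· + ·) (texp_rep (texp x)) (texp_rep (texp y))) (texp_rep (texp z)) hxy hm a
  have h2 := key x _ y _ k l rfl rfl (texp_rep (texp x)) (texp_rep (texp y)) hk hl b
  have h3 := key x _ (y + z) _ k (l + m) rfl rfl (texp_rep (texp x))
    (congrArg₂ (· + ·) (texp_rep (texp y)) (texp_rep (texp z))) hk hyz a
  have h4 := key y _ z _ l m rfl rfl (texp_rep (texp y)) (texp_rep (texp z)) hl hm b
  refine (LinearIsometryEquiv.symm_apply_eq _).2 ?_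
  refine (congrArg₂ (fun u v : ℂ => u ⊗ₜ[ℂ] v) h1 h2).trans
    (Eq.trans ?_ (congrArg₂ (fun u v : ℂ => u ⊗ₜ[ℂ] v) h3 h4).symm)
  have e : ∀ u v : ℂ, u ⊗ₜ[ℂ] v = (u * v) • ((1 : ℂ) ⊗ₜ[ℂ] (1 : ℂ)) := fun u v => by
    rw [mul_smul, ← TensorProduct.tmul_smul, TensorProduct.smul_tmul']
    simp
  rw [e, e (_ * a) (multiplier J l z * b)]
  congr 1
  rw [multiplier_add_left, multiplier_add_right]
  push_cast
  ring

/-- The objects `(t, L)` of the groupoid `ℐ` of the trivial bundle gerbe over `T`. -/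
@[ext] structure Gerbe (_J : LinearMap.BilinForm ℤ Λ) where
  base : Torus Λ
  line : HermLine

/-- The arrows `(t, L) ⟶ (t, L')` are the unitary isomorphisms from `L` to `L'`. -/
@[ext] structure GerbeHom (a b : Gerbe J) where
  base_eq : a.base = b.base
  iso : a.line.carrier ≃ₗᵢ[ℂ] b.line.carrier

instance : Groupoid.{0} (Gerbe J) where
  Hom a b := GerbeHom J a b
  id a := ⟨rfl, .refl ℂ _⟩
  comp f g := ⟨f.base_eq.trans g.base_eq, f.iso.trans g.iso⟩
  inv f := ⟨f.base_eq.symm, f.iso.symm⟩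
  inv_comp f := GerbeHom.ext (by ext; simp)
  comp_inv f := GerbeHom.ext (by ext; simp)

/-- An isomorphism in `ℐ`, from a unitary isomorphism. -/
def Gerbe.mkIso {a b : Gerbe J} (h : a.base = b.base)
    (f : a.line.carrier ≃ₗᵢ[ℂ] b.line.carrier) : a ≅ b where
  hom := (⟨h, f⟩ : GerbeHom J a b)
  inv := (⟨h.symm, f.symm⟩ : GerbeHom J b a)
  hom_inv_id := GerbeHom.ext (by change f.trans f.symm = _; simp; rfl)
  inv_hom_id := GerbeHom.ext (by change f.symm.trans f = _; simp; rfl)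

/-- `(s, L) ⊛ (t, L') = (s t, 𝐋_{s,t} ⊗ L ⊗ L')` on objects. -/
def Gerbe.tensorObj (a b : Gerbe J) : Gerbe J :=
  ⟨a.base + b.base, (HermLine.fib J a.base b.base).tensor (a.line.tensor b.line)⟩

/-- `(s, L) ⊛ (t, L') = (s t, 𝐋_{s,t} ⊗ L ⊗ L')` on arrows. -/
def GerbeHom.tensor {a b c d : Gerbe J} (f : GerbeHom J a b) (g : GerbeHom J c d) :
    GerbeHom J (Gerbe.tensorObj J a c) (Gerbe.tensorObj J b d) where
  base_eq := congrArg₂ (· + ·) f.base_eq g.base_eq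
  iso := by
    obtain ⟨s, L⟩ := a
    obtain ⟨s', L'⟩ := b
    obtain ⟨t, M⟩ := c
    obtain ⟨t', M'⟩ := d
    obtain rfl : s = s' := f.base_eq
    obtain rfl : t = t' := g.base_eq
    exact TensorProduct.congrIsometry (.refl ℂ _) (TensorProduct.congrIsometry f.iso g.iso)

/-- The groupoid `ℐ` with the multiplication `⊛`, the unit object `(1, ℂ)`, the associativity
isomorphisms encoded in `α`, and the unit isomorphisms encoded in the trivializations
`[z, 0, y] ↦ z` of `𝐋_{1, t}` and `[z, x, 0] ↦ z` of `𝐋_{s, 1}`. -/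
instance : MonoidalCategoryStruct (Gerbe J) where
  tensorObj := Gerbe.tensorObj J
  whiskerLeft a _ _ f := GerbeHom.tensor J (𝟙 a : GerbeHom J a a) f
  whiskerRight f a := GerbeHom.tensor J f (𝟙 a : GerbeHom J a a)
  tensorHom f g := GerbeHom.tensor J f g
  tensorUnit := ⟨0, HermLine.std⟩
  associator a b c := Gerbe.mkIso J (add_assoc a.base b.base c.base)
    (((HermLine.reassocLeft (HermLine.fib J (a.base + b.base) c.base)
          (HermLine.fib J a.base b.base) a.line b.line c.line).trans
        (HermLine.tensorIso (gerbeAlpha J a.base b.base c.base) (.refl ℂ _))).trans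
      (HermLine.reassocRight (HermLine.fib J a.base (b.base + c.base))
        (HermLine.fib J b.base c.base) a.line (b.line.tensor c.line)))
  leftUnitor a := Gerbe.mkIso J (zero_add a.base)
    ((HermLine.tensorIso
        (fibTriv J 0 (rep a.base) (QuotientAddGroup.mk_zero _) (texp_rep a.base))
        (HermLine.lidIso a.line)).trans (HermLine.lidIso a.line))
  rightUnitor a := Gerbe.mkIso J (add_zero a.base)
    ((HermLine.tensorIso
        (fibTriv J (rep a.base) 0 (texp_rep a.base) (QuotientAddGroup.mk_zero _))
        (HermLine.ridIso a.line)).trans (HermLine.lidIso a.line))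

/-- The functor `T × pt // U(1) ⥤ ℐ`, `t ↦ (t, ℂ)`: the Lie groupoid underlying the trivial bundle
gerbe over `T`. -/
def gerbePres : CompactT Λ ⥤ Gerbe J where
  obj t := ⟨t.1.as, HermLine.std⟩
  map f := (⟨Discrete.eq_of_hom f.1, HermLine.unitMul f.2⟩ : GerbeHom J _ _)
  map_id _ := GerbeHom.ext (LinearIsometryEquiv.ext fun z : ℂ => one_mul z)
  map_comp _ _ := GerbeHom.ext (LinearIsometryEquiv.ext fun z : ℂ => mul_assoc _ _ z)

/-- The functor `F : 𝒯 ⥤ ℐ`, `x ↦ (exp x, ℂ)`, `(x, m, z) ↦ z`. -/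
def gerbeFunctor : StrictT J ⥤ Gerbe J where
  obj x := ⟨texp x.val.toAdd, HermLine.std⟩
  map f := (⟨texp_eq_of_hom J f, HermLine.unitMul (CrossedModule.Hom.h f).2⟩ : GerbeHom J _ _)
  map_id _ := GerbeHom.ext (LinearIsometryEquiv.ext fun z : ℂ => one_mul z)
  map_comp _ _ := GerbeHom.ext (LinearIsometryEquiv.ext fun z : ℂ =>
    (congrArg (fun u : Circle => (u : ℂ) * z) (mul_comm _ _)).trans (mul_assoc _ _ z))

/-- `ε = id : (1, ℂ) ⟶ F 0`. -/
def gerbeFunctorε : 𝟙_ (Gerbe J) ⟶ (gerbeFunctor J).obj (𝟙_ (StrictT J)) :=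
  (⟨rfl, .refl ℂ _⟩ : GerbeHom J _ _)

/-- `φ_{x,y} : F x ⊛ F y ⟶ F (x • y)`, the trivialization `[z, x, y] ↦ z` of
`𝐋_{exp x, exp y}` (and `ℂ ⊗ ℂ ≅ ℂ`). -/
def gerbeFunctorφ (x y : StrictT J) :
    (gerbeFunctor J).obj x ⊗ (gerbeFunctor J).obj y ⟶ (gerbeFunctor J).obj (x ⊗ y) :=
  (⟨rfl, (HermLine.tensorIso (fibTriv J x.val.toAdd y.val.toAdd rfl rfl)
    (HermLine.lidIso HermLine.std)).trans (HermLine.lidIso HermLine.std)⟩ :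
    GerbeHom J ((gerbeFunctor J).obj x ⊗ (gerbeFunctor J).obj y) ((gerbeFunctor J).obj (x ⊗ y)))

/-- The projection `ℐ ⥤ T`, `(t, L) ↦ t`. -/
def gerbeBase : Gerbe J ⥤ Discrete (Torus Λ) where
  obj a := ⟨a.base⟩
  map f := Discrete.eqToHom (GerbeHom.base_eq f)

/-- The inclusion of `pt // U(1)` as the automorphisms of the unit object `(1, ℂ)` of `ℐ`. -/
def gerbeIncl : BU1 ⥤ Gerbe J where
  obj _ := 𝟙_ (Gerbe J)
  map z := (⟨rfl, HermLine.unitMul (show Circle from z)⟩ : GerbeHom J _ _)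
  map_id _ := GerbeHom.ext (LinearIsometryEquiv.ext fun z : ℂ => one_mul z)
  map_comp _ _ := GerbeHom.ext (LinearIsometryEquiv.ext fun z : ℂ => mul_assoc _ _ z)

/-- The vector of `𝐋_{s,t}` (as a point of the total space `𝐋`) that corresponds to the preimage of
`1` under a unitary isomorphism `𝐋_{s,t} ⊗ (ℂ ⊗ ℂ) ⟶ ℂ`. -/
def gerbeMulPoint
    (b : Σ q : CompactT Λ × CompactT Λ, Σ r : CompactT Λ,
      ((gerbePres J).obj q.1 ⊗ (gerbePres J).obj q.2 ⟶ (gerbePres J).obj r)) : LineBundle J :=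
  (show LineFib J b.1.1.1.as b.1.2.1.as from
    HermLine.ridIso (HermLine.fib J b.1.1.1.as b.1.2.1.as)
      (HermLine.tensorIso (.refl ℂ _) (HermLine.lidIso HermLine.std)
        ((GerbeHom.iso b.2.2).symm (show ℂ from 1)))).1

/-- The 2-group structure of the multiplicative bundle gerbe `(𝐋, α)`, on the Lie groupoid
`T × pt // U(1)` underlying the trivial bundle gerbe: the elements of the multiplication bibundle
over `(s, t; r)` are the arrows `(s, ℂ) ⊛ (t, ℂ) ⟶ (r, ℂ)` in `ℐ`, that is, the unit vectors of
`𝐋_{s,t}` if `r = s t`, with the smooth structure of the unit circle bundle of `𝐋`. -/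
def gerbeTwoGroup : TwoGroupData (CompactT Λ) :=
  TwoGroupData.ofMonoidal (gerbePres J)
    (inducedDiff (gerbeMulPoint J) inferInstance)
    (inducedDiff (fun b => (show ℂ from (GerbeHom.iso b.2.2) (show ℂ from 1))) inferInstance)

/-! ### The three extensions and the equivalences between them -/

/-- `1 ⟶ pt // U(1) ⟶ 𝒯 ⟶ T ⟶ 1`. -/
def strictExt : ExtData (Torus Λ) where
  X := StrictT J
  G := strictTwoGroup J
  incl := TwoGroupHom.ofMonoidal (𝟭 BU1) (𝟭 (StrictT J)) (strictIncl J) (𝟙 _) (fun _ _ => (λ_ _).hom)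
    (inducedDiff (fun b => (⟨_, b.2.1, b.2.2⟩ : Arr (StrictT J))) inferInstance)
  proj := TwoGroupHom.toDiscrete _ (compactProj J ⋙ CategoryTheory.Prod.fst _ _)

/-- `1 ⟶ pt // U(1) ⟶ T × pt // U(1) ⟶ T ⟶ 1`, inherited from `𝒯`. -/
def compactExt : ExtData (Torus Λ) where
  X := CompactT Λ
  G := compactTwoGroup J
  incl := TwoGroupHom.toTransport (compactProj J) (strictIncl J) (𝟙 _) (fun _ _ => (λ_ _).hom)
  proj := TwoGroupHom.toDiscrete _ (CategoryTheory.Prod.fst _ _)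

/-- The extension given by the multiplicative bundle gerbe. -/
def gerbeExt : ExtData (Torus Λ) where
  X := CompactT Λ
  G := gerbeTwoGroup J
  incl := TwoGroupHom.ofMonoidal (𝟭 BU1) (gerbePres J) (gerbeIncl J) (𝟙 _) (fun _ _ => (λ_ _).hom)
    (inducedDiff (fun b => (show ℂ from (GerbeHom.iso b.2.2) (show ℂ from 1))) inferInstance)
  proj := TwoGroupHom.toDiscrete _ (CategoryTheory.Prod.fst _ _)

/-- The 1-morphism from the strict 2-group to its compact model given by
`p : 𝒯 ⥤ T × pt // U(1)`. -/
def strictToCompact : TwoGroupHom (strictTwoGroup J) (compactTwoGroup J) :=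
  TwoGroupHom.toTransport (compactProj J) (𝟭 (StrictT J)) (𝟙 _) (fun _ _ => 𝟙 _)

/-- The 1-morphism from the strict 2-group to the multiplicative bundle gerbe given by the monoidal
functor `(F, φ, ε)`. -/
def strictToGerbe : TwoGroupHom (strictTwoGroup J) (gerbeTwoGroup J) :=
  TwoGroupHom.ofMonoidal (𝟭 (StrictT J)) (gerbePres J) (gerbeFunctor J) (gerbeFunctorε J)
    (gerbeFunctorφ J)
    (inducedDiff (fun b => ((b.1, (show ℂ from (GerbeHom.iso b.2.2) (show ℂ from 1))) :
      StrictT J × ℂ)) inferInstance)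

end Constructions

end

/-! The strict 2-group is a smooth monoidal groupoid with a functorial multiplication, so its axioms
can be checked by hand. Interchange is the Peiffer identity, all constraints have trivial label, and
the equation x + y = q is solved smoothly by y = q - x. This is `isSmoothMonoidal_strict`, from
which `IsSmoothMonoidal.isLieTwoGroup` produces a monoid object in `Bibun` with invertible shear
map. Centrality (`StrictT.eq_of_central`) holds because an automorphism has lattice part 0, so the
multiplier does not see it and U(1) is commutative; exactness holds because the kernel of exp is the
lattice.

The other two 2-groups live on T × pt // U(1), where the multiplication is a genuine bibundle. But p
is fully faithful and a surjective submersion on objects (`isSmoothCover_compactProj`), and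
everything about bibundles is local on objects: a pointwise identity may be checked after lifting
the objects along p, and a smooth family of objects lifts near each point of its parameter space.
Hence a structure over T × pt // U(1) satisfies its axioms as soon as its pullback to the strict
groupoid does. This descent is carried out for bibundles (`BibCover.isRightPrincipal`,
`BibCover.isLeftPrincipalOver`), 2-groups (`TwoGroupCover.isLieTwoGroup`), 1-morphisms
(`HomCover.isHom`) and isomorphisms between composites (`TwoGroupHom.IsCompIso.of_cover`).

It remains to see that both pullbacks are the strict 2-group. For the compact model, full
faithfulness moves the outer legs of a zig-zag into the strict groupoid, and the identification of
representatives then absorbs them, so an element over (p x, p y; p z) is an arrow x • y ⟶ z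
(`toZigzag_bijective`). For the gerbe, every arrow F x ⊛ F y ⟶ F z is φ followed by F of a unique
arrow x • y ⟶ z. That this respects all structure is the monoidality of F
(`gerbeFunctor_isMonoidal`): lines are one-dimensional, so each law is tested on one vector [1, x,
y] ⊗ 1 ⊗ 1, and the only scalar that ever appears is exp(J(m, y)), the change of trivialization,
which is exactly the twist in the tensor product of arrows of the strict 2-group. The smooth
structures match because 𝐋 is trivial over smooth lifts to the Lie algebra (`isPlot_lineBundle_mk`).

Under these identifications p, F and the comparison from the compact model to the gerbe are all
covered by the identity of the strict 2-group. Their invertibility and their compatibility with the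
inclusions descend from this trivial case. Compatibility with the projections is immediate, since T
has only identity arrows. -/

/-! ## Plots -/

/-- Around every point there is a smooth self-map of the test space with values in a given
neighbourhood which is the identity near the point. -/
lemma exists_smooth_retract {n : ℕ} {v : Euc n} {U : Set (Euc n)} (hU : U ∈ 𝓝 v) :
    ∃ σ : Euc n → Euc n, ContDiff ℝ ∞ σ ∧ (∀ w, σ w ∈ U) ∧ ∀ᶠ w in 𝓝 v, σ w = w := by
  obtain ⟨ε, hε, hb⟩ := Metric.mem_nhds_iff.1 hU
  -- The bump is 1 within distance ε/2 of v and 0 beyond ε. Scaling w - v by it keeps the image in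
  -- the ε-ball: inside the ball because β ≤ 1, outside because everything collapses to v.
  let β : ContDiffBump v := ⟨ε / 2, ε, by positivity, by linarith⟩
  refine ⟨fun w => v + β w • (w - v), ?_, fun w => hb ?_, ?_⟩
  · exact contDiff_const.add (β.contDiff.smul (contDiff_id.sub contDiff_const))
  · rw [Metric.mem_ball, dist_eq_norm, add_sub_cancel_left, norm_smul]
    by_cases hw : w ∈ Metric.ball v ε
    · rw [Metric.mem_ball, dist_eq_norm] at hw
      refine lt_of_le_of_lt ?_ hw
      rw [Real.norm_of_nonneg β.nonneg]
      exact mul_le_of_le_one_left (norm_nonneg _) β.le_one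
    · have : β w = 0 := by
        rw [← Function.notMem_support, β.support_eq]; exact hw
      simpa [this] using hε
  · filter_upwards [β.eventuallyEq_one] with w hw
    rw [hw]; simp

section Plots

variable {X Y Z : Type*}

/-- Test spaces are whole Euclidean spaces, so restricting to a neighbourhood is replaced by
precomposing with a retraction: a reparametrization with values where σ is the identity factors
through p ∘ σ. -/
lemma isPlot_of_local [DiffeologicalSpace X] {n : ℕ} {p : Euc n → X}
    (h : ∀ v, ∃ σ : Euc n → Euc n, (∀ᶠ w in 𝓝 v, σ w = w) ∧ IsPlot (p ∘ σ)) : IsPlot p := by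
  refine DiffeologicalSpace.locality fun v => ?_
  obtain ⟨σ, hσ, hp⟩ := h v
  obtain ⟨u, hu, ho, hv⟩ := eventually_nhds_iff.1 hσ
  refine ⟨u, ho, hv, fun {m f} hf hs => ?_⟩
  have : p ∘ f = (p ∘ σ) ∘ f := by
    funext x; simp [hu _ (hf x)]
  rw [this]
  exact isPlot_reparam hp hs

/-- Being a plot depends only on germs: a retraction into the set where p and q agree turns p ∘ σ
into a reparametrization of the plot q. -/
lemma isPlot_of_eventually [DiffeologicalSpace X] {n : ℕ} {p : Euc n → X}
    (h : ∀ v, ∃ q : Euc n → X, IsPlot q ∧ ∀ᶠ w in 𝓝 v, p w = q w) : IsPlot p := by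
  refine isPlot_of_local fun v => ?_
  obtain ⟨q, hq, he⟩ := h v
  obtain ⟨σ, hσ, hm, hs⟩ := exists_smooth_retract he
  refine ⟨σ, hs, ?_⟩
  have : p ∘ σ = q ∘ σ := funext fun w => hm w
  rw [this]
  exact isPlot_reparam hq hσ

lemma isPlot_induced {d : DiffeologicalSpace Y} {f : X → Y} {n : ℕ} {p : Euc n → X} :
    @IsPlot X (inducedDiff f d) n p ↔ IsPlot (fun v => f (p v)) := Iff.rfl

lemma isPlot_prod [DiffeologicalSpace X] [DiffeologicalSpace Y] {n : ℕ} {p : Euc n → X × Y} :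
    IsPlot p ↔ IsPlot (fun v => (p v).1) ∧ IsPlot (fun v => (p v).2) :=
  DiffeologicalSpace.isPlot_inf_iff

lemma Diffeology.IsPlot.prodMk [DiffeologicalSpace X] [DiffeologicalSpace Y] {n : ℕ} {p : Euc n → X}
    {q : Euc n → Y} (hp : IsPlot p) (hq : IsPlot q) : IsPlot (fun v => (p v, q v)) :=
  isPlot_prod.2 ⟨hp, hq⟩

/-- The maps which locally lift along `f` to plots. -/
@[reducible] def localLiftDiff (f : X → Y) (d : DiffeologicalSpace X) :
    DiffeologicalSpace Y where
  plots n := {q | ∀ v, (∃ y, ∀ᶠ w in 𝓝 v, q w = y) ∨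
    ∃ p : Euc n → X, IsPlot p ∧ ∀ᶠ w in 𝓝 v, q w = f (p w)}
  constant_plots y := fun v => Or.inl ⟨y, by simp⟩
  plot_reparam {n m p g} hp hg := fun v => by
    rcases hp (g v) with ⟨y, hy⟩ | ⟨q, hq, he⟩
    · exact Or.inl ⟨y, hg.continuous.continuousAt.eventually hy⟩
    · exact Or.inr ⟨q ∘ g, isPlot_reparam hq hg, hg.continuous.continuousAt.eventually he⟩
  locality {n p} hp := fun v => by
    obtain ⟨u, hu, hv, h⟩ := hp v
    obtain ⟨σ, hσ, hm, hs⟩ := exists_smooth_retract (hu.mem_nhds hv)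
    rcases h hm hσ v with ⟨y, hy⟩ | ⟨q, hq, he⟩
    · refine Or.inl ⟨y, ?_⟩
      filter_upwards [hs, hy] with w hw hy
      simpa [hw] using hy
    · refine Or.inr ⟨q, hq, ?_⟩
      filter_upwards [hs, he] with w hw hy
      simpa [hw] using hy

lemma isPlot_coinduced_comp {d : DiffeologicalSpace X} {f : X → Y} {n : ℕ} {p : Euc n → X}
    (hp : IsPlot p) : @IsPlot Y (coinducedDiff f d) n (fun v => f (p v)) :=
  DiffeologicalSpace.isPlot_generatedFrom_of_mem ⟨p, hp, rfl⟩

/-- For surjective `f`, the plots of the quotient diffeology are the maps which locally lift. -/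
lemma isPlot_coinduced {d : DiffeologicalSpace X} {f : X → Y} (hf : Function.Surjective f) {n : ℕ}
    {q : Euc n → Y} : @IsPlot Y (coinducedDiff f d) n q ↔
      ∀ v, ∃ p : Euc n → X, IsPlot p ∧ ∀ᶠ w in 𝓝 v, q w = f (p w) := by
  constructor
  · intro h v
    -- The quotient diffeology is the smallest one containing all f ∘ p, so comparing it with
    -- `localLiftDiff` yields the lifts. The locally constant alternative there only serves to make
    -- constants off the range plots; surjectivity of f turns it into a lift as well.
    have : coinducedDiff f d ≤ localLiftDiff f d := by
      refine DiffeologicalSpace.generateFrom_le_iff.2 ?_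
      rintro n q ⟨p, hp, hq⟩
      intro v
      exact Or.inr ⟨p, hp, by simp only at hq; simp [hq]⟩
    rcases DiffeologicalSpace.le_iff'.1 this n q h v with ⟨y, hy⟩ | h
    · obtain ⟨x, rfl⟩ := hf y
      exact ⟨fun _ => x, isPlot_const, hy⟩
    · exact h
  · intro h
    let := coinducedDiff f d
    refine isPlot_of_eventually fun v => ?_
    obtain ⟨p, hp, he⟩ := h v
    exact ⟨_, isPlot_coinduced_comp hp, he⟩

/-- The diffeology of locally constant maps. -/
@[reducible] def locallyConstDiff (X : Type*) : DiffeologicalSpace X where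
  plots n := {q | ∀ v, ∀ᶠ w in 𝓝 v, q w = q v}
  constant_plots y := fun v => by simp
  plot_reparam {n m p g} hp hg := fun v => hg.continuous.continuousAt.eventually (hp (g v))
  locality {n p} hp := fun v => by
    obtain ⟨u, hu, hv, h⟩ := hp v
    obtain ⟨σ, hσ, hm, hs⟩ := exists_smooth_retract (hu.mem_nhds hv)
    filter_upwards [hs, h hm hσ v] with w hw hy
    simpa [hw, hs.self_of_nhds] using hy

/-- The bottom diffeology lies below the one of locally constant maps; conversely a locally constant
map has the germ of a constant plot at every point. -/
lemma isPlot_bot {n : ℕ} {q : Euc n → X} :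
    @IsPlot X ⊥ n q ↔ ∀ v, ∀ᶠ w in 𝓝 v, q w = q v := by
  constructor
  · exact DiffeologicalSpace.le_iff'.1 (bot_le : ⊥ ≤ locallyConstDiff X) n q
  · intro h
    let : DiffeologicalSpace X := ⊥
    exact isPlot_of_eventually fun v => ⟨fun _ => q v, isPlot_const, h v⟩

/-- The top diffeology contains the one induced by a constant map to ℝ, for which every map is a
plot. -/
lemma isPlot_top {n : ℕ} {q : Euc n → X} : @IsPlot X ⊤ n q := by
  have : inducedDiff (fun _ : X => (0 : ℝ)) inferInstance ≤ (⊤ : DiffeologicalSpace X) := le_top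
  exact DiffeologicalSpace.le_iff'.1 this n q (isPlot_const (x := (0 : ℝ)))

lemma dSmooth_fst [DiffeologicalSpace X] [DiffeologicalSpace Y] :
    DSmooth (Prod.fst : X × Y → X) := fun _ _ h => (isPlot_prod.1 h).1

lemma dSmooth_snd [DiffeologicalSpace X] [DiffeologicalSpace Y] :
    DSmooth (Prod.snd : X × Y → Y) := fun _ _ h => (isPlot_prod.1 h).2

/-- Local sections of a submersion, defined everywhere on a retracted test space. -/
lemma IsSubmersion.exists_lift [DiffeologicalSpace X] [DiffeologicalSpace Y] {q : X → Y}
    (hq : IsSubmersion q) {n : ℕ} {c : Euc n → Y} (hc : IsPlot c) (v : Euc n) (b : X)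
    (hb : q b = c v) : ∃ (σ : Euc n → Euc n) (c' : Euc n → X), ContDiff ℝ ∞ σ ∧
      (∀ᶠ w in 𝓝 v, σ w = w) ∧ IsPlot c' ∧ c' v = b ∧ ∀ w, q (c' w) = c (σ w) := by
  obtain ⟨c', hc', hv, he⟩ := hq.2 n c v b hc hb
  obtain ⟨σ, hσ, hm, hs⟩ := exists_smooth_retract he
  exact ⟨σ, c' ∘ σ, hσ, hs, isPlot_reparam hc' hσ, by simp [hs.self_of_nhds, hv], hm⟩

end Plots


/-! ## Atlases -/

/-- `φ` is a chart, with inverse `ψ` on its range. -/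
structure IsChart {X : Type*} [DiffeologicalSpace X] {n : ℕ} (φ : Euc n → X) (ψ : X → Euc n) :
    Prop where
  plot : IsPlot φ
  left_inv : ∀ u, ψ (φ u) = u
  smooth : ∀ (m : ℕ) (p : Euc m → X) (v : Euc m), IsPlot p → φ (ψ (p v)) = p v →
    (∀ᶠ w in 𝓝 v, φ (ψ (p w)) = p w) ∧ ContDiffAt ℝ ∞ (fun w => ψ (p w)) v

/-- Smooth functions separate points, and there is a countable atlas. -/
structure HasAtlas (X : Type*) [DiffeologicalSpace X] : Prop where
  separating : ∀ x y : X, x ≠ y → ∃ f : X → ℂ, DSmooth f ∧ f x ≠ f y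
  charts : ∃ (ι : Type) (_ : Countable ι) (n : ι → ℕ) (φ : ∀ i, Euc (n i) → X)
    (ψ : ∀ i, X → Euc (n i)), (∀ i, IsChart (φ i) (ψ i)) ∧ ∀ x, ∃ i, φ i (ψ i x) = x

instance : IsContDiffCompatible ℂ := ⟨Iff.rfl⟩
instance : IsDTopologyCompatible ℂ := ⟨rfl⟩

section Atlas

variable {X Y : Type*} [DiffeologicalSpace X] [DiffeologicalSpace Y]

lemma IsChart.mem_range {n : ℕ} {φ : Euc n → X} {ψ : X → Euc n} (h : IsChart φ ψ) {x : X} :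
    x ∈ Set.range φ ↔ φ (ψ x) = x :=
  ⟨by rintro ⟨u, rfl⟩; rw [h.left_inv], fun hx => ⟨_, hx⟩⟩

/-- The D-topology is tested on plots: near a point where a plot meets φ(V) it stays in the range of
φ, and its coordinate is continuous, hence stays in the open set V. -/
lemma IsChart.isOpen_image {n : ℕ} {φ : Euc n → X} {ψ : X → Euc n} (h : IsChart φ ψ)
    {V : Set (Euc n)} (hV : IsOpen V) : IsOpen[dTopology] (φ '' V) := by
  rw [isOpen_iff_preimages_plots]
  intro m p hp
  rw [isOpen_iff_mem_nhds]
  rintro v ⟨u, hu, huv⟩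
  obtain ⟨h1, h2⟩ := h.smooth m p v hp (h.mem_range.1 ⟨u, huv⟩)
  have h3 : ψ (p v) ∈ V := by rwa [← huv, h.left_inv]
  filter_upwards [h1, h2.continuousAt.eventually (hV.mem_nhds h3)] with w hw hw'
  exact ⟨_, hw', hw⟩

/-- Smooth functions are continuous for the D-topology, so separating points by them gives
Hausdorffness. Chart images are open and homeomorphic to Euclidean spaces, so a countable cover by
them gives second countability. -/
theorem HasAtlas.isSmoothManifold (h : HasAtlas X) : IsSmoothManifold X := by
  let tX : TopologicalSpace X := dTopology
  have : IsDTopologyCompatible X := ⟨rfl⟩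
  obtain ⟨ι, hι, n, φ, ψ, hc, hx⟩ := h.charts
  have hr : ∀ i, IsOpen (Set.range (φ i)) := fun i => by
    have := (hc i).isOpen_image isOpen_univ
    rwa [Set.image_univ] at this
  refine ⟨⟨fun x y hxy => ?_⟩, ?_, fun x => ?_⟩
  · obtain ⟨f, hf, hne⟩ := h.separating x y hxy
    obtain ⟨u, v, hu, hv, hxu, hyv, huv⟩ := t2_separation hne
    exact ⟨f ⁻¹' u, f ⁻¹' v, hu.preimage hf.continuous', hv.preimage hf.continuous', hxu, hyv,
      huv.preimage f⟩
  · have hs : ∀ i, SecondCountableTopology (Set.range (φ i)) := fun i => by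
      have ho : Topology.IsOpenEmbedding (φ i) :=
        .of_continuous_injective_isOpenMap (hc i).plot.continuous
          (Function.LeftInverse.injective (hc i).left_inv) fun V hV => (hc i).isOpen_image hV
      exact ho.isEmbedding.toHomeomorph.symm.secondCountableTopology
    exact TopologicalSpace.secondCountableTopology_of_countable_cover hr
      (Set.eq_univ_of_forall fun x => Set.mem_iUnion.2 ((hx x).imp fun i hi => ⟨_, hi⟩))
  · obtain ⟨i, hi⟩ := hx x
    refine ⟨n i, φ i, (hc i).plot, Function.LeftInverse.injective (hc i).left_inv, ⟨_, hi⟩, hr i,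
      fun m p hp hm => ⟨fun v => ψ i (p v), ?_, funext fun v => ((hc i).mem_range.1 (hm v)).symm⟩⟩
    exact contDiff_iff_contDiffAt.2 fun v =>
      ((hc i).smooth m p v hp ((hc i).mem_range.1 (hm v))).2

lemma HasAtlas.of_equiv (h : HasAtlas Y) (e : X ≃ Y)
    (he : ∀ (n : ℕ) (p : Euc n → X), IsPlot p ↔ IsPlot (fun v => e (p v))) : HasAtlas X := by
  obtain ⟨ι, hι, n, φ, ψ, hc, hx⟩ := h.charts
  refine ⟨fun x y hxy => ?_, ι, hι, n, fun i => e.symm ∘ φ i, fun i => ψ i ∘ e, fun i => ⟨?_, ?_, ?_⟩,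
    fun x => ?_⟩
  · obtain ⟨f, hf, hne⟩ := h.separating _ _ (e.injective.ne hxy)
    exact ⟨f ∘ e, fun n p hp => hf n _ ((he n p).1 hp), hne⟩
  · rw [he]
    simpa using (hc i).plot
  · intro u; simp [(hc i).left_inv]
  · intro m p v hp hv
    have := (hc i).smooth m (fun v => e (p v)) v ((he m p).1 hp) (by
      simpa [Equiv.symm_apply_eq] using hv)
    simpa [Equiv.symm_apply_eq] using this
  · obtain ⟨i, hi⟩ := hx (e x)
    exact ⟨i, by simp [hi]⟩

lemma HasAtlas.prod (hX : HasAtlas X) (hY : HasAtlas Y) : HasAtlas (X × Y) := by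
  obtain ⟨ι, hι, n, φ, ψ, hc, hx⟩ := hX.charts
  obtain ⟨ι', hι', n', φ', ψ', hc', hx'⟩ := hY.charts
  have E : ∀ a b : ℕ, Euc (a + b) ≃L[ℝ] Euc a × Euc b := fun a b =>
    EuclideanSpace.finAddEquivProd (𝕜 := ℝ)
  refine ⟨fun x y hxy => ?_, ι × ι', inferInstance, fun i => n i.1 + n' i.2,
    fun i u => (φ i.1 (E _ _ u).1,
      φ' i.2 (E _ _ u).2),
    fun i x => (E _ _).symm (ψ i.1 x.1, ψ' i.2 x.2), fun i => ?_,
    fun x => ?_⟩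
  · by_cases h1 : x.1 = y.1
    · have h2 : x.2 ≠ y.2 := fun h2 => hxy (Prod.ext h1 h2)
      obtain ⟨f, hf, hne⟩ := hY.separating _ _ h2
      exact ⟨fun x => f x.2, hf.comp dSmooth_snd, hne⟩
    · obtain ⟨f, hf, hne⟩ := hX.separating _ _ h1
      exact ⟨fun x => f x.1, hf.comp dSmooth_fst, hne⟩
  · refine ⟨?_, ?_, ?_⟩
    · refine IsPlot.prodMk ?_ ?_
      · exact isPlot_reparam (hc i.1).plot
          (contDiff_fst.comp (E _ _).contDiff)
      · exact isPlot_reparam (hc' i.2).plot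
          (contDiff_snd.comp (E _ _).contDiff)
    · intro u
      simp [(hc i.1).left_inv, (hc' i.2).left_inv]
    · intro m p v hp hv
      obtain ⟨hp1, hp2⟩ := isPlot_prod.1 hp
      simp only [ContinuousLinearEquiv.apply_symm_apply, Prod.ext_iff] at hv ⊢
      obtain ⟨h1, h2⟩ := (hc i.1).smooth m _ v hp1 hv.1
      obtain ⟨h3, h4⟩ := (hc' i.2).smooth m _ v hp2 hv.2
      refine ⟨h1.and h3, ?_⟩
      exact (E _ _).symm.contDiff.contDiffAt.comp v (h2.prodMk h4)
  · obtain ⟨i, hi⟩ := hx x.1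
    obtain ⟨j, hj⟩ := hx' x.2
    exact ⟨(i, j), by simp [hi, hj]⟩

end Atlas

lemma hasAtlas_punit : HasAtlas PUnit.{1} := by
  refine ⟨fun x y h => (h rfl).elim, Unit, inferInstance, fun _ => 0, fun _ _ => PUnit.unit,
    fun _ _ => 0, fun _ => ⟨isPlot_const, fun u => Subsingleton.elim _ _, fun m p v _ _ => ?_⟩,
    fun _ => ⟨(), rfl⟩⟩
  exact ⟨by simp, contDiffAt_const⟩

/-- A countable discrete space has an atlas. -/
lemma hasAtlas_bot (X : Type) [Countable X] : @HasAtlas X ⊥ := by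
  let d : DiffeologicalSpace X := ⊥
  classical
  refine ⟨fun x y h => ⟨fun z => if z = x then 1 else 0, fun n p hp => ?_, by simp [h.symm]⟩,
    X, inferInstance, fun _ => 0, fun i _ => i, fun _ _ => 0,
    fun _ => ⟨isPlot_const, fun u => Subsingleton.elim _ _, fun m p v hp hv => ?_⟩,
    fun x => ⟨x, rfl⟩⟩
  · refine isPlot_of_eventually fun v => ⟨_, isPlot_const (x := if p v = x then (1 : ℂ) else 0), ?_⟩
    filter_upwards [isPlot_bot.1 hp v] with w hw
    simp [hw]
  · refine ⟨?_, contDiffAt_const⟩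
    filter_upwards [isPlot_bot.1 hp v] with w hw
    rw [hw, ← hv]

/-! ### The circle -/

lemma isPlot_circle {n : ℕ} {p : Euc n → Circle} :
    IsPlot p ↔ ContDiff ℝ ∞ (fun v => (p v : ℂ)) := Iff.rfl

lemma Diffeology.IsPlot.circle_mul {n : ℕ} {p q : Euc n → Circle} (hp : IsPlot p) (hq : IsPlot q) :
    IsPlot (fun v => p v * q v) := by
  rw [isPlot_circle] at *
  simpa using hp.mul hq

lemma Diffeology.IsPlot.circle_inv {n : ℕ} {p : Euc n → Circle} (hp : IsPlot p) :
    IsPlot (fun v => (p v)⁻¹) := by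
  rw [isPlot_circle] at *
  simp only [Circle.coe_inv_eq_conj]
  exact Complex.conjCLE.contDiff.comp hp

lemma one_sub_mul_I_ne_zero (t : ℝ) : (1 - t * Complex.I : ℂ) ≠ 0 := fun h => by
  simpa using congrArg Complex.re h

/-- The Cayley transform, an inverse of stereographic projection. -/
noncomputable def cayley (t : ℝ) : Circle :=
  Circle.ofConjDivSelf (1 - t * Complex.I) (one_sub_mul_I_ne_zero t)

/-- Stereographic projection of the circle. -/
noncomputable def stereo (z : Circle) : ℝ := (z : ℂ).im / (1 + (z : ℂ).re)

lemma cayley_coe (t : ℝ) :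
    (cayley t : ℂ) = (1 + t * Complex.I) / (1 - t * Complex.I) := by
  simp [cayley, Circle.ofConjDivSelf]

lemma cayley_re_im (t : ℝ) : (cayley t : ℂ) =
    ⟨(1 - t ^ 2) / (1 + t ^ 2), 2 * t / (1 + t ^ 2)⟩ := by
  have h : (1 + t ^ 2 : ℝ) ≠ 0 := by positivity
  rw [cayley_coe, div_eq_iff (one_sub_mul_I_ne_zero t)]
  apply Complex.ext <;> simp <;> field_simp <;> ring

lemma stereo_cayley (t : ℝ) : stereo (cayley t) = t := by
  have h : (1 + t ^ 2 : ℝ) ≠ 0 := by positivity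
  rw [stereo, cayley_re_im]
  simp only
  field_simp
  ring

/-- On the circle the real part is -1 only at the centre of projection; away from it the identity
reduces to |z| = 1. -/
lemma cayley_stereo {z : Circle} (hz : (z : ℂ).re ≠ -1) : cayley (stereo z) = z := by
  have h : (1 + (z : ℂ).re) ≠ 0 := fun h => hz (by linarith)
  have h1 : (z : ℂ).re ^ 2 + (z : ℂ).im ^ 2 = 1 := by
    have := Circle.normSq_coe z
    rw [Complex.normSq_apply] at this; nlinarith
  have h2 : (1 + (z : ℂ).re) ^ 2 + (z : ℂ).im ^ 2 ≠ 0 := by positivity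
  ext
  rw [cayley_re_im, stereo]
  apply Complex.ext <;> simp only <;> field_simp
  · linear_combination (-1 - (z : ℂ).re) * h1
  · linear_combination (-(z : ℂ).im) * h1

lemma cayley_re_ne (t : ℝ) : (cayley t : ℂ).re ≠ -1 := by
  have h : (1 + t ^ 2 : ℝ) ≠ 0 := by positivity
  rw [cayley_re_im]
  simp only
  rw [ne_eq, div_eq_iff h]
  intro h; linarith

lemma contDiff_cayley : ContDiff ℝ ∞ (fun t : ℝ => (cayley t : ℂ)) := by
  simp only [cayley_coe]
  have : ContDiff ℝ ∞ (fun t : ℝ => (t : ℂ)) := Complex.ofRealCLM.contDiff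
  have h : ∀ t : ℝ, (1 - (t : ℂ) * Complex.I) ≠ 0 := one_sub_mul_I_ne_zero
  simp only [div_eq_mul_inv]
  exact (contDiff_const.add (this.mul contDiff_const)).mul
    ((contDiff_const.sub (this.mul contDiff_const)).inv h)

/-- The line as a Euclidean space. -/
noncomputable def eucOne : Euc 1 ≃L[ℝ] ℝ :=
  (EuclideanSpace.equiv (Fin 1) ℝ).trans (ContinuousLinearEquiv.funUnique (Fin 1) ℝ ℝ)

/-- A rotation of the Cayley parametrization by u, missing only the point -u. The range is described
by an open condition on a real part, and there the stereographic coordinate is a quotient with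
nonvanishing denominator. -/
lemma isChart_circle (u : Circle) : IsChart (fun t : Euc 1 => u * cayley (eucOne t))
    (fun z => eucOne.symm (stereo (u⁻¹ * z))) := by
  have key : ∀ z : Circle, u * cayley (eucOne (eucOne.symm (stereo (u⁻¹ * z)))) = z ↔
      ((u⁻¹ * z : Circle) : ℂ).re ≠ -1 := by
    intro z
    rw [ContinuousLinearEquiv.apply_symm_apply]
    constructor
    · intro h
      rw [← h, inv_mul_cancel_left]
      exact cayley_re_ne _
    · intro h
      rw [cayley_stereo h, mul_inv_cancel_left]
  refine ⟨?_, ?_, ?_⟩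
  · exact (isPlot_const (x := u)).circle_mul (isPlot_circle.2 (contDiff_cayley.comp eucOne.contDiff))
  · intro t; simp [stereo_cayley]
  · intro m p v hp hv
    replace hv := (key _).1 hv
    have hs : ContDiff ℝ ∞ (fun v => ((u⁻¹ * p v : Circle) : ℂ)) :=
      isPlot_circle.1 ((isPlot_const (x := u⁻¹)).circle_mul hp)
    have hre := Complex.reCLM.contDiff.comp hs
    have him := Complex.imCLM.contDiff.comp hs
    refine ⟨(hre.continuous.continuousAt.eventually_ne hv).mono fun w hw => (key _).2 hw, ?_⟩
    refine eucOne.symm.contDiff.contDiffAt.comp v ?_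
    refine him.contDiffAt.div (contDiffAt_const.add hre.contDiffAt) fun h => hv ?_
    change 1 + ((u⁻¹ * p v : Circle) : ℂ).re = 0 at h
    linarith

/-- The rotations by 1 and -1 suffice, since z and -z cannot both have real part -1; the inclusion
into ℂ separates points. -/
theorem hasAtlas_circle : HasAtlas Circle := by
  refine ⟨fun x y h => ⟨fun z => (z : ℂ), fun _ _ hp => hp, fun h' => h (Circle.ext h')⟩,
    Bool, inferInstance, fun _ => 1, fun b t => (bif b then 1 else -1) * cayley (eucOne t),
    fun b z => eucOne.symm (stereo ((bif b then 1 else -1)⁻¹ * z)), fun b => isChart_circle _,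
    fun z => ?_⟩
  by_cases h : (z : ℂ).re = -1
  · refine ⟨false, ?_⟩
    have : (((-1 : Circle)⁻¹ * z : Circle) : ℂ).re ≠ -1 := by
      simp only [inv_neg, inv_one, neg_mul, one_mul, Circle.coe_neg, Complex.neg_re]
      rw [h]; norm_num
    simp only [ContinuousLinearEquiv.apply_symm_apply, cond_false]
    rw [cayley_stereo this, mul_inv_cancel_left]
  · refine ⟨true, ?_⟩
    simp [cayley_stereo h]


/-! ### The torus -/

lemma fourierChar_eq_one_iff {r : ℝ} : Real.fourierChar r = 1 ↔ ∃ n : ℤ, r = n := by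
  rw [← Circle.coe_inj, Real.fourierChar_apply, Circle.coe_one, Complex.exp_eq_one_iff]
  refine exists_congr fun n => ?_
  have h : (2 * Real.pi * Complex.I : ℂ) ≠ 0 := Complex.two_pi_I_ne_zero
  rw [show ((2 * Real.pi * r : ℝ) : ℂ) * Complex.I = r * (2 * Real.pi * Complex.I) by
    push_cast; ring, mul_left_inj' h]
  norm_cast

lemma contDiff_fourierChar : ContDiff ℝ ∞ (fun r : ℝ => (Real.fourierChar r : ℂ)) := by
  simp only [Real.fourierChar_apply]
  exact ((Complex.ofRealCLM.contDiff.comp (contDiff_const.mul contDiff_id)).mul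
    contDiff_const).cexp

section Torus

variable {Λ : Type} [AddCommGroup Λ] [Module.Free ℤ Λ] [Module.Finite ℤ Λ]

variable (Λ) in
/-- The coordinates on `𝔱` with respect to a basis of the lattice. -/
noncomputable def lieCoord : LieT Λ ≃ₗ[ℝ] Euc (Module.finrank ℤ Λ) :=
  ((Module.finBasis ℤ Λ).baseChange ℝ).equivFun ≪≫ₗ (WithLp.linearEquiv 2 ℝ _).symm

lemma lieCoord_lattice (m : Λ) (i) :
    lieCoord Λ (lattice Λ m) i = ((Module.finBasis ℤ Λ).repr m i : ℝ) := by
  simp [lieCoord, lattice]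

lemma lattice_injective : Function.Injective (lattice Λ) := by
  intro m n h
  refine (Module.finBasis ℤ Λ).repr.injective (Finsupp.ext fun i => ?_)
  have := congrArg (fun x => lieCoord Λ x i) h
  simp only [lieCoord_lattice] at this
  exact_mod_cast this

lemma mem_lattice_iff {x : LieT Λ} :
    (∃ m, x = lattice Λ m) ↔ ∀ i, ∃ n : ℤ, lieCoord Λ x i = n := by
  constructor
  · rintro ⟨m, rfl⟩ i
    exact ⟨_, lieCoord_lattice m i⟩
  · intro h
    choose k hk using h
    refine ⟨(Module.finBasis ℤ Λ).equivFun.symm k, (lieCoord Λ).injective ?_⟩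
    ext i
    rw [lieCoord_lattice, hk, ← Module.Basis.equivFun_apply, LinearEquiv.apply_symm_apply]

/-- Coordinates are linear functionals, and in finite dimension every linear functional is a
continuous linear function of the coordinates, so testing on coordinates is testing on all
functionals. -/
lemma isPlot_lieT {n : ℕ} {p : Euc n → LieT Λ} :
    IsPlot p ↔ ContDiff ℝ ∞ (fun v => lieCoord Λ (p v)) := by
  refine DiffeologicalSpace.isPlot_iInf_iff.trans ⟨fun h => ?_, fun h ℓ => ?_⟩
  · rw [contDiff_euclidean]
    intro i
    exact IsPlot.contDiff (X := ℝ) (isPlot_induced.1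
      (h ((EuclideanSpace.proj i).toLinearMap.comp (lieCoord Λ).toLinearMap)))
  · have : (fun v => ℓ (p v)) =
        fun v => (ℓ.comp (lieCoord Λ).symm.toLinearMap).toContinuousLinearMap
          (lieCoord Λ (p v)) := by
      funext v; simp
    refine isPlot_induced.2 ?_
    rw [this]
    exact (ContDiff.comp (ContinuousLinearMap.contDiff _) h).isPlot

lemma Diffeology.IsPlot.lieT_add {n : ℕ} {p q : Euc n → LieT Λ} (hp : IsPlot p) (hq : IsPlot q) :
    IsPlot (fun v => p v + q v) := by
  rw [isPlot_lieT] at *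
  simpa using hp.add hq

lemma Diffeology.IsPlot.lieT_neg {n : ℕ} {p : Euc n → LieT Λ} (hp : IsPlot p) :
    IsPlot (fun v => - p v) := by
  rw [isPlot_lieT] at *
  simpa using hp.neg

lemma Diffeology.IsPlot.lieT_sub {n : ℕ} {p q : Euc n → LieT Λ} (hp : IsPlot p) (hq : IsPlot q) :
    IsPlot (fun v => p v - q v) := by
  simpa only [sub_eq_add_neg] using hp.lieT_add hq.lieT_neg

/-- Lattice points have integer coordinates, so two of them at distance less than 1 coincide; a
continuous lattice-valued map is therefore locally constant. This is how the lattice part of an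
arrow is recovered smoothly from its endpoints. -/
lemma isPlot_lattice {n : ℕ} {m : Euc n → Λ} :
    IsPlot (fun v => lattice Λ (m v)) ↔ @IsPlot Λ (latticeDiff Λ) n m := by
  constructor
  · intro h
    refine isPlot_bot.2 fun v => ?_
    have hc := (isPlot_lieT.1 h).continuous
    have : ∀ᶠ w in 𝓝 v, dist (lieCoord Λ (lattice Λ (m w))) (lieCoord Λ (lattice Λ (m v))) < 1 :=
      hc.continuousAt.eventually (Metric.ball_mem_nhds _ one_pos)
    filter_upwards [this] with w hw
    refine (Module.finBasis ℤ Λ).repr.injective (Finsupp.ext fun i => ?_)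
    have h1 := (PiLp.norm_apply_le (lieCoord Λ (lattice Λ (m w)) - lieCoord Λ (lattice Λ (m v))) i)
    rw [dist_eq_norm] at hw
    have h2 := h1.trans_lt hw
    rw [PiLp.sub_apply, lieCoord_lattice, lieCoord_lattice, Real.norm_eq_abs] at h2
    have h3 : |(Module.finBasis ℤ Λ).repr (m w) i - (Module.finBasis ℤ Λ).repr (m v) i| < 1 := by
      exact_mod_cast h2
    rw [Int.abs_lt_one_iff] at h3
    linarith
  · intro h
    refine isPlot_of_eventually fun v => ⟨_, isPlot_const (x := lattice Λ (m v)), ?_⟩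
    filter_upwards [isPlot_bot.1 h v] with w hw
    rw [hw]

lemma hasAtlas_lieT : HasAtlas (LieT Λ) := by
  have : HasAtlas (Euc (Module.finrank ℤ Λ)) := by
    refine ⟨fun x y h => ?_, Unit, inferInstance, fun _ => _, fun _ => id, fun _ => id,
      fun _ => ⟨isPlot_id, fun _ => rfl, fun m p v hp _ => ⟨by simp, ?_⟩⟩, fun x => ⟨(), rfl⟩⟩
    · obtain ⟨i, hi⟩ : ∃ i, x i ≠ y i := by
        by_contra! h'
        exact h (PiLp.ext h')
      refine ⟨fun z => (z i : ℂ), fun n p hp => ?_, by simpa using hi⟩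
      exact (Complex.ofRealCLM.contDiff.comp
        ((contDiff_euclidean.1 hp.contDiff) i)).isPlot
    · exact hp.contDiff.contDiffAt
  exact this.of_equiv (lieCoord Λ).toEquiv fun n p => isPlot_lieT.trans isPlot_iff_contDiff.symm

lemma texp_surjective : Function.Surjective (texp : LieT Λ → Torus Λ) :=
  QuotientAddGroup.mk_surjective

lemma isPlot_torus {n : ℕ} {q : Euc n → Torus Λ} : IsPlot q ↔
    ∀ v, ∃ p : Euc n → LieT Λ, IsPlot p ∧ ∀ᶠ w in 𝓝 v, q w = texp (p w) :=
  isPlot_coinduced texp_surjective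

lemma dSmooth_texp : DSmooth (texp : LieT Λ → Torus Λ) :=
  fun _ _ hp => isPlot_coinduced_comp hp

/-- Local lifts exist by definition of the quotient diffeology, and translating by a lattice vector
makes a lift pass through any prescribed point of the fibre. -/
theorem isSubmersion_texp : IsSubmersion (texp : LieT Λ → Torus Λ) := by
  refine ⟨dSmooth_texp, fun n c v b hc hb => ?_⟩
  obtain ⟨p, hp, he⟩ := isPlot_torus.1 hc v
  obtain ⟨m, rfl⟩ := exists_lattice_of_texp_eq (he.self_of_nhds.symm.trans hb.symm)
  refine ⟨fun w => p w + lattice Λ m, hp.lieT_add isPlot_const, rfl, ?_⟩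
  filter_upwards [he] with w hw
  rw [texp_add_lattice, hw]

lemma Diffeology.IsPlot.torus_add {n : ℕ} {s t : Euc n → Torus Λ} (hs : IsPlot s) (ht : IsPlot t) :
    IsPlot (fun v => s v + t v) := by
  refine isPlot_torus.2 fun v => ?_
  obtain ⟨p, hp, he⟩ := isPlot_torus.1 hs v
  obtain ⟨q, hq, he'⟩ := isPlot_torus.1 ht v
  refine ⟨_, hp.lieT_add hq, ?_⟩
  filter_upwards [he, he'] with w h h'
  rw [h, h']; rfl

lemma Diffeology.IsPlot.torus_neg {n : ℕ} {s : Euc n → Torus Λ} (hs : IsPlot s) :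
    IsPlot (fun v => - s v) := by
  refine isPlot_torus.2 fun v => ?_
  obtain ⟨p, hp, he⟩ := isPlot_torus.1 hs v
  refine ⟨_, hp.lieT_neg, ?_⟩
  filter_upwards [he] with w h
  rw [h]; rfl

/-- The chart of the torus around `exp x`. -/
noncomputable def torusChart (x : LieT Λ) (u : Euc (Module.finrank ℤ Λ)) : Torus Λ :=
  texp (x + (lieCoord Λ).symm ((1 / 2 : ℝ) • OpenPartialHomeomorph.univUnitBall u))

lemma norm_univUnitBall_lt {E : Type*} [NormedAddCommGroup E] [NormedSpace ℝ E] (u : E) :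
    ‖OpenPartialHomeomorph.univUnitBall u‖ < 1 := by
  have h : OpenPartialHomeomorph.univUnitBall u ∈ Metric.ball (0 : E) 1 :=
    OpenPartialHomeomorph.univUnitBall.map_source (x := u) trivial
  simpa using h

lemma univUnitBall_injective {E : Type*} [NormedAddCommGroup E] [NormedSpace ℝ E] :
    Function.Injective (OpenPartialHomeomorph.univUnitBall : E → E) := fun _ _ h =>
  OpenPartialHomeomorph.univUnitBall.injOn trivial trivial h

/-- The chart parametrizes a coordinate ball of radius 1/2. Two of its points differ by less than 1
in each coordinate, so they are congruent modulo the lattice only if they are equal. -/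
lemma torusChart_injective (x : LieT Λ) : Function.Injective (torusChart x) := by
  intro u v h
  obtain ⟨m, hm⟩ := exists_lattice_of_texp_eq h
  have h1 : lattice Λ m = (lieCoord Λ).symm ((1 / 2 : ℝ) •
      (OpenPartialHomeomorph.univUnitBall v - OpenPartialHomeomorph.univUnitBall u)) := by
    rw [smul_sub, map_sub]
    rw [add_assoc] at hm
    rw [add_left_cancel hm]
    abel
  have h2 : m = 0 := by
    refine (Module.finBasis ℤ Λ).repr.injective (Finsupp.ext fun i => ?_)
    have h3 := lieCoord_lattice m i
    rw [h1, LinearEquiv.apply_symm_apply] at h3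
    have h4 := (PiLp.norm_apply_le ((1 / 2 : ℝ) •
      (OpenPartialHomeomorph.univUnitBall v - OpenPartialHomeomorph.univUnitBall u)) i)
    rw [h3, norm_smul, Real.norm_eq_abs] at h4
    have h5 := norm_sub_le (OpenPartialHomeomorph.univUnitBall v)
      (OpenPartialHomeomorph.univUnitBall u)
    have h6 := norm_univUnitBall_lt v
    have h7 := norm_univUnitBall_lt u
    have h8 : ‖(1 / 2 : ℝ)‖ = 1 / 2 := by norm_num
    rw [h8] at h4
    have h9 : |((Module.finBasis ℤ Λ).repr m i : ℝ)| < 1 := by linarith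
    have h10 : |(Module.finBasis ℤ Λ).repr m i| < 1 := by exact_mod_cast h9
    rw [Int.abs_lt_one_iff] at h10
    simpa using h10
  rw [h2, map_zero, eq_comm, map_eq_zero_iff _ (lieCoord Λ).symm.injective, smul_eq_zero,
    sub_eq_zero] at h1
  exact (univUnitBall_injective (h1.resolve_left (by norm_num))).symm

/-- Near a point of the chart a plot lifts to the Lie algebra. After correction by a lattice vector
the lift stays in the ball of radius 1/2 around x, on which the parametrization has a smooth
inverse. -/
lemma isChart_torusChart (x : LieT Λ) :
    IsChart (torusChart x) (Function.invFun (torusChart x)) := by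
  have hl := Function.leftInverse_invFun (torusChart_injective x)
  refine ⟨?_, hl, fun m p v hp hv => ?_⟩
  · refine isPlot_coinduced_comp (f := texp) (isPlot_const.lieT_add (isPlot_lieT.2 ?_))
    simp only [LinearEquiv.apply_symm_apply]
    exact OpenPartialHomeomorph.contDiff_univUnitBall.const_smul _
  · obtain ⟨P, hP, he⟩ := isPlot_torus.1 hp v
    set u := Function.invFun (torusChart x) (p v)
    obtain ⟨k, hk⟩ := exists_lattice_of_texp_eq (hv.trans he.self_of_nhds)
    -- Here k is the lattice vector by which the lift P differs at v from the lift used in the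
    -- chart; the factor 2 undoes the radius 1/2.
    let y : Euc m → Euc (Module.finrank ℤ Λ) := fun w =>
      (2 : ℝ) • lieCoord Λ (P w - x - lattice Λ k)
    have hy : ContDiff ℝ ∞ y := ContDiff.const_smul _
      (isPlot_lieT.1 ((hP.lieT_sub isPlot_const).lieT_sub isPlot_const))
    have hyv : y v = OpenPartialHomeomorph.univUnitBall u := by
      simp only [y, hk]
      rw [show x + (lieCoord Λ).symm ((1 / 2 : ℝ) • OpenPartialHomeomorph.univUnitBall u) +
        lattice Λ k - x - lattice Λ k =
        (lieCoord Λ).symm ((1 / 2 : ℝ) • OpenPartialHomeomorph.univUnitBall u) by abel,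
        LinearEquiv.apply_symm_apply, smul_smul]
      norm_num
    have hy1 : y v ∈ Metric.ball (0 : Euc (Module.finrank ℤ Λ)) 1 := by
      simpa [hyv] using norm_univUnitBall_lt u
    have key : ∀ᶠ w in 𝓝 v, p w = torusChart x (OpenPartialHomeomorph.univUnitBall.symm (y w)) := by
      filter_upwards [he, hy.continuous.continuousAt.eventually
        (Metric.isOpen_ball.mem_nhds hy1)] with w hw hw'
      rw [torusChart, OpenPartialHomeomorph.right_inv _
        (show y w ∈ Metric.ball 0 1 from hw'), hw]
      simp only [y, smul_smul]
      rw [show (1 / 2 * 2 : ℝ) = 1 by norm_num, one_smul, LinearEquiv.symm_apply_apply,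
        ← texp_add_lattice (x + _) k]
      congr 1
      abel
    refine ⟨?_, ?_⟩
    · filter_upwards [key] with w hw
      rw [hw, hl]
    · refine ContDiffAt.congr_of_eventuallyEq
        (f := fun w => OpenPartialHomeomorph.univUnitBall.symm (y w)) ?_ ?_
      · exact ((OpenPartialHomeomorph.contDiffOn_univUnitBall_symm).contDiffAt
          (Metric.isOpen_ball.mem_nhds hy1)).comp v hy.contDiffAt
      · filter_upwards [key] with w hw
        rw [hw, hl]

lemma texp_eq_iff {x y : LieT Λ} :
    texp x = texp y ↔ ∀ i, ∃ n : ℤ, lieCoord Λ (y - x) i = n := by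
  rw [← mem_lattice_iff]
  constructor
  · intro h
    obtain ⟨m, rfl⟩ := exists_lattice_of_texp_eq h
    exact ⟨m, by abel⟩
  · rintro ⟨m, hm⟩
    rw [show y = x + lattice Λ m by rw [← hm]; abel, texp_add_lattice]

/-- The coordinate characters exp(2πi xᵢ) descend to the torus and separate its points. Balls of
radius 1/2 around a dense sequence cover the Lie algebra, so countably many charts are enough. -/
theorem hasAtlas_torus : HasAtlas (Torus Λ) := by
  refine ⟨fun s t hst => ?_, ℕ, inferInstance, fun _ => _,
    fun k => torusChart ((lieCoord Λ).symm (TopologicalSpace.denseSeq _ k)), _,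
    fun k => isChart_torusChart _, fun t => ?_⟩
  · obtain ⟨x, rfl⟩ := texp_surjective s
    obtain ⟨y, rfl⟩ := texp_surjective t
    rw [ne_eq, texp_eq_iff] at hst
    push Not at hst
    obtain ⟨i, hi⟩ := hst
    have key : ∀ x y : LieT Λ, Real.fourierChar (lieCoord Λ x i) = Real.fourierChar (lieCoord Λ y i) ↔
        ∃ n : ℤ, lieCoord Λ (y - x) i = n := by
      intro x y
      rw [map_sub, PiLp.sub_apply, ← fourierChar_eq_one_iff, AddChar.map_sub_eq_div, div_eq_one,
        eq_comm]
    -- The character is written with the discontinuous representative `rep`. It does not depend on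
    -- the lift, so a local smooth lift may be substituted to prove smoothness.
    have key' : ∀ x : LieT Λ, Real.fourierChar (lieCoord Λ (rep (texp x)) i) =
        Real.fourierChar (lieCoord Λ x i) := fun x =>
      (key _ _).2 (texp_eq_iff.1 (texp_rep (texp x)) i)
    refine ⟨fun t => (Real.fourierChar (lieCoord Λ (rep t) i) : ℂ), fun n p hp => ?_, ?_⟩
    · refine isPlot_of_eventually fun v => ?_
      obtain ⟨P, hP, he⟩ := isPlot_torus.1 hp v
      refine ⟨fun w => (Real.fourierChar (lieCoord Λ (P w) i) : ℂ), ?_, ?_⟩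
      · exact (contDiff_fourierChar.comp (contDiff_euclidean.1 (isPlot_lieT.1 hP) i)).isPlot
      · filter_upwards [he] with w hw
        simp only [Function.comp, hw, key']
    · simp only [key', ne_eq, Circle.coe_inj, key]
      rintro ⟨n, hn⟩
      exact hi n hn
  · obtain ⟨x, rfl⟩ := texp_surjective t
    obtain ⟨k, hk⟩ := (TopologicalSpace.denseRange_denseSeq (Euc (Module.finrank ℤ Λ))).exists_dist_lt
      (lieCoord Λ x) (ε := 1 / 2) (by norm_num)
    refine ⟨k, (isChart_torusChart _).mem_range.1 ?_⟩
    set d := TopologicalSpace.denseSeq (Euc (Module.finrank ℤ Λ)) k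
    refine ⟨OpenPartialHomeomorph.univUnitBall.symm ((2 : ℝ) • (lieCoord Λ x - d)), ?_⟩
    rw [torusChart, OpenPartialHomeomorph.right_inv, smul_smul]
    · rw [show (1 / 2 * 2 : ℝ) = 1 by norm_num, one_smul, ← map_add]
      simp
    · rw [dist_eq_norm] at hk
      simp only [OpenPartialHomeomorph.univUnitBall_target, Metric.mem_ball, dist_zero_right,
        norm_smul, Real.norm_ofNat]
      linarith

/-- A smooth family of lattice vectors is locally constant, so locally the exponent is one fixed
linear functional of x. -/
lemma isPlot_multiplier (J : LinearMap.BilinForm ℤ Λ) {n : ℕ} {m : Euc n → Λ} {x : Euc n → LieT Λ}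
    (hm : @IsPlot Λ (latticeDiff Λ) n m) (hx : IsPlot x) :
    IsPlot (fun v => multiplier J (m v) (x v)) := by
  refine isPlot_of_eventually fun v => ⟨fun w => multiplier J (m v) (x w), ?_, ?_⟩
  · rw [isPlot_circle]
    have : IsPlot (fun w => LinearMap.BilinForm.baseChange ℝ J (lattice Λ (m v)) (x w)) :=
      DiffeologicalSpace.isPlot_iInf_iff.1 hx
        (LinearMap.BilinForm.baseChange ℝ J (lattice Λ (m v)))
    exact contDiff_fourierChar.comp this.contDiff
  · filter_upwards [isPlot_bot.1 hm v] with w hw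
    rw [hw]

end Torus


/-! ## Smooth families of arrows -/

section SmoothArr

variable {X : Type} [Groupoid.{0} X] [SmoothStr X]

namespace IsLieGroupoid

variable (hX : IsLieGroupoid X) {n : ℕ} {x y z : Euc n → X}
include hX

lemma isPlot_source {f : ∀ v, x v ⟶ y v} (hf : SmoothArr f) : IsPlot x :=
  hX.source.1 n _ hf

lemma isPlot_target {f : ∀ v, x v ⟶ y v} (hf : SmoothArr f) : IsPlot y :=
  hX.target.1 n _ hf

lemma smoothArr_id (hx : IsPlot x) : SmoothArr (fun v => 𝟙 (x v)) := hX.ident n _ hx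

lemma smoothArr_comp {f : ∀ v, x v ⟶ y v} {g : ∀ v, y v ⟶ z v} (hf : SmoothArr f)
    (hg : SmoothArr g) : SmoothArr (fun v => f v ≫ g v) := hX.comp n x y z f g hf hg

lemma smoothArr_inv {f : ∀ v, x v ⟶ y v} (hf : SmoothArr f) :
    SmoothArr (fun v => Groupoid.inv (f v)) := hX.inverse n _ hf

lemma smoothArr_inv' {f : ∀ v, x v ⟶ y v} (hf : SmoothArr f) :
    SmoothArr (fun v => inv (f v)) := by
  simpa only [Groupoid.inv_eq_inv] using hX.smoothArr_inv hf

end IsLieGroupoid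

lemma SmoothArr.reparam {n m : ℕ} {x y : Euc n → X} {f : ∀ v, x v ⟶ y v} (hf : SmoothArr f)
    {σ : Euc m → Euc n} (hσ : ContDiff ℝ ∞ σ) : SmoothArr (fun v => f (σ v)) :=
  isPlot_reparam hf hσ

lemma Bibundle.SmoothFam.reparam {Y : Type} [Groupoid.{0} Y] {B : Bibundle X Y} {n m : ℕ}
    {x : Euc n → X} {y : Euc n → Y} {b : ∀ v, B.Fib (x v) (y v)} (hb : B.SmoothFam b)
    {σ : Euc m → Euc n} (hσ : ContDiff ℝ ∞ σ) : B.SmoothFam (fun v => b (σ v)) :=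
  isPlot_reparam hb hσ

end SmoothArr

namespace Bibundle

variable {X Y : Type} [Groupoid.{0} X] [Groupoid.{0} Y] [SmoothStr X] [SmoothStr Y]

/-- Lifting along a source map gives arrows whose source equals the prescribed object only
propositionally. Composing with `eqToHom` corrects the type, and this lemma and the next say that
the underlying point is unchanged. -/
lemma sigma_eqToHom_comp {F : X ⥤ Y} {x x' : X} (hx : x = x') {a : Arr Y} (h : a.1 = F.obj x)
    {y : Y} {f : F.obj x' ⟶ y} (ha : a = ⟨F.obj x', y, f⟩) :
    (⟨x, a.2.1, eqToHom h.symm ≫ a.2.2⟩ : Σ x : X, Σ y : Y, (F.obj x ⟶ y)) = ⟨x', y, f⟩ := by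
  subst hx ha
  simp

lemma arr_eqToHom_comp {z : Y} (a : Arr Y) (h : a.1 = z) :
    (⟨z, a.2.1, eqToHom h.symm ≫ a.2.2⟩ : Arr Y) = a := by
  subst h
  simp

/-- The bibundle of a smooth functor between Lie groupoids is right principal. -/
theorem ofFunctors_isRightPrincipal (hY : IsLieGroupoid Y) (F : X ⥤ Y) (hobj : DSmooth F.obj)
    (harr : ∀ {n : ℕ} {x y : Euc n → X} {f : ∀ v, x v ⟶ y v}, SmoothArr f →
      SmoothArr (fun v => F.map (f v)))
    (hsrc : ∀ {n : ℕ} {x y : Euc n → X} {f : ∀ v, x v ⟶ y v}, SmoothArr f → IsPlot x)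
    {d : DiffeologicalSpace (Σ x : X, Σ y : Y, (F.obj x ⟶ (𝟭 Y).obj y))}
    (hd : ∀ {n : ℕ} {x : Euc n → X} {y : Euc n → Y} {b : ∀ v, F.obj (x v) ⟶ y v},
      (ofFunctors F (𝟭 Y) d).SmoothFam b ↔ IsPlot x ∧ SmoothArr b) :
    (ofFunctors F (𝟭 Y) d).IsRightPrincipal where
  act_id {x y} b := by
    change F.obj x ⟶ y at b
    simp [ofFunctors]
  act_act {x _ _ y _ _} f' f b g g' := by
    change F.obj x ⟶ y at b
    simp [ofFunctors]
  act_smooth n x x' y y' f b g hf hb hg := by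
    obtain ⟨_, hb⟩ := hd.1 hb
    exact hd.2 ⟨hsrc hf, hY.smoothArr_comp (harr hf) (hY.smoothArr_comp hb hg)⟩
  left_submersion := by
    refine ⟨fun n p hp => (hd.1 hp).1, fun n c v b hc hb => ?_⟩
    obtain ⟨x, y, f⟩ := b
    obtain rfl : x = c v := hb
    -- A section of the left anchor through f amounts to a smooth family of arrows out of F (c w)
    -- starting at f, which the source submersion of Y provides.
    obtain ⟨σ, a, hσ, hs, ha, hav, hae⟩ :=
      hY.source.exists_lift (hobj n c hc) v ⟨F.obj (c v), y, f⟩ rfl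
    refine ⟨fun w => ⟨c (σ w), (a w).2.1, eqToHom (hae w).symm ≫ (a w).2.2⟩, ?_, ?_, ?_⟩
    · refine hd.2 ⟨isPlot_reparam hc hσ, ?_⟩
      exact (congrArg IsPlot (funext fun w => arr_eqToHom_comp (a w) (hae w))).mpr ha
    · exact sigma_eqToHom_comp (by rw [hs.self_of_nhds]) (hae v) hav
    · filter_upwards [hs] with w hw
      rw [hw]
  left_surjective x := ⟨F.obj x, ⟨𝟙 _⟩⟩
  right_smooth n p hp := hY.isPlot_target (hd.1 hp).2
  division {x y y'} b b' := by
    change F.obj x ⟶ y at b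
    change F.obj x ⟶ y' at b'
    refine ⟨inv b ≫ b', ?_, fun g hg => ?_⟩
    · simp [ofFunctors]
    · change F.map (𝟙 x) ≫ b ≫ g = b' at hg
      simp [← hg]
  division_smooth n x y y' b g hb hbg := by
    change ∀ v, F.obj (x v) ⟶ y v at b
    have h1 := hY.smoothArr_comp (hY.smoothArr_inv' (hd.1 hb).2) (hd.1 hbg).2
    simpa [ofFunctors] using h1

end Bibundle


/-! ## Lie groupoids with a functorial multiplication -/

/-- A smooth functorial multiplication on a Lie groupoid for which left multiplications are smoothly
invertible. -/
structure IsSmoothMonoidal (X : Type) [Groupoid.{0} X] [SmoothStr X] [MonoidalCategory X] :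
    Prop where
  lie : IsLieGroupoid X
  tensorObj : ∀ {n : ℕ} {x y : Euc n → X}, IsPlot x → IsPlot y → IsPlot (fun v => x v ⊗ y v)
  tensorHom : ∀ {n : ℕ} {x y x' y' : Euc n → X} {f : ∀ v, x v ⟶ y v} {g : ∀ v, x' v ⟶ y' v},
    SmoothArr f → SmoothArr g → SmoothArr (fun v => f v ⊗ₘ g v)
  associator : ∀ {n : ℕ} {x y z : Euc n → X}, IsPlot x → IsPlot y → IsPlot z →
    SmoothArr (fun v => (α_ (x v) (y v) (z v)).hom)
  leftUnitor : ∀ {n : ℕ} {x : Euc n → X}, IsPlot x → SmoothArr (fun v => (λ_ (x v)).hom)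
  rightUnitor : ∀ {n : ℕ} {x : Euc n → X}, IsPlot x → SmoothArr (fun v => (ρ_ (x v)).hom)
  target_lift : ∀ {n : ℕ} {q : Euc n → X}, IsPlot q → ∀ (v : Euc n) {x₀ : X} (f₀ : x₀ ⟶ q v),
    ∃ (x : Euc n → X) (f : ∀ w, x w ⟶ q w), SmoothArr f ∧
      (⟨x v, f v⟩ : Σ x : X, (x ⟶ q v)) = ⟨x₀, f₀⟩
  solve : ∀ {n : ℕ} {x q : Euc n → X}, IsPlot x → IsPlot q →
    ∃ (y : Euc n → X) (g : ∀ w, x w ⊗ y w ⟶ q w), IsPlot y ∧ SmoothArr g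
  cancel : ∀ x y y' : X, Function.Bijective (fun l : y ⟶ y' => x ◁ l)
  cancel_smooth : ∀ {n : ℕ} {x y y' : Euc n → X} {l : ∀ v, y v ⟶ y' v}, IsPlot x → IsPlot y →
    IsPlot y' → SmoothArr (fun v => x v ◁ l v) → SmoothArr l

/-! ### Pentagon and triangle for composed multiplications -/

section Coherence

variable {C : Type*} [Category C] [MonoidalCategory C]

/-- The associator, composed with multiplications. -/
def AssocRel {x y w u s v : C} (a : x ⊗ y ⟶ u) (b : u ⊗ w ⟶ v) (c : y ⊗ w ⟶ s)
    (d : x ⊗ s ⟶ v) : Prop := a ▷ w ≫ b = (α_ x y w).hom ≫ x ◁ c ≫ d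

/-- The composite a ▷ z ▷ w ≫ b ▷ w ≫ c is rewritten in two ways, one ending in e₁ and one in e₂;
the pentagon of C identifies the intermediate associators. Since d and e are invertible, everything
in front of e₁ and e₂ cancels. -/
lemma AssocRel.pentagon {x y z w p q r s g k : C} {a : x ⊗ y ⟶ p} {b : p ⊗ z ⟶ q}
    {c : q ⊗ w ⟶ r} {d : z ⊗ w ⟶ s} {f : y ⊗ z ⟶ g} {h : g ⊗ w ⟶ k} {b₁ : p ⊗ s ⟶ r}
    {e : y ⊗ s ⟶ k} {a₁ : x ⊗ g ⟶ q} {e₁ e₂ : x ⊗ k ⟶ r} [IsIso d] [IsIso e]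
    (h₁ : AssocRel b c d b₁) (h₂ : AssocRel f h d e) (h₃ : AssocRel a b₁ e e₁)
    (h₄ : AssocRel a b f a₁) (h₅ : AssocRel a₁ c h e₂) : e₁ = e₂ := by
  rw [AssocRel] at *
  rw [← cancel_epi (x ◁ e), ← cancel_epi (x ◁ y ◁ d), ← cancel_epi (α_ x y (z ⊗ w)).hom,
    ← cancel_epi (α_ (x ⊗ y) z w).hom]
  have l : a ▷ z ▷ w ≫ b ▷ w ≫ c = (α_ (x ⊗ y) z w).hom ≫ (α_ x y (z ⊗ w)).hom ≫
      x ◁ y ◁ d ≫ x ◁ e ≫ e₁ := by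
    rw [h₁]
    simp only [associator_naturality_left_assoc, Iso.cancel_iso_hom_left]
    rw [← whisker_exchange_assoc, h₃]
    simp
  have r : a ▷ z ▷ w ≫ b ▷ w ≫ c = (α_ (x ⊗ y) z w).hom ≫ (α_ x y (z ⊗ w)).hom ≫
      x ◁ y ◁ d ≫ x ◁ e ≫ e₂ := by
    rw [← comp_whiskerRight_assoc, h₄, ← whiskerLeft_comp_assoc (f := y ◁ d)]
    have h₂' : y ◁ d ≫ e = (α_ y z w).inv ≫ f ▷ w ≫ h := by rw [h₂]; simp
    rw [h₂']
    simp [h₅]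
  rw [← l, ← r]

/-- After precomposition with the invertible ρ ▷ y both unit relations can be substituted, and what
is left is the triangle identity of C. -/
lemma AssocRel.triangle {i x y u v s : C} {e : 𝟙_ C ⟶ i} {a : x ⊗ i ⟶ u} {b : u ⊗ y ⟶ v}
    {c : i ⊗ y ⟶ s} {d : x ⊗ s ⟶ v} {f : x ⟶ u} {g : y ⟶ s} (h : AssocRel a b c d)
    (hr : x ◁ e ≫ a = (ρ_ x).hom ≫ f) (hl : e ▷ y ≫ c = (λ_ y).hom ≫ g) :
    f ▷ y ≫ b = x ◁ g ≫ d := by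
  rw [AssocRel] at h
  rw [← cancel_epi ((ρ_ x).hom ▷ y), ← comp_whiskerRight_assoc, ← hr, comp_whiskerRight_assoc, h,
    associator_naturality_middle_assoc, ← whiskerLeft_comp_assoc, hl]
  simp

end Coherence

/-- The action matters only through its values. This is needed for the unit bibundle, whose action
ignores the arrow of `pt`, whereas the bibundle of a constant functor composes with an identity. -/
lemma Bibundle.IsRightPrincipal.congr_act {X Y : Type} [Groupoid.{0} X] [Groupoid.{0} Y]
    [SmoothStr X] [SmoothStr Y] {Fib : X → Y → Type} {d : DiffeologicalSpace (Σ x, Σ y, Fib x y)}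
    {act act' : ∀ {x x' : X} {y y' : Y}, (x' ⟶ x) → Fib x y → (y ⟶ y') → Fib x' y'}
    (h : (⟨Fib, act, d⟩ : Bibundle X Y).IsRightPrincipal)
    (he : ∀ {x x' : X} {y y' : Y} (f : x' ⟶ x) (b : Fib x y) (g : y ⟶ y'), act f b g = act' f b g) :
    (⟨Fib, act', d⟩ : Bibundle X Y).IsRightPrincipal := by
  have : @act = @act' := by
    funext x x' y y' f b g
    exact he f b g
  subst this
  exact h

namespace IsSmoothMonoidal

variable {X : Type} [Groupoid.{0} X] [SmoothStr X] [MonoidalCategory X] (hX : IsSmoothMonoidal X)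
include hX

variable {n : ℕ} {x y z : Euc n → X}

lemma whiskerLeft (hx : IsPlot x) {f : ∀ v, y v ⟶ z v} (hf : SmoothArr f) :
    SmoothArr (fun v => x v ◁ f v) := by
  simpa only [id_tensorHom] using hX.tensorHom (hX.lie.smoothArr_id hx) hf

lemma whiskerRight (hx : IsPlot x) {f : ∀ v, y v ⟶ z v} (hf : SmoothArr f) :
    SmoothArr (fun v => f v ▷ x v) := by
  simpa only [tensorHom_id] using hX.tensorHom hf (hX.lie.smoothArr_id hx)

omit hX in
lemma smoothFam_mul {x y z : Euc n → X} {b : ∀ v, x v ⊗ y v ⟶ z v} :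
    (TwoGroupData.ofStrict X).mul.SmoothFam (x := fun v => (x v, y v)) b ↔
      (IsPlot x ∧ IsPlot y) ∧ SmoothArr b :=
  isPlot_prod.trans (and_congr_left fun _ => isPlot_prod)

omit hX in
lemma smoothArr_prod {Y : Type} [Groupoid.{0} Y] [SmoothStr Y] {x y : Euc n → X × Y}
    {f : ∀ v, x v ⟶ y v} :
    SmoothArr f ↔ SmoothArr (fun v => (f v).1) ∧ SmoothArr (fun v => (f v).2) := isPlot_prod

lemma mul_isRightPrincipal : (TwoGroupData.ofStrict X).mul.IsRightPrincipal := by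
  refine Bibundle.ofFunctors_isRightPrincipal (X := X × X) (Y := X) hX.lie (tensor X) ?_ ?_ ?_ ?_
  · exact fun n p hp => hX.tensorObj (isPlot_prod.1 hp).1 (isPlot_prod.1 hp).2
  · exact fun hf => hX.tensorHom (smoothArr_prod.1 hf).1 (smoothArr_prod.1 hf).2
  · exact fun hf => (hX.lie.isPlot_source (smoothArr_prod.1 hf).1).prodMk
      (hX.lie.isPlot_source (smoothArr_prod.1 hf).2)
  · exact isPlot_prod

lemma unit_isRightPrincipal : (TwoGroupData.ofStrict X).unit.IsRightPrincipal := by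
  refine Bibundle.IsRightPrincipal.congr_act
    (act := fun f b g => ((Functor.const Pt).obj (𝟙_ X)).map f ≫ b ≫ (𝟭 X).map g)
    (Bibundle.ofFunctors_isRightPrincipal hX.lie ((Functor.const Pt).obj (𝟙_ X))
      (fun n p hp => isPlot_const) ?_ ?_ ?_) fun f b g => Category.id_comp _
  · exact fun hf => hX.lie.smoothArr_id isPlot_const
  · exact fun hf => isPlot_top
  · exact ⟨fun h => ⟨isPlot_top, h⟩, fun h => h.2⟩

/-- An element over (x, y) and q is a pair of arrows x ⟶ q₁ and x ⊗ y ⟶ q₂. Given x, the second can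
be solved smoothly for y, and since x ◁ - is bijective on arrows, two solutions differ by a unique
arrow that depends smoothly on the data. -/
lemma shear_isInvertible : (TwoGroupData.ofStrict X).shear.IsInvertible where
  right_mem _ := trivial
  right_surjective q _ := by
    obtain ⟨y, g, -, -⟩ := hX.solve (n := 0) (isPlot_const (x := q.1)) (isPlot_const (x := q.2))
    exact ⟨(q.1, y 0), ⟨𝟙 _, g 0⟩⟩
  right_submersion n c v b hc _ hb := by
    obtain ⟨⟨x₀, y₀⟩, q, ⟨f₀, g₀⟩⟩ := b
    obtain rfl : q = c v := hb
    change x₀ ⟶ (c v).1 at f₀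
    change x₀ ⊗ y₀ ⟶ (c v).2 at g₀
    obtain ⟨hc1, hc2⟩ := isPlot_prod.1 hc
    obtain ⟨x, f, hf, hfv⟩ := hX.target_lift hc1 v f₀
    obtain ⟨rfl, h⟩ := Sigma.mk.inj hfv
    obtain rfl := eq_of_heq h
    have hx := hX.lie.isPlot_source hf
    obtain ⟨y₁, g₁, hy₁, hg₁⟩ := hX.solve hx hc2
    -- The smooth solution y₁ need not pass through the prescribed (y₀, g₀) at v. Cancelling x v
    -- yields the arrow y₀ ⟶ y₁ v that measures the difference, and lifting it to a family of arrows
    -- into y₁ corrects the solution.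
    obtain ⟨l₀, hl₀⟩ := (hX.cancel (x v) y₀ (y₁ v)).2 (g₀ ≫ inv (g₁ v))
    obtain ⟨y, l, hl, hlv⟩ := hX.target_lift hy₁ v l₀
    obtain ⟨rfl, h⟩ := Sigma.mk.inj hlv
    obtain rfl := eq_of_heq h
    have hg₀ : x v ◁ l v ≫ g₁ v = g₀ := by
      rw [show x v ◁ l v = g₀ ≫ inv (g₁ v) from hl₀]
      simp
    refine ⟨fun w => ⟨(x w, y w), c w, (f w, x w ◁ l w ≫ g₁ w)⟩, ?_, ?_, Filter.Eventually.of_forall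
      fun w => rfl⟩
    · refine isPlot_prod.2 ⟨hf, smoothFam_mul.2 ⟨⟨hx, hX.lie.isPlot_source hl⟩, ?_⟩⟩
      exact hX.lie.smoothArr_comp (hX.whiskerLeft hx hl) hg₁
    · subst hg₀
      rfl
  division {x x' q} b b' := by
    obtain ⟨b₁, b₂⟩ := b
    obtain ⟨b₁', b₂'⟩ := b'
    change x.1 ⊗ x.2 ⟶ q.2 at b₂
    change x'.1 ⊗ x'.2 ⟶ q.2 at b₂'
    -- The first component of f is forced to be a quotient of b₁ by b₁'. Factoring the tensor
    -- product of arrows into whiskerings then isolates x'.1 ◁ f.2, to which cancellation applies.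
    have key : ∀ f : x ⟶ x', (TwoGroupData.ofStrict X).shear.act f (b₁', b₂') (𝟙 q) =
        ((b₁, b₂) : (x.1 ⟶ q.1) × (x.1 ⊗ x.2 ⟶ q.2)) ↔
        f.1 = b₁ ≫ inv b₁' ∧ x'.1 ◁ f.2 = inv ((b₁ ≫ inv b₁') ▷ x.2) ≫ b₂ ≫ inv b₂' := by
      intro f
      refine Prod.ext_iff.trans ?_
      refine (and_congr (a := f.1 ≫ b₁' ≫ 𝟙 _ = b₁)
        (b := (f.1 ⊗ₘ f.2) ≫ b₂' ≫ 𝟙 _ = b₂) (c := f.1 = b₁ ≫ inv b₁')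
        (d := (f.1 ⊗ₘ f.2) = b₂ ≫ inv b₂') ?_ ?_).trans
        (and_congr_right fun h => ?_)
      · simp
      · simp
      · rw [IsIso.eq_inv_comp, ← h, MonoidalCategory.tensorHom_def]
    obtain ⟨l, hl, hu⟩ := (hX.cancel x'.1 x.2 x'.2).existsUnique
      (inv ((b₁ ≫ inv b₁') ▷ x.2) ≫ b₂ ≫ inv b₂')
    refine ⟨(b₁ ≫ inv b₁', l), (key _).2 ⟨rfl, hl⟩, fun f hf => ?_⟩
    obtain ⟨h1, h2⟩ := (key _).1 hf
    exact Prod.ext h1 (hu _ h2)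
  division_smooth n p p' q b' f hb hfb := by
    obtain ⟨h1, h2⟩ := isPlot_prod.1 hb
    obtain ⟨h3, h4⟩ := isPlot_prod.1 hfb
    obtain ⟨h5, h6⟩ := smoothFam_mul.1 h2
    obtain ⟨h7, h8⟩ := smoothFam_mul.1 h4
    have k1 : SmoothArr (fun v => (f v).1) := by
      have : SmoothArr (fun v => ((f v).1 ≫ (b' v).1 ≫ 𝟙 _) ≫ inv (b' v).1) :=
        hX.lie.smoothArr_comp h3 (hX.lie.smoothArr_inv' h1)
      simpa using this
    have k2 : SmoothArr (fun v => ((f v).1 ⊗ₘ (f v).2)) := by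
      let b₂ : ∀ v, (p' v).1 ⊗ (p' v).2 ⟶ (q v).2 := fun v => (b' v).2
      have h8' : SmoothArr (fun v => ((f v).1 ⊗ₘ (f v).2) ≫ b₂ v ≫ 𝟙 _) := h8
      have := hX.lie.smoothArr_comp h8' (hX.lie.smoothArr_inv' (f := b₂) h6)
      simpa using this
    refine smoothArr_prod.2 ⟨k1, hX.cancel_smooth h5.1 h7.2 h5.2 ?_⟩
    have := hX.lie.smoothArr_comp (hX.whiskerRight h7.2 (hX.lie.smoothArr_inv' k1)) k2
    simpa [MonoidalCategory.tensorHom_def] using this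

end IsSmoothMonoidal


/-! ### Equivariance of the associator and unit relations -/

section Coherence

variable {C : Type*} [Category C] [MonoidalCategory C]

lemma assocRel_iff {x y w u s v : C} {a : x ⊗ y ⟶ u} {b : u ⊗ w ⟶ v} {c : y ⊗ w ⟶ s}
    [IsIso c] {d : x ⊗ s ⟶ v} :
    AssocRel a b c d ↔ d = inv ((α_ x y w).hom ≫ x ◁ c) ≫ a ▷ w ≫ b := by
  rw [AssocRel, IsIso.eq_inv_comp, Category.assoc, eq_comm]

/-- By interchange, p and q meet their inverses and cancel, leaving f, g, k in front; naturality of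
the associator moves them across. -/
lemma AssocRel.equivariant {x y w u s v x' y' w' u' s' v' : C} {a : x ⊗ y ⟶ u} {b : u ⊗ w ⟶ v}
    {c : y ⊗ w ⟶ s} {d : x ⊗ s ⟶ v} (h : AssocRel a b c d) (f : x' ⟶ x) (g : y' ⟶ y) (k : w' ⟶ w)
    (p : u ≅ u') (q : s ≅ s') (m : v ⟶ v') :
    AssocRel ((f ⊗ₘ g) ≫ a ≫ p.hom) ((p.inv ⊗ₘ k) ≫ b ≫ m) ((g ⊗ₘ k) ≫ c ≫ q.hom)
      ((f ⊗ₘ q.inv) ≫ d ≫ m) := by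
  have e1 : ((f ⊗ₘ g) ≫ a ≫ p.hom) ▷ w' ≫ (p.inv ⊗ₘ k) = ((f ⊗ₘ g) ⊗ₘ k) ≫ a ▷ w := by
    simp only [← tensorHom_id, tensorHom_comp_tensorHom]
    simp
  have e2 : x' ◁ ((g ⊗ₘ k) ≫ c ≫ q.hom) ≫ (f ⊗ₘ q.inv) = (f ⊗ₘ (g ⊗ₘ k)) ≫ x ◁ c := by
    simp only [← id_tensorHom, tensorHom_comp_tensorHom]
    simp
  rw [AssocRel] at *
  rw [reassoc_of% e1, reassoc_of% e2, reassoc_of% h, associator_naturality_assoc]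

lemma leftUnit_equivariant {i x y i' x' y' : C} {e : 𝟙_ C ⟶ i} {a : i ⊗ x ⟶ y} {f : x ⟶ y}
    (h : e ▷ x ≫ a = (λ_ x).hom ≫ f) (k : i ≅ i') (g : x' ⟶ x) (l : y ⟶ y') :
    (e ≫ k.hom) ▷ x' ≫ (k.inv ⊗ₘ g) ≫ a ≫ l = (λ_ x').hom ≫ g ≫ f ≫ l := by
  have e1 : (e ≫ k.hom) ▷ x' ≫ (k.inv ⊗ₘ g) = _ ◁ g ≫ e ▷ x := by
    simp only [← tensorHom_id, ← id_tensorHom, tensorHom_comp_tensorHom]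
    simp
  rw [reassoc_of% e1, reassoc_of% h]
  simp

lemma rightUnit_equivariant {i x y i' x' y' : C} {e : 𝟙_ C ⟶ i} {a : x ⊗ i ⟶ y} {f : x ⟶ y}
    (h : x ◁ e ≫ a = (ρ_ x).hom ≫ f) (k : i ≅ i') (g : x' ⟶ x) (l : y ⟶ y') :
    x' ◁ (e ≫ k.hom) ≫ (g ⊗ₘ k.inv) ≫ a ≫ l = (ρ_ x').hom ≫ g ≫ f ≫ l := by
  have e1 : x' ◁ (e ≫ k.hom) ≫ (g ⊗ₘ k.inv) = g ▷ _ ≫ x ◁ e := by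
    simp only [← tensorHom_id, ← id_tensorHom, tensorHom_comp_tensorHom]
    simp
  rw [reassoc_of% e1, reassoc_of% h]
  simp

end Coherence

namespace IsSmoothMonoidal

section

variable {X : Type} [Groupoid.{0} X] [SmoothStr X] [MonoidalCategory X]

lemma assoc_iff {x y w u s v : X} {a : x ⊗ y ⟶ u} {b : u ⊗ w ⟶ v} {c : y ⊗ w ⟶ s}
    {d : x ⊗ s ⟶ v} : (TwoGroupData.ofStrict X).assoc a b c d ↔ AssocRel a b c d := by
  change (a ⊗ₘ 𝟙 w) ≫ b = (α_ x y w).hom ≫ (𝟙 x ⊗ₘ c) ≫ d ↔ _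
  rw [tensorHom_id, id_tensorHom]
  rfl

lemma lunit_iff {i x y : X} {e : 𝟙_ X ⟶ i} {a : i ⊗ x ⟶ y} {f : x ⟶ y} :
    (TwoGroupData.ofStrict X).lunit e a f ↔ e ▷ x ≫ a = (λ_ x).hom ≫ f := by
  change (e ⊗ₘ 𝟙 x) ≫ a = (λ_ x).hom ≫ f ↔ _
  rw [tensorHom_id]

lemma runit_iff {i x y : X} {e : 𝟙_ X ⟶ i} {a : x ⊗ i ⟶ y} {f : x ⟶ y} :
    (TwoGroupData.ofStrict X).runit e a f ↔ x ◁ e ≫ a = (ρ_ x).hom ≫ f := by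
  change (𝟙 x ⊗ₘ e) ≫ a = (ρ_ x).hom ≫ f ↔ _
  rw [id_tensorHom]

end

variable {X : Type} [Groupoid.{0} X] [SmoothStr X] [MonoidalCategory X] (hX : IsSmoothMonoidal X)
include hX

/-- A smooth monoidal groupoid with invertible multiplication is a Lie 2-group. -/
theorem isLieTwoGroup : (TwoGroupData.ofStrict X).IsLieTwoGroup where
  lie := hX.lie
  mul_bibundle := hX.mul_isRightPrincipal
  unit_bibundle := hX.unit_isRightPrincipal
  assoc_existsUnique {x y w u s v} a b c := by
    change x ⊗ y ⟶ u at a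
    change u ⊗ w ⟶ v at b
    change y ⊗ w ⟶ s at c
    exact ⟨_, assoc_iff.2 (assocRel_iff.2 rfl), fun d hd => assocRel_iff.1 (assoc_iff.1 hd)⟩
  assoc_equivariant a b c d f g h k l m H := by
    replace H := assoc_iff.1 H
    exact assoc_iff.2 (H.equivariant f g h (Groupoid.isoEquivHom _ _ |>.symm k)
      (Groupoid.isoEquivHom _ _ |>.symm l) m)
  assoc_smooth n x y w u s v a b c d H ha hb hc := by
    obtain ⟨⟨hx, hy⟩, ha⟩ := smoothFam_mul.1 ha
    obtain ⟨⟨hu, hw⟩, hb⟩ := smoothFam_mul.1 hb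
    obtain ⟨-, hc⟩ := smoothFam_mul.1 hc
    refine smoothFam_mul.2 ⟨⟨hx, hX.lie.isPlot_target hc⟩, ?_⟩
    let a' : ∀ t, x t ⊗ y t ⟶ u t := a
    let b' : ∀ t, u t ⊗ w t ⟶ v t := b
    let c' : ∀ t, y t ⊗ w t ⟶ s t := c
    have : d = fun t => inv ((α_ (x t) (y t) (w t)).hom ≫ x t ◁ c' t) ≫ a' t ▷ w t ≫ b' t :=
      funext fun t => assocRel_iff.1 (assoc_iff.1 (H t))
    rw [this]
    exact hX.lie.smoothArr_comp (hX.lie.smoothArr_inv' (hX.lie.smoothArr_comp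
      (hX.associator hx hy hw) (hX.whiskerLeft hx hc)))
      (hX.lie.smoothArr_comp (hX.whiskerRight hw ha) hb)
  lunit_existsUnique {i x y} e a := by
    change 𝟙_ X ⟶ i at e
    change i ⊗ x ⟶ y at a
    refine ⟨inv (λ_ x).hom ≫ e ▷ x ≫ a, ?_, fun f hf => ?_⟩
    · refine lunit_iff.2 ?_
      simp
    · rw [lunit_iff.1 hf]
      simp
  lunit_equivariant e a f k g h H :=
    lunit_iff.2 (leftUnit_equivariant (lunit_iff.1 H) (Groupoid.isoEquivHom _ _ |>.symm k) g h)
  lunit_smooth n i x y e a f H he ha := by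
    obtain ⟨⟨hi, hx⟩, ha⟩ := smoothFam_mul.1 ha
    let e' : ∀ t, 𝟙_ X ⟶ i t := e
    let a' : ∀ t, i t ⊗ x t ⟶ y t := a
    have : f = fun t => inv (λ_ (x t)).hom ≫ e' t ▷ x t ≫ a' t := by
      funext t
      rw [IsIso.eq_inv_comp]
      exact (lunit_iff.1 (H t)).symm
    rw [this]
    exact hX.lie.smoothArr_comp (hX.lie.smoothArr_inv' (hX.leftUnitor hx))
      (hX.lie.smoothArr_comp (hX.whiskerRight hx he) ha)
  runit_existsUnique {i x y} e a := by
    change 𝟙_ X ⟶ i at e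
    change x ⊗ i ⟶ y at a
    refine ⟨inv (ρ_ x).hom ≫ x ◁ e ≫ a, ?_, fun f hf => ?_⟩
    · refine runit_iff.2 ?_
      simp
    · rw [runit_iff.1 hf]
      simp
  runit_equivariant e a f k g h H :=
    runit_iff.2 (rightUnit_equivariant (runit_iff.1 H) (Groupoid.isoEquivHom _ _ |>.symm k) g h)
  runit_smooth n i x y e a f H he ha := by
    obtain ⟨⟨hx, hi⟩, ha⟩ := smoothFam_mul.1 ha
    let e' : ∀ t, 𝟙_ X ⟶ i t := e
    let a' : ∀ t, x t ⊗ i t ⟶ y t := a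
    have : f = fun t => inv (ρ_ (x t)).hom ≫ x t ◁ e' t ≫ a' t := by
      funext t
      rw [IsIso.eq_inv_comp]
      exact (runit_iff.1 (H t)).symm
    rw [this]
    exact hX.lie.smoothArr_comp (hX.lie.smoothArr_inv' (hX.rightUnitor hx))
      (hX.lie.smoothArr_comp (hX.whiskerLeft hx he) ha)
  pentagon {x y z w p q r s g k} a b c d f h b₁ e a₁ e₁ e₂ h₁ h₂ h₃ h₄ h₅ := by
    change z ⊗ w ⟶ s at d
    change y ⊗ s ⟶ k at e
    exact AssocRel.pentagon (assoc_iff.1 h₁) (assoc_iff.1 h₂) (assoc_iff.1 h₃) (assoc_iff.1 h₄)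
      (assoc_iff.1 h₅)
  triangle {i x y u v s} e a b c d f g h hr hl := by
    have := AssocRel.triangle (assoc_iff.1 h) (runit_iff.1 hr) (lunit_iff.1 hl)
    change u ⊗ y ⟶ v at b
    change x ⊗ s ⟶ v at d
    change (f ⊗ₘ 𝟙 y) ≫ b ≫ 𝟙 v = (𝟙 x ⊗ₘ g) ≫ d ≫ 𝟙 v
    simpa using this
  invertible := hX.shear_isInvertible

end IsSmoothMonoidal


/-! ## Monoidal functors -/

/-- `(F, ε, μ)` is a lax monoidal functor. -/
structure IsMonoidalFunctor {C D : Type*} [Category C] [Category D] [MonoidalCategory C]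
    [MonoidalCategory D] (F : C ⥤ D) (ε : 𝟙_ D ⟶ F.obj (𝟙_ C))
    (μ : ∀ x y : C, F.obj x ⊗ F.obj y ⟶ F.obj (x ⊗ y)) : Prop where
  natural : ∀ {x x' y y' : C} (f : x ⟶ x') (g : y ⟶ y'),
    (F.map f ⊗ₘ F.map g) ≫ μ x' y' = μ x y ≫ F.map (f ⊗ₘ g)
  assoc : ∀ x y z : C, μ x y ▷ F.obj z ≫ μ (x ⊗ y) z ≫ F.map (α_ x y z).hom =
    (α_ (F.obj x) (F.obj y) (F.obj z)).hom ≫ F.obj x ◁ μ y z ≫ μ x (y ⊗ z)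
  left_unit : ∀ x : C, ε ▷ F.obj x ≫ μ (𝟙_ C) x ≫ F.map (λ_ x).hom = (λ_ (F.obj x)).hom
  right_unit : ∀ x : C, F.obj x ◁ ε ≫ μ x (𝟙_ C) ≫ F.map (ρ_ x).hom = (ρ_ (F.obj x)).hom

namespace IsMonoidalFunctor

variable {C D : Type*} [Category C] [Category D] [MonoidalCategory C] [MonoidalCategory D]
  {F : C ⥤ D} {ε : 𝟙_ D ⟶ F.obj (𝟙_ C)} {μ : ∀ x y : C, F.obj x ⊗ F.obj y ⟶ F.obj (x ⊗ y)}
  (hF : IsMonoidalFunctor F ε μ)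
include hF

lemma natural_left {x x' : C} (f : x ⟶ x') (y : C) :
    F.map f ▷ F.obj y ≫ μ x' y = μ x y ≫ F.map (f ▷ y) := by
  simpa using hF.natural f (𝟙 y)

lemma natural_right {y y' : C} (x : C) (f : y ⟶ y') :
    F.obj x ◁ F.map f ≫ μ x y' = μ x y ≫ F.map (x ◁ f) := by
  simpa using hF.natural (𝟙 x) f

/-- Naturality of μ pulls the whiskered images together into F of the two sides of the relation, and
the associativity of μ compares the remaining factors. -/
lemma assocRel_map {x y w u s v : C} {a : x ⊗ y ⟶ u} {b : u ⊗ w ⟶ v} {c : y ⊗ w ⟶ s}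
    {d : x ⊗ s ⟶ v} (h : AssocRel a b c d) : AssocRel (μ x y ≫ F.map a) (μ u w ≫ F.map b)
      (μ y w ≫ F.map c) (μ x s ≫ F.map d) := by
  rw [AssocRel] at *
  have e1 : (μ x y ≫ F.map a) ▷ F.obj w ≫ μ u w ≫ F.map b =
      μ x y ▷ F.obj w ≫ μ (x ⊗ y) w ≫ F.map (a ▷ w ≫ b) := by
    rw [comp_whiskerRight_assoc, reassoc_of% hF.natural_left a w, F.map_comp]
  have e2 : F.obj x ◁ (μ y w ≫ F.map c) ≫ μ x s ≫ F.map d =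
      F.obj x ◁ μ y w ≫ μ x (y ⊗ w) ≫ F.map (x ◁ c ≫ d) := by
    rw [MonoidalCategory.whiskerLeft_comp_assoc, reassoc_of% hF.natural_right x c, F.map_comp]
  rw [e1, e2, h, F.map_comp, reassoc_of% hF.assoc x y w]

/-- The equations for a', b', c', d' say that they are the images of a, b, c, d conjugated by p, q,
r, k, m, l. Precomposing with the invertible (p ⊗ q) ⊗ r therefore reduces the claim to
`assocRel_map`. -/
lemma assocRel_of_map {x y w u s v : C} {x' y' w' u' s' v' : D} {a : x ⊗ y ⟶ u} {b : u ⊗ w ⟶ v}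
    {c : y ⊗ w ⟶ s} {d : x ⊗ s ⟶ v} (h : AssocRel a b c d) {p : F.obj x ⟶ x'} {q : F.obj y ⟶ y'}
    {r : F.obj w ⟶ w'} {k : F.obj u ⟶ u'} {m : F.obj s ⟶ s'} {l : F.obj v ⟶ v'} {a' : x' ⊗ y' ⟶ u'}
    {b' : u' ⊗ w' ⟶ v'} {c' : y' ⊗ w' ⟶ s'} {d' : x' ⊗ s' ⟶ v'} [IsIso p] [IsIso q] [IsIso r]
    (ha : (p ⊗ₘ q) ≫ a' = μ x y ≫ F.map a ≫ k) (hb : (k ⊗ₘ r) ≫ b' = μ u w ≫ F.map b ≫ l)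
    (hc : (q ⊗ₘ r) ≫ c' = μ y w ≫ F.map c ≫ m) (hd : (p ⊗ₘ m) ≫ d' = μ x s ≫ F.map d ≫ l) :
    AssocRel a' b' c' d' := by
  have h' := hF.assocRel_map h
  rw [AssocRel] at *
  rw [← cancel_epi ((p ⊗ₘ q) ⊗ₘ r)]
  have e1 : ((p ⊗ₘ q) ⊗ₘ r) ≫ a' ▷ w' = (μ x y ≫ F.map a) ▷ F.obj w ≫ (k ⊗ₘ r) := by
    rw [← tensorHom_id, ← tensorHom_id, tensorHom_comp_tensorHom, tensorHom_comp_tensorHom, ha]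
    simp
  have e2 : (p ⊗ₘ (q ⊗ₘ r)) ≫ x' ◁ c' = F.obj x ◁ (μ y w ≫ F.map c) ≫ (p ⊗ₘ m) := by
    rw [← id_tensorHom, ← id_tensorHom, tensorHom_comp_tensorHom, tensorHom_comp_tensorHom, hc]
    simp
  rw [reassoc_of% e1, associator_naturality_assoc, reassoc_of% e2, hb, hd]
  simpa using congrArg (· ≫ l) h'

lemma leftUnit_map {i x y : C} {e : 𝟙_ C ⟶ i} {a : i ⊗ x ⟶ y} {f : x ⟶ y}
    (h : e ▷ x ≫ a = (λ_ x).hom ≫ f) :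
    (ε ≫ F.map e) ▷ F.obj x ≫ μ i x ≫ F.map a = (λ_ (F.obj x)).hom ≫ F.map f := by
  rw [comp_whiskerRight_assoc, reassoc_of% hF.natural_left e x, ← F.map_comp, h, F.map_comp,
    ← Category.assoc (μ _ _), ← Category.assoc, hF.left_unit]

lemma rightUnit_map {i x y : C} {e : 𝟙_ C ⟶ i} {a : x ⊗ i ⟶ y} {f : x ⟶ y}
    (h : x ◁ e ≫ a = (ρ_ x).hom ≫ f) :
    F.obj x ◁ (ε ≫ F.map e) ≫ μ x i ≫ F.map a = (ρ_ (F.obj x)).hom ≫ F.map f := by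
  rw [MonoidalCategory.whiskerLeft_comp_assoc, reassoc_of% hF.natural_right x e, ← F.map_comp, h,
    F.map_comp, ← Category.assoc (μ _ _), ← Category.assoc, hF.right_unit]

/-- The same conjugation argument for the unit: comparing both unit relations after precomposing
with the left unitor at F x leaves exactly the compatibility of r and q with f and f'. -/
lemma leftUnit_of_map {i x y : C} {i' x' y' : D} {e : 𝟙_ C ⟶ i} {a : i ⊗ x ⟶ y} {f : x ⟶ y}
    (h : e ▷ x ≫ a = (λ_ x).hom ≫ f) {p : F.obj i ⟶ i'} {q : F.obj x ⟶ x'} {r : F.obj y ⟶ y'}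
    {e' : 𝟙_ D ⟶ i'} {a' : i' ⊗ x' ⟶ y'} {f' : x' ⟶ y'} (he : ε ≫ F.map e ≫ p = e')
    (ha : (p ⊗ₘ q) ≫ a' = μ i x ≫ F.map a ≫ r) (h' : e' ▷ x' ≫ a' = (λ_ x').hom ≫ f') :
    F.map f ≫ r = q ≫ f' := by
  rw [← cancel_epi (λ_ (F.obj x)).hom, ← reassoc_of% hF.leftUnit_map h, ← ha,
    ← leftUnitor_naturality_assoc, ← h', ← he]
  have : (ε ≫ F.map e) ▷ F.obj x ≫ (p ⊗ₘ q) = 𝟙_ D ◁ q ≫ (ε ≫ F.map e ≫ p) ▷ x' := by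
    simp only [← tensorHom_id, ← id_tensorHom, tensorHom_comp_tensorHom]
    simp
  rw [reassoc_of% this]

lemma rightUnit_of_map {i x y : C} {i' x' y' : D} {e : 𝟙_ C ⟶ i} {a : x ⊗ i ⟶ y} {f : x ⟶ y}
    (h : x ◁ e ≫ a = (ρ_ x).hom ≫ f) {p : F.obj i ⟶ i'} {q : F.obj x ⟶ x'} {r : F.obj y ⟶ y'}
    {e' : 𝟙_ D ⟶ i'} {a' : x' ⊗ i' ⟶ y'} {f' : x' ⟶ y'} (he : ε ≫ F.map e ≫ p = e')
    (ha : (q ⊗ₘ p) ≫ a' = μ x i ≫ F.map a ≫ r) (h' : x' ◁ e' ≫ a' = (ρ_ x').hom ≫ f') :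
    F.map f ≫ r = q ≫ f' := by
  rw [← cancel_epi (ρ_ (F.obj x)).hom, ← reassoc_of% hF.rightUnit_map h, ← ha,
    ← rightUnitor_naturality_assoc, ← h', ← he]
  have : F.obj x ◁ (ε ≫ F.map e) ≫ (q ⊗ₘ p) = q ▷ 𝟙_ D ≫ x' ◁ (ε ≫ F.map e ≫ p) := by
    simp only [← tensorHom_id, ← id_tensorHom, tensorHom_comp_tensorHom]
    simp
  rw [reassoc_of% this]

/-- The inserted arrows f', g', h occur next to their inverses and cancel; f and g pass through μ by
naturality. -/
lemma map_equivariant {x y z x₁ y₁ z₁ : C} {x' y' z' x₁' y₁' z₁' : D} {a : x ⊗ y ⟶ z}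
    {r : F.obj z ⟶ z'} {p : F.obj x ⟶ x'} {q : F.obj y ⟶ y'} {b : x' ⊗ y' ⟶ z'} (f : x₁ ⟶ x)
    (g : y₁ ⟶ y) (h : z ≅ z₁) (f' : x' ≅ x₁') (g' : y' ≅ y₁') (h' : z' ⟶ z₁')
    (H : (p ⊗ₘ q) ≫ b = μ x y ≫ F.map a ≫ r) :
    ((F.map f ≫ p ≫ f'.hom) ⊗ₘ (F.map g ≫ q ≫ g'.hom)) ≫ (f'.inv ⊗ₘ g'.inv) ≫ b ≫ h' =
      μ x₁ y₁ ≫ F.map ((f ⊗ₘ g) ≫ a ≫ h.hom) ≫ F.map h.inv ≫ r ≫ h' := by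
  rw [tensorHom_comp_tensorHom_assoc]
  simp only [Category.assoc, Iso.hom_inv_id, Category.comp_id]
  rw [← tensorHom_comp_tensorHom_assoc, reassoc_of% H, reassoc_of% hF.natural f g, ← F.map_comp_assoc]
  have e : F.map ((f ⊗ₘ g) ≫ a ≫ h.hom) ≫ F.map h.inv = F.map ((f ⊗ₘ g) ≫ a) := by
    rw [← F.map_comp]
    simp
  rw [reassoc_of% e]

end IsMonoidalFunctor

namespace IsSmoothMonoidal

variable {C A : Type} [Groupoid.{0} C] [SmoothStr C] [MonoidalCategory C] [Groupoid.{0} A]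
  [SmoothStr A] [MonoidalCategory A]

/-- A smooth monoidal functor between smooth monoidal groupoids is a 1-morphism of 2-groups. -/
theorem ofMonoidal_isHom (hC : IsSmoothMonoidal C) (hA : IsSmoothMonoidal A) {F : C ⥤ A}
    {ε : 𝟙_ A ⟶ F.obj (𝟙_ C)} {μ : ∀ x y : C, F.obj x ⊗ F.obj y ⟶ F.obj (x ⊗ y)}
    (hF : IsMonoidalFunctor F ε μ) (hobj : DSmooth F.obj)
    (harr : ∀ {n : ℕ} {x y : Euc n → C} {f : ∀ v, x v ⟶ y v}, SmoothArr f →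
      SmoothArr (fun v => F.map (f v)))
    (hμ : ∀ {n : ℕ} {x y : Euc n → C}, IsPlot x → IsPlot y → SmoothArr (fun v => μ (x v) (y v)))
    {d : DiffeologicalSpace (Σ x : C, Σ y : A, (F.obj x ⟶ y))}
    (hd : ∀ {n : ℕ} {x : Euc n → C} {y : Euc n → A} {b : ∀ v, F.obj (x v) ⟶ y v},
      @IsPlot _ d n (fun v => ⟨x v, y v, b v⟩) ↔ IsPlot x ∧ SmoothArr b) :
    (TwoGroupHom.ofMonoidal (𝟭 C) (𝟭 A) F ε μ d :
      TwoGroupHom (TwoGroupData.ofStrict C) (TwoGroupData.ofStrict A)).IsHom where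
  bibundle := Bibundle.ofFunctors_isRightPrincipal hA.lie (𝟭 C ⋙ F) hobj harr
    (fun hf => hC.lie.isPlot_source hf) hd
  φ_existsUnique {x y z x' y' z'} a r p q := by
    change x ⊗ y ⟶ z at a
    change F.obj z ⟶ z' at r
    change F.obj x ⟶ x' at p
    change F.obj y ⟶ y' at q
    have key : ∀ b : x' ⊗ y' ⟶ z', (p ⊗ₘ q) ≫ b = μ x y ≫ F.map a ≫ r ↔
        b = inv (p ⊗ₘ q) ≫ μ x y ≫ F.map a ≫ r := fun b => by rw [IsIso.eq_inv_comp]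
    exact ⟨_, (key _).2 rfl, fun b hb => (key b).1 hb⟩
  φ_equivariant a r p q b f g h f' g' h' H :=
    hF.map_equivariant f g (Groupoid.isoEquivHom _ _ |>.symm h)
      (Groupoid.isoEquivHom _ _ |>.symm f') (Groupoid.isoEquivHom _ _ |>.symm g') h' H
  φ_smooth n x y z x' y' z' a r p q b H ha hr hp hq := by
    obtain ⟨⟨hx, hy⟩, ha⟩ := smoothFam_mul.1 ha
    have hr := (hd.1 hr).2
    have hp := (hd.1 hp).2
    have hq := (hd.1 hq).2
    refine smoothFam_mul.2 ⟨⟨hA.lie.isPlot_target hp, hA.lie.isPlot_target hq⟩, ?_⟩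
    let a₁ : ∀ t, x t ⊗ y t ⟶ z t := a
    let r₁ : ∀ t, F.obj (z t) ⟶ z' t := r
    let p₁ : ∀ t, F.obj (x t) ⟶ x' t := p
    let q₁ : ∀ t, F.obj (y t) ⟶ y' t := q
    have : b = fun t => inv (p₁ t ⊗ₘ q₁ t) ≫ μ (x t) (y t) ≫ F.map (a₁ t) ≫ r₁ t :=
      funext fun t => (IsIso.eq_inv_comp _).2 (H t)
    rw [this]
    exact hA.lie.smoothArr_comp (hA.lie.smoothArr_inv' (hA.tensorHom hp hq))
      (hA.lie.smoothArr_comp (hμ hx hy) (hA.lie.smoothArr_comp (harr ha) hr))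
  ε_existsUnique e p := ⟨_, rfl, fun e' he' => he'.symm⟩
  ε_equivariant {i i₁ i' i₁'} e p e' h h' H := by
    change 𝟙_ C ⟶ i at e
    change F.obj i ⟶ i' at p
    change ε ≫ F.map e ≫ p = e' at H
    change ε ≫ F.map (e ≫ h) ≫ F.map (Groupoid.inv h) ≫ p ≫ h' = e' ≫ h'
    rw [← H]
    simp
  ε_smooth n i i' e p e' H he hp := by
    have hp := (hd.1 hp).2
    let e₁ : ∀ t, 𝟙_ C ⟶ i t := e
    let p₁ : ∀ t, F.obj (i t) ⟶ i' t := p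
    have : e' = fun t => ε ≫ F.map (e₁ t) ≫ p₁ t := funext fun t => (H t).symm
    rw [this]
    exact hA.lie.smoothArr_comp (isPlot_const (x := (⟨_, _, ε⟩ : Arr A)))
      (hA.lie.smoothArr_comp (harr he) hp)
  assoc {x y w u s v x' y' w' u' s' v'} a b c d p q r k m l a' b' c' d' H ha hb hc hd := by
    change F.obj x ⟶ x' at p
    change F.obj y ⟶ y' at q
    change F.obj w ⟶ w' at r
    exact assoc_iff.2 (hF.assocRel_of_map (assoc_iff.1 H) ha hb hc hd)
  lunit {i x y i' x' y'} e a f p q r e' a' f' H he ha H' := by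
    have := hF.leftUnit_of_map (lunit_iff.1 H) he ha (lunit_iff.1 H')
    change F.obj y ⟶ y' at r
    change F.obj x ⟶ x' at q
    change F.map f ≫ r ≫ 𝟙 y' = F.map (𝟙 x) ≫ q ≫ f'
    simpa using this
  runit {i x y i' x' y'} e a f p q r e' a' f' H he ha H' := by
    have := hF.rightUnit_of_map (runit_iff.1 H) he ha (runit_iff.1 H')
    change F.obj y ⟶ y' at r
    change F.obj x ⟶ x' at q
    change F.map f ≫ r ≫ 𝟙 y' = F.map (𝟙 x) ≫ q ≫ f'
    simpa using this

end IsSmoothMonoidal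

/-! ## 1-morphisms to a Lie group -/

section Discrete

variable {X T : Type} [Groupoid.{0} X] [SmoothStr X] [AddCommGroup T] [DiffeologicalSpace T]

lemma isPlot_discrete {M : Type} [DiffeologicalSpace M] {n : ℕ} {x : Euc n → Discrete M} :
    IsPlot x ↔ IsPlot (fun v => (x v).as) := Iff.rfl

lemma arr_discrete_ext {M : Type} (a b : Arr (Discrete M)) (h : a.1 = b.1) : a = b := by
  obtain ⟨⟨x⟩, ⟨y⟩, f⟩ := a
  obtain ⟨⟨x'⟩, ⟨y'⟩, g⟩ := b
  obtain rfl : x = y := Discrete.eq_of_hom f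
  obtain rfl : x' = y' := Discrete.eq_of_hom g
  obtain rfl : x = x' := congrArg Discrete.as h
  rw [Subsingleton.elim f g]

lemma discrete_plot_of_eq {M : Type} [DiffeologicalSpace M] {n : ℕ} {x y : Euc n → Discrete M}
    (hx : IsPlot x) (f : ∀ v, x v ⟶ y v) : IsPlot y := by
  have : x = y := funext fun v => Discrete.ext (Discrete.eq_of_hom (f v))
  rwa [← this]

lemma isLieGroupoid_discrete {M : Type} [DiffeologicalSpace M] (hM : HasAtlas M) :
    IsLieGroupoid (Discrete M) where
  obj_manifold := (hM.of_equiv (X := Discrete M) discreteEquiv fun n p => Iff.rfl).isSmoothManifold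
  arr_manifold := (hM.of_equiv (X := Arr (Discrete M))
    ⟨fun a => a.1.as, fun x => ⟨⟨x⟩, ⟨x⟩, 𝟙 _⟩, fun a => arr_discrete_ext _ _ rfl, fun x => rfl⟩
    fun n p => Iff.rfl).isSmoothManifold
  source := ⟨fun n p hp => hp, fun n c v b hc hb => ⟨fun w => ⟨c w, c w, 𝟙 _⟩, hc,
    arr_discrete_ext _ _ hb.symm, by simp⟩⟩
  target := ⟨fun n p hp => discrete_plot_of_eq (x := fun v => (p v).1) hp (fun v => (p v).2.2),
    fun n c v b hc hb => ⟨fun w => ⟨c w, c w, 𝟙 _⟩, hc,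
    arr_discrete_ext _ _ (hb.symm.trans (Discrete.ext (Discrete.eq_of_hom b.2.2)).symm), by simp⟩⟩
  ident n p hp := hp
  inverse n p hp := discrete_plot_of_eq (x := fun v => (p v).1) hp (fun v => (p v).2.2)
  comp n x y z f g hf hg := hf

lemma isSmoothMonoidal_discrete (hM : HasAtlas T)
    (hadd : ∀ {n : ℕ} {s t : Euc n → T}, IsPlot s → IsPlot t → IsPlot (fun v => s v + t v))
    (hneg : ∀ {n : ℕ} {s : Euc n → T}, IsPlot s → IsPlot (fun v => - s v)) :
    IsSmoothMonoidal (Discrete T) where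
  lie := isLieGroupoid_discrete hM
  tensorObj hx hy := hadd hx hy
  tensorHom hf hg := hadd hf hg
  associator hx hy hz := hadd (hadd hx hy) hz
  leftUnitor hx := hadd isPlot_const hx
  rightUnitor hx := hadd hx isPlot_const
  target_lift {n q} hq v x₀ f₀ := by
    obtain rfl : x₀ = q v := Discrete.ext (Discrete.eq_of_hom f₀)
    exact ⟨q, fun w => 𝟙 _, hq, rfl⟩
  solve {n x q} hx hq := by
    refine ⟨fun v => ⟨-(x v).as + (q v).as⟩, fun v => Discrete.eqToHom ?_, hadd (hneg hx) hq,
      hadd hx (hadd (hneg hx) hq)⟩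
    exact add_neg_cancel_left (x v).as (q v).as
  cancel x y y' := by
    refine ⟨fun _ _ _ => Subsingleton.elim _ _, fun k => ⟨Discrete.eqToHom ?_,
      Subsingleton.elim _ _⟩⟩
    have : x.as + y.as = x.as + y'.as := Discrete.eq_of_hom k
    exact add_left_cancel this
  cancel_smooth hx hy hy' h := hy

/-- Hom-sets of a discrete groupoid have at most one element, so every equation is automatic. Only
the existence of the image elements has content, and this is additivity of π on products and its
vanishing on units. -/
lemma toDiscrete_isHom (hT : IsSmoothMonoidal (Discrete T)) {G : TwoGroupData X} {π : X ⥤ Discrete T}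
    (hX : IsLieGroupoid X) (hπ : DSmooth π.obj)
    (hadd : ∀ {x y z : X}, G.mul.Fib (x, y) z → (π.obj x).as + (π.obj y).as = (π.obj z).as)
    (hunit : ∀ {i : X}, G.unit.Fib pt i → (π.obj i).as = 0) :
    (TwoGroupHom.toDiscrete G π).IsHom := by
  have heq : ∀ {x : X} {t : Discrete T}, (TwoGroupHom.toDiscrete G π).bib.Fib x t →
      (π.obj x).as = t.as := fun f => Discrete.eq_of_hom f
  have hsub : ∀ (x : X) (t : Discrete T), Subsingleton ((TwoGroupHom.toDiscrete G π).bib.Fib x t) :=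
    fun x t => inferInstanceAs (Subsingleton (π.obj x ⟶ t))
  have hbib : (TwoGroupHom.toDiscrete G π).bib.IsRightPrincipal := by
    refine Bibundle.ofFunctors_isRightPrincipal hT.lie π hπ (fun hf => ?_)
      (fun hf => hX.isPlot_source hf) isPlot_prod
    exact hπ _ _ (hX.isPlot_source hf)
  refine ⟨hbib, fun {x y z x' y' z'} a r p q => ?_, fun _ _ _ _ _ _ _ _ _ _ _ _ => trivial, ?_,
    fun {i i'} e p => ?_, fun _ _ _ _ _ _ => trivial, ?_, ?_, ?_, ?_⟩
  · refine ⟨Discrete.eqToHom ?_, trivial, fun _ _ => Subsingleton.elim (α := (_ ⟶ z')) _ _⟩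
    change x'.as + y'.as = z'.as
    rw [← heq p, ← heq q, ← heq r, hadd a]
  · intro n x y z x' y' z' a r p q b _ ha hr hp hq
    have hx' := hbib.right_smooth n _ hp
    have hy' := hbib.right_smooth n _ hq
    exact isPlot_prod.2 ⟨isPlot_prod.2 ⟨hx', hy'⟩, hT.tensorObj hx' hy'⟩
  · refine ⟨Discrete.eqToHom ?_, trivial, fun _ _ => Subsingleton.elim (α := (_ ⟶ i')) _ _⟩
    change 0 = i'.as
    rw [← heq p, hunit e]
  · intro n i i' e p e' _ he hp
    exact isPlot_const (x := (0 : T))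
  · intros
    exact Subsingleton.elim (α := (_ ⟶ _)) _ _
  · intros
    exact (hsub _ _).elim _ _
  · intros
    exact (hsub _ _).elim _ _

end Discrete


/-! ## Covers

A cover is a functor which is fully faithful and a surjective submersion on objects.  Structures on the
source which are compatible with it descend to the target. -/

section Covers

variable {A X B Y : Type} [Groupoid.{0} A] [SmoothStr A] [Groupoid.{0} X] [SmoothStr X]
  [Groupoid.{0} B] [SmoothStr B] [Groupoid.{0} Y] [SmoothStr Y]

/-- A weak equivalence of Lie groupoids which is a surjective submersion on objects. -/
structure IsSmoothCover (p : A ⥤ X) : Prop where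
  submersion : IsSubmersion p.obj
  surj : Function.Surjective p.obj
  bij : ∀ a b : A, Function.Bijective (p.map : (a ⟶ b) → _)
  smooth : ∀ {n : ℕ} {x y : Euc n → A} {f : ∀ v, x v ⟶ y v}, SmoothArr f →
    SmoothArr (fun v => p.map (f v))
  smooth_lift : ∀ {n : ℕ} {x y : Euc n → A} {f : ∀ v, x v ⟶ y v}, IsPlot x → IsPlot y →
    SmoothArr (fun v => p.map (f v)) → SmoothArr f

lemma map_groupoid_inv (p : A ⥤ X) {a b : A} (f : a ⟶ b) :
    p.map (Groupoid.inv f) = Groupoid.inv (p.map f) := by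
  simp

/-- Sources and targets of smooth families of arrows are smooth. -/
def HasSmoothEnds (X : Type) [Groupoid.{0} X] [SmoothStr X] : Prop :=
  ∀ {n : ℕ} {x y : Euc n → X} {f : ∀ v, x v ⟶ y v}, SmoothArr f → IsPlot x ∧ IsPlot y

lemma IsLieGroupoid.hasSmoothEnds (h : IsLieGroupoid X) : HasSmoothEnds X :=
  fun hf => ⟨h.isPlot_source hf, h.isPlot_target hf⟩

lemma HasSmoothEnds.prod (hX : HasSmoothEnds X) (hY : HasSmoothEnds Y) : HasSmoothEnds (X × Y) :=
  fun hf => ⟨(hX (isPlot_prod.1 hf).1).1.prodMk (hY (isPlot_prod.1 hf).2).1,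
    (hX (isPlot_prod.1 hf).1).2.prodMk (hY (isPlot_prod.1 hf).2).2⟩

lemma hasSmoothEnds_pt : HasSmoothEnds Pt := fun _ => ⟨isPlot_top, isPlot_top⟩

namespace IsSmoothCover

lemma refl : IsSmoothCover (𝟭 A) where
  submersion := ⟨fun _ _ hp => hp, fun n c v b hc hb => ⟨c, hc, hb.symm, by simp⟩⟩
  surj a := ⟨a, rfl⟩
  bij a b := Function.bijective_id
  smooth hf := hf
  smooth_lift _ _ hf := hf

variable {p : A ⥤ X} {q : B ⥤ Y}

lemma prod (hp : IsSmoothCover p) (hq : IsSmoothCover q) : IsSmoothCover (p.prod q) where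
  submersion := by
    refine ⟨fun n c hc => (hp.submersion.1 n _ (isPlot_prod.1 hc).1).prodMk
      (hq.submersion.1 n _ (isPlot_prod.1 hc).2), fun n c v b hc hb => ?_⟩
    obtain ⟨c₁, h₁, e₁, g₁⟩ := hp.submersion.2 n _ v b.1 (isPlot_prod.1 hc).1 (congrArg Prod.fst hb)
    obtain ⟨c₂, h₂, e₂, g₂⟩ := hq.submersion.2 n _ v b.2 (isPlot_prod.1 hc).2 (congrArg Prod.snd hb)
    refine ⟨_, h₁.prodMk h₂, Prod.ext e₁ e₂, ?_⟩
    filter_upwards [g₁, g₂] with w h h'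
    exact Prod.ext h h'
  surj x := by
    obtain ⟨a, ha⟩ := hp.surj x.1
    obtain ⟨b, hb⟩ := hq.surj x.2
    exact ⟨(a, b), Prod.ext ha hb⟩
  bij a b := (hp.bij a.1 b.1).prodMap (hq.bij a.2 b.2)
  smooth hf := isPlot_prod.2 ⟨hp.smooth (isPlot_prod.1 hf).1, hq.smooth (isPlot_prod.1 hf).2⟩
  smooth_lift hx hy hf := isPlot_prod.2
    ⟨hp.smooth_lift (isPlot_prod.1 hx).1 (isPlot_prod.1 hy).1 (isPlot_prod.1 hf).1,
      hq.smooth_lift (isPlot_prod.1 hx).2 (isPlot_prod.1 hy).2 (isPlot_prod.1 hf).2⟩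

variable (hp : IsSmoothCover p)
include hp

/-- Fullness applied to each member of a family. Smoothness of the chosen preimages comes separately
from `smooth_lift`. -/
lemma exists_map_eq {n : ℕ} {a b : Euc n → A} (f : ∀ v, p.obj (a v) ⟶ p.obj (b v)) :
    ∃ g : ∀ v, a v ⟶ b v, f = fun v => p.map (g v) := by
  choose g hg using fun v => (hp.bij (a v) (b v)).2 (f v)
  exact ⟨g, (funext hg).symm⟩

/-- Finitely many plots lift simultaneously, after retraction to a neighbourhood of a point. -/
lemma exists_lifts {k n : ℕ} (x : Fin k → Euc n → X) (hx : ∀ i, IsPlot (x i)) (v : Euc n) :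
    ∃ (σ : Euc n → Euc n) (a : Fin k → Euc n → A), ContDiff ℝ ∞ σ ∧ (∀ᶠ w in 𝓝 v, σ w = w) ∧
      (∀ i, IsPlot (a i)) ∧ ∀ i, (fun w => x i (σ w)) = fun w => p.obj (a i w) := by
  have h : ∀ i, ∃ a : Euc n → A, IsPlot a ∧ ∀ᶠ w in 𝓝 v, p.obj (a w) = x i w := fun i => by
    obtain ⟨b, hb⟩ := hp.surj (x i v)
    obtain ⟨a, ha, -, he⟩ := hp.submersion.2 n (x i) v b (hx i) hb
    exact ⟨a, ha, he⟩
  choose a ha he using h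
  obtain ⟨σ, hσ, hm, hs⟩ := exists_smooth_retract (Filter.eventually_all.2 he)
  exact ⟨σ, fun i w => a i (σ w), hσ, hs, fun i => isPlot_reparam (ha i) hσ,
    fun i => funext fun w => (hm w i).symm⟩

/-- Plots in the targets of two covers lift simultaneously. -/
lemma exists_lifts₂ (hq : IsSmoothCover q) {k l n : ℕ} (x : Fin k → Euc n → X)
    (hx : ∀ i, IsPlot (x i)) (y : Fin l → Euc n → Y) (hy : ∀ i, IsPlot (y i)) (v : Euc n) :
    ∃ (σ : Euc n → Euc n) (a : Fin k → Euc n → A) (b : Fin l → Euc n → B), ContDiff ℝ ∞ σ ∧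
      (∀ᶠ w in 𝓝 v, σ w = w) ∧ (∀ i, IsPlot (a i)) ∧ (∀ i, IsPlot (b i)) ∧
      (∀ i, (fun w => x i (σ w)) = fun w => p.obj (a i w)) ∧
      ∀ i, (fun w => y i (σ w)) = fun w => q.obj (b i w) := by
  obtain ⟨σ, a, hσ, hs, ha, hxa⟩ := hp.exists_lifts x hx v
  obtain ⟨τ, b, hτ, ht, hb, hyb⟩ := hq.exists_lifts (fun i w => y i (σ w))
    (fun i => isPlot_reparam (hy i) hσ) v
  refine ⟨σ ∘ τ, fun i w => a i (τ w), b, hσ.comp hτ, ?_, fun i => isPlot_reparam (ha i) hτ, hb,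
    fun i => funext fun w => congrFun (hxa i) (τ w), hyb⟩
  -- Since τ fixes v and is continuous, it maps points near v to where σ is the identity.
  have : ∀ᶠ w in 𝓝 v, σ (τ w) = τ w := by
    have h := hτ.continuous.continuousAt (x := v)
    rw [ContinuousAt, ht.self_of_nhds] at h
    exact h.eventually hs
  filter_upwards [this, ht] with w h h'
  rw [Function.comp, h, h']

end IsSmoothCover

/-- A bibundle `E` together with an identification of its pullback along covers with `D`. -/
structure BibCover (p : A ⥤ X) (q : B ⥤ Y) (D : Bibundle A B) (E : Bibundle X Y) where
  θ : ∀ {a : A} {b : B}, D.Fib a b → E.Fib (p.obj a) (q.obj b)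
  bij : ∀ (a : A) (b : B), Function.Bijective (θ (a := a) (b := b))
  act : ∀ {a a' : A} {b b' : B} (f : a' ⟶ a) (c : D.Fib a b) (g : b ⟶ b'),
    θ (D.act f c g) = E.act (p.map f) (θ c) (q.map g)
  smooth : ∀ {n : ℕ} {x : Euc n → A} {y : Euc n → B} {c : ∀ v, D.Fib (x v) (y v)},
    D.SmoothFam c → E.SmoothFam (fun v => θ (c v))
  smooth_lift : ∀ {n : ℕ} {x : Euc n → A} {y : Euc n → B} {c : ∀ v, D.Fib (x v) (y v)},
    IsPlot x → IsPlot y → E.SmoothFam (fun v => θ (c v)) → D.SmoothFam c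
  plots : ∀ {n : ℕ} {x : Euc n → X} {y : Euc n → Y} {c : ∀ v, E.Fib (x v) (y v)},
    E.SmoothFam c → IsPlot x ∧ IsPlot y

namespace BibCover

variable {p : A ⥤ X} {q : B ⥤ Y} {D : Bibundle A B} {E : Bibundle X Y}

/-- The identity cover of a bibundle. -/
def refl (hD : D.IsRightPrincipal) : BibCover (𝟭 A) (𝟭 B) D D where
  θ c := c
  bij _ _ := Function.bijective_id
  act _ _ _ := rfl
  smooth hc := hc
  smooth_lift _ _ hc := hc
  plots hc := ⟨hD.left_submersion.1 _ _ hc, hD.right_smooth _ _ hc⟩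

variable (C : BibCover p q D E)

lemma exists_θ_eq {n : ℕ} {a : Euc n → A} {b : Euc n → B} (c : ∀ v, E.Fib (p.obj (a v)) (q.obj (b v))) :
    ∃ d : ∀ v, D.Fib (a v) (b v), c = fun v => C.θ (d v) := by
  choose g hg using fun v => (C.bij (a v) (b v)).2 (c v)
  exact ⟨g, (funext hg).symm⟩

/-- The map of total spaces. -/
def total (b : D.Total) : E.Total := ⟨p.obj b.1, q.obj b.2.1, C.θ b.2.2⟩

lemma total_surjective (hp : IsSmoothCover p) (hq : IsSmoothCover q) :
    Function.Surjective C.total := by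
  rintro ⟨x, y, c⟩
  obtain ⟨a, rfl⟩ := hp.surj x
  obtain ⟨b, rfl⟩ := hq.surj y
  obtain ⟨d, rfl⟩ := (C.bij a b).2 c
  exact ⟨⟨a, b, d⟩, rfl⟩

include C

/-- Pointwise axioms transfer because p, q and θ are surjective, with uniqueness from injectivity.
The smoothness axioms are local in the parameter, so the families of objects are lifted near each
point, the axiom is applied upstairs, and the result is pushed down again. -/
theorem isRightPrincipal (hp : IsSmoothCover p) (hq : IsSmoothCover q) (hX : HasSmoothEnds X)
    (hY : HasSmoothEnds Y) (hD : D.IsRightPrincipal) : E.IsRightPrincipal where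
  act_id {x y} c := by
    obtain ⟨a, rfl⟩ := hp.surj x
    obtain ⟨b, rfl⟩ := hq.surj y
    obtain ⟨d, rfl⟩ := (C.bij a b).2 c
    rw [← p.map_id, ← q.map_id, ← C.act, hD.act_id]
  act_act {x x' x'' y y' y''} f' f c g g' := by
    obtain ⟨a, rfl⟩ := hp.surj x
    obtain ⟨a', rfl⟩ := hp.surj x'
    obtain ⟨a'', rfl⟩ := hp.surj x''
    obtain ⟨b, rfl⟩ := hq.surj y
    obtain ⟨b', rfl⟩ := hq.surj y'
    obtain ⟨b'', rfl⟩ := hq.surj y''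
    obtain ⟨d, rfl⟩ := (C.bij a b).2 c
    obtain ⟨f', rfl⟩ := (hp.bij _ _).2 f'
    obtain ⟨f, rfl⟩ := (hp.bij _ _).2 f
    obtain ⟨g', rfl⟩ := (hq.bij _ _).2 g'
    obtain ⟨g, rfl⟩ := (hq.bij _ _).2 g
    rw [← p.map_comp, ← q.map_comp, ← C.act, ← C.act, ← C.act, hD.act_act]
  act_smooth n x x' y y' f c g hf hc hg := by
    -- The objects downstairs are kept as variables together with equations to images of lifts, so
    -- that the dependent families can be rewritten by substitution once the lifts are known.
    have key : ∀ (a a' : Euc n → A) (b b' : Euc n → B) (x x' : Euc n → X) (y y' : Euc n → Y)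
        (f : ∀ v, x' v ⟶ x v) (c : ∀ v, E.Fib (x v) (y v)) (g : ∀ v, y v ⟶ y' v),
        IsPlot a → IsPlot a' → IsPlot b → IsPlot b' →
        x = (fun v => p.obj (a v)) → x' = (fun v => p.obj (a' v)) →
        y = (fun v => q.obj (b v)) → y' = (fun v => q.obj (b' v)) →
        SmoothArr f → E.SmoothFam c → SmoothArr g →
        E.SmoothFam (fun v => E.act (f v) (c v) (g v)) := by
      rintro a a' b b' _ _ _ _ f c g ha ha' hb hb' rfl rfl rfl rfl hf hc hg
      obtain ⟨f, rfl⟩ := hp.exists_map_eq f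
      obtain ⟨g, rfl⟩ := hq.exists_map_eq g
      obtain ⟨c, rfl⟩ := C.exists_θ_eq c
      simp only [← C.act]
      exact C.smooth (hD.act_smooth n a a' b b' f c g (hp.smooth_lift ha' ha hf)
        (C.smooth_lift ha hb hc) (hq.smooth_lift hb hb' hg))
    refine isPlot_of_local fun v => ?_
    obtain ⟨σ, a, b, hσ, hs, ha, hb, hxa, hyb⟩ := hp.exists_lifts₂ hq ![x, x']
      (Fin.forall_fin_two.2 (hX hf).symm) ![y, y'] (Fin.forall_fin_two.2 (hY hg)) v
    exact ⟨σ, hs, key (a 0) (a 1) (b 0) (b 1) _ _ _ _ _ _ _ (ha 0) (ha 1) (hb 0) (hb 1) (hxa 0)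
      (hxa 1) (hyb 0) (hyb 1) (hf.reparam hσ) (hc.reparam hσ) (hg.reparam hσ)⟩
  left_submersion := by
    refine ⟨fun n c hc => (C.plots hc).1, fun n c v b hc hb => ?_⟩
    obtain ⟨d, rfl⟩ := C.total_surjective hp hq b
    obtain ⟨σ, c', hσ, hs, hc', hv, he⟩ := hp.submersion.exists_lift hc v d.1 hb
    obtain ⟨b', h1, h2, h3⟩ := hD.left_submersion.2 n c' v d hc' hv.symm
    refine ⟨fun w => C.total (b' w), C.smooth h1, congrArg C.total h2, ?_⟩
    filter_upwards [h3, hs] with w h h'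
    exact (congrArg p.obj h).trans ((he w).trans (congrArg c h'))
  left_surjective x := by
    obtain ⟨a, rfl⟩ := hp.surj x
    obtain ⟨b, ⟨d⟩⟩ := hD.left_surjective a
    exact ⟨_, ⟨C.θ d⟩⟩
  right_smooth n c hc := (C.plots hc).2
  division {x y y'} c c' := by
    obtain ⟨a, rfl⟩ := hp.surj x
    obtain ⟨b, rfl⟩ := hq.surj y
    obtain ⟨b', rfl⟩ := hq.surj y'
    obtain ⟨d, rfl⟩ := (C.bij a b).2 c
    obtain ⟨d', rfl⟩ := (C.bij a b').2 c'
    obtain ⟨g, hg, hu⟩ := hD.division d d'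
    refine ⟨q.map g, ?_, fun g' hg' => ?_⟩
    · change E.act _ _ _ = _
      rw [← p.map_id, ← C.act, hg]
    · obtain ⟨g', rfl⟩ := (hq.bij _ _).2 g'
      change E.act _ _ _ = _ at hg'
      rw [← p.map_id, ← C.act] at hg'
      rw [hu g' ((C.bij _ _).1 hg')]
  division_smooth n x y y' c g hc hg := by
    have key : ∀ (a : Euc n → A) (b b' : Euc n → B) (x : Euc n → X) (y y' : Euc n → Y)
        (c : ∀ v, E.Fib (x v) (y v)) (g : ∀ v, y v ⟶ y' v), IsPlot a → IsPlot b → IsPlot b' →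
        x = (fun v => p.obj (a v)) → y = (fun v => q.obj (b v)) → y' = (fun v => q.obj (b' v)) →
        E.SmoothFam c → E.SmoothFam (fun v => E.act (𝟙 (x v)) (c v) (g v)) → SmoothArr g := by
      rintro a b b' _ _ _ c g ha hb hb' rfl rfl rfl hc hg
      obtain ⟨g, rfl⟩ := hq.exists_map_eq g
      obtain ⟨c, rfl⟩ := C.exists_θ_eq c
      simp only [← p.map_id, ← C.act] at hg
      exact hq.smooth (hD.division_smooth n a b b' c g (C.smooth_lift ha hb hc)
        (C.smooth_lift ha hb' hg))
    refine isPlot_of_local fun v => ?_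
    obtain ⟨σ, a, b, hσ, hs, ha, hb, hxa, hyb⟩ := hp.exists_lifts₂ hq ![x]
      (Fin.forall_fin_one.2 (C.plots hc).1) ![y, y']
      (Fin.forall_fin_two.2 ⟨(C.plots hc).2, (C.plots hg).2⟩) v
    exact ⟨σ, hs, key (a 0) (b 0) (b 1) _ _ _ _ _ (ha 0) (hb 0) (hb 1) (hxa 0)
      (hyb 0) (hyb 1) (hc.reparam hσ) (hg.reparam hσ)⟩

/-- The mirror image of right principality. The restriction on the right anchor is pulled back to a
preimage, which a lift of a family in S automatically respects. -/
theorem isLeftPrincipalOver (hp : IsSmoothCover p) (hq : IsSmoothCover q) {S : Set Y}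
    (hD : D.IsLeftPrincipalOver (q.obj ⁻¹' S)) : E.IsLeftPrincipalOver S where
  right_mem {x y} c := by
    obtain ⟨a, rfl⟩ := hp.surj x
    obtain ⟨b, rfl⟩ := hq.surj y
    obtain ⟨d, rfl⟩ := (C.bij a b).2 c
    exact hD.right_mem d
  right_surjective y hy := by
    obtain ⟨b, rfl⟩ := hq.surj y
    obtain ⟨a, ⟨d⟩⟩ := hD.right_surjective b hy
    exact ⟨_, ⟨C.θ d⟩⟩
  right_submersion n c v b hc hS hb := by
    obtain ⟨d, rfl⟩ := C.total_surjective hp hq b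
    obtain ⟨σ, c', hσ, hs, hc', hv, he⟩ := hq.submersion.exists_lift hc v d.2.1 hb
    obtain ⟨b', h1, h2, h3⟩ := hD.right_submersion n c' v d hc'
      (fun w => by rw [Set.mem_preimage, he]; exact hS _) hv.symm
    refine ⟨fun w => C.total (b' w), C.smooth h1, congrArg C.total h2, ?_⟩
    filter_upwards [h3, hs] with w h h'
    exact (congrArg q.obj h).trans ((he w).trans (congrArg c h'))
  division {x x' y} c c' := by
    obtain ⟨a, rfl⟩ := hp.surj x
    obtain ⟨a', rfl⟩ := hp.surj x'
    obtain ⟨b, rfl⟩ := hq.surj y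
    obtain ⟨d, rfl⟩ := (C.bij a b).2 c
    obtain ⟨d', rfl⟩ := (C.bij a' b).2 c'
    obtain ⟨g, hg, hu⟩ := hD.division d d'
    refine ⟨p.map g, ?_, fun g' hg' => ?_⟩
    · change E.act _ _ _ = _
      rw [← q.map_id, ← C.act, hg]
    · obtain ⟨g', rfl⟩ := (hp.bij _ _).2 g'
      change E.act _ _ _ = _ at hg'
      rw [← q.map_id, ← C.act] at hg'
      rw [hu g' ((C.bij _ _).1 hg')]
  division_smooth n x x' y c f hc hf := by
    have key : ∀ (a a' : Euc n → A) (b : Euc n → B) (x x' : Euc n → X) (y : Euc n → Y)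
        (c : ∀ v, E.Fib (x' v) (y v)) (f : ∀ v, x v ⟶ x' v), IsPlot a → IsPlot a' → IsPlot b →
        x = (fun v => p.obj (a v)) → x' = (fun v => p.obj (a' v)) → y = (fun v => q.obj (b v)) →
        E.SmoothFam c → E.SmoothFam (fun v => E.act (f v) (c v) (𝟙 (y v))) → SmoothArr f := by
      rintro a a' b _ _ _ c f ha ha' hb rfl rfl rfl hc hf
      obtain ⟨f, rfl⟩ := hp.exists_map_eq f
      obtain ⟨c, rfl⟩ := C.exists_θ_eq c
      simp only [← q.map_id, ← C.act] at hf
      exact hp.smooth (hD.division_smooth n a a' b c f (C.smooth_lift ha' hb hc)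
        (C.smooth_lift ha hb hf))
    refine isPlot_of_local fun v => ?_
    obtain ⟨σ, a, b, hσ, hs, ha, hb, hxa, hyb⟩ := hp.exists_lifts₂ hq ![x, x']
      (Fin.forall_fin_two.2 ⟨(C.plots hf).1, (C.plots hc).1⟩) ![y]
      (Fin.forall_fin_one.2 (C.plots hc).2) v
    exact ⟨σ, hs, key (a 0) (a 1) (b 0) _ _ _ _ _ (ha 0) (ha 1) (hb 0) (hxa 0)
      (hxa 1) (hyb 0) (hc.reparam hσ) (hf.reparam hσ)⟩

lemma isInvertible (hp : IsSmoothCover p) (hq : IsSmoothCover q) (hD : D.IsInvertible) :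
    E.IsInvertible := C.isLeftPrincipalOver hp hq hD

end BibCover

end Covers


/-! ### Covers of 2-groups -/

section TwoGroupCovers

variable {A X : Type} [Groupoid.{0} A] [SmoothStr A] [Groupoid.{0} X] [SmoothStr X]

/-- An identification of the pullback of the 2-group `H` along a cover with `G`. -/
structure TwoGroupCover (p : A ⥤ X) (G : TwoGroupData A) (H : TwoGroupData X) where
  mulCover : BibCover (p.prod p) p G.mul H.mul
  unitCover : BibCover (𝟭 Pt) p G.unit H.unit
  assoc : ∀ {x y w u s v : A} (a : G.mul.Fib (x, y) u) (b : G.mul.Fib (u, w) v)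
    (c : G.mul.Fib (y, w) s) (d : G.mul.Fib (x, s) v), G.assoc a b c d ↔
      H.assoc (x := p.obj x) (y := p.obj y) (w := p.obj w) (mulCover.θ a) (mulCover.θ b)
        (mulCover.θ c) (mulCover.θ d)
  lunit : ∀ {i x y : A} (e : G.unit.Fib pt i) (a : G.mul.Fib (i, x) y) (f : x ⟶ y),
    G.lunit e a f ↔ H.lunit (x := p.obj x) (unitCover.θ e) (mulCover.θ a) (p.map f)
  runit : ∀ {i x y : A} (e : G.unit.Fib pt i) (a : G.mul.Fib (x, i) y) (f : x ⟶ y),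
    G.runit e a f ↔ H.runit (x := p.obj x) (unitCover.θ e) (mulCover.θ a) (p.map f)

namespace TwoGroupCover

variable {p : A ⥤ X} {G : TwoGroupData A} {H : TwoGroupData X}

/-- The identity cover of a 2-group. -/
def refl (hG : G.IsLieTwoGroup) : TwoGroupCover (𝟭 A) G G where
  mulCover := BibCover.refl hG.mul_bibundle
  unitCover := BibCover.refl hG.unit_bibundle
  assoc _ _ _ _ := Iff.rfl
  lunit _ _ _ := Iff.rfl
  runit _ _ _ := Iff.rfl

variable (C : TwoGroupCover p G H)

/-- The map on elements of the multiplication. -/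
def m {x y z : A} (a : G.mul.Fib (x, y) z) : H.mul.Fib (p.obj x, p.obj y) (p.obj z) :=
  C.mulCover.θ a

/-- The map on elements of the unit. -/
def u {i : A} (e : G.unit.Fib pt i) : H.unit.Fib pt (p.obj i) := C.unitCover.θ e

lemma m_bij (x y z : A) : Function.Bijective (C.m (x := x) (y := y) (z := z)) :=
  C.mulCover.bij (x, y) z

lemma u_bij (i : A) : Function.Bijective (C.u (i := i)) := C.unitCover.bij pt i

lemma m_surj {x y z : A} (a : H.mul.Fib (p.obj x, p.obj y) (p.obj z)) : ∃ b, C.m b = a :=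
  (C.m_bij x y z).2 a

lemma u_surj {i : A} (a : H.unit.Fib pt (p.obj i)) : ∃ b, C.u b = a := (C.u_bij i).2 a

lemma m_act {x y z x' y' z' : A} (f : x' ⟶ x) (g : y' ⟶ y) (a : G.mul.Fib (x, y) z) (k : z ⟶ z') :
    C.m (G.mul.act (x' := (x', y')) (f, g) a k) =
      H.mul.act (x' := (p.obj x', p.obj y')) (p.map f, p.map g) (C.m a) (p.map k) :=
  C.mulCover.act (a := (x, y)) (a' := (x', y')) (f, g) a k

lemma u_act {i i' : A} (e : G.unit.Fib pt i) (k : i ⟶ i') :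
    C.u (G.unit.act (𝟙 pt) e k) = H.unit.act (𝟙 pt) (C.u e) (p.map k) :=
  C.unitCover.act (𝟙 pt) e k

lemma assoc_iff {x y w u s v : A} {a : G.mul.Fib (x, y) u} {b : G.mul.Fib (u, w) v}
    {c : G.mul.Fib (y, w) s} {d : G.mul.Fib (x, s) v} :
    H.assoc (C.m a) (C.m b) (C.m c) (C.m d) ↔ G.assoc a b c d := (C.assoc a b c d).symm

lemma lunit_iff {i x y : A} {e : G.unit.Fib pt i} {a : G.mul.Fib (i, x) y} {f : x ⟶ y} :
    H.lunit (C.u e) (C.m a) (p.map f) ↔ G.lunit e a f := (C.lunit e a f).symm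

lemma runit_iff {i x y : A} {e : G.unit.Fib pt i} {a : G.mul.Fib (x, i) y} {f : x ⟶ y} :
    H.runit (C.u e) (C.m a) (p.map f) ↔ G.runit e a f := (C.runit e a f).symm

lemma exists_m_eq {n : ℕ} {x y z : Euc n → A}
    (c : ∀ v, H.mul.Fib (p.obj (x v), p.obj (y v)) (p.obj (z v))) :
    ∃ d : ∀ v, G.mul.Fib (x v, y v) (z v), c = fun v => C.m (d v) :=
  C.mulCover.exists_θ_eq (a := fun v => (x v, y v)) c

lemma exists_u_eq {n : ℕ} {z : Euc n → A} (c : ∀ v, H.unit.Fib pt (p.obj (z v))) :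
    ∃ d : ∀ v, G.unit.Fib pt (z v), c = fun v => C.u (d v) :=
  C.unitCover.exists_θ_eq (a := fun _ => pt) c

lemma m_smooth {n : ℕ} {x y z : Euc n → A} {d : ∀ v, G.mul.Fib (x v, y v) (z v)}
    (hd : G.mul.SmoothFam (x := fun v => (x v, y v)) d) :
    H.mul.SmoothFam (x := fun v => (p.obj (x v), p.obj (y v))) (fun v => C.m (d v)) :=
  C.mulCover.smooth hd

lemma m_smooth_lift {n : ℕ} {x y z : Euc n → A} {d : ∀ v, G.mul.Fib (x v, y v) (z v)}
    (hx : IsPlot x) (hy : IsPlot y) (hz : IsPlot z)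
    (hd : H.mul.SmoothFam (x := fun v => (p.obj (x v), p.obj (y v))) (fun v => C.m (d v))) :
    G.mul.SmoothFam (x := fun v => (x v, y v)) d :=
  C.mulCover.smooth_lift (hx.prodMk hy) hz hd

lemma u_smooth {n : ℕ} {z : Euc n → A} {d : ∀ v, G.unit.Fib pt (z v)}
    (hd : G.unit.SmoothFam (x := fun _ => pt) d) :
    H.unit.SmoothFam (x := fun _ => pt) (fun v => C.u (d v)) := C.unitCover.smooth hd

lemma u_smooth_lift {n : ℕ} {z : Euc n → A} {d : ∀ v, G.unit.Fib pt (z v)} (hz : IsPlot z)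
    (hd : H.unit.SmoothFam (x := fun _ => pt) (fun v => C.u (d v))) :
    G.unit.SmoothFam (x := fun _ => pt) d := C.unitCover.smooth_lift isPlot_top hz hd

include C

lemma mul_plots {n : ℕ} {x y z : Euc n → X} {c : ∀ v, H.mul.Fib (x v, y v) (z v)}
    (hc : H.mul.SmoothFam (x := fun v => (x v, y v)) c) : IsPlot x ∧ IsPlot y ∧ IsPlot z :=
  have h := C.mulCover.plots hc
  ⟨(isPlot_prod.1 h.1).1, (isPlot_prod.1 h.1).2, h.2⟩

/-- The cover of the shear map. -/
def shearCover (hp : IsSmoothCover p) (hX : HasSmoothEnds X) :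
    BibCover (p.prod p) (p.prod p) G.shear H.shear where
  θ b := (p.map b.1, C.mulCover.θ b.2)
  bij a b := (hp.bij _ _).prodMap (C.mulCover.bij a b.2)
  act f b g := by
    refine Prod.ext ?_ (C.mulCover.act f b.2 g.2)
    change p.map (f.1 ≫ b.1 ≫ g.1) = p.map f.1 ≫ p.map b.1 ≫ p.map g.1
    simp
  smooth hc := isPlot_prod.2 ⟨hp.smooth (isPlot_prod.1 hc).1, C.mulCover.smooth (isPlot_prod.1 hc).2⟩
  smooth_lift hx hy hc := isPlot_prod.2
    ⟨hp.smooth_lift (isPlot_prod.1 hx).1 (isPlot_prod.1 hy).1 (isPlot_prod.1 hc).1,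
      C.mulCover.smooth_lift hx (isPlot_prod.1 hy).2 (isPlot_prod.1 hc).2⟩
  plots {n x y c} hc := by
    have h := C.mulCover.plots (isPlot_prod.1 hc).2
    have h' : IsPlot (fun v => (x v).1) ∧ IsPlot (fun v => (y v).1) := hX (isPlot_prod.1 hc).1
    exact ⟨h.1, h'.2.prodMk h.2⟩

/-- Lie 2-groups descend along covers. -/
theorem isLieTwoGroup (hp : IsSmoothCover p) (hG : G.IsLieTwoGroup) (hX : IsLieGroupoid X) :
    H.IsLieTwoGroup where
  lie := hX
  mul_bibundle := C.mulCover.isRightPrincipal (hp.prod hp) hp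
    (HasSmoothEnds.prod hX.hasSmoothEnds hX.hasSmoothEnds) hX.hasSmoothEnds hG.mul_bibundle
  unit_bibundle := C.unitCover.isRightPrincipal .refl hp hasSmoothEnds_pt hX.hasSmoothEnds
    hG.unit_bibundle
  assoc_existsUnique {x y w u s v} a b c := by
    obtain ⟨x, rfl⟩ := hp.surj x
    obtain ⟨y, rfl⟩ := hp.surj y
    obtain ⟨w, rfl⟩ := hp.surj w
    obtain ⟨u, rfl⟩ := hp.surj u
    obtain ⟨s, rfl⟩ := hp.surj s
    obtain ⟨v, rfl⟩ := hp.surj v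
    obtain ⟨a, rfl⟩ := C.m_surj a
    obtain ⟨b, rfl⟩ := C.m_surj b
    obtain ⟨c, rfl⟩ := C.m_surj c
    obtain ⟨d, hd, hu⟩ := hG.assoc_existsUnique a b c
    refine ⟨C.m d, C.assoc_iff.2 hd, fun d' hd' => ?_⟩
    obtain ⟨d', rfl⟩ := C.m_surj d'
    rw [hu d' (C.assoc_iff.1 hd')]
  assoc_equivariant {x y w u s v x' y' w' u' s' v'} a b c d f g h k l m hrel := by
    obtain ⟨x, rfl⟩ := hp.surj x
    obtain ⟨y, rfl⟩ := hp.surj y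
    obtain ⟨w, rfl⟩ := hp.surj w
    obtain ⟨u, rfl⟩ := hp.surj u
    obtain ⟨s, rfl⟩ := hp.surj s
    obtain ⟨v, rfl⟩ := hp.surj v
    obtain ⟨x', rfl⟩ := hp.surj x'
    obtain ⟨y', rfl⟩ := hp.surj y'
    obtain ⟨w', rfl⟩ := hp.surj w'
    obtain ⟨u', rfl⟩ := hp.surj u'
    obtain ⟨s', rfl⟩ := hp.surj s'
    obtain ⟨v', rfl⟩ := hp.surj v'
    obtain ⟨a, rfl⟩ := C.m_surj a
    obtain ⟨b, rfl⟩ := C.m_surj b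
    obtain ⟨c, rfl⟩ := C.m_surj c
    obtain ⟨d, rfl⟩ := C.m_surj d
    obtain ⟨f, rfl⟩ := (hp.bij _ _).2 f
    obtain ⟨g, rfl⟩ := (hp.bij _ _).2 g
    obtain ⟨h, rfl⟩ := (hp.bij _ _).2 h
    obtain ⟨k, rfl⟩ := (hp.bij _ _).2 k
    obtain ⟨l, rfl⟩ := (hp.bij _ _).2 l
    obtain ⟨m, rfl⟩ := (hp.bij _ _).2 m
    rw [← map_groupoid_inv, ← map_groupoid_inv, ← C.m_act, ← C.m_act, ← C.m_act, ← C.m_act,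
      C.assoc_iff]
    exact hG.assoc_equivariant a b c d f g h k l m (C.assoc_iff.1 hrel)
  assoc_smooth n x y w u s v a b c d hrel ha hb hc := by
    have key : ∀ (x₁ y₁ w₁ u₁ s₁ v₁ : Euc n → A) (x y w u s v : Euc n → X)
        (a : ∀ t, H.mul.Fib (x t, y t) (u t)) (b : ∀ t, H.mul.Fib (u t, w t) (v t))
        (c : ∀ t, H.mul.Fib (y t, w t) (s t)) (d : ∀ t, H.mul.Fib (x t, s t) (v t)),
        IsPlot x₁ → IsPlot y₁ → IsPlot w₁ → IsPlot u₁ → IsPlot s₁ → IsPlot v₁ →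
        x = (fun t => p.obj (x₁ t)) → y = (fun t => p.obj (y₁ t)) → w = (fun t => p.obj (w₁ t)) →
        u = (fun t => p.obj (u₁ t)) → s = (fun t => p.obj (s₁ t)) → v = (fun t => p.obj (v₁ t)) →
        (∀ t, H.assoc (a t) (b t) (c t) (d t)) → H.mul.SmoothFam (x := fun t => (x t, y t)) a →
        H.mul.SmoothFam (x := fun t => (u t, w t)) b →
        H.mul.SmoothFam (x := fun t => (y t, w t)) c →
        H.mul.SmoothFam (x := fun t => (x t, s t)) d := by
      rintro x y w u s v _ _ _ _ _ _ a b c d hx hy hw hu hs hv rfl rfl rfl rfl rfl rfl h ha hb hc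
      obtain ⟨a, rfl⟩ := C.exists_m_eq a
      obtain ⟨b, rfl⟩ := C.exists_m_eq b
      obtain ⟨c, rfl⟩ := C.exists_m_eq c
      obtain ⟨d, rfl⟩ := C.exists_m_eq d
      exact C.m_smooth (hG.assoc_smooth n x y w u s v a b c d (fun t => C.assoc_iff.1 (h t))
        (C.m_smooth_lift hx hy hu ha) (C.m_smooth_lift hu hw hv hb) (C.m_smooth_lift hy hw hs hc))
    refine isPlot_of_local fun t => ?_
    obtain ⟨hx, hy, hu⟩ := C.mul_plots ha
    obtain ⟨-, hw, hv⟩ := C.mul_plots hb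
    obtain ⟨-, -, hs⟩ := C.mul_plots hc
    -- All six families of objects must be lifted over one common retraction, since the elements a,
    -- b, c, d share them.
    obtain ⟨σ, z, hσ, ht, hz, hxz⟩ := hp.exists_lifts ![x, y, w, u, s, v]
      (by simp [Fin.forall_fin_succ, *]) t
    exact ⟨σ, ht, key (z 0) (z 1) (z 2) (z 3) (z 4) (z 5) _ _ _ _ _ _ _ _ _ _ (hz 0) (hz 1) (hz 2)
      (hz 3) (hz 4) (hz 5) (hxz 0) (hxz 1) (hxz 2) (hxz 3) (hxz 4) (hxz 5) (fun t => hrel (σ t))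
      (ha.reparam hσ) (hb.reparam hσ) (hc.reparam hσ)⟩
  lunit_existsUnique {i x y} e a := by
    obtain ⟨i, rfl⟩ := hp.surj i
    obtain ⟨x, rfl⟩ := hp.surj x
    obtain ⟨y, rfl⟩ := hp.surj y
    obtain ⟨e, rfl⟩ := C.u_surj e
    obtain ⟨a, rfl⟩ := C.m_surj a
    obtain ⟨f, hf, hu⟩ := hG.lunit_existsUnique e a
    refine ⟨p.map f, C.lunit_iff.2 hf, fun f' hf' => ?_⟩
    obtain ⟨f', rfl⟩ := (hp.bij _ _).2 f'
    rw [hu f' (C.lunit_iff.1 hf')]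
  lunit_equivariant {i x y i' x' y'} e a f k g h hrel := by
    obtain ⟨i, rfl⟩ := hp.surj i
    obtain ⟨x, rfl⟩ := hp.surj x
    obtain ⟨y, rfl⟩ := hp.surj y
    obtain ⟨i', rfl⟩ := hp.surj i'
    obtain ⟨x', rfl⟩ := hp.surj x'
    obtain ⟨y', rfl⟩ := hp.surj y'
    obtain ⟨e, rfl⟩ := C.u_surj e
    obtain ⟨a, rfl⟩ := C.m_surj a
    obtain ⟨f, rfl⟩ := (hp.bij _ _).2 f
    obtain ⟨k, rfl⟩ := (hp.bij _ _).2 k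
    obtain ⟨g, rfl⟩ := (hp.bij _ _).2 g
    obtain ⟨h, rfl⟩ := (hp.bij _ _).2 h
    rw [← map_groupoid_inv, ← C.m_act, ← C.u_act, ← p.map_comp, ← p.map_comp, C.lunit_iff]
    exact hG.lunit_equivariant e a f k g h (C.lunit_iff.1 hrel)
  lunit_smooth n i x y e a f hrel he ha := by
    have key : ∀ (i₁ x₁ y₁ : Euc n → A) (i x y : Euc n → X) (e : ∀ t, H.unit.Fib pt (i t))
        (a : ∀ t, H.mul.Fib (i t, x t) (y t)) (f : ∀ t, x t ⟶ y t),
        IsPlot i₁ → IsPlot x₁ → IsPlot y₁ → i = (fun t => p.obj (i₁ t)) →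
        x = (fun t => p.obj (x₁ t)) → y = (fun t => p.obj (y₁ t)) →
        (∀ t, H.lunit (e t) (a t) (f t)) → H.unit.SmoothFam (x := fun _ => pt) e →
        H.mul.SmoothFam (x := fun t => (i t, x t)) a → SmoothArr f := by
      rintro i x y _ _ _ e a f hi hx hy rfl rfl rfl h he ha
      obtain ⟨e, rfl⟩ := C.exists_u_eq e
      obtain ⟨a, rfl⟩ := C.exists_m_eq a
      obtain ⟨f, rfl⟩ := hp.exists_map_eq f
      exact hp.smooth (hG.lunit_smooth n i x y e a f (fun t => C.lunit_iff.1 (h t))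
        (C.u_smooth_lift hi he) (C.m_smooth_lift hi hx hy ha))
    refine isPlot_of_local fun t => ?_
    obtain ⟨hi, hx, hy⟩ := C.mul_plots ha
    obtain ⟨σ, z, hσ, ht, hz, hxz⟩ := hp.exists_lifts ![i, x, y]
      (by simp [Fin.forall_fin_succ, *]) t
    exact ⟨σ, ht, key (z 0) (z 1) (z 2) _ _ _ _ _ _ (hz 0) (hz 1) (hz 2) (hxz 0) (hxz 1) (hxz 2)
      (fun t => hrel (σ t)) (he.reparam hσ) (ha.reparam hσ)⟩
  runit_existsUnique {i x y} e a := by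
    obtain ⟨i, rfl⟩ := hp.surj i
    obtain ⟨x, rfl⟩ := hp.surj x
    obtain ⟨y, rfl⟩ := hp.surj y
    obtain ⟨e, rfl⟩ := C.u_surj e
    obtain ⟨a, rfl⟩ := C.m_surj a
    obtain ⟨f, hf, hu⟩ := hG.runit_existsUnique e a
    refine ⟨p.map f, C.runit_iff.2 hf, fun f' hf' => ?_⟩
    obtain ⟨f', rfl⟩ := (hp.bij _ _).2 f'
    rw [hu f' (C.runit_iff.1 hf')]
  runit_equivariant {i x y i' x' y'} e a f k g h hrel := by
    obtain ⟨i, rfl⟩ := hp.surj i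
    obtain ⟨x, rfl⟩ := hp.surj x
    obtain ⟨y, rfl⟩ := hp.surj y
    obtain ⟨i', rfl⟩ := hp.surj i'
    obtain ⟨x', rfl⟩ := hp.surj x'
    obtain ⟨y', rfl⟩ := hp.surj y'
    obtain ⟨e, rfl⟩ := C.u_surj e
    obtain ⟨a, rfl⟩ := C.m_surj a
    obtain ⟨f, rfl⟩ := (hp.bij _ _).2 f
    obtain ⟨k, rfl⟩ := (hp.bij _ _).2 k
    obtain ⟨g, rfl⟩ := (hp.bij _ _).2 g
    obtain ⟨h, rfl⟩ := (hp.bij _ _).2 h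
    rw [← map_groupoid_inv, ← C.m_act, ← C.u_act, ← p.map_comp, ← p.map_comp, C.runit_iff]
    exact hG.runit_equivariant e a f k g h (C.runit_iff.1 hrel)
  runit_smooth n i x y e a f hrel he ha := by
    have key : ∀ (i₁ x₁ y₁ : Euc n → A) (i x y : Euc n → X) (e : ∀ t, H.unit.Fib pt (i t))
        (a : ∀ t, H.mul.Fib (x t, i t) (y t)) (f : ∀ t, x t ⟶ y t),
        IsPlot i₁ → IsPlot x₁ → IsPlot y₁ → i = (fun t => p.obj (i₁ t)) →
        x = (fun t => p.obj (x₁ t)) → y = (fun t => p.obj (y₁ t)) →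
        (∀ t, H.runit (e t) (a t) (f t)) → H.unit.SmoothFam (x := fun _ => pt) e →
        H.mul.SmoothFam (x := fun t => (x t, i t)) a → SmoothArr f := by
      rintro i x y _ _ _ e a f hi hx hy rfl rfl rfl h he ha
      obtain ⟨e, rfl⟩ := C.exists_u_eq e
      obtain ⟨a, rfl⟩ := C.exists_m_eq a
      obtain ⟨f, rfl⟩ := hp.exists_map_eq f
      exact hp.smooth (hG.runit_smooth n i x y e a f (fun t => C.runit_iff.1 (h t))
        (C.u_smooth_lift hi he) (C.m_smooth_lift hx hi hy ha))
    refine isPlot_of_local fun t => ?_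
    obtain ⟨hx, hi, hy⟩ := C.mul_plots ha
    obtain ⟨σ, z, hσ, ht, hz, hxz⟩ := hp.exists_lifts ![i, x, y]
      (by simp [Fin.forall_fin_succ, *]) t
    exact ⟨σ, ht, key (z 0) (z 1) (z 2) _ _ _ _ _ _ (hz 0) (hz 1) (hz 2) (hxz 0) (hxz 1) (hxz 2)
      (fun t => hrel (σ t)) (he.reparam hσ) (ha.reparam hσ)⟩
  pentagon {x y z w p₁ q r s g k} a b c d f h b₁ e a₁ e₁ e₂ h₁ h₂ h₃ h₄ h₅ := by
    obtain ⟨x, rfl⟩ := hp.surj x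
    obtain ⟨y, rfl⟩ := hp.surj y
    obtain ⟨z, rfl⟩ := hp.surj z
    obtain ⟨w, rfl⟩ := hp.surj w
    obtain ⟨p₁, rfl⟩ := hp.surj p₁
    obtain ⟨q, rfl⟩ := hp.surj q
    obtain ⟨r, rfl⟩ := hp.surj r
    obtain ⟨s, rfl⟩ := hp.surj s
    obtain ⟨g, rfl⟩ := hp.surj g
    obtain ⟨k, rfl⟩ := hp.surj k
    obtain ⟨a, rfl⟩ := C.m_surj a
    obtain ⟨b, rfl⟩ := C.m_surj b
    obtain ⟨c, rfl⟩ := C.m_surj c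
    obtain ⟨d, rfl⟩ := C.m_surj d
    obtain ⟨f, rfl⟩ := C.m_surj f
    obtain ⟨h, rfl⟩ := C.m_surj h
    obtain ⟨b₁, rfl⟩ := C.m_surj b₁
    obtain ⟨e, rfl⟩ := C.m_surj e
    obtain ⟨a₁, rfl⟩ := C.m_surj a₁
    obtain ⟨e₁, rfl⟩ := C.m_surj e₁
    obtain ⟨e₂, rfl⟩ := C.m_surj e₂
    rw [C.assoc_iff] at h₁ h₂ h₃ h₄ h₅
    rw [hG.pentagon a b c d f h b₁ e a₁ e₁ e₂ h₁ h₂ h₃ h₄ h₅]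
  triangle {i x y u v s} e a b c d f g h hr hl := by
    obtain ⟨i, rfl⟩ := hp.surj i
    obtain ⟨x, rfl⟩ := hp.surj x
    obtain ⟨y, rfl⟩ := hp.surj y
    obtain ⟨u, rfl⟩ := hp.surj u
    obtain ⟨v, rfl⟩ := hp.surj v
    obtain ⟨s, rfl⟩ := hp.surj s
    obtain ⟨e, rfl⟩ := C.u_surj e
    obtain ⟨a, rfl⟩ := C.m_surj a
    obtain ⟨b, rfl⟩ := C.m_surj b
    obtain ⟨c, rfl⟩ := C.m_surj c
    obtain ⟨d, rfl⟩ := C.m_surj d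
    obtain ⟨f, rfl⟩ := (hp.bij _ _).2 f
    obtain ⟨g, rfl⟩ := (hp.bij _ _).2 g
    rw [C.assoc_iff] at h
    rw [C.lunit_iff] at hl
    rw [C.runit_iff] at hr
    rw [← p.map_id, ← p.map_id, ← p.map_id, ← C.m_act, ← C.m_act,
      hG.triangle e a b c d f g h hr hl]
  invertible := (C.shearCover hp hX.hasSmoothEnds).isInvertible (hp.prod hp) (hp.prod hp)
    hG.invertible

end TwoGroupCover

end TwoGroupCovers


/-! ### Covers of 1-morphisms of 2-groups -/

section HomCovers

variable {A X B Y : Type} [Groupoid.{0} A] [SmoothStr A] [Groupoid.{0} X] [SmoothStr X]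
  [Groupoid.{0} B] [SmoothStr B] [Groupoid.{0} Y] [SmoothStr Y]
  {p : A ⥤ X} {q : B ⥤ Y} {G : TwoGroupData A} {H : TwoGroupData X} {G' : TwoGroupData B}
  {H' : TwoGroupData Y}

/-- An identification of the pullback of a 1-morphism `F` of 2-groups along covers with `F'`. -/
structure HomCover (C : TwoGroupCover p G H) (C' : TwoGroupCover q G' H') (F' : TwoGroupHom G G')
    (F : TwoGroupHom H H') where
  bib : BibCover p q F'.bib F.bib
  φ : ∀ {x y z : A} {x' y' z' : B} {a : G.mul.Fib (x, y) z} {r : F'.bib.Fib z z'}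
    {k : F'.bib.Fib x x'} {l : F'.bib.Fib y y'} {b : G'.mul.Fib (x', y') z'},
    F.φ (C.m a) (bib.θ r) (bib.θ k) (bib.θ l) (C'.m b) ↔ F'.φ a r k l b
  ε : ∀ {i : A} {i' : B} {e : G.unit.Fib pt i} {k : F'.bib.Fib i i'} {e' : G'.unit.Fib pt i'},
    F.ε (C.u e) (bib.θ k) (C'.u e') ↔ F'.ε e k e'

namespace HomCover

variable {C : TwoGroupCover p G H} {C' : TwoGroupCover q G' H'} {F' : TwoGroupHom G G'}
    {F : TwoGroupHom H H'} (D : HomCover C C' F' F)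

include D

lemma θ_surj {a : A} {b : B} (c : F.bib.Fib (p.obj a) (q.obj b)) : ∃ d, D.bib.θ d = c :=
  (D.bib.bij a b).2 c

/-- 1-morphisms of 2-groups descend along covers. -/
theorem isHom (hp : IsSmoothCover p) (hq : IsSmoothCover q) (hX : HasSmoothEnds X)
    (hY : HasSmoothEnds Y) (hF : F'.IsHom) : F.IsHom where
  bibundle := D.bib.isRightPrincipal hp hq hX hY hF.bibundle
  φ_existsUnique {x y z x' y' z'} a r k l := by
    obtain ⟨x, rfl⟩ := hp.surj x
    obtain ⟨y, rfl⟩ := hp.surj y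
    obtain ⟨z, rfl⟩ := hp.surj z
    obtain ⟨x', rfl⟩ := hq.surj x'
    obtain ⟨y', rfl⟩ := hq.surj y'
    obtain ⟨z', rfl⟩ := hq.surj z'
    obtain ⟨a, rfl⟩ := C.m_surj a
    obtain ⟨r, rfl⟩ := D.θ_surj r
    obtain ⟨k, rfl⟩ := D.θ_surj k
    obtain ⟨l, rfl⟩ := D.θ_surj l
    obtain ⟨b, hb, hu⟩ := hF.φ_existsUnique a r k l
    refine ⟨C'.m b, D.φ.2 hb, fun b' hb' => ?_⟩
    obtain ⟨b', rfl⟩ := C'.m_surj b'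
    rw [hu b' (D.φ.1 hb')]
  φ_equivariant {x y z x₁ y₁ z₁ x' y' z' x₁' y₁' z₁'} a r k l b f g h f' g' h' hrel := by
    obtain ⟨x, rfl⟩ := hp.surj x
    obtain ⟨y, rfl⟩ := hp.surj y
    obtain ⟨z, rfl⟩ := hp.surj z
    obtain ⟨x', rfl⟩ := hq.surj x'
    obtain ⟨y', rfl⟩ := hq.surj y'
    obtain ⟨z', rfl⟩ := hq.surj z'
    obtain ⟨x₁, rfl⟩ := hp.surj x₁
    obtain ⟨y₁, rfl⟩ := hp.surj y₁
    obtain ⟨z₁, rfl⟩ := hp.surj z₁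
    obtain ⟨x₁', rfl⟩ := hq.surj x₁'
    obtain ⟨y₁', rfl⟩ := hq.surj y₁'
    obtain ⟨z₁', rfl⟩ := hq.surj z₁'
    obtain ⟨a, rfl⟩ := C.m_surj a
    obtain ⟨r, rfl⟩ := D.θ_surj r
    obtain ⟨k, rfl⟩ := D.θ_surj k
    obtain ⟨l, rfl⟩ := D.θ_surj l
    obtain ⟨b, rfl⟩ := C'.m_surj b
    obtain ⟨f, rfl⟩ := (hp.bij _ _).2 f
    obtain ⟨g, rfl⟩ := (hp.bij _ _).2 g
    obtain ⟨h, rfl⟩ := (hp.bij _ _).2 h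
    obtain ⟨f', rfl⟩ := (hq.bij _ _).2 f'
    obtain ⟨g', rfl⟩ := (hq.bij _ _).2 g'
    obtain ⟨h', rfl⟩ := (hq.bij _ _).2 h'
    rw [← map_groupoid_inv, ← map_groupoid_inv, ← map_groupoid_inv, ← C.m_act, ← C'.m_act,
      ← D.bib.act, ← D.bib.act, ← D.bib.act, D.φ]
    exact hF.φ_equivariant a r k l b f g h f' g' h' (D.φ.1 hrel)
  φ_smooth n x y z x' y' z' a r k l b hrel ha hr hk hl := by
    have key : ∀ (x₁ y₁ z₁ : Euc n → A) (x₁' y₁' z₁' : Euc n → B) (x y z : Euc n → X)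
        (x' y' z' : Euc n → Y) (a : ∀ t, H.mul.Fib (x t, y t) (z t))
        (r : ∀ t, F.bib.Fib (z t) (z' t)) (k : ∀ t, F.bib.Fib (x t) (x' t))
        (l : ∀ t, F.bib.Fib (y t) (y' t)) (b : ∀ t, H'.mul.Fib (x' t, y' t) (z' t)),
        IsPlot x₁ → IsPlot y₁ → IsPlot z₁ → IsPlot x₁' → IsPlot y₁' → IsPlot z₁' →
        x = (fun t => p.obj (x₁ t)) → y = (fun t => p.obj (y₁ t)) → z = (fun t => p.obj (z₁ t)) →
        x' = (fun t => q.obj (x₁' t)) → y' = (fun t => q.obj (y₁' t)) →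
        z' = (fun t => q.obj (z₁' t)) → (∀ t, F.φ (a t) (r t) (k t) (l t) (b t)) →
        H.mul.SmoothFam (x := fun t => (x t, y t)) a → F.bib.SmoothFam r → F.bib.SmoothFam k →
        F.bib.SmoothFam l → H'.mul.SmoothFam (x := fun t => (x' t, y' t)) b := by
      rintro x y z x' y' z' _ _ _ _ _ _ a r k l b hx hy hz hx' hy' hz' rfl rfl rfl rfl rfl rfl
        h ha hr hk hl
      obtain ⟨a, rfl⟩ := C.exists_m_eq a
      obtain ⟨b, rfl⟩ := C'.exists_m_eq b
      obtain ⟨r, rfl⟩ := D.bib.exists_θ_eq r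
      obtain ⟨k, rfl⟩ := D.bib.exists_θ_eq k
      obtain ⟨l, rfl⟩ := D.bib.exists_θ_eq l
      exact C'.m_smooth (hF.φ_smooth n x y z x' y' z' a r k l b (fun t => D.φ.1 (h t))
        (C.m_smooth_lift hx hy hz ha) (D.bib.smooth_lift hz hz' hr) (D.bib.smooth_lift hx hx' hk)
        (D.bib.smooth_lift hy hy' hl))
    refine isPlot_of_local fun t => ?_
    obtain ⟨hz, hz'⟩ := D.bib.plots hr
    obtain ⟨hx, hx'⟩ := D.bib.plots hk
    obtain ⟨hy, hy'⟩ := D.bib.plots hl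
    obtain ⟨σ, u, v, hσ, ht, hu, hv, hxu, hyv⟩ := hp.exists_lifts₂ hq ![x, y, z]
      (by simp [Fin.forall_fin_succ, *]) ![x', y', z'] (by simp [Fin.forall_fin_succ, *]) t
    exact ⟨σ, ht, key (u 0) (u 1) (u 2) (v 0) (v 1) (v 2) _ _ _ _ _ _ _ _ _ _ _ (hu 0) (hu 1)
      (hu 2) (hv 0) (hv 1) (hv 2) (hxu 0) (hxu 1) (hxu 2) (hyv 0) (hyv 1) (hyv 2)
      (fun t => hrel (σ t)) (ha.reparam hσ) (hr.reparam hσ) (hk.reparam hσ) (hl.reparam hσ)⟩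
  ε_existsUnique {i i'} e k := by
    obtain ⟨i, rfl⟩ := hp.surj i
    obtain ⟨i', rfl⟩ := hq.surj i'
    obtain ⟨e, rfl⟩ := C.u_surj e
    obtain ⟨k, rfl⟩ := D.θ_surj k
    obtain ⟨b, hb, hu⟩ := hF.ε_existsUnique e k
    refine ⟨C'.u b, D.ε.2 hb, fun b' hb' => ?_⟩
    obtain ⟨b', rfl⟩ := C'.u_surj b'
    rw [hu b' (D.ε.1 hb')]
  ε_equivariant {i i₁ i' i₁'} e k e' h h' hrel := by
    obtain ⟨i, rfl⟩ := hp.surj i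
    obtain ⟨i', rfl⟩ := hq.surj i'
    obtain ⟨i₁, rfl⟩ := hp.surj i₁
    obtain ⟨i₁', rfl⟩ := hq.surj i₁'
    obtain ⟨e, rfl⟩ := C.u_surj e
    obtain ⟨e', rfl⟩ := C'.u_surj e'
    obtain ⟨k, rfl⟩ := D.θ_surj k
    obtain ⟨h, rfl⟩ := (hp.bij _ _).2 h
    obtain ⟨h', rfl⟩ := (hq.bij _ _).2 h'
    rw [← map_groupoid_inv, ← C.u_act, ← C'.u_act, ← D.bib.act, D.ε]
    exact hF.ε_equivariant e k e' h h' (D.ε.1 hrel)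
  ε_smooth n i i' e k e' hrel he hk := by
    have key : ∀ (i₁ : Euc n → A) (i₁' : Euc n → B) (i : Euc n → X) (i' : Euc n → Y)
        (e : ∀ t, H.unit.Fib pt (i t)) (k : ∀ t, F.bib.Fib (i t) (i' t))
        (e' : ∀ t, H'.unit.Fib pt (i' t)), IsPlot i₁ → IsPlot i₁' →
        i = (fun t => p.obj (i₁ t)) → i' = (fun t => q.obj (i₁' t)) →
        (∀ t, F.ε (e t) (k t) (e' t)) → H.unit.SmoothFam (x := fun _ => pt) e →
        F.bib.SmoothFam k → H'.unit.SmoothFam (x := fun _ => pt) e' := by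
      rintro i i' _ _ e k e' hi hi' rfl rfl h he hk
      obtain ⟨e, rfl⟩ := C.exists_u_eq e
      obtain ⟨e', rfl⟩ := C'.exists_u_eq e'
      obtain ⟨k, rfl⟩ := D.bib.exists_θ_eq k
      exact C'.u_smooth (hF.ε_smooth n i i' e k e' (fun t => D.ε.1 (h t))
        (C.u_smooth_lift hi he) (D.bib.smooth_lift hi hi' hk))
    refine isPlot_of_local fun t => ?_
    obtain ⟨σ, u, v, hσ, ht, hu, hv, hxu, hyv⟩ := hp.exists_lifts₂ hq ![i]
      (Fin.forall_fin_one.2 (D.bib.plots hk).1) ![i'] (Fin.forall_fin_one.2 (D.bib.plots hk).2) t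
    exact ⟨σ, ht, key (u 0) (v 0) _ _ _ _ _ (hu 0) (hv 0) (hxu 0) (hyv 0)
      (fun t => hrel (σ t)) (he.reparam hσ) (hk.reparam hσ)⟩
  assoc {x y w u s v x' y' w' u' s' v'} a b c d k₁ k₂ k₃ k₄ k₅ k₆ a' b' c' d' h h₁ h₂ h₃ h₄ := by
    obtain ⟨x, rfl⟩ := hp.surj x
    obtain ⟨y, rfl⟩ := hp.surj y
    obtain ⟨w, rfl⟩ := hp.surj w
    obtain ⟨u, rfl⟩ := hp.surj u
    obtain ⟨s, rfl⟩ := hp.surj s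
    obtain ⟨v, rfl⟩ := hp.surj v
    obtain ⟨x', rfl⟩ := hq.surj x'
    obtain ⟨y', rfl⟩ := hq.surj y'
    obtain ⟨w', rfl⟩ := hq.surj w'
    obtain ⟨u', rfl⟩ := hq.surj u'
    obtain ⟨s', rfl⟩ := hq.surj s'
    obtain ⟨v', rfl⟩ := hq.surj v'
    obtain ⟨a, rfl⟩ := C.m_surj a
    obtain ⟨b, rfl⟩ := C.m_surj b
    obtain ⟨c, rfl⟩ := C.m_surj c
    obtain ⟨d, rfl⟩ := C.m_surj d
    obtain ⟨a', rfl⟩ := C'.m_surj a'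
    obtain ⟨b', rfl⟩ := C'.m_surj b'
    obtain ⟨c', rfl⟩ := C'.m_surj c'
    obtain ⟨d', rfl⟩ := C'.m_surj d'
    obtain ⟨k₁, rfl⟩ := D.θ_surj k₁
    obtain ⟨k₂, rfl⟩ := D.θ_surj k₂
    obtain ⟨k₃, rfl⟩ := D.θ_surj k₃
    obtain ⟨k₄, rfl⟩ := D.θ_surj k₄
    obtain ⟨k₅, rfl⟩ := D.θ_surj k₅
    obtain ⟨k₆, rfl⟩ := D.θ_surj k₆
    rw [D.φ] at h₁ h₂ h₃ h₄
    exact C'.assoc_iff.2 (hF.assoc a b c d k₁ k₂ k₃ k₄ k₅ k₆ a' b' c' d' (C.assoc_iff.1 h)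
      h₁ h₂ h₃ h₄)
  lunit {i x y i' x' y'} e a f k₁ k₂ k₃ e' a' f' h h₁ h₂ h₃ := by
    obtain ⟨i, rfl⟩ := hp.surj i
    obtain ⟨x, rfl⟩ := hp.surj x
    obtain ⟨y, rfl⟩ := hp.surj y
    obtain ⟨i', rfl⟩ := hq.surj i'
    obtain ⟨x', rfl⟩ := hq.surj x'
    obtain ⟨y', rfl⟩ := hq.surj y'
    obtain ⟨e, rfl⟩ := C.u_surj e
    obtain ⟨a, rfl⟩ := C.m_surj a
    obtain ⟨e', rfl⟩ := C'.u_surj e'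
    obtain ⟨a', rfl⟩ := C'.m_surj a'
    obtain ⟨k₁, rfl⟩ := D.θ_surj k₁
    obtain ⟨k₂, rfl⟩ := D.θ_surj k₂
    obtain ⟨k₃, rfl⟩ := D.θ_surj k₃
    obtain ⟨f, rfl⟩ := (hp.bij _ _).2 f
    obtain ⟨f', rfl⟩ := (hq.bij _ _).2 f'
    rw [C.lunit_iff] at h
    rw [C'.lunit_iff] at h₃
    rw [D.ε] at h₁
    rw [D.φ] at h₂
    rw [← p.map_id, ← q.map_id, ← D.bib.act, ← D.bib.act,
      hF.lunit e a f k₁ k₂ k₃ e' a' f' h h₁ h₂ h₃]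
  runit {i x y i' x' y'} e a f k₁ k₂ k₃ e' a' f' h h₁ h₂ h₃ := by
    obtain ⟨i, rfl⟩ := hp.surj i
    obtain ⟨x, rfl⟩ := hp.surj x
    obtain ⟨y, rfl⟩ := hp.surj y
    obtain ⟨i', rfl⟩ := hq.surj i'
    obtain ⟨x', rfl⟩ := hq.surj x'
    obtain ⟨y', rfl⟩ := hq.surj y'
    obtain ⟨e, rfl⟩ := C.u_surj e
    obtain ⟨a, rfl⟩ := C.m_surj a
    obtain ⟨e', rfl⟩ := C'.u_surj e'
    obtain ⟨a', rfl⟩ := C'.m_surj a'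
    obtain ⟨k₁, rfl⟩ := D.θ_surj k₁
    obtain ⟨k₂, rfl⟩ := D.θ_surj k₂
    obtain ⟨k₃, rfl⟩ := D.θ_surj k₃
    obtain ⟨f, rfl⟩ := (hp.bij _ _).2 f
    obtain ⟨f', rfl⟩ := (hq.bij _ _).2 f'
    rw [C.runit_iff] at h
    rw [C'.runit_iff] at h₃
    rw [D.ε] at h₁
    rw [D.φ] at h₂
    rw [← p.map_id, ← q.map_id, ← D.bib.act, ← D.bib.act,
      hF.runit e a f k₁ k₂ k₃ e' a' f' h h₁ h₂ h₃]

end HomCover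

variable {E Z : Type} [Groupoid.{0} E] [SmoothStr E] [Groupoid.{0} Z] [SmoothStr Z] {r : E ⥤ Z}
  {G'' : TwoGroupData E} {H'' : TwoGroupData Z} {C : TwoGroupCover p G H}
  {C' : TwoGroupCover q G' H'} {C'' : TwoGroupCover r G'' H''} {F : TwoGroupHom G G'}
  {F' : TwoGroupHom G' G''} {F'' : TwoGroupHom G G''} {K : TwoGroupHom H H'}
  {K' : TwoGroupHom H' H''} {K'' : TwoGroupHom H H''}

/-- Isomorphisms of 1-morphisms of 2-groups descend along covers. -/
theorem TwoGroupHom.IsCompIso.of_cover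
    {ψ : ∀ {x : A} {y : B} {z : E}, F.bib.Fib x y → F'.bib.Fib y z → F''.bib.Fib x z → Prop}
    (hψ : TwoGroupHom.IsCompIso F F' F'' ψ) (D : HomCover C C' F K) (D' : HomCover C' C'' F' K')
    (D'' : HomCover C C'' F'' K'') (hp : IsSmoothCover p) (hq : IsSmoothCover q)
    (hr : IsSmoothCover r)
    (χ : ∀ {x : X} {y : Y} {z : Z}, K.bib.Fib x y → K'.bib.Fib y z → K''.bib.Fib x z → Prop)
    (hχ : ∀ {x y z} (a : F.bib.Fib x y) (b : F'.bib.Fib y z) (c : F''.bib.Fib x z),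
      χ (D.bib.θ a) (D'.bib.θ b) (D''.bib.θ c) ↔ ψ a b c) :
    TwoGroupHom.IsCompIso K K' K'' χ where
  existsUnique {x y z} a b := by
    obtain ⟨x, rfl⟩ := hp.surj x
    obtain ⟨y, rfl⟩ := hq.surj y
    obtain ⟨z, rfl⟩ := hr.surj z
    obtain ⟨a, rfl⟩ := D.θ_surj a
    obtain ⟨b, rfl⟩ := D'.θ_surj b
    obtain ⟨c, hc, hu⟩ := hψ.existsUnique a b
    refine ⟨D''.bib.θ c, (hχ a b c).2 hc, fun c' hc' => ?_⟩
    obtain ⟨c', rfl⟩ := D''.θ_surj c'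
    rw [hu c' ((hχ _ _ _).1 hc')]
  equivariant {x x₁ y y₁ z z₁} a b c f g h hrel := by
    obtain ⟨x, rfl⟩ := hp.surj x
    obtain ⟨y, rfl⟩ := hq.surj y
    obtain ⟨z, rfl⟩ := hr.surj z
    obtain ⟨x₁, rfl⟩ := hp.surj x₁
    obtain ⟨y₁, rfl⟩ := hq.surj y₁
    obtain ⟨z₁, rfl⟩ := hr.surj z₁
    obtain ⟨a, rfl⟩ := D.θ_surj a
    obtain ⟨b, rfl⟩ := D'.θ_surj b
    obtain ⟨c, rfl⟩ := D''.θ_surj c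
    obtain ⟨f, rfl⟩ := (hp.bij _ _).2 f
    obtain ⟨g, rfl⟩ := (hq.bij _ _).2 g
    obtain ⟨h, rfl⟩ := (hr.bij _ _).2 h
    rw [← map_groupoid_inv, ← D.bib.act, ← D'.bib.act, ← D''.bib.act, hχ]
    exact hψ.equivariant a b c f g h ((hχ _ _ _).1 hrel)
  smooth n x y z a b c hrel ha hb := by
    have key : ∀ (x₁ : Euc n → A) (y₁ : Euc n → B) (z₁ : Euc n → E) (x : Euc n → X)
        (y : Euc n → Y) (z : Euc n → Z) (a : ∀ t, K.bib.Fib (x t) (y t))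
        (b : ∀ t, K'.bib.Fib (y t) (z t)) (c : ∀ t, K''.bib.Fib (x t) (z t)),
        IsPlot x₁ → IsPlot y₁ → IsPlot z₁ → x = (fun t => p.obj (x₁ t)) →
        y = (fun t => q.obj (y₁ t)) → z = (fun t => r.obj (z₁ t)) →
        (∀ t, χ (a t) (b t) (c t)) → K.bib.SmoothFam a → K'.bib.SmoothFam b →
        K''.bib.SmoothFam c := by
      rintro x y z _ _ _ a b c hx hy hz rfl rfl rfl h ha hb
      obtain ⟨a, rfl⟩ := D.bib.exists_θ_eq a
      obtain ⟨b, rfl⟩ := D'.bib.exists_θ_eq b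
      obtain ⟨c, rfl⟩ := D''.bib.exists_θ_eq c
      exact D''.bib.smooth (hψ.smooth n x y z a b c (fun t => (hχ _ _ _).1 (h t))
        (D.bib.smooth_lift hx hy ha) (D'.bib.smooth_lift hy hz hb))
    refine isPlot_of_local fun t => ?_
    obtain ⟨σ, u, w, hσ, ht, hu, hw, hxu, hzw⟩ := hp.exists_lifts₂ hr ![x]
      (Fin.forall_fin_one.2 (D.bib.plots ha).1) ![z] (Fin.forall_fin_one.2 (D'.bib.plots hb).2) t
    -- Three different covers are involved: x and z have been lifted over σ, and y is lifted
    -- afterwards over a further retraction τ, along which the first lifts are restricted.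
    obtain ⟨τ, v, hτ, ht', hv, hyv⟩ := hq.exists_lifts (k := 1) (fun _ t => y (σ t))
      (fun _ => isPlot_reparam (D.bib.plots ha).2 hσ) t
    refine ⟨σ ∘ τ, ?_, key (fun t => u 0 (τ t)) (v 0) (fun t => w 0 (τ t)) _ _ _ _ _ _
      (isPlot_reparam (hu 0) hτ) (hv 0) (isPlot_reparam (hw 0) hτ)
      (funext fun t => congrFun (hxu 0) (τ t)) (hyv 0) (funext fun t => congrFun (hzw 0) (τ t))
      (fun t => hrel (σ (τ t))) ((ha.reparam hσ).reparam hτ) ((hb.reparam hσ).reparam hτ)⟩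
    have : ∀ᶠ w in 𝓝 t, σ (τ w) = τ w := by
      have h := hτ.continuous.continuousAt (x := t)
      rw [ContinuousAt, ht'.self_of_nhds] at h
      exact h.eventually ht
    filter_upwards [this, ht'] with w h h'
    rw [Function.comp, h, h']
  mul {x₁ x₂ x₃ y₁ y₂ y₃ z₁ z₂ z₃} a b c k₁ k₂ k₃ l₁ l₂ l₃ m₁ m₂ m₃ h h' e₁ e₂ e₃ := by
    obtain ⟨x₁, rfl⟩ := hp.surj x₁
    obtain ⟨x₂, rfl⟩ := hp.surj x₂
    obtain ⟨x₃, rfl⟩ := hp.surj x₃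
    obtain ⟨y₁, rfl⟩ := hq.surj y₁
    obtain ⟨y₂, rfl⟩ := hq.surj y₂
    obtain ⟨y₃, rfl⟩ := hq.surj y₃
    obtain ⟨z₁, rfl⟩ := hr.surj z₁
    obtain ⟨z₂, rfl⟩ := hr.surj z₂
    obtain ⟨z₃, rfl⟩ := hr.surj z₃
    obtain ⟨a, rfl⟩ := C.m_surj a
    obtain ⟨b, rfl⟩ := C'.m_surj b
    obtain ⟨c, rfl⟩ := C''.m_surj c
    obtain ⟨k₁, rfl⟩ := D.θ_surj k₁
    obtain ⟨k₂, rfl⟩ := D.θ_surj k₂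
    obtain ⟨k₃, rfl⟩ := D.θ_surj k₃
    obtain ⟨l₁, rfl⟩ := D'.θ_surj l₁
    obtain ⟨l₂, rfl⟩ := D'.θ_surj l₂
    obtain ⟨l₃, rfl⟩ := D'.θ_surj l₃
    obtain ⟨m₁, rfl⟩ := D''.θ_surj m₁
    obtain ⟨m₂, rfl⟩ := D''.θ_surj m₂
    obtain ⟨m₃, rfl⟩ := D''.θ_surj m₃
    rw [hχ] at e₁ e₂ e₃
    exact D''.φ.2 (hψ.mul a b c k₁ k₂ k₃ l₁ l₂ l₃ m₁ m₂ m₃ (D.φ.1 h) (D'.φ.1 h') e₁ e₂ e₃)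
  unit {i i' i''} e e' e'' k l m h h' hrel := by
    obtain ⟨i, rfl⟩ := hp.surj i
    obtain ⟨i', rfl⟩ := hq.surj i'
    obtain ⟨i'', rfl⟩ := hr.surj i''
    obtain ⟨e, rfl⟩ := C.u_surj e
    obtain ⟨e', rfl⟩ := C'.u_surj e'
    obtain ⟨e'', rfl⟩ := C''.u_surj e''
    obtain ⟨k, rfl⟩ := D.θ_surj k
    obtain ⟨l, rfl⟩ := D'.θ_surj l
    obtain ⟨m, rfl⟩ := D''.θ_surj m
    rw [hχ] at hrel
    exact D''.ε.2 (hψ.unit e e' e'' k l m (D.ε.1 h) (D'.ε.1 h') hrel)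

end HomCovers


/-! ### Transported 2-groups -/

section TransportCover

variable {A X : Type} [Groupoid.{0} A] [SmoothStr A] [MonoidalCategory A] [Groupoid.{0} X]
  [SmoothStr X] {p : A ⥤ X}

/-- Arrows of A × A can be moved from the outer legs into the inner one; this is the generating
relation of the quotient. -/
lemma zigzag_map {s t r : X} {x y x' y' : A} (f : s ⟶ p.obj x) (g : t ⟶ p.obj y) (h : x ⟶ x')
    (l : y ⟶ y') (k : p.obj (x' ⊗ y') ⟶ r) :
    zigzag p x' y' (f ≫ p.map h) (g ≫ p.map l) k = zigzag p x y f g (p.map (h ⊗ₘ l) ≫ k) :=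
  (Quot.sound (ZigZag.Rel.mk f g h l k)).symm

/-- The element of the transported multiplication over `(p x, p y; p z)` given by an arrow
`x ⊗ y ⟶ z`. -/
def toZigzag (p : A ⥤ X) {x y z : A} (a : x ⊗ y ⟶ z) :
    Quot (ZigZag.Rel p (s := p.obj x) (t := p.obj y) (r := p.obj z)) :=
  zigzag p x y (𝟙 _) (𝟙 _) (p.map a)

/-- If the outer legs come from A, the relation absorbs them completely and leaves a representative
with identity legs. -/
lemma zigzag_eq {x y z x' y' : A} (f : x ⟶ x') (g : y ⟶ y') (k : x' ⊗ y' ⟶ z) :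
    zigzag p x' y' (p.map f) (p.map g) (p.map k) = toZigzag p ((f ⊗ₘ g) ≫ k) := by
  rw [← Category.id_comp (p.map f), ← Category.id_comp (p.map g), zigzag_map, ← p.map_comp]
  rfl

lemma zigzag_eq' {x y z x' y' : A} {f : p.obj x ⟶ p.obj x'} {g : p.obj y ⟶ p.obj y'}
    {k : p.obj (x' ⊗ y') ⟶ p.obj z} {f' : x ⟶ x'} {g' : y ⟶ y'} {k' : x' ⊗ y' ⟶ z}
    (hf : f = p.map f') (hg : g = p.map g') (hk : k = p.map k') :
    zigzag p x' y' f g k = toZigzag p ((f' ⊗ₘ g') ≫ k') := by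
  rw [hf, hg, hk, zigzag_eq]

variable (hp : IsSmoothCover p)
include hp

/-- A cover is fully faithful. -/
noncomputable def IsSmoothCover.fullyFaithful : p.FullyFaithful where
  preimage f := ((hp.bij _ _).2 f).choose
  map_preimage f := ((hp.bij _ _).2 f).choose_spec
  preimage_map f := (hp.bij _ _).1 ((hp.bij _ _).2 (p.map f)).choose_spec

/-- By full faithfulness all three legs of a representative come from A, and (f ⊗ g) ≫ k is an
invariant of the class by interchange. It inverts `toZigzag`, because `zigzag_eq` brings any
representative to the form with identity legs. This identifies the pullback of the transported
multiplication with that of A. -/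
lemma toZigzag_bijective (x y z : A) :
    Function.Bijective (toZigzag p : (x ⊗ y ⟶ z) → _) := by
  have hff := hp.fullyFaithful
  constructor
  · let back : Quot (ZigZag.Rel p (s := p.obj x) (t := p.obj y) (r := p.obj z)) → (x ⊗ y ⟶ z) :=
      Quot.lift (fun a => (hff.preimage a.f ⊗ₘ hff.preimage a.g) ≫ hff.preimage a.k) (by
        rintro _ _ ⟨f, g, h, l, k⟩
        simp [hff.preimage_comp, MonoidalCategory.tensorHom_comp_tensorHom_assoc])
    refine Function.LeftInverse.injective (g := back) fun a => ?_
    change (hff.preimage (𝟙 (p.obj x)) ⊗ₘ hff.preimage (𝟙 (p.obj y))) ≫ hff.preimage (p.map a) = a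
    simp
  · rintro ⟨x', y', f, g, k⟩
    refine ⟨(hff.preimage f ⊗ₘ hff.preimage g) ≫ hff.preimage k, ?_⟩
    rw [← zigzag_eq]
    simp
    rfl


omit hp

lemma toZigzag_act {x y z x' y' z' : A} (f : x' ⟶ x) (g : y' ⟶ y) (c : x ⊗ y ⟶ z) (k : z ⟶ z') :
    toZigzag p ((f ⊗ₘ g) ≫ c ≫ k) =
      (transportMul p).act (x := (p.obj x, p.obj y)) (x' := (p.obj x', p.obj y'))
        (y := p.obj z) (y' := p.obj z') (p.map f, p.map g) (toZigzag p c) (p.map k) := by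
  change _ = zigzag p x y (p.map f ≫ 𝟙 _) (p.map g ≫ 𝟙 _) (p.map c ≫ p.map k)
  rw [Category.comp_id, Category.comp_id, ← zigzag_eq, p.map_comp]

lemma smoothFam_zigzag {n : ℕ} {s t r : Euc n → X} {x y : Euc n → A} {f : ∀ v, s v ⟶ p.obj (x v)}
    {g : ∀ v, t v ⟶ p.obj (y v)} {k : ∀ v, p.obj (x v ⊗ y v) ⟶ r v} (hx : IsPlot x)
    (hy : IsPlot y) (hf : SmoothArr f) (hg : SmoothArr g) (hk : SmoothArr k) :
    (transportMul p).SmoothFam (x := fun v => (s v, t v))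
      (fun v => zigzag p (x v) (y v) (f v) (g v) (k v)) :=
  isPlot_coinduced_comp (p := fun v => (⟨(s v, t v), r v, ⟨x v, y v, f v, g v, k v⟩⟩ :
    Σ q : X × X, Σ r : X, ZigZag p q.1 q.2 r)) ((hx.prodMk hy).prodMk (hf.prodMk (hg.prodMk hk)))

/-- Plots of the quotient lift locally to representatives; retracting to the neighbourhood in
question makes the lift valid on the whole test space. -/
lemma exists_zigzag {n : ℕ} {s t r : Euc n → X}
    {c : ∀ v, (transportMul p).Fib (s v, t v) (r v)}
    (hc : (transportMul p).SmoothFam (x := fun v => (s v, t v)) c) (v : Euc n) :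
    ∃ (σ : Euc n → Euc n) (x y : Euc n → A) (f : ∀ w, s (σ w) ⟶ p.obj (x w))
      (g : ∀ w, t (σ w) ⟶ p.obj (y w)) (k : ∀ w, p.obj (x w ⊗ y w) ⟶ r (σ w)),
      ContDiff ℝ ∞ σ ∧ (∀ᶠ w in 𝓝 v, σ w = w) ∧ IsPlot x ∧ IsPlot y ∧ SmoothArr f ∧ SmoothArr g ∧
      SmoothArr k ∧ ∀ w, c (σ w) = zigzag p (x w) (y w) (f w) (g w) (k w) := by
  obtain ⟨P, hP, he⟩ := (isPlot_coinduced (by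
    rintro ⟨q, r, ⟨a⟩⟩
    exact ⟨⟨q, r, a⟩, rfl⟩)).1 hc v
  obtain ⟨σ, hσ, hm, hs⟩ := exists_smooth_retract he
  have hQ := @isPlot_reparam _ (_) _ _ _ _ hP hσ
  -- The lifted representatives agree with the family only as points of a dependent total space.
  -- Substituting the equalities of the endpoints turns this into an equality of elements over the
  -- given s, t, r.
  have key : ∀ (s t r : Euc n → X) (c : ∀ v, (transportMul p).Fib (s v, t v) (r v))
      (q : Euc n → X × X) (r' : Euc n → X) (Q : ∀ w, ZigZag p (q w).1 (q w).2 (r' w)),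
      (∀ w, (⟨(s w, t w), r w, c w⟩ : (transportMul p).Total) = ⟨q w, r' w, Quot.mk _ (Q w)⟩) →
      ∃ (f : ∀ w, s w ⟶ p.obj (Q w).x) (g : ∀ w, t w ⟶ p.obj (Q w).y)
        (k : ∀ w, p.obj ((Q w).x ⊗ (Q w).y) ⟶ r w),
        (SmoothArr (fun w => (Q w).f) → SmoothArr f) ∧
        (SmoothArr (fun w => (Q w).g) → SmoothArr g) ∧
        (SmoothArr (fun w => (Q w).k) → SmoothArr k) ∧
        ∀ w, c w = zigzag p (Q w).x (Q w).y (f w) (g w) (k w) := by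
    intro s t r c q r' Q h
    obtain rfl : q = fun w => (s w, t w) := funext fun w => (congrArg (fun b => b.1) (h w)).symm
    obtain rfl : r' = r := funext fun w => (congrArg (fun b => b.2.1) (h w)).symm
    refine ⟨fun w => (Q w).f, fun w => (Q w).g, fun w => (Q w).k, id, id, id, fun w => ?_⟩
    have h := eq_of_heq (Sigma.mk.inj (eq_of_heq (Sigma.mk.inj (h w)).2)).2
    exact h
  obtain ⟨f, g, k, hf, hg, hk, h⟩ := key _ _ _ (fun w => c (σ w)) (fun w => (P (σ w)).1)
    (fun w => (P (σ w)).2.1) (fun w => (P (σ w)).2.2) hm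
  obtain ⟨h1, h2⟩ := isPlot_prod.1 hQ
  obtain ⟨h1, h1'⟩ := isPlot_prod.1 h1
  obtain ⟨h2, h3⟩ := isPlot_prod.1 h2
  obtain ⟨h3, h4⟩ := isPlot_prod.1 h3
  exact ⟨σ, _, _, f, g, k, hσ, hs, h1, h1', hf h2, hg h3, hk h4, h⟩

lemma plots_of_transportMul (hX : HasSmoothEnds X) {n : ℕ} {x : Euc n → X × X}
    {y : Euc n → X} {c : ∀ v, (transportMul p).Fib (x v) (y v)}
    (hc : (transportMul p).SmoothFam c) : IsPlot x ∧ IsPlot y := by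
  have h := exists_zigzag (s := fun v => (x v).1) (t := fun v => (x v).2) hc
  constructor
  · refine isPlot_of_local fun v => ?_
    obtain ⟨σ, x', y', f, g, k, hσ, hs, hx, hy, hf, hg, hk, -⟩ := h v
    exact ⟨σ, hs, isPlot_prod.2 ⟨(hX hf).1, (hX hg).1⟩⟩
  · refine isPlot_of_local fun v => ?_
    obtain ⟨σ, x', y', f, g, k, hσ, hs, hx, hy, hf, hg, hk, -⟩ := h v
    exact ⟨σ, hs, (hX hk).2⟩

include hp

/-- The multiplication of a transported 2-group is covered by the original one. -/
def transportMulCover (hA : IsSmoothMonoidal A) (hX : IsLieGroupoid X) :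
    BibCover (p.prod p) p (TwoGroupData.ofStrict A).mul (TwoGroupData.transport p).mul where
  θ {a b} c := toZigzag p (x := a.1) (y := a.2) (z := b) c
  bij a b := toZigzag_bijective hp a.1 a.2 b
  act {a a' b b'} f c g := toZigzag_act f.1 f.2 c g
  smooth {n x y c} hc := by
    obtain ⟨⟨hx, hy⟩, hc⟩ := IsSmoothMonoidal.smoothFam_mul.1 hc
    exact smoothFam_zigzag hx hy (hX.smoothArr_id (hp.submersion.1 _ _ hx))
      (hX.smoothArr_id (hp.submersion.1 _ _ hy)) (hp.smooth hc)
  smooth_lift {n x y c} hx hy hc := by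
    refine IsSmoothMonoidal.smoothFam_mul.2 ⟨isPlot_prod.1 hx, isPlot_of_local fun v => ?_⟩
    obtain ⟨hx₁, hx₂⟩ := isPlot_prod.1 hx
    obtain ⟨σ, x', y', f, g, k, hσ, hs, hx', hy', hf, hg, hk, h⟩ := exists_zigzag hc v
    obtain ⟨f, rfl⟩ := hp.exists_map_eq f
    obtain ⟨g, rfl⟩ := hp.exists_map_eq g
    obtain ⟨k, rfl⟩ := hp.exists_map_eq k
    have hk := hp.smooth_lift (hA.tensorObj hx' hy') (isPlot_reparam hy hσ) hk
    have hf := hp.smooth_lift (isPlot_reparam hx₁ hσ) hx' hf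
    have hg := hp.smooth_lift (isPlot_reparam hx₂ hσ) hy' hg
    -- The zig-zag of c is also the zig-zag of (f ⊗ g) ≫ k, so injectivity of `toZigzag` identifies
    -- the two families, the second of which is visibly smooth.
    have e : ∀ w, c (σ w) = (f w ⊗ₘ g w) ≫ k w := fun w =>
      (toZigzag_bijective hp _ _ _).1 ((h w).trans (zigzag_eq _ _ _))
    have := hA.lie.smoothArr_comp (hA.tensorHom hf hg) hk
    exact ⟨σ, hs, by
      have e' : (fun w => c (σ w)) = fun w => (f w ⊗ₘ g w) ≫ k w := funext e
      change SmoothArr (fun w => c (σ w))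
      rw [e']
      exact this⟩
  plots hc := plots_of_transportMul hX.hasSmoothEnds hc

/-- The unit of a transported 2-group is covered by the original one. -/
def transportUnitCover (hX : IsLieGroupoid X) :
    BibCover (𝟭 Pt) p (TwoGroupData.ofStrict A).unit (TwoGroupData.transport p).unit where
  θ {a b} c := p.map (X := 𝟙_ A) (Y := b) c
  bij a b := hp.bij _ _
  act f c g := p.map_comp _ _
  smooth hc := hp.smooth hc
  smooth_lift hx hy hc := hp.smooth_lift isPlot_const hy hc
  plots hc := ⟨isPlot_top, (hX.hasSmoothEnds hc).2⟩

/-- In one direction identity legs on x, y, w serve as witnesses: k and n are the images of a and c,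
and their inverses restore b and d. In the other direction full faithfulness brings the witnesses
into A, where the relation follows by interchange and naturality of the associator. -/
lemma transport_assoc {x y w u s v : A} (a : x ⊗ y ⟶ u) (b : u ⊗ w ⟶ v) (c : y ⊗ w ⟶ s)
    (d : x ⊗ s ⟶ v) :
    (a ⊗ₘ 𝟙 w) ≫ b = (α_ x y w).hom ≫ (𝟙 x ⊗ₘ c) ≫ d ↔
    (TwoGroupData.transport p).assoc (x := p.obj x) (y := p.obj y) (w := p.obj w)
      (toZigzag p a) (toZigzag p b) (toZigzag p c) (toZigzag p d) := by
  constructor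
  · intro h
    refine ⟨x, y, w, 𝟙 _, 𝟙 _, 𝟙 _, p.map a, p.map ((a ⊗ₘ 𝟙 w) ≫ b), p.map c, rfl, ?_, rfl, ?_⟩
    · rw [zigzag_eq' (f' := Groupoid.inv a) (g' := 𝟙 w) (map_groupoid_inv _ _).symm
        (p.map_id _).symm rfl]
      congr 1
      simp
    · rw [zigzag_eq' (f' := 𝟙 x) (g' := Groupoid.inv c)
        (k' := (α_ x y w).inv ≫ (a ⊗ₘ 𝟙 w) ≫ b) (p.map_id _).symm
        (map_groupoid_inv _ _).symm (p.map_comp _ _).symm, h]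
      congr 1
      simp [← MonoidalCategory.whiskerLeft_comp_assoc]
  · rintro ⟨x', y', w', f, g, h, k, l, n, ha, hb, hc, hd⟩
    obtain ⟨f, rfl⟩ := (hp.bij _ _).2 f
    obtain ⟨g, rfl⟩ := (hp.bij _ _).2 g
    obtain ⟨h, rfl⟩ := (hp.bij _ _).2 h
    obtain ⟨k, rfl⟩ := (hp.bij _ _).2 k
    obtain ⟨l, rfl⟩ := (hp.bij _ _).2 l
    obtain ⟨n, rfl⟩ := (hp.bij _ _).2 n
    rw [zigzag_eq] at ha hc
    rw [zigzag_eq' (map_groupoid_inv _ _).symm rfl rfl] at hb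
    rw [zigzag_eq' (k' := (α_ x' y' w').inv ≫ l) rfl (map_groupoid_inv _ _).symm
      (p.map_comp _ _).symm] at hd
    rw [(toZigzag_bijective hp _ _ _).1 ha, (toZigzag_bijective hp _ _ _).1 hb,
      (toZigzag_bijective hp _ _ _).1 hc, (toZigzag_bijective hp _ _ _).1 hd]
    rw [MonoidalCategory.tensorHom_comp_tensorHom_assoc,
      MonoidalCategory.tensorHom_comp_tensorHom_assoc]
    simp

lemma transport_lunit {i x y : A} (e : 𝟙_ A ⟶ i) (a : i ⊗ x ⟶ y) (f : x ⟶ y) :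
    (e ⊗ₘ 𝟙 x) ≫ a = (λ_ x).hom ≫ f ↔
    (TwoGroupData.transport p).lunit (x := p.obj x) (p.map e) (toZigzag p a) (p.map f) := by
  constructor
  · intro h
    refine ⟨x, 𝟙 _, p.map ((e ⊗ₘ 𝟙 x) ≫ a), ?_, ?_⟩
    · rw [zigzag_eq' (map_groupoid_inv _ _).symm (p.map_id _).symm rfl]
      congr 1
      simp
    · rw [h, ← p.map_comp]
      simp
  · rintro ⟨x', g, k, ha, hf⟩
    obtain ⟨g, rfl⟩ := (hp.bij _ _).2 g
    obtain ⟨k, rfl⟩ := (hp.bij _ _).2 k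
    rw [zigzag_eq' (map_groupoid_inv _ _).symm rfl rfl] at ha
    rw [← p.map_comp, ← p.map_comp] at hf
    rw [(toZigzag_bijective hp _ _ _).1 ha, (hp.bij _ _).1 hf]
    rw [MonoidalCategory.tensorHom_comp_tensorHom_assoc]
    simp

lemma transport_runit {i x y : A} (e : 𝟙_ A ⟶ i) (a : x ⊗ i ⟶ y) (f : x ⟶ y) :
    (𝟙 x ⊗ₘ e) ≫ a = (ρ_ x).hom ≫ f ↔
    (TwoGroupData.transport p).runit (x := p.obj x) (p.map e) (toZigzag p a) (p.map f) := by
  constructor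
  · intro h
    refine ⟨x, 𝟙 _, p.map ((𝟙 x ⊗ₘ e) ≫ a), ?_, ?_⟩
    · rw [zigzag_eq' (p.map_id _).symm (map_groupoid_inv _ _).symm rfl]
      congr 1
      simp
    · rw [h, ← p.map_comp]
      simp
  · rintro ⟨x', g, k, ha, hf⟩
    obtain ⟨g, rfl⟩ := (hp.bij _ _).2 g
    obtain ⟨k, rfl⟩ := (hp.bij _ _).2 k
    rw [zigzag_eq' rfl (map_groupoid_inv _ _).symm rfl] at ha
    rw [← p.map_comp, ← p.map_comp] at hf
    rw [(toZigzag_bijective hp _ _ _).1 ha, (hp.bij _ _).1 hf]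
    rw [MonoidalCategory.tensorHom_comp_tensorHom_assoc]
    simp

/-- A transported 2-group is covered by the original one. -/
def transportCover (hA : IsSmoothMonoidal A) (hX : IsLieGroupoid X) :
    TwoGroupCover p (TwoGroupData.ofStrict A) (TwoGroupData.transport p) where
  mulCover := transportMulCover hp hA hX
  unitCover := transportUnitCover hp hX
  assoc a b c d := transport_assoc hp a b c d
  lunit e a f := transport_lunit hp e a f
  runit e a f := transport_runit hp e a f

end TransportCover


/-! ### 2-groups modelled on a monoidal category -/

namespace IsMonoidalFunctor

variable {C D : Type*} [Category C] [Category D] [MonoidalCategory C] [MonoidalCategory D]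
  {F : C ⥤ D} {ε : 𝟙_ D ⟶ F.obj (𝟙_ C)} {μ : ∀ x y : C, F.obj x ⊗ F.obj y ⟶ F.obj (x ⊗ y)}
  (hF : IsMonoidalFunctor F ε μ) [∀ x y, IsIso (μ x y)] [IsIso ε] [F.Faithful]
include hF

/-- The argument for `assocRel_map` can be reversed: the factors of μ in front are invertible and
cancel, and F is faithful. -/
lemma assocRel_map_iff {x y w u s v : C} {a : x ⊗ y ⟶ u} {b : u ⊗ w ⟶ v} {c : y ⊗ w ⟶ s}
    {d : x ⊗ s ⟶ v} : AssocRel (μ x y ≫ F.map a) (μ u w ≫ F.map b) (μ y w ≫ F.map c)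
      (μ x s ≫ F.map d) ↔ AssocRel a b c d := by
  refine ⟨fun h => ?_, hF.assocRel_map⟩
  rw [AssocRel] at *
  have e1 : (μ x y ≫ F.map a) ▷ F.obj w ≫ μ u w ≫ F.map b =
      μ x y ▷ F.obj w ≫ μ (x ⊗ y) w ≫ F.map (a ▷ w ≫ b) := by
    rw [comp_whiskerRight_assoc, reassoc_of% hF.natural_left a w, F.map_comp]
  have e2 : F.obj x ◁ (μ y w ≫ F.map c) ≫ μ x s ≫ F.map d =
      F.obj x ◁ μ y w ≫ μ x (y ⊗ w) ≫ F.map (x ◁ c ≫ d) := by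
    rw [MonoidalCategory.whiskerLeft_comp_assoc, reassoc_of% hF.natural_right x c, F.map_comp]
  rw [e1, e2, ← reassoc_of% hF.assoc x y w, ← F.map_comp, cancel_epi, cancel_epi] at h
  exact F.map_injective h

lemma leftUnit_map_iff {i x y : C} {e : 𝟙_ C ⟶ i} {a : i ⊗ x ⟶ y} {f : x ⟶ y} :
    (ε ≫ F.map e) ▷ F.obj x ≫ μ i x ≫ F.map a = (λ_ (F.obj x)).hom ≫ F.map f ↔
      e ▷ x ≫ a = (λ_ x).hom ≫ f := by
  refine ⟨fun h => ?_, hF.leftUnit_map⟩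
  rw [comp_whiskerRight_assoc, reassoc_of% hF.natural_left e x, ← F.map_comp, ← hF.left_unit,
    Category.assoc, Category.assoc, ← F.map_comp, cancel_epi, cancel_epi] at h
  exact F.map_injective h

lemma rightUnit_map_iff {i x y : C} {e : 𝟙_ C ⟶ i} {a : x ⊗ i ⟶ y} {f : x ⟶ y} :
    F.obj x ◁ (ε ≫ F.map e) ≫ μ x i ≫ F.map a = (ρ_ (F.obj x)).hom ≫ F.map f ↔
      x ◁ e ≫ a = (ρ_ x).hom ≫ f := by
  refine ⟨fun h => ?_, hF.rightUnit_map⟩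
  rw [MonoidalCategory.whiskerLeft_comp_assoc, reassoc_of% hF.natural_right x e, ← F.map_comp,
    ← hF.right_unit, Category.assoc, Category.assoc, ← F.map_comp, cancel_epi, cancel_epi] at h
  exact F.map_injective h

lemma tensor_assoc_iff {x y w u s v : C} {a : x ⊗ y ⟶ u} {b : u ⊗ w ⟶ v} {c : y ⊗ w ⟶ s}
    {d : x ⊗ s ⟶ v} : ((μ x y ≫ F.map a) ⊗ₘ 𝟙 (F.obj w)) ≫ μ u w ≫ F.map b =
      (α_ (F.obj x) (F.obj y) (F.obj w)).hom ≫ (𝟙 (F.obj x) ⊗ₘ (μ y w ≫ F.map c)) ≫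
        μ x s ≫ F.map d ↔
      (a ⊗ₘ 𝟙 w) ≫ b = (α_ x y w).hom ≫ (𝟙 x ⊗ₘ c) ≫ d := by
  simp only [tensorHom_id, id_tensorHom]
  exact hF.assocRel_map_iff

lemma tensor_leftUnit_iff {i x y : C} {e : 𝟙_ C ⟶ i} {a : i ⊗ x ⟶ y} {f : x ⟶ y} :
    ((ε ≫ F.map e) ⊗ₘ 𝟙 (F.obj x)) ≫ μ i x ≫ F.map a = (λ_ (F.obj x)).hom ≫ F.map f ↔
      (e ⊗ₘ 𝟙 x) ≫ a = (λ_ x).hom ≫ f := by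
  simp only [tensorHom_id]
  exact hF.leftUnit_map_iff

lemma tensor_rightUnit_iff {i x y : C} {e : 𝟙_ C ⟶ i} {a : x ⊗ i ⟶ y} {f : x ⟶ y} :
    (𝟙 (F.obj x) ⊗ₘ (ε ≫ F.map e)) ≫ μ x i ≫ F.map a = (ρ_ (F.obj x)).hom ≫ F.map f ↔
      (𝟙 x ⊗ₘ e) ≫ a = (ρ_ x).hom ≫ f := by
  simp only [id_tensorHom]
  exact hF.rightUnit_map_iff

omit [IsIso ε] in
/-- Composition of monoidal functors, on the level of relations, up to a monoidal transformation
`τ`. -/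
lemma map_mul_iff {x y z : C} {x' y' z' : C} {u v w : D} (t : u ⟶ F.obj x) (t' : v ⟶ F.obj y)
    (t'' : w ⟶ F.obj z) [IsIso t] [IsIso t'] (r : z ⟶ z') (k : x ⟶ x') (l : y ⟶ y')
    (b : x' ⊗ y' ⟶ z') (m : u ⊗ v ⟶ w) (n : x ⊗ y ⟶ z)
    (h : (t ⊗ₘ t') ≫ μ x y ≫ F.map n = m ≫ t'') :
    ((t ≫ F.map k) ⊗ₘ (t' ≫ F.map l)) ≫ μ x' y' ≫ F.map b = m ≫ t'' ≫ F.map r ↔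
      (k ⊗ₘ l) ≫ b = n ≫ r := by
  rw [← MonoidalCategory.tensorHom_comp_tensorHom_assoc, reassoc_of% hF.natural k l,
    ← F.map_comp, ← reassoc_of% h, ← F.map_comp, cancel_epi, cancel_epi]
  exact F.map_injective.eq_iff

omit [∀ x y, IsIso (μ x y)] [IsIso ε] [F.Faithful] in
lemma map_act {x y z x' y' z' : C} (f : x' ⟶ x) (g : y' ⟶ y) (c : x ⊗ y ⟶ z) (k : z ⟶ z') :
    μ x' y' ≫ F.map ((f ⊗ₘ g) ≫ c ≫ k) =
      (F.map f ⊗ₘ F.map g) ≫ (μ x y ≫ F.map c) ≫ F.map k := by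
  rw [Category.assoc, reassoc_of% hF.natural f g]
  simp only [Functor.map_comp]

end IsMonoidalFunctor

section Models

variable {A X : Type} [Groupoid.{0} A] [SmoothStr A] [MonoidalCategory A] [Groupoid.{0} X]
  [SmoothStr X] {M : Type*} [Category.{0} M] [MonoidalCategory M]

/-- The functor `p ⋙ j` is monoidal and fully faithful, `p` is a cover, and the smooth structures on
the multiplication and the unit induced along `j` correspond to those of `A`. -/
structure IsMonoidalModel (p : A ⥤ X) (j : X ⥤ M) (ε : 𝟙_ M ⟶ (p ⋙ j).obj (𝟙_ A))
    (μ : ∀ x y : A, (p ⋙ j).obj x ⊗ (p ⋙ j).obj y ⟶ (p ⋙ j).obj (x ⊗ y))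
    (dm : DiffeologicalSpace (Σ p : X × X, Σ z : X, (j.obj p.1 ⊗ j.obj p.2 ⟶ j.obj z)))
    (du : DiffeologicalSpace (Σ _ : Pt, Σ z : X, (𝟙_ M ⟶ j.obj z))) : Prop where
  cover : IsSmoothCover p
  bij : ∀ x y : X, Function.Bijective (j.map : (x ⟶ y) → _)
  monoidal : IsMonoidalFunctor (p ⋙ j) ε μ
  ε_iso : IsIso ε
  μ_iso : ∀ x y, IsIso (μ x y)
  mul_smooth : ∀ {n : ℕ} {x y z : Euc n → A} {h : ∀ v, x v ⊗ y v ⟶ z v}, IsPlot x → IsPlot y →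
    IsPlot z → ((TwoGroupData.ofMonoidal j dm du).mul.SmoothFam
      (x := fun v => (p.obj (x v), p.obj (y v))) (y := fun v => p.obj (z v))
      (fun v => μ (x v) (y v) ≫ (p ⋙ j).map (h v)) ↔ SmoothArr h)
  unit_smooth : ∀ {n : ℕ} {z : Euc n → A} {h : ∀ v, 𝟙_ A ⟶ z v}, IsPlot z →
    ((TwoGroupData.ofMonoidal j dm du).unit.SmoothFam (x := fun _ => pt) (y := fun v => p.obj (z v))
      (fun v => ε ≫ (p ⋙ j).map (h v)) ↔ SmoothArr h)
  mul_plots : ∀ {n : ℕ} {x : Euc n → X × X} {y : Euc n → X}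
    {c : ∀ v, (TwoGroupData.ofMonoidal j dm du).mul.Fib (x v) (y v)},
    (TwoGroupData.ofMonoidal j dm du).mul.SmoothFam c → IsPlot x ∧ IsPlot y
  unit_plots : ∀ {n : ℕ} {x : Euc n → Pt} {y : Euc n → X}
    {c : ∀ v, (TwoGroupData.ofMonoidal j dm du).unit.Fib (x v) (y v)},
    (TwoGroupData.ofMonoidal j dm du).unit.SmoothFam c → IsPlot y

namespace IsMonoidalModel

variable {p : A ⥤ X} {j : X ⥤ M} {ε : 𝟙_ M ⟶ (p ⋙ j).obj (𝟙_ A)}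
  {μ : ∀ x y : A, (p ⋙ j).obj x ⊗ (p ⋙ j).obj y ⟶ (p ⋙ j).obj (x ⊗ y)}
  {dm : DiffeologicalSpace (Σ p : X × X, Σ z : X, (j.obj p.1 ⊗ j.obj p.2 ⟶ j.obj z))}
  {du : DiffeologicalSpace (Σ _ : Pt, Σ z : X, (𝟙_ M ⟶ j.obj z))}
  (hM : IsMonoidalModel p j ε μ dm du)
include hM

lemma comp_bij (x y : A) : Function.Bijective ((p ⋙ j).map : (x ⟶ y) → _) :=
  (hM.bij _ _).comp (hM.cover.bij x y)

lemma faithful : (p ⋙ j).Faithful := ⟨fun h => (hM.comp_bij _ _).1 h⟩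

lemma iso_comp_bij {x y : A} {m : M} (t : m ⟶ (p ⋙ j).obj x) [IsIso t] :
    Function.Bijective (fun f : x ⟶ y => t ≫ (p ⋙ j).map f) :=
  Function.Bijective.comp (g := fun f => t ≫ f)
    ⟨fun f g h => (cancel_epi t).1 h, fun f => ⟨inv t ≫ f, by simp⟩⟩ (hM.comp_bij x y)

/-- The multiplication of the 2-group modelled along `j` is covered by that of `A`. -/
def mulCover (hA : IsLieGroupoid A) : BibCover (p.prod p) p (TwoGroupData.ofStrict A).mul
    (TwoGroupData.ofMonoidal j dm du).mul where
  θ {a b} c := μ a.1 a.2 ≫ (p ⋙ j).map (X := a.1 ⊗ a.2) (Y := b) c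
  bij a b :=
    have := hM.μ_iso a.1 a.2
    hM.iso_comp_bij (μ a.1 a.2)
  act f c g := hM.monoidal.map_act f.1 f.2 c g
  smooth {n x y c} hc := by
    obtain ⟨⟨hx, hy⟩, hc⟩ := IsSmoothMonoidal.smoothFam_mul.1 hc
    exact (hM.mul_smooth hx hy (hA.isPlot_target hc)).2 hc
  smooth_lift {n x y c} hx hy hc := IsSmoothMonoidal.smoothFam_mul.2 ⟨isPlot_prod.1 hx,
    (hM.mul_smooth (isPlot_prod.1 hx).1 (isPlot_prod.1 hx).2 hy).1 hc⟩
  plots hc := hM.mul_plots hc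

/-- The unit of the 2-group modelled along `j` is covered by that of `A`. -/
def unitCover (hA : IsLieGroupoid A) : BibCover (𝟭 Pt) p (TwoGroupData.ofStrict A).unit
    (TwoGroupData.ofMonoidal j dm du).unit where
  θ {a b} c := ε ≫ (p ⋙ j).map (X := 𝟙_ A) (Y := b) c
  bij a b :=
    have := hM.ε_iso
    hM.iso_comp_bij ε
  act f c g := by
    refine (congrArg (ε ≫ ·) ((p ⋙ j).map_comp _ _)).trans (Category.assoc _ _ _).symm
  smooth hc := (hM.unit_smooth (hA.isPlot_target hc)).2 hc
  smooth_lift hx hy hc := (hM.unit_smooth hy).1 hc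
  plots hc := ⟨isPlot_top, hM.unit_plots hc⟩

/-- The 2-group modelled along `j` is covered by `A`. -/
def twoGroupCover (hA : IsLieGroupoid A) :
    TwoGroupCover p (TwoGroupData.ofStrict A) (TwoGroupData.ofMonoidal j dm du) where
  mulCover := hM.mulCover hA
  unitCover := hM.unitCover hA
  assoc {x y w u s v} a b c d := by
    have := hM.ε_iso
    have := hM.μ_iso
    have := hM.faithful
    exact hM.monoidal.tensor_assoc_iff.symm
  lunit {i x y} e a f := by
    have := hM.ε_iso
    have := hM.μ_iso
    have := hM.faithful
    exact hM.monoidal.tensor_leftUnit_iff.symm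
  runit {i x y} e a f := by
    have := hM.ε_iso
    have := hM.μ_iso
    have := hM.faithful
    exact hM.monoidal.tensor_rightUnit_iff.symm

variable {C : Type} [Groupoid.{0} C] [SmoothStr C] [MonoidalCategory C]

/-- A 1-morphism to the 2-group modelled along `j` which is given by a functor `K` that is monoidally
isomorphic to `S ⋙ p ⋙ j` is covered by the 1-morphism given by `S`. -/
def homCover (hA : IsLieGroupoid A) (hC : IsSmoothMonoidal C) {S : C ⥤ A}
    {εS : 𝟙_ A ⟶ S.obj (𝟙_ C)}
    {μS : ∀ x y : C, S.obj x ⊗ S.obj y ⟶ S.obj (x ⊗ y)} {K : C ⥤ M} {εK : 𝟙_ M ⟶ K.obj (𝟙_ C)}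
    {μK : ∀ x y : C, K.obj x ⊗ K.obj y ⟶ K.obj (x ⊗ y)} (τ : K ⟶ S ⋙ p ⋙ j) [∀ x, IsIso (τ.app x)]
    (hε : εK ≫ τ.app (𝟙_ C) = ε ≫ (p ⋙ j).map εS)
    (hμ : ∀ x y, (τ.app x ⊗ₘ τ.app y) ≫ μ (S.obj x) (S.obj y) ≫ (p ⋙ j).map (μS x y) =
      μK x y ≫ τ.app (x ⊗ y))
    {d : DiffeologicalSpace (Σ x : C, Σ y : A, (S.obj x ⟶ y))}
    (hd : ∀ {n : ℕ} {x : Euc n → C} {y : Euc n → A} {b : ∀ v, S.obj (x v) ⟶ y v},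
      @IsPlot _ d n (fun v => ⟨x v, y v, b v⟩) ↔ IsPlot x ∧ SmoothArr b)
    {d' : DiffeologicalSpace (Σ x : C, Σ y : X, (K.obj x ⟶ j.obj y))}
    (hd' : ∀ {n : ℕ} {x : Euc n → C} {y : Euc n → A} {b : ∀ v, S.obj (x v) ⟶ y v}, IsPlot x →
      IsPlot y → (@IsPlot _ d' n (fun v => ⟨x v, p.obj (y v), τ.app (x v) ≫ (p ⋙ j).map (b v)⟩) ↔
        SmoothArr b))
    (hplots : ∀ {n : ℕ} {x : Euc n → C} {y : Euc n → X} {b : ∀ v, K.obj (x v) ⟶ j.obj (y v)},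
      @IsPlot _ d' n (fun v => ⟨x v, y v, b v⟩) → IsPlot x ∧ IsPlot y) :
    HomCover (TwoGroupCover.refl hC.isLieTwoGroup) (hM.twoGroupCover hA)
      (TwoGroupHom.ofMonoidal (𝟭 C) (𝟭 A) S εS μS d)
      (TwoGroupHom.ofMonoidal (𝟭 C) j K εK μK d') where
  bib :=
    { θ := fun {a b} c => τ.app a ≫ (p ⋙ j).map (X := S.obj a) (Y := b) c
      bij := fun a b => hM.iso_comp_bij (τ.app a)
      act := fun {a a' b b'} f c g => by
        have key : ∀ c : S.obj a ⟶ b, τ.app a' ≫ (p ⋙ j).map (S.map f ≫ c ≫ g) =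
            K.map f ≫ (τ.app a ≫ (p ⋙ j).map c) ≫ (p ⋙ j).map g := fun c => by
          rw [Category.assoc, NatTrans.naturality_assoc]
          simp
        exact key c
      smooth := fun {n x y c} hc => by
        obtain ⟨hx, hc⟩ := hd.1 hc
        exact (hd' hx (hA.isPlot_target hc)).2 hc
      smooth_lift := fun {n x y c} hx hy hc => hd.2 ⟨hx, (hd' hx hy).1 hc⟩
      plots := fun hc => hplots hc }
  φ {x y z x' y' z' a r k l b} := by
    have := hM.μ_iso
    have := hM.faithful
    have key : ∀ (a : x ⊗ y ⟶ z) (r : S.obj z ⟶ z') (k : S.obj x ⟶ x') (l : S.obj y ⟶ y')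
        (b : x' ⊗ y' ⟶ z'),
        ((τ.app x ≫ (p ⋙ j).map k) ⊗ₘ (τ.app y ≫ (p ⋙ j).map l)) ≫ μ x' y' ≫ (p ⋙ j).map b =
          μK x y ≫ K.map a ≫ τ.app z ≫ (p ⋙ j).map r ↔
        (k ⊗ₘ l) ≫ b = μS x y ≫ S.map a ≫ r := fun a r k l b => by
      have h := hM.monoidal.map_mul_iff (τ.app x) (τ.app y) (τ.app (x ⊗ y)) (S.map a ≫ r) k l b
        _ _ (hμ x y)
      rw [← h, NatTrans.naturality_assoc]
      simp
    exact key a r k l b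
  ε {i i' e k e'} := by
    have := hM.ε_iso
    have key : ∀ (e : 𝟙_ C ⟶ i) (k : S.obj i ⟶ i') (e' : 𝟙_ A ⟶ i'),
        εK ≫ K.map e ≫ τ.app i ≫ (p ⋙ j).map k = ε ≫ (p ⋙ j).map e' ↔
        εS ≫ S.map e ≫ k = e' := fun e k e' => by
      rw [NatTrans.naturality_assoc, ← Category.assoc, hε, Category.assoc, cancel_epi]
      have : (S ⋙ p ⋙ j).map e = (p ⋙ j).map (S.map e) := rfl
      rw [this, ← Functor.map_comp, ← Functor.map_comp, (hM.comp_bij _ _).1.eq_iff]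
    exact key e k e'

end IsMonoidalModel

end Models


/-! ### 1-morphisms between transported and modelled 2-groups -/

/-- The identity cover of a 1-morphism of 2-groups. -/
def HomCover.refl {A B : Type} [Groupoid.{0} A] [SmoothStr A] [Groupoid.{0} B] [SmoothStr B]
    {G : TwoGroupData A} {G' : TwoGroupData B} (hG : G.IsLieTwoGroup) (hG' : G'.IsLieTwoGroup)
    {F : TwoGroupHom G G'} (hF : F.bib.IsRightPrincipal) :
    HomCover (TwoGroupCover.refl hG) (TwoGroupCover.refl hG') F F where
  bib := BibCover.refl hF
  φ := Iff.rfl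
  ε := Iff.rfl

section FunctorBibundles

variable {C A X : Type} [Groupoid.{0} C] [SmoothStr C] [Groupoid.{0} A] [SmoothStr A]
  [Groupoid.{0} X] [SmoothStr X]

/-- The bibundle of a functor followed by a cover is covered by the bibundle of the functor. -/
def IsSmoothCover.functorCover {p : A ⥤ X} (hp : IsSmoothCover p) (hA : IsLieGroupoid A)
    (hX : IsLieGroupoid X) (F : C ⥤ A) (hF : DSmooth F.obj)
    {d : DiffeologicalSpace (Σ x : C, Σ y : A, (F.obj x ⟶ y))}
    (hd : ∀ {n : ℕ} {x : Euc n → C} {y : Euc n → A} {b : ∀ v, F.obj (x v) ⟶ y v},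
      @IsPlot _ d n (fun v => ⟨x v, y v, b v⟩) ↔ IsPlot x ∧ SmoothArr b) :
    BibCover (𝟭 C) p (Bibundle.ofFunctors (𝟭 C ⋙ F) (𝟭 A) d) (Bibundle.ofFunctor (F ⋙ p)) where
  θ {a b} c := p.map (X := F.obj a) (Y := b) c
  bij a b := hp.bij (F.obj a) b
  act {a a' b b'} f c g := by
    have key : ∀ c : F.obj a ⟶ b, p.map (F.map f ≫ c ≫ g) =
        p.map (F.map f) ≫ p.map c ≫ p.map g := fun c => by simp
    exact key c
  smooth hc := by
    obtain ⟨hx, hc⟩ := hd.1 hc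
    exact isPlot_prod.2 ⟨hx, hp.smooth hc⟩
  smooth_lift hx hy hc := hd.2 ⟨hx, hp.smooth_lift (hF _ _ hx) hy (isPlot_prod.1 hc).2⟩
  plots hc := ⟨(isPlot_prod.1 hc).1, (hX.hasSmoothEnds (isPlot_prod.1 hc).2).2⟩

/-- The identity bibundle of the target of a cover is covered by that of the source. -/
def IsSmoothCover.idCover {p : A ⥤ X} (hp : IsSmoothCover p) (hX : IsLieGroupoid X)
    {d : DiffeologicalSpace (Σ x : A, Σ y : A, (x ⟶ y))}
    (hd : ∀ {n : ℕ} {x : Euc n → A} {y : Euc n → A} {b : ∀ v, x v ⟶ y v},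
      @IsPlot _ d n (fun v => ⟨x v, y v, b v⟩) ↔ IsPlot x ∧ SmoothArr b) :
    BibCover p p (Bibundle.ofFunctors (𝟭 A ⋙ 𝟭 A) (𝟭 A) d) (Bibundle.ofFunctor (𝟭 X)) where
  θ {a b} c := p.map (X := a) (Y := b) c
  bij a b := hp.bij a b
  act {a a' b b'} f c g := by
    have key : ∀ c : a ⟶ b, p.map (f ≫ c ≫ g) = p.map f ≫ p.map c ≫ p.map g := fun c => by simp
    exact key c
  smooth hc := by
    obtain ⟨hx, hc⟩ := hd.1 hc
    exact isPlot_prod.2 ⟨hp.submersion.1 _ _ hx, hp.smooth hc⟩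
  smooth_lift hx hy hc := hd.2 ⟨hx, hp.smooth_lift hx hy (isPlot_prod.1 hc).2⟩
  plots hc := hX.hasSmoothEnds (isPlot_prod.1 hc).2

/-- The bibundle of the identity functor is invertible. -/
lemma isInvertible_id (hA : IsLieGroupoid A)
    {d : DiffeologicalSpace (Σ x : A, Σ y : A, (x ⟶ y))}
    (hd : ∀ {n : ℕ} {x : Euc n → A} {y : Euc n → A} {b : ∀ v, x v ⟶ y v},
      @IsPlot _ d n (fun v => ⟨x v, y v, b v⟩) ↔ IsPlot x ∧ SmoothArr b) :
    (Bibundle.ofFunctors (𝟭 A ⋙ 𝟭 A) (𝟭 A) d).IsInvertible where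
  right_mem _ := trivial
  right_surjective y _ := ⟨y, ⟨𝟙 y⟩⟩
  right_submersion n c v b hc _ hb := by
    obtain ⟨x, y, f⟩ := b
    change x ⟶ y at f
    obtain rfl : y = c v := hb
    obtain ⟨a', ha, hv, he⟩ := hA.target.2 n c v ⟨x, c v, f⟩ hc rfl
    exact ⟨a', hd.2 ⟨hA.source.1 _ _ ha, ha⟩, hv, he⟩
  division {x x' y} b b' := by
    change x ⟶ y at b
    change x' ⟶ y at b'
    have key : ∀ f : x ⟶ x', f ≫ b' ≫ 𝟙 y = b ↔ f = b ≫ inv b' := fun f => by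
      rw [Category.comp_id, IsIso.eq_comp_inv]
    exact ⟨b ≫ inv b', (key _).2 rfl, fun f hf => (key f).1 hf⟩
  division_smooth n x x' y b' f hb hf := by
    have hb := (hd.1 hb).2
    have hf := (hd.1 hf).2
    have := hA.smoothArr_comp hf (hA.smoothArr_inv' hb)
    have key : ∀ (b' : ∀ v, x' v ⟶ y v), f = fun v => (f v ≫ b' v ≫ 𝟙 (y v)) ≫ inv (b' v) :=
      fun b' => funext fun v => by simp
    rw [key b']
    exact this

end FunctorBibundles

section TransportHoms

variable {C A X : Type} [Groupoid.{0} C] [SmoothStr C] [MonoidalCategory C] [Groupoid.{0} A]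
  [SmoothStr A] [MonoidalCategory A] [Groupoid.{0} X] [SmoothStr X] {p : A ⥤ X}
  {F : C ⥤ A} {ε : 𝟙_ A ⟶ F.obj (𝟙_ C)} {μ : ∀ x y : C, F.obj x ⊗ F.obj y ⟶ F.obj (x ⊗ y)}

/-- The 1-morphism to a transported 2-group given by a monoidal functor is covered by the 1-morphism
to the original 2-group. -/
def transportHomCover (hp : IsSmoothCover p) (hC : IsSmoothMonoidal C) (hA : IsSmoothMonoidal A)
    (hX : IsLieGroupoid X) (hF : DSmooth F.obj)
    {d : DiffeologicalSpace (Σ x : C, Σ y : A, (F.obj x ⟶ y))}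
    (hd : ∀ {n : ℕ} {x : Euc n → C} {y : Euc n → A} {b : ∀ v, F.obj (x v) ⟶ y v},
      @IsPlot _ d n (fun v => ⟨x v, y v, b v⟩) ↔ IsPlot x ∧ SmoothArr b) :
    HomCover (TwoGroupCover.refl hC.isLieTwoGroup) (transportCover hp hA hX)
      (TwoGroupHom.ofMonoidal (𝟭 C) (𝟭 A) F ε μ d) (TwoGroupHom.toTransport p F ε μ) where
  bib := hp.functorCover hA.lie hX F hF hd
  φ {x y z x' y' z' a r k l b} := by
    have key : ∀ (a : x ⊗ y ⟶ z) (r : F.obj z ⟶ z') (k : F.obj x ⟶ x') (l : F.obj y ⟶ y')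
        (b : x' ⊗ y' ⟶ z'),
        toZigzag p b = zigzag p (F.obj x) (F.obj y) (Groupoid.inv (p.map k))
          (Groupoid.inv (p.map l)) (p.map (μ x y ≫ F.map a) ≫ p.map r) ↔
        (k ⊗ₘ l) ≫ b = μ x y ≫ F.map a ≫ r := fun a r k l b => by
      rw [← p.map_comp, zigzag_eq' (map_groupoid_inv _ _).symm (map_groupoid_inv _ _).symm rfl,
        (toZigzag_bijective hp _ _ _).1.eq_iff]
      constructor
      · rintro rfl
        rw [MonoidalCategory.tensorHom_comp_tensorHom_assoc]
        simp
      · intro h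
        rw [Category.assoc, ← h, MonoidalCategory.tensorHom_comp_tensorHom_assoc]
        simp
    exact key a r k l b
  ε {i i' e k e'} := by
    have key : ∀ (e : 𝟙_ C ⟶ i) (k : F.obj i ⟶ i') (e' : 𝟙_ A ⟶ i'),
        p.map e' = p.map (ε ≫ F.map e) ≫ p.map k ↔ ε ≫ F.map e ≫ k = e' := fun e k e' => by
      rw [← p.map_comp, (hp.bij _ _).1.eq_iff, Category.assoc, eq_comm]
    exact key e k e'

variable {M : Type*} [Category.{0} M] [MonoidalCategory M] {j : X ⥤ M}
  {ε : 𝟙_ M ⟶ (p ⋙ j).obj (𝟙_ A)}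
  {μ : ∀ x y : A, (p ⋙ j).obj x ⊗ (p ⋙ j).obj y ⟶ (p ⋙ j).obj (x ⊗ y)}
  {dm : DiffeologicalSpace (Σ p : X × X, Σ z : X, (j.obj p.1 ⊗ j.obj p.2 ⟶ j.obj z))}
  {du : DiffeologicalSpace (Σ _ : Pt, Σ z : X, (𝟙_ M ⟶ j.obj z))}

/-- The element of the multiplication modelled along `j` that corresponds to an element of the
transported multiplication. -/
def IsMonoidalModel.ofZigzag (hM : IsMonoidalModel p j ε μ dm du) {s t r : X} :
    Quot (ZigZag.Rel p (s := s) (t := t) (r := r)) → (j.obj s ⊗ j.obj t ⟶ j.obj r) :=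
  Quot.lift (fun a => (j.map a.f ⊗ₘ j.map a.g) ≫ μ a.x a.y ≫ j.map a.k) (by
    -- Moving h and l from the outer legs to the inner one is undone by naturality of μ.
    rintro _ _ ⟨f, g, h, l, k⟩
    have e := hM.monoidal.natural h l
    simp only [Functor.comp_map] at e
    simp only [Functor.map_comp, ← MonoidalCategory.tensorHom_comp_tensorHom, Category.assoc]
    rw [reassoc_of% e])

lemma IsMonoidalModel.ofZigzag_toZigzag (hM : IsMonoidalModel p j ε μ dm du) {x y z : A}
    (a : x ⊗ y ⟶ z) : hM.ofZigzag (toZigzag p a) = μ x y ≫ (p ⋙ j).map a := by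
  change (j.map (𝟙 _) ⊗ₘ j.map (𝟙 _)) ≫ μ x y ≫ j.map (p.map a) = _
  simp

/-- The 1-morphism from the transported 2-group to the one modelled along `j`. -/
def IsMonoidalModel.fromTransport (hM : IsMonoidalModel p j ε μ dm du) :
    TwoGroupHom (TwoGroupData.transport p) (TwoGroupData.ofMonoidal j dm du) where
  bib := Bibundle.ofFunctor (𝟭 X)
  φ {x y z x' y' z'} a r k l b :=
    (j.map (X := x) (Y := x') k ⊗ₘ j.map (X := y) (Y := y') l) ≫ b =
      hM.ofZigzag a ≫ j.map (X := z) (Y := z') r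
  ε {i i'} e k e' := e' = (ε ≫ j.map (X := p.obj (𝟙_ A)) (Y := i) e) ≫ j.map (X := i) (Y := i') k

/-- It is covered by the identity of `A`. -/
def IsMonoidalModel.fromTransportCover (hM : IsMonoidalModel p j ε μ dm du)
    (hA : IsSmoothMonoidal A) (hX : IsLieGroupoid X)
    {d : DiffeologicalSpace (Σ x : A, Σ y : A, (x ⟶ y))}
    (hd : ∀ {n : ℕ} {x : Euc n → A} {y : Euc n → A} {b : ∀ v, x v ⟶ y v},
      @IsPlot _ d n (fun v => ⟨x v, y v, b v⟩) ↔ IsPlot x ∧ SmoothArr b) :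
    HomCover (transportCover hM.cover hA hX) (hM.twoGroupCover hA.lie)
      (TwoGroupHom.ofMonoidal (𝟭 A) (𝟭 A) (𝟭 A) (𝟙 _) (fun _ _ => 𝟙 _) d) hM.fromTransport where
  bib := hM.cover.idCover hX hd
  φ {x y z x' y' z' a r k l b} := by
    have := hM.μ_iso
    have := hM.faithful
    have key : ∀ (a : x ⊗ y ⟶ z) (r : z ⟶ z') (k : x ⟶ x') (l : y ⟶ y') (b : x' ⊗ y' ⟶ z'),
        ((p ⋙ j).map k ⊗ₘ (p ⋙ j).map l) ≫ μ x' y' ≫ (p ⋙ j).map b =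
          hM.ofZigzag (toZigzag p a) ≫ (p ⋙ j).map r ↔
        (k ⊗ₘ l) ≫ b = 𝟙 (x ⊗ y) ≫ a ≫ r := fun a r k l b => by
      rw [hM.ofZigzag_toZigzag, Category.id_comp, Category.assoc, ← Functor.map_comp,
        ← Category.assoc, hM.monoidal.natural, Category.assoc, ← Functor.map_comp, cancel_epi]
      exact (p ⋙ j).map_injective.eq_iff
    exact key a r k l b
  ε {i i' e k e'} := by
    have := hM.ε_iso
    have key : ∀ (e : 𝟙_ A ⟶ i) (k : i ⟶ i') (e' : 𝟙_ A ⟶ i'),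
        ε ≫ (p ⋙ j).map e' = (ε ≫ (p ⋙ j).map e) ≫ (p ⋙ j).map k ↔ 𝟙 _ ≫ e ≫ k = e' :=
        fun e k e' => by
      rw [Category.assoc, cancel_epi, ← Functor.map_comp, (hM.comp_bij _ _).1.eq_iff,
        Category.id_comp, eq_comm]
    exact key e k e'

end TransportHoms

/-! ### Composition with the identity and with projections to a Lie group -/

section CompIso

variable {C A : Type} [Groupoid.{0} C] [SmoothStr C] [MonoidalCategory C] [Groupoid.{0} A]
  [SmoothStr A] [MonoidalCategory A]
  {S : C ⥤ A} {ε : 𝟙_ A ⟶ S.obj (𝟙_ C)} {μ : ∀ x y : C, S.obj x ⊗ S.obj y ⟶ S.obj (x ⊗ y)}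

/-- Composition with the identity 1-morphism. -/
lemma isCompIso_id (hA : IsSmoothMonoidal A)
    {d : DiffeologicalSpace (Σ x : C, Σ y : A, (S.obj x ⟶ y))}
    (hd : ∀ {n : ℕ} {x : Euc n → C} {y : Euc n → A} {b : ∀ v, S.obj (x v) ⟶ y v},
      @IsPlot _ d n (fun v => ⟨x v, y v, b v⟩) ↔ IsPlot x ∧ SmoothArr b)
    {d' : DiffeologicalSpace (Σ x : A, Σ y : A, (x ⟶ y))}
    (hd' : ∀ {n : ℕ} {x : Euc n → A} {y : Euc n → A} {b : ∀ v, x v ⟶ y v},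
      @IsPlot _ d' n (fun v => ⟨x v, y v, b v⟩) ↔ IsPlot x ∧ SmoothArr b) :
    TwoGroupHom.IsCompIso
      (TwoGroupHom.ofMonoidal (𝟭 C) (𝟭 A) S ε μ d :
        TwoGroupHom (TwoGroupData.ofStrict C) (TwoGroupData.ofStrict A))
      (TwoGroupHom.ofMonoidal (𝟭 A) (𝟭 A) (𝟭 A) (𝟙 _) (fun _ _ => 𝟙 _) d' :
        TwoGroupHom (TwoGroupData.ofStrict A) (TwoGroupData.ofStrict A))
      (TwoGroupHom.ofMonoidal (𝟭 C) (𝟭 A) S ε μ d :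
        TwoGroupHom (TwoGroupData.ofStrict C) (TwoGroupData.ofStrict A))
      (fun {x y z} (k : S.obj x ⟶ y) (l : y ⟶ z) (r : S.obj x ⟶ z) => k ≫ l = r) where
  existsUnique {x y z} k l := ⟨_, rfl, fun r hr => Eq.symm hr⟩
  equivariant {x x₁ y y₁ z z₁} k l r f g h hrel := by
    have key : ∀ (k : S.obj x ⟶ y) (l : y ⟶ z) (r : S.obj x ⟶ z), k ≫ l = r →
        (S.map f ≫ k ≫ g) ≫ Groupoid.inv g ≫ l ≫ h = S.map f ≫ r ≫ h := by
      rintro k l _ rfl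
      simp
    exact key k l r hrel
  smooth n x y z k l r hrel hk hl := by
    have key : ∀ (k : ∀ t, S.obj (x t) ⟶ y t) (l : ∀ t, y t ⟶ z t) (r : ∀ t, S.obj (x t) ⟶ z t),
        (∀ t, k t ≫ l t = r t) → SmoothArr k → SmoothArr l → SmoothArr r := by
      intro k l r h hk hl
      obtain rfl : (fun t => k t ≫ l t) = r := funext h
      exact hA.lie.smoothArr_comp hk hl
    exact hd.2 ⟨(hd.1 hk).1, key k l r hrel (hd.1 hk).2 (hd'.1 hl).2⟩
  mul {x₁ x₂ x₃ y₁ y₂ y₃ z₁ z₂ z₃} a b c k₁ k₂ k₃ l₁ l₂ l₃ m₁ m₂ m₃ h h' e₁ e₂ e₃ := by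
    have key : ∀ (a : x₁ ⊗ x₂ ⟶ x₃) (b : y₁ ⊗ y₂ ⟶ y₃) (c : z₁ ⊗ z₂ ⟶ z₃) (k₁ : S.obj x₁ ⟶ y₁)
        (k₂ : S.obj x₂ ⟶ y₂) (k₃ : S.obj x₃ ⟶ y₃) (l₁ : y₁ ⟶ z₁) (l₂ : y₂ ⟶ z₂) (l₃ : y₃ ⟶ z₃)
        (m₁ : S.obj x₁ ⟶ z₁) (m₂ : S.obj x₂ ⟶ z₂) (m₃ : S.obj x₃ ⟶ z₃),
        (k₁ ⊗ₘ k₂) ≫ b = μ x₁ x₂ ≫ S.map a ≫ k₃ → (l₁ ⊗ₘ l₂) ≫ c = 𝟙 _ ≫ b ≫ l₃ →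
        k₁ ≫ l₁ = m₁ → k₂ ≫ l₂ = m₂ → k₃ ≫ l₃ = m₃ →
        (m₁ ⊗ₘ m₂) ≫ c = μ x₁ x₂ ≫ S.map a ≫ m₃ := by
      rintro a b c k₁ k₂ k₃ l₁ l₂ l₃ _ _ _ h h' rfl rfl rfl
      rw [← MonoidalCategory.tensorHom_comp_tensorHom_assoc, h', Category.id_comp,
        reassoc_of% h]
    exact key a b c k₁ k₂ k₃ l₁ l₂ l₃ m₁ m₂ m₃ h h' e₁ e₂ e₃
  unit {i i' i''} e e' e'' k l m h h' hrel := by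
    have key : ∀ (e : 𝟙_ C ⟶ i) (e' : 𝟙_ A ⟶ i') (e'' : 𝟙_ A ⟶ i'') (k : S.obj i ⟶ i')
        (l : i' ⟶ i'') (m : S.obj i ⟶ i''), ε ≫ S.map e ≫ k = e' → 𝟙 _ ≫ e' ≫ l = e'' →
        k ≫ l = m → ε ≫ S.map e ≫ m = e'' := by
      rintro e _ _ k l _ rfl rfl rfl
      simp
    exact key e e' e'' k l m h h' hrel

/-- Any 1-morphism of 2-groups over `T` is compatible with the projections to `T`. -/
lemma isCompIso_toDiscrete {X Y T : Type} [Groupoid.{0} X] [SmoothStr X] [Groupoid.{0} Y]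
    [SmoothStr Y] [AddCommGroup T] [DiffeologicalSpace T] {G : TwoGroupData X} {H : TwoGroupData Y}
    {F : TwoGroupHom G H} {π : X ⥤ Discrete T} {ρ : Y ⥤ Discrete T} (hπ : DSmooth π.obj)
    (hF : F.bib.IsRightPrincipal) (h : ∀ {x y}, F.bib.Fib x y → π.obj x = ρ.obj y) :
    TwoGroupHom.IsCompIso F (TwoGroupHom.toDiscrete H ρ) (TwoGroupHom.toDiscrete G π)
      (fun _ _ _ => True) where
  existsUnique {x y z} k l := ⟨eqToHom ((h k).trans (Discrete.ext (Discrete.eq_of_hom l))), trivial,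
    fun _ _ => Subsingleton.elim (α := (π.obj x ⟶ z)) _ _⟩
  equivariant _ _ _ _ _ _ _ := trivial
  smooth n x y z k l r _ hk hl :=
    have hx : IsPlot x := hF.left_submersion.1 _ _ hk
    isPlot_prod.2 ⟨hx, hπ _ _ hx⟩
  mul _ _ _ _ _ _ _ _ _ _ _ _ _ _ _ _ _ := trivial
  unit _ _ _ _ _ _ _ _ _ := trivial

end CompIso


/-! ## The strict 2-groups as monoidal categories -/

/-- Tensor product and composition are both multiplication in U(1), so interchange holds because
U(1) is commutative. -/
noncomputable instance : MonoidalCategory BU1 :=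
  MonoidalCategory.ofTensorHom
    (id_tensorHom_id := fun _ _ => one_mul (1 : Circle))
    (id_tensorHom := fun _ _ _ f => one_mul (show Circle from f))
    (tensorHom_id := fun f _ => mul_one (show Circle from f))
    (tensorHom_comp_tensorHom := fun {_ _ _ _ _ _} f₁ f₂ g₁ g₂ => mul_mul_mul_comm (G := Circle) g₁ g₂ f₁ f₂)
    (associator_naturality := fun f g h =>
      (one_mul (M := Circle) _).trans ((mul_assoc (G := Circle) f g h).trans (mul_one (M := Circle) _).symm))
    (leftUnitor_naturality := fun f =>
      (one_mul (M := Circle) _).trans (one_mul (M := Circle) f) |>.trans (mul_one (M := Circle) _).symm)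
    (rightUnitor_naturality := fun f =>
      (one_mul (M := Circle) _).trans (mul_one (M := Circle) f) |>.trans (mul_one (M := Circle) _).symm)
    (pentagon := fun _ _ _ _ => by
      change (((1 * 1) * 1) * (1 * 1) : Circle) = 1 * 1
      simp)
    (triangle := fun _ _ => mul_one (M := Circle) _)

namespace CrossedModule

variable {G H : Type} [Group G] [Group H] {c : CrossedModule G H}

lemma TwoGp.hom_ext {x y : c.TwoGp} {f g : x ⟶ y} (h : Hom.h f = Hom.h g) : f = g := Hom.ext h

lemma TwoGp.comp_h {x y z : c.TwoGp} (f : x ⟶ y) (g : y ⟶ z) : Hom.h (f ≫ g) = Hom.h f * Hom.h g :=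
  rfl

lemma TwoGp.id_h (x : c.TwoGp) : Hom.h (𝟙 x) = 1 := rfl

lemma TwoGp.eqToHom_h {x y : c.TwoGp} (h : x = y) : Hom.h (eqToHom h) = 1 := by
  subst h
  rfl

lemma TwoGp.tensorHom_h {x x' y y' : c.TwoGp} (f : x ⟶ x') (g : y ⟶ y') :
    Hom.h (f ⊗ₘ g) = c.act y.val (Hom.h f) * Hom.h g := rfl

lemma TwoGp.associator_h (x y z : c.TwoGp) : Hom.h (α_ x y z).hom = 1 :=
  TwoGp.eqToHom_h (TwoGp.ext (mul_assoc _ _ _))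

lemma TwoGp.leftUnitor_h (x : c.TwoGp) : Hom.h (λ_ x).hom = 1 :=
  TwoGp.eqToHom_h (TwoGp.ext (one_mul _))

lemma TwoGp.rightUnitor_h (x : c.TwoGp) : Hom.h (ρ_ x).hom = 1 :=
  TwoGp.eqToHom_h (TwoGp.ext (mul_one _))

/-- The constraints have label 1, so every law is an identity in H. Interchange is the Peiffer
identity, and naturality of the associator is compatibility of the action with products. -/
instance : MonoidalCategory c.TwoGp :=
  MonoidalCategory.ofTensorHom
    (id_tensorHom_id := fun _ _ => TwoGp.hom_ext (by simp [TwoGp.tensorHom_h, TwoGp.id_h]))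
    (id_tensorHom := fun _ _ _ f => rfl)
    (tensorHom_id := fun f _ => rfl)
    (tensorHom_comp_tensorHom := fun {_ _ _ _ y z} f₁ f₂ g₁ g₂ => TwoGp.hom_ext (by
      simp only [TwoGp.tensorHom_h, TwoGp.comp_h, map_mul]
      -- The second tensor product acts through the target of f₂, which differs from its source by a
      -- boundary; by the Peiffer identity that boundary acts by conjugation and lets the two middle
      -- labels pass each other.
      have hy : y.val = _ := Hom.eq f₂
      rw [hy, c.act_mul, c.peiffer]
      group))
    (associator_naturality := fun f g h => TwoGp.hom_ext (by
      simp only [TwoGp.tensorHom_h, TwoGp.comp_h, TwoGp.associator_h, map_mul, mul_one, one_mul]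
      change c.act _ (c.act _ _) * _ * _ = c.act (_ * _) _ * _
      rw [c.act_mul, mul_assoc]))
    (leftUnitor_naturality := fun f => TwoGp.hom_ext (by
      simp [TwoGp.tensorHom_h, TwoGp.comp_h, TwoGp.leftUnitor_h, TwoGp.id_h]))
    (rightUnitor_naturality := fun f => TwoGp.hom_ext (by
      simp only [TwoGp.tensorHom_h, TwoGp.comp_h, TwoGp.rightUnitor_h, TwoGp.id_h, mul_one, one_mul]
      exact c.act_one _))
    (pentagon := fun _ _ _ _ => TwoGp.hom_ext (by
      simp [TwoGp.tensorHom_h, TwoGp.comp_h, TwoGp.associator_h, TwoGp.id_h]))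
    (triangle := fun _ _ => TwoGp.hom_ext (by
      simp [TwoGp.tensorHom_h, TwoGp.comp_h, TwoGp.associator_h, TwoGp.leftUnitor_h,
        TwoGp.rightUnitor_h, TwoGp.id_h]))

end CrossedModule



/-! ## The monoidal groupoid of the gerbe -/

section GerbeMonoidal

variable {Λ : Type} [AddCommGroup Λ] {J : LinearMap.BilinForm ℤ Λ}

lemma HermLine.exists_smul_eq (L : HermLine) {u : L.carrier} (hu : u ≠ 0) (v : L.carrier) :
    ∃ c : ℂ, c • u = v :=
  (finrank_eq_one_iff_of_nonzero' u hu).1 L.finrank_eq v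

lemma HermLine.exists_ne_zero (L : HermLine) : ∃ u : L.carrier, u ≠ 0 := by
  have : Module.finrank ℂ L.carrier ≠ 0 := by rw [L.finrank_eq]; simp
  by_contra! h
  have : Subsingleton L.carrier := ⟨fun a b => (h a).trans (h b).symm⟩
  exact absurd Module.finrank_zero_of_subsingleton ‹Module.finrank ℂ L.carrier ≠ 0›

lemma HermLine.tmul_ne_zero {L M : HermLine} {u : L.carrier} {v : M.carrier} (hu : u ≠ 0)
    (hv : v ≠ 0) : tmul u v ≠ 0 := by
  have : ‖tmul u v‖ = ‖u‖ * ‖v‖ := TensorProduct.norm_tmul u v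
  rw [← norm_ne_zero_iff, this]
  exact mul_ne_zero (norm_ne_zero_iff.2 hu) (norm_ne_zero_iff.2 hv)

lemma fibTriv_fibMk {s t : Torus Λ} (x y : LieT Λ) (hx : texp x = s) (hy : texp y = t) (z : ℂ) :
    fibTriv J x y hx hy (fibMk J z x y hx hy) = z :=
  (frame J x y hx hy).symm_apply_apply z

lemma fibTriv_fibMk' {s t : Torus Λ} {x y x' y' : LieT Λ} {m n : Λ} (hx : texp x = s)
    (hy : texp y = t) (hx' : texp x' = s) (hy' : texp y' = t) (ex : x' = x + lattice Λ m)
    (ey : y' = y + lattice Λ n) (z : ℂ) :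
    fibTriv J x' y' hx' hy' (fibMk J z x y hx hy) = (multiplier J m y * z : ℂ) := by
  subst ex ey
  exact fibTriv_mk J x y m n hx hy hx' hy' z

lemma fibMk_ne_zero {s t : Torus Λ} (x y : LieT Λ) (hx : texp x = s) (hy : texp y = t) :
    fibMk J 1 x y hx hy ≠ 0 := fun h => by
  have e := fibTriv_fibMk (J := J) x y hx hy 1
  rw [h, map_zero] at e
  exact zero_ne_one (α := ℂ) e

namespace Gerbe

/-- The action of an arrow on vectors. -/
def app {a b : Gerbe J} (f : a ⟶ b) (u : a.line.carrier) : b.line.carrier := GerbeHom.iso f u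

lemma app_id (a : Gerbe J) (u : a.line.carrier) : app (𝟙 a) u = u := rfl

lemma app_comp {a b c : Gerbe J} (f : a ⟶ b) (g : b ⟶ c) (u : a.line.carrier) :
    app (f ≫ g) u = app g (app f u) := rfl

lemma app_smul {a b : Gerbe J} (f : a ⟶ b) (c : ℂ) (u : a.line.carrier) :
    app f (c • u) = c • app f u := map_smul (GerbeHom.iso f) c u

/-- A linear map out of a one-dimensional space is determined by a single nonzero vector.
Consequently every coherence law in ℐ need only be evaluated on one vector [1, x, y] ⊗ u ⊗ v. -/
lemma hom_ext {a b : Gerbe J} {f g : a ⟶ b} {u : a.line.carrier} (hu : u ≠ 0)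
    (h : app f u = app g u) : f = g := by
  refine GerbeHom.ext (LinearIsometryEquiv.ext fun v => ?_)
  obtain ⟨c, rfl⟩ := a.line.exists_smul_eq hu v
  exact (app_smul f c u).trans ((congrArg (c • ·) h).trans (app_smul g c u).symm)

/-- The vector `[1, x, y] ⊗ u ⊗ v`. -/
noncomputable def tmk {a b : Gerbe J} (x y : LieT Λ) (hx : texp x = a.base) (hy : texp y = b.base)
    (u : a.line.carrier) (v : b.line.carrier) : (a ⊗ b).line.carrier :=
  HermLine.tmul (fibMk J 1 x y hx hy) (HermLine.tmul u v)

lemma tmk_ne_zero {a b : Gerbe J} {x y : LieT Λ} {hx : texp x = a.base} {hy : texp y = b.base}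
    {u : a.line.carrier} {v : b.line.carrier} (hu : u ≠ 0) (hv : v ≠ 0) :
    tmk x y hx hy u v ≠ 0 :=
  HermLine.tmul_ne_zero (fibMk_ne_zero x y hx hy) (HermLine.tmul_ne_zero hu hv)

lemma tmk_congr {a b : Gerbe J} {x y x' y' : LieT Λ} {hx : texp x = a.base} {hy : texp y = b.base}
    (ex : x = x') (ey : y = y') (u : a.line.carrier) (v : b.line.carrier) :
    tmk x y hx hy u v = tmk x' y' (ex ▸ hx) (ey ▸ hy) u v := by
  subst ex ey
  rfl

lemma app_tensorHom {a b c d : Gerbe J} (f : a ⟶ c) (g : b ⟶ d) (x y : LieT Λ)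
    (hx : texp x = a.base) (hy : texp y = b.base) (u : a.line.carrier) (v : b.line.carrier) :
    app (f ⊗ₘ g) (tmk x y hx hy u v) =
      tmk x y (hx.trans (GerbeHom.base_eq f)) (hy.trans (GerbeHom.base_eq g)) (app f u)
        (app g v) := by
  obtain ⟨s, L⟩ := a
  obtain ⟨t, M⟩ := b
  obtain ⟨s', L'⟩ := c
  obtain ⟨t', M'⟩ := d
  obtain ⟨e, f⟩ := f
  obtain ⟨e', g⟩ := g
  obtain rfl : s = s' := e
  obtain rfl : t = t' := e'
  rfl

/-- By `gerbeAlpha_mk`, α introduces no scalar when the lifts are added compatibly, namely x + y on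
one side and y + z on the other; the remaining isomorphisms only permute tensor factors. -/
lemma app_associator {a b c : Gerbe J} (x y z : LieT Λ) (hx : texp x = a.base)
    (hy : texp y = b.base) (hz : texp z = c.base) (hxy : texp (x + y) = (a ⊗ b).base)
    (hyz : texp (y + z) = (b ⊗ c).base) (u : a.line.carrier) (v : b.line.carrier)
    (w : c.line.carrier) :
    app (α_ a b c).hom (tmk (x + y) z hxy hz (tmk x y hx hy u v) w) =
      tmk x (y + z) hx hyz u (tmk y z hy hz v w) := by
  obtain ⟨s, L⟩ := a
  obtain ⟨t, M⟩ := b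
  obtain ⟨r, N⟩ := c
  obtain rfl : texp x = s := hx
  obtain rfl : texp y = t := hy
  obtain rfl : texp z = r := hz
  have h := congrArg (fun q => HermLine.reassocRight _ _ _ _
    (HermLine.tmul q (HermLine.tmul u (HermLine.tmul v w)))) (gerbeAlpha_mk J x y z 1 1)
  exact h

/-- A vector of the line of the unit object. -/
def unitVec (z : ℂ) : (𝟙_ (Gerbe J)).line.carrier := z

lemma unitVec_ne_zero : unitVec (J := J) 1 ≠ 0 := one_ne_zero (α := ℂ)

/-- The unitor uses the trivialization at (0, `rep`). Changing only the second lift costs the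
multiplier of the lattice vector 0, which is 1. -/
lemma app_leftUnitor {a : Gerbe J} (y : LieT Λ) (h : texp 0 = (𝟙_ (Gerbe J)).base)
    (hy : texp y = a.base) (z : ℂ) (u : a.line.carrier) :
    app (λ_ a).hom (tmk 0 y h hy (unitVec z) u) = z • u := by
  obtain ⟨n, hn⟩ := exists_lattice_of_texp_eq (hy.trans (texp_rep a.base).symm)
  have e := fibTriv_fibMk' (J := J) (m := 0) h hy
    (QuotientAddGroup.mk_zero _) (texp_rep a.base) (by simp) hn 1
  rw [multiplier_zero_left, Circle.coe_one, one_mul] at e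
  have h := congrArg (fun q => HermLine.lidIso a.line (HermLine.tmul q (z • u))) e
  exact h.trans (one_smul ℂ _)

/-- Here the first lift changes by n, at the cost of exp(J(n, 0)) = 1. -/
lemma app_rightUnitor {a : Gerbe J} (x : LieT Λ) (h : texp 0 = (𝟙_ (Gerbe J)).base)
    (hx : texp x = a.base) (z : ℂ) (u : a.line.carrier) :
    app (ρ_ a).hom (tmk x 0 hx h u (unitVec z)) = z • u := by
  obtain ⟨n, hn⟩ := exists_lattice_of_texp_eq (hx.trans (texp_rep a.base).symm)
  have e := fibTriv_fibMk' (J := J) (n := 0) hx h (texp_rep a.base)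
    (QuotientAddGroup.mk_zero _) hn (by simp) 1
  rw [multiplier_zero_right, Circle.coe_one, one_mul] at e
  have h := congrArg (fun q => HermLine.lidIso a.line (HermLine.tmul q (z • u))) e
  exact h.trans (one_smul ℂ _)

lemma exists_rep (a : Gerbe J) : ∃ x : LieT Λ, texp x = a.base := ⟨_, texp_rep _⟩

lemma texp_add {a b : Gerbe J} {x y : LieT Λ} (hx : texp x = a.base) (hy : texp y = b.base) :
    texp (x + y) = (a ⊗ b).base := congrArg₂ (· + ·) hx hy

lemma texp_zero : texp 0 = (𝟙_ (Gerbe J)).base := QuotientAddGroup.mk_zero _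

/-- Lifts of the base points and nonzero vectors of the lines are fixed, and each law is evaluated
on the resulting vector. Arrows leave the lifts unchanged and the constraints act without scalars,
so both sides give the same vector. -/
noncomputable instance : MonoidalCategory (Gerbe J) :=
  MonoidalCategory.ofTensorHom
    (id_tensorHom_id := fun a b => by
      obtain ⟨x, hx⟩ := a.exists_rep
      obtain ⟨y, hy⟩ := b.exists_rep
      obtain ⟨u, hu⟩ := a.line.exists_ne_zero
      obtain ⟨v, hv⟩ := b.line.exists_ne_zero
      refine hom_ext (tmk_ne_zero (hx := hx) (hy := hy) hu hv) ?_
      rw [app_tensorHom]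
      rfl)
    (id_tensorHom := fun _ _ _ _ => rfl)
    (tensorHom_id := fun _ _ => rfl)
    (tensorHom_comp_tensorHom := fun {a _ _ b _ _} f₁ f₂ g₁ g₂ => by
      obtain ⟨x, hx⟩ := a.exists_rep
      obtain ⟨y, hy⟩ := b.exists_rep
      obtain ⟨u, hu⟩ := a.line.exists_ne_zero
      obtain ⟨v, hv⟩ := b.line.exists_ne_zero
      refine hom_ext (tmk_ne_zero (hx := hx) (hy := hy) hu hv) ?_
      rw [app_comp, app_tensorHom, app_tensorHom, app_tensorHom, app_comp, app_comp])
    (associator_naturality := fun {a b c _ _ _} f g h => by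
      obtain ⟨x, hx⟩ := a.exists_rep
      obtain ⟨y, hy⟩ := b.exists_rep
      obtain ⟨z, hz⟩ := c.exists_rep
      obtain ⟨u, hu⟩ := a.line.exists_ne_zero
      obtain ⟨v, hv⟩ := b.line.exists_ne_zero
      obtain ⟨w, hw⟩ := c.line.exists_ne_zero
      refine hom_ext (tmk_ne_zero (hx := texp_add hx hy) (hy := hz)
        (tmk_ne_zero (hx := hx) (hy := hy) hu hv) hw) ?_
      rw [app_comp, app_comp, app_tensorHom, app_tensorHom, app_associator, app_associator,
        app_tensorHom, app_tensorHom]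
      exact texp_add hy hz)
    (leftUnitor_naturality := fun {a _} f => by
      obtain ⟨x, hx⟩ := a.exists_rep
      obtain ⟨u, hu⟩ := a.line.exists_ne_zero
      refine hom_ext (tmk_ne_zero (hx := texp_zero) (hy := hx) unitVec_ne_zero hu) ?_
      rw [app_comp, app_comp, app_tensorHom, app_id, app_leftUnitor, app_leftUnitor, app_smul])
    (rightUnitor_naturality := fun {a _} f => by
      obtain ⟨x, hx⟩ := a.exists_rep
      obtain ⟨u, hu⟩ := a.line.exists_ne_zero
      refine hom_ext (tmk_ne_zero (hx := hx) (hy := texp_zero) hu unitVec_ne_zero) ?_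
      rw [app_comp, app_comp, app_tensorHom, app_id, app_rightUnitor, app_rightUnitor, app_smul])
    (pentagon := fun a b c d => by
      obtain ⟨x, hx⟩ := a.exists_rep
      obtain ⟨y, hy⟩ := b.exists_rep
      obtain ⟨z, hz⟩ := c.exists_rep
      obtain ⟨w, hw⟩ := d.exists_rep
      obtain ⟨u₁, h₁⟩ := a.line.exists_ne_zero
      obtain ⟨u₂, h₂⟩ := b.line.exists_ne_zero
      obtain ⟨u₃, h₃⟩ := c.line.exists_ne_zero
      obtain ⟨u₄, h₄⟩ := d.line.exists_ne_zero
      refine hom_ext (tmk_ne_zero (hx := texp_add (texp_add hx hy) hz) (hy := hw)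
        (tmk_ne_zero (hx := texp_add hx hy) (hy := hz)
        (tmk_ne_zero (hx := hx) (hy := hy) h₁ h₂) h₃) h₄) ?_
      -- The vectors depend on the lifts themselves and not only on their images in T, so sums of
      -- lifts must be reassociated explicitly by `tmk_congr` where the bracketings of the two paths
      -- differ.
      rw [app_comp, app_comp, app_comp, app_tensorHom, app_associator x y z hx hy hz _
        (texp_add hy hz), app_id, tmk_congr (add_assoc x y z) rfl,
        app_associator x (y + z) w _ _ _ _ (texp_add (texp_add hy hz) hw), app_tensorHom,
        app_associator y z w _ _ _ _ (texp_add hz hw), app_id,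
        app_associator (x + y) z w _ _ _ _ (texp_add hz hw),
        app_associator x y (z + w) _ _ _ _ (texp_add hy (texp_add hz hw))]
      exact tmk_congr rfl (add_assoc y z w) _ _)
    (triangle := fun a b => by
      obtain ⟨x, hx⟩ := a.exists_rep
      obtain ⟨y, hy⟩ := b.exists_rep
      obtain ⟨u, hu⟩ := a.line.exists_ne_zero
      obtain ⟨v, hv⟩ := b.line.exists_ne_zero
      refine hom_ext (tmk_ne_zero (hx := texp_add hx texp_zero) (hy := hy)
        (tmk_ne_zero (hx := hx) (hy := texp_zero) hu unitVec_ne_zero) hv) ?_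
      rw [app_comp, app_associator x 0 y _ _ _ _ (texp_add texp_zero hy), app_tensorHom,
        app_tensorHom, app_leftUnitor, app_rightUnitor, one_smul, one_smul]
      exact (tmk_congr rfl (zero_add y) _ _).trans (tmk_congr (add_zero x).symm rfl _ _))

end Gerbe

end GerbeMonoidal


/-! ## The monoidal equivalence -/

section GerbeFunctor

variable {Λ : Type} [AddCommGroup Λ] {J : LinearMap.BilinForm ℤ Λ}

lemma StrictT.val_eq {x y : StrictT J} (f : x ⟶ y) :
    y.val.toAdd = x.val.toAdd + lattice Λ (CrossedModule.Hom.h f).1.toAdd :=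
  congrArg Multiplicative.toAdd (CrossedModule.Hom.eq f)

lemma StrictT.tensorHom_label {x x' y y' : StrictT J} (f : x ⟶ x') (g : y ⟶ y') :
    (CrossedModule.Hom.h (f ⊗ₘ g)).2 = (CrossedModule.Hom.h f).2 *
      multiplier J (CrossedModule.Hom.h f).1.toAdd y.val.toAdd * (CrossedModule.Hom.h g).2 := rfl

lemma StrictT.tensor_val (x y : StrictT J) :
    x.val.toAdd + y.val.toAdd = (x ⊗ y).val.toAdd := rfl

lemma StrictT.unit_val : 0 = (𝟙_ (StrictT J)).val.toAdd := rfl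

lemma texp_base (x : StrictT J) : texp x.val.toAdd = ((gerbeFunctor J).obj x).base := rfl

/-- A vector of the line of `F x`. -/
def gerbeVec (x : StrictT J) (z : ℂ) : ((gerbeFunctor J).obj x).line.carrier := z

lemma gerbeVec_ne_zero (x : StrictT J) : gerbeVec x 1 ≠ 0 := one_ne_zero (α := ℂ)

lemma gerbeVec_smul (x : StrictT J) (z : ℂ) : z • gerbeVec x 1 = gerbeVec x z :=
  mul_one (M := ℂ) z

lemma app_gerbeFunctor {x y : StrictT J} (f : x ⟶ y) (z : ℂ) :
    Gerbe.app ((gerbeFunctor J).map f) (gerbeVec x z) =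
      gerbeVec y ((CrossedModule.Hom.h f).2 * z) := rfl

lemma app_gerbeFunctorε (z : ℂ) :
    Gerbe.app (gerbeFunctorε J) (Gerbe.unitVec z) = gerbeVec (𝟙_ (StrictT J)) z := rfl

/-- φ is the trivialization at the lifts given by the objects x and y; evaluating it on a vector
written with other lifts a, b produces the multiplier of the change of frame. -/
lemma app_gerbeFunctorφ (x y : StrictT J) {a b : LieT Λ} {m n : Λ}
    (ha : texp a = ((gerbeFunctor J).obj x).base) (hb : texp b = ((gerbeFunctor J).obj y).base)
    (hm : x.val.toAdd = a + lattice Λ m) (hn : y.val.toAdd = b + lattice Λ n) (u v : ℂ) :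
    Gerbe.app (gerbeFunctorφ J x y) (Gerbe.tmk a b ha hb (gerbeVec x u) (gerbeVec y v)) =
      gerbeVec (x ⊗ y) (multiplier J m b * (u * v)) := by
  have e := fibTriv_fibMk' (J := J) ha hb rfl rfl hm hn 1
  rw [mul_one] at e
  exact congrArg (fun q => HermLine.lidIso HermLine.std (HermLine.tmul q (show ℂ from u * v))) e

lemma app_gerbeFunctorφ_self (x y : StrictT J) {a b : LieT Λ}
    {ha : texp a = ((gerbeFunctor J).obj x).base} {hb : texp b = ((gerbeFunctor J).obj y).base}
    (hm : a = x.val.toAdd) (hn : b = y.val.toAdd) (u v : ℂ) :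
    Gerbe.app (gerbeFunctorφ J x y) (Gerbe.tmk a b ha hb (gerbeVec x u) (gerbeVec y v)) =
      gerbeVec (x ⊗ y) (u * v) := by
  rw [app_gerbeFunctorφ x y (m := 0) (n := 0) ha hb (by simp [hm]) (by simp [hn]),
    multiplier_zero_left, Circle.coe_one, one_mul]

lemma gerbe_tmk_ne_zero {x y : StrictT J} {a b : LieT Λ}
    {ha : texp a = ((gerbeFunctor J).obj x).base} {hb : texp b = ((gerbeFunctor J).obj y).base} :
    Gerbe.tmk a b ha hb (gerbeVec x 1) (gerbeVec y 1) ≠ 0 :=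
  Gerbe.tmk_ne_zero (gerbeVec_ne_zero x) (gerbeVec_ne_zero y)

/-- Naturality is the crucial law. Arrows of ℐ keep the vector [1, x, y], whereas φ at the targets
trivializes at x + m and y + n, so exp(J(m, y)) appears; this is exactly the twist in the label of
the tensor product of two arrows of the strict 2-group. For associativity and units all lifts
already match and no multiplier occurs. -/
theorem gerbeFunctor_isMonoidal :
    IsMonoidalFunctor (gerbeFunctor J) (gerbeFunctorε J) (gerbeFunctorφ J) where
  natural {x x' y y'} f g := by
    refine Gerbe.hom_ext (gerbe_tmk_ne_zero (ha := texp_base _) (hb := texp_base _)) ?_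
    rw [Gerbe.app_comp, Gerbe.app_comp, Gerbe.app_tensorHom, app_gerbeFunctor, app_gerbeFunctor,
      app_gerbeFunctorφ x' y' _ _ (StrictT.val_eq f) (StrictT.val_eq g),
      app_gerbeFunctorφ_self x y rfl rfl, app_gerbeFunctor, StrictT.tensorHom_label]
    congr 1
    push_cast
    ring
  assoc x y z := by
    refine Gerbe.hom_ext (Gerbe.tmk_ne_zero (hx := Gerbe.texp_add (texp_base x) (texp_base y))
      (hy := texp_base z) (gerbe_tmk_ne_zero (ha := texp_base _) (hb := texp_base _))
      (gerbeVec_ne_zero z)) ?_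
    rw [Gerbe.app_comp, Gerbe.app_comp, Gerbe.app_comp, Gerbe.app_comp, ← tensorHom_id,
      ← id_tensorHom, Gerbe.app_tensorHom, Gerbe.app_associator _ _ _ _ _ _ _
        (Gerbe.texp_add (texp_base y) (texp_base z)), Gerbe.app_tensorHom,
      Gerbe.app_id, Gerbe.app_id, app_gerbeFunctorφ_self x y rfl rfl,
      app_gerbeFunctorφ_self y z rfl rfl, app_gerbeFunctorφ_self (x ⊗ y) z (StrictT.tensor_val x y) rfl,
      app_gerbeFunctorφ_self x (y ⊗ z) rfl (StrictT.tensor_val y z), app_gerbeFunctor,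
      CrossedModule.TwoGp.associator_h]
    simp
  left_unit x := by
    refine Gerbe.hom_ext (Gerbe.tmk_ne_zero (hx := Gerbe.texp_zero) (hy := texp_base _)
      Gerbe.unitVec_ne_zero (gerbeVec_ne_zero x)) ?_
    rw [Gerbe.app_comp, Gerbe.app_comp, ← tensorHom_id, Gerbe.app_tensorHom, app_gerbeFunctorε,
      Gerbe.app_id, app_gerbeFunctorφ_self _ _ StrictT.unit_val rfl, app_gerbeFunctor, Gerbe.app_leftUnitor,
      CrossedModule.TwoGp.leftUnitor_h]
    simp [gerbeVec_smul]
  right_unit x := by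
    refine Gerbe.hom_ext (Gerbe.tmk_ne_zero (hx := texp_base _) (hy := Gerbe.texp_zero)
      (gerbeVec_ne_zero x) Gerbe.unitVec_ne_zero) ?_
    rw [Gerbe.app_comp, Gerbe.app_comp, ← id_tensorHom, Gerbe.app_tensorHom, app_gerbeFunctorε,
      Gerbe.app_id, app_gerbeFunctorφ_self _ _ rfl StrictT.unit_val, app_gerbeFunctor, Gerbe.app_rightUnitor,
      CrossedModule.TwoGp.rightUnitor_h]
    simp [gerbeVec_smul]

end GerbeFunctor


/-! ## Equivalence of the gerbe with its presentation -/

section GerbeEquivalence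

variable {Λ : Type} [AddCommGroup Λ] {J : LinearMap.BilinForm ℤ Λ}

/-- A unitary map from ℂ to itself is multiplication by its value at 1, a number of absolute value
1. -/
lemma gerbePres_map_bijective (x y : CompactT Λ) :
    Function.Bijective ((gerbePres J).map : (x ⟶ y) → _) := by
  constructor
  · intro f g h
    have := congrArg (fun k => (Gerbe.app k (show ℂ from 1) : ℂ)) h
    refine Prod.ext (Subsingleton.elim _ _) (Circle.ext ?_)
    exact (mul_one (M := ℂ) _).symm.trans (this.trans (mul_one (M := ℂ) _))
  · intro k
    have hn : ‖(Gerbe.app k (show ℂ from 1) : ℂ)‖ = 1 :=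
      ((GerbeHom.iso k).norm_map _).trans (norm_one (α := ℂ))
    refine ⟨(Discrete.eqToHom (GerbeHom.base_eq k),
      (⟨Gerbe.app k (show ℂ from 1), mem_sphere_zero_iff_norm.2 hn⟩ : Circle)), ?_⟩
    exact Gerbe.hom_ext (one_ne_zero (α := ℂ)) (mul_one (M := ℂ) _)

lemma HermLine.exists_unitary (L : HermLine) : Nonempty (std.Unitary L) := by
  have h : Module.finrank ℂ std.carrier = Module.finrank ℂ L.carrier := by
    rw [L.finrank_eq, std.finrank_eq]
  have : FiniteDimensional ℂ std.carrier := Module.finite_of_finrank_eq_succ std.finrank_eq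
  have : FiniteDimensional ℂ L.carrier := Module.finite_of_finrank_eq_succ L.finrank_eq
  exact ⟨(stdOrthonormalBasis ℂ std.carrier).equiv (stdOrthonormalBasis ℂ L.carrier) (finCongr h)⟩

theorem gerbePres_isEquivalence : (gerbePres J).IsEquivalence where
  faithful := ⟨fun {x y} _ _ h => (gerbePres_map_bijective x y).1 h⟩
  full := ⟨fun {x y} f => (gerbePres_map_bijective x y).2 f⟩
  essSurj := ⟨fun a => by
    obtain ⟨e⟩ := a.line.exists_unitary
    exact ⟨CompactT.of a.base, ⟨Gerbe.mkIso J rfl e⟩⟩⟩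

/-- An arrow x ⟶ y is a label together with a lattice vector equal to y - x. Such a vector exists as
soon as exp x = exp y, and it is unique because the lattice embeds. -/
lemma compactProj_map_bijective (x y : StrictT J) (hΛ : Function.Injective (lattice Λ)) :
    Function.Bijective ((compactProj J).map : (x ⟶ y) → _) := by
  constructor
  · intro f g h
    have h2 : (CrossedModule.Hom.h f).2 = (CrossedModule.Hom.h g).2 :=
      have e : ((compactProj J).map f).2 = ((compactProj J).map g).2 := by rw [h]
      e
    refine CrossedModule.TwoGp.hom_ext (Prod.ext ?_ h2)
    have := (StrictT.val_eq f).symm.trans (StrictT.val_eq g)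
    exact Multiplicative.toAdd.injective (hΛ (add_left_cancel this))
  · intro k
    obtain ⟨m, hm⟩ := exists_lattice_of_texp_eq (Discrete.eq_of_hom k.1)
    exact ⟨(⟨(Multiplicative.ofAdd m, (show Circle from k.2)), congrArg Multiplicative.ofAdd hm⟩ :
      CrossedModule.Hom _ _), Prod.ext (Subsingleton.elim _ _) rfl⟩

lemma compactProj_surjective : Function.Surjective (compactProj J).obj := by
  rintro ⟨⟨t⟩, ⟨⟩⟩
  exact ⟨⟨Multiplicative.ofAdd (rep t)⟩, congrArg CompactT.of (texp_rep t)⟩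

theorem compactProj_isEquivalence (hΛ : Function.Injective (lattice Λ)) :
    (compactProj J).IsEquivalence where
  faithful := ⟨fun {x y} _ _ h => (compactProj_map_bijective x y hΛ).1 h⟩
  full := ⟨fun {x y} f => (compactProj_map_bijective x y hΛ).2 f⟩
  essSurj := ⟨fun a => by
    obtain ⟨x, rfl⟩ := compactProj_surjective (J := J) a
    exact ⟨x, ⟨Iso.refl _⟩⟩⟩

theorem gerbeFunctor_isMonoidalEquivalence (hΛ : Function.Injective (lattice Λ)) :
    IsMonoidalEquivalence (gerbeFunctor J) (gerbeFunctorε J) (gerbeFunctorφ J) where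
  source := ⟨inferInstance, rfl⟩
  target := ⟨inferInstance, rfl⟩
  equivalence := by
    have := compactProj_isEquivalence (J := J) hΛ
    have := gerbePres_isEquivalence (J := J)
    -- F unfolds to the composite of p with the presentation t ↦ (t, ℂ), both of which are
    -- equivalences.
    exact (inferInstance : (compactProj J ⋙ gerbePres J).IsEquivalence)
  ε_iso := inferInstance
  μ_iso _ _ := inferInstance
  natural := gerbeFunctor_isMonoidal.natural
  assoc x y z := by
    rw [tensorHom_id, id_tensorHom]
    exact gerbeFunctor_isMonoidal.assoc x y z
  left_unit x := by
    rw [tensorHom_id]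
    exact gerbeFunctor_isMonoidal.left_unit x
  right_unit x := by
    rw [id_tensorHom]
    exact gerbeFunctor_isMonoidal.right_unit x

lemma gerbeFunctor_gerbeBase :
    gerbeFunctor J ⋙ gerbeBase J = compactProj J ⋙ CategoryTheory.Prod.fst _ _ := rfl

lemma gerbeIncl_ε (z : SingleObj.star Circle ⟶ SingleObj.star Circle) :
    (gerbeIncl J).map z ≫ gerbeFunctorε J =
      gerbeFunctorε J ≫ (gerbeFunctor J).map ((strictIncl J).map z) :=
  Gerbe.hom_ext Gerbe.unitVec_ne_zero rfl

end GerbeEquivalence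


/-! ## Smoothness of the strict 2-group and of the compact model -/

section StrictSmooth

variable {Λ : Type} [AddCommGroup Λ] {J : LinearMap.BilinForm ℤ Λ}

lemma smoothArr_strict {n : ℕ} {x y : Euc n → StrictT J} {f : ∀ v, x v ⟶ y v} :
    SmoothArr f ↔ IsPlot (fun v => (x v).val.toAdd) ∧
      @IsPlot Λ (latticeDiff Λ) n (fun v => (CrossedModule.Hom.h (f v)).1.toAdd) ∧
      IsPlot (fun v => (CrossedModule.Hom.h (f v)).2) :=
  DiffeologicalSpace.isPlot_inf_iff.trans
    ((and_congr_left' DiffeologicalSpace.isPlot_inf_iff).trans and_assoc)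

lemma isPlot_strict {n : ℕ} {x : Euc n → StrictT J} :
    IsPlot x ↔ IsPlot (fun v => (x v).val.toAdd) := Iff.rfl

/-- The arrow `x ⟶ x + m` with label `z`. -/
def StrictT.arrow (x y : StrictT J) (m : Λ) (z : Circle)
    (h : y.val.toAdd = x.val.toAdd + lattice Λ m) : x ⟶ y :=
  (⟨(Multiplicative.ofAdd m, z), congrArg Multiplicative.ofAdd h⟩ : CrossedModule.Hom x y)

lemma smoothArr_arrow {n : ℕ} {x y : Euc n → StrictT J} {m : Euc n → Λ} {z : Euc n → Circle}
    {h : ∀ v, (y v).val.toAdd = (x v).val.toAdd + lattice Λ (m v)} :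
    SmoothArr (fun v => StrictT.arrow (x v) (y v) (m v) (z v) (h v)) ↔
      IsPlot x ∧ @IsPlot Λ (latticeDiff Λ) n m ∧ IsPlot z := smoothArr_strict

lemma smoothArr_of_label_one {n : ℕ} {x y : Euc n → StrictT J} {f : ∀ v, x v ⟶ y v}
    (hx : IsPlot x) (h : ∀ v, CrossedModule.Hom.h (f v) = 1) : SmoothArr f := by
  refine smoothArr_strict.2 ⟨hx, ?_, ?_⟩
  · simp only [h]
    exact @isPlot_const _ (latticeDiff Λ) _ _
  · simp only [h]
    exact isPlot_const

lemma StrictT.arr_ext {a b : Arr (StrictT J)} (hx : a.1 = b.1)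
    (h : CrossedModule.Hom.h a.2.2 = CrossedModule.Hom.h b.2.2) : a = b := by
  obtain ⟨x, ⟨y⟩, f⟩ := a
  obtain ⟨x', ⟨y'⟩, f'⟩ := b
  obtain rfl : x = x' := hx
  obtain rfl : y = y' := (CrossedModule.Hom.eq f).trans
    ((congrArg (fun k => x.val * (crossedModule J).bd k) h).trans (CrossedModule.Hom.eq f').symm)
  obtain rfl : f = f' := CrossedModule.TwoGp.hom_ext h
  rfl

lemma StrictT.source_ext {x x' y : StrictT J} {f : x ⟶ y} {f' : x' ⟶ y}
    (h : CrossedModule.Hom.h f = CrossedModule.Hom.h f') :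
    (⟨x, f⟩ : Σ x : StrictT J, (x ⟶ y)) = ⟨x', f'⟩ := by
  obtain rfl : x = x' := CrossedModule.TwoGp.ext (mul_right_cancel
    ((CrossedModule.Hom.eq f).symm.trans ((CrossedModule.Hom.eq f').trans
      (congrArg (fun k => x'.val * (crossedModule J).bd k) h.symm))))
  obtain rfl : f = f' := CrossedModule.TwoGp.hom_ext h
  rfl

variable [Module.Free ℤ Λ] [Module.Finite ℤ Λ]

lemma isPlot_strict_target {n : ℕ} {x y : Euc n → StrictT J} {f : ∀ v, x v ⟶ y v}
    (hf : SmoothArr f) : IsPlot y := by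
  obtain ⟨hx, hm, -⟩ := smoothArr_strict.1 hf
  refine isPlot_strict.2 ?_
  simp only [fun v => StrictT.val_eq (f v)]
  exact hx.lieT_add (isPlot_lattice.2 hm)

/-- The label and the lattice vector of f₀ are kept constant, and the vector is subtracted from the
moving target. -/
lemma strict_target_lift {n : ℕ} {q : Euc n → StrictT J} (hq : IsPlot q) (v : Euc n)
    {x₀ : StrictT J} (f₀ : x₀ ⟶ q v) : ∃ (x : Euc n → StrictT J) (f : ∀ w, x w ⟶ q w),
      SmoothArr f ∧ (⟨x v, f v⟩ : Σ x : StrictT J, (x ⟶ q v)) = ⟨x₀, f₀⟩ := by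
  refine ⟨fun w => ⟨Multiplicative.ofAdd ((q w).val.toAdd -
      lattice Λ (CrossedModule.Hom.h f₀).1.toAdd)⟩,
    fun w => StrictT.arrow _ _ (CrossedModule.Hom.h f₀).1.toAdd (CrossedModule.Hom.h f₀).2
      (sub_add_cancel _ _).symm, ?_, StrictT.source_ext rfl⟩
  exact smoothArr_arrow.2 ⟨hq.lieT_sub isPlot_const, @isPlot_const _ (latticeDiff Λ) _ _,
    isPlot_const⟩

lemma isPlot_lattice_add {n : ℕ} {m k : Euc n → Λ} (hm : @IsPlot Λ (latticeDiff Λ) n m)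
    (hk : @IsPlot Λ (latticeDiff Λ) n k) : @IsPlot Λ (latticeDiff Λ) n (fun v => m v + k v) := by
  rw [← isPlot_lattice] at *
  simp only [map_add]
  exact hm.lieT_add hk

lemma isPlot_lattice_neg {n : ℕ} {m : Euc n → Λ} (hm : @IsPlot Λ (latticeDiff Λ) n m) :
    @IsPlot Λ (latticeDiff Λ) n (fun v => - m v) := by
  rw [← isPlot_lattice] at *
  simp only [map_neg]
  exact hm.lieT_neg

/-- The coordinates `(x, m, z)` on the space of arrows. -/
def strictArrEquiv : Arr (StrictT J) ≃ LieT Λ × Λ × Circle where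
  toFun a := (a.1.val.toAdd, (CrossedModule.Hom.h a.2.2).1.toAdd, (CrossedModule.Hom.h a.2.2).2)
  invFun b := ⟨⟨Multiplicative.ofAdd b.1⟩, ⟨Multiplicative.ofAdd (b.1 + lattice Λ b.2.1)⟩,
    StrictT.arrow _ _ b.2.1 b.2.2 rfl⟩
  left_inv _ := StrictT.arr_ext rfl rfl
  right_inv _ := rfl

theorem isLieGroupoid_strict : IsLieGroupoid (StrictT J) where
  obj_manifold := (hasAtlas_lieT.of_equiv (X := StrictT J) (Y := LieT Λ)
    ⟨fun x => x.val.toAdd, fun x => ⟨Multiplicative.ofAdd x⟩, fun _ => rfl, fun _ => rfl⟩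
    fun _ _ => Iff.rfl).isSmoothManifold
  arr_manifold := by
    let : DiffeologicalSpace Λ := latticeDiff Λ
    -- The arrow space is 𝔱 × Λ × U(1) with Λ discrete; countability of Λ is what makes it second
    -- countable.
    have : Countable Λ := (Module.finBasis ℤ Λ).repr.injective.countable
    refine ((hasAtlas_lieT.prod ((hasAtlas_bot Λ).prod hasAtlas_circle)).of_equiv
      strictArrEquiv fun n p => ?_).isSmoothManifold
    rw [isPlot_prod, isPlot_prod]
    exact smoothArr_strict (f := fun v => (p v).2.2)
  source := by
    refine ⟨fun n p hp => (smoothArr_strict (f := fun v => (p v).2.2).1 hp).1,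
      fun n c v b hc hb => ?_⟩
    obtain ⟨x, y, f⟩ := b
    obtain rfl : x = c v := hb
    exact ⟨fun w => ⟨c w, ⟨Multiplicative.ofAdd ((c w).val.toAdd +
        lattice Λ (CrossedModule.Hom.h f).1.toAdd)⟩,
      StrictT.arrow _ _ (CrossedModule.Hom.h f).1.toAdd (CrossedModule.Hom.h f).2 rfl⟩,
      smoothArr_arrow.2 ⟨hc, @isPlot_const _ (latticeDiff Λ) _ _, isPlot_const⟩,
      StrictT.arr_ext rfl rfl, .of_forall fun _ => rfl⟩
  target := by
    refine ⟨fun n p hp => isPlot_strict_target (f := fun v => (p v).2.2) hp,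
      fun n c v b hc hb => ?_⟩
    obtain ⟨x, y, f⟩ := b
    obtain rfl : y = c v := hb
    obtain ⟨x', f', hf, he⟩ := strict_target_lift hc v f
    refine ⟨fun w => ⟨x' w, c w, f' w⟩, hf, ?_, .of_forall fun _ => rfl⟩
    exact congrArg (fun s : Σ x : StrictT J, (x ⟶ c v) => (⟨s.1, c v, s.2⟩ : Arr (StrictT J))) he
  ident _ _ hp := smoothArr_of_label_one hp fun _ => rfl
  inverse n p hp := by
    have h := smoothArr_strict (f := fun v => (p v).2.2).1 hp
    exact smoothArr_strict (f := fun v => Groupoid.inv (p v).2.2).2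
      ⟨isPlot_strict_target (f := fun v => (p v).2.2) hp, isPlot_lattice_neg h.2.1,
        h.2.2.circle_inv⟩
  comp n x y z f g hf hg := by
    obtain ⟨hx, hm, hz⟩ := smoothArr_strict.1 hf
    obtain ⟨-, hm', hz'⟩ := smoothArr_strict.1 hg
    exact smoothArr_strict.2 ⟨hx, isPlot_lattice_add hm hm', hz.circle_mul hz'⟩

lemma isPlot_strict_tensor {n : ℕ} {x y : Euc n → StrictT J} (hx : IsPlot x) (hy : IsPlot y) :
    IsPlot (fun v => x v ⊗ y v) :=
  isPlot_strict.2 ((isPlot_strict.1 hx).lieT_add (isPlot_strict.1 hy))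

lemma smoothArr_strict_tensor {n : ℕ} {x y x' y' : Euc n → StrictT J} {f : ∀ v, x v ⟶ y v}
    {g : ∀ v, x' v ⟶ y' v} (hf : SmoothArr f) (hg : SmoothArr g) :
    SmoothArr (fun v => f v ⊗ₘ g v) := by
  obtain ⟨hx, hm, hz⟩ := smoothArr_strict.1 hf
  obtain ⟨hx', hm', hz'⟩ := smoothArr_strict.1 hg
  have h1 : IsPlot (fun v => (x v ⊗ x' v).val.toAdd) := isPlot_strict_tensor hx hx'
  have h2 : @IsPlot Λ (latticeDiff Λ) n
      (fun v => (CrossedModule.Hom.h (f v ⊗ₘ g v)).1.toAdd) := isPlot_lattice_add hm hm'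
  refine smoothArr_strict.2 ⟨h1, h2, ?_⟩
  simp only [StrictT.tensorHom_label]
  exact (hz.circle_mul (isPlot_multiplier J hm hx')).circle_mul hz'

theorem isSmoothMonoidal_strict : IsSmoothMonoidal (StrictT J) where
  lie := isLieGroupoid_strict
  tensorObj hx hy := isPlot_strict_tensor hx hy
  tensorHom hf hg := smoothArr_strict_tensor hf hg
  associator hx hy hz := smoothArr_of_label_one
    (isPlot_strict_tensor (isPlot_strict_tensor hx hy) hz) fun _ => CrossedModule.TwoGp.associator_h _ _ _
  leftUnitor hx := smoothArr_of_label_one (isPlot_strict_tensor isPlot_const hx)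
    fun _ => CrossedModule.TwoGp.leftUnitor_h _
  rightUnitor hx := smoothArr_of_label_one
    (isPlot_strict_tensor hx isPlot_const) fun _ => CrossedModule.TwoGp.rightUnitor_h _
  target_lift hq v _ f₀ := strict_target_lift hq v f₀
  solve {n x q} hx hq := by
    refine ⟨fun w => ⟨Multiplicative.ofAdd ((q w).val.toAdd - (x w).val.toAdd)⟩,
      fun w => StrictT.arrow _ _ 0 1 ?_, Diffeology.IsPlot.lieT_sub hq hx, ?_⟩
    · rw [map_zero, add_zero]
      exact (add_sub_cancel _ _).symm
    · exact smoothArr_of_label_one (isPlot_strict.2 (Diffeology.IsPlot.lieT_add hx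
        (Diffeology.IsPlot.lieT_sub hq hx))) fun _ => rfl
  cancel x y y' := by
    -- Left whiskering uses the action only on the trivial element of Λ × U(1), so it does not
    -- change labels; cancellation is then immediate.
    have key : ∀ l : y ⟶ y', CrossedModule.Hom.h (x ◁ l) = CrossedModule.Hom.h l := fun l => by
      rw [← id_tensorHom, CrossedModule.TwoGp.tensorHom_h, CrossedModule.TwoGp.id_h, map_one,
        one_mul]
    refine ⟨fun l l' h => CrossedModule.TwoGp.hom_ext ?_, fun k => ?_⟩
    · rw [← key l, ← key l']
      exact congrArg CrossedModule.Hom.h h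
    · refine ⟨(⟨CrossedModule.Hom.h k, mul_left_cancel (a := x.val) ?_⟩ : CrossedModule.Hom y y'),
        CrossedModule.TwoGp.hom_ext (key _)⟩
      exact (CrossedModule.Hom.eq k).trans (mul_assoc _ _ _)
  cancel_smooth {n x y y' l} hx hy hy' h := by
    have key : ∀ v, CrossedModule.Hom.h (x v ◁ l v) = CrossedModule.Hom.h (l v) := fun v => by
      rw [← id_tensorHom, CrossedModule.TwoGp.tensorHom_h, CrossedModule.TwoGp.id_h, map_one,
        one_mul]
    obtain ⟨-, hm, hz⟩ := smoothArr_strict.1 h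
    simp only [key] at hm hz
    exact smoothArr_strict.2 ⟨hy, hm, hz⟩

end StrictSmooth


/-! ### Smoothness of pt // U(1) -/

section BU1Smooth

lemma isPlot_bu1 {n : ℕ} {x : Euc n → BU1} : IsPlot x := isPlot_top (X := PUnit)

lemma smoothArr_bu1 {n : ℕ} {x y : Euc n → BU1} {f : ∀ v, x v ⟶ y v} :
    SmoothArr f ↔ IsPlot (fun v => (show Circle from f v)) := Iff.rfl

theorem isLieGroupoid_bu1 : IsLieGroupoid BU1 where
  obj_manifold := (hasAtlas_punit.of_equiv (X := BU1) (Y := PUnit) (Equiv.refl _)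
    fun _ _ => Iff.rfl).isSmoothManifold
  arr_manifold := (hasAtlas_circle.of_equiv (X := Arr BU1) (Y := Circle)
    ⟨fun a => a.2.2, fun z => ⟨SingleObj.star Circle, SingleObj.star Circle, z⟩, fun _ => rfl,
      fun _ => rfl⟩ fun _ _ => Iff.rfl).isSmoothManifold
  source := ⟨fun _ _ _ => isPlot_bu1, fun n c v b _ _ => ⟨fun _ => b, isPlot_const, rfl,
    .of_forall fun _ => rfl⟩⟩
  target := ⟨fun _ _ _ => isPlot_bu1, fun n c v b _ _ => ⟨fun _ => b, isPlot_const, rfl,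
    .of_forall fun _ => rfl⟩⟩
  ident _ _ _ := smoothArr_bu1.2 (isPlot_const (x := (1 : Circle)))
  inverse n p hp := IsPlot.circle_inv (p := fun v => (p v).2.2) hp
  comp n x y z f g hf hg := IsPlot.circle_mul (smoothArr_bu1.1 hg) (smoothArr_bu1.1 hf)

theorem isSmoothMonoidal_bu1 : IsSmoothMonoidal BU1 where
  lie := isLieGroupoid_bu1
  tensorObj _ _ := isPlot_bu1
  tensorHom hf hg := IsPlot.circle_mul (smoothArr_bu1.1 hf) (smoothArr_bu1.1 hg)
  associator _ _ _ := smoothArr_bu1.2 (isPlot_const (x := (1 : Circle)))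
  leftUnitor _ := smoothArr_bu1.2 (isPlot_const (x := (1 : Circle)))
  rightUnitor _ := smoothArr_bu1.2 (isPlot_const (x := (1 : Circle)))
  target_lift _ v x₀ f₀ := ⟨fun _ => x₀, fun _ => f₀,
    smoothArr_bu1.2 (isPlot_const (x := (show Circle from f₀))), rfl⟩
  solve _ _ := ⟨fun _ => SingleObj.star Circle, fun _ => (show Circle from 1), isPlot_bu1,
    smoothArr_bu1.2 (isPlot_const (x := (1 : Circle)))⟩
  cancel x y y' := ⟨fun _ _ h => h, fun k => ⟨k, rfl⟩⟩
  cancel_smooth _ _ _ h := h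

end BU1Smooth

/-! ### Smoothness of T × pt // U(1) and of its cover by the strict groupoid -/

section CompactSmooth

variable {Λ : Type} [AddCommGroup Λ] {J : LinearMap.BilinForm ℤ Λ}

lemma isPlot_compact {n : ℕ} {x : Euc n → CompactT Λ} :
    IsPlot x ↔ IsPlot (fun v => (x v).1.as) :=
  isPlot_prod.trans ⟨And.left, fun h => ⟨h, isPlot_bu1⟩⟩

lemma smoothArr_compact {n : ℕ} {x y : Euc n → CompactT Λ} {f : ∀ v, x v ⟶ y v} :
    SmoothArr f ↔ IsPlot (fun v => (x v).1.as) ∧ IsPlot (fun v => (show Circle from (f v).2)) :=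
  isPlot_prod

lemma CompactT.base_eq {x y : CompactT Λ} (f : x ⟶ y) : x.1.as = y.1.as := Discrete.eq_of_hom f.1

lemma CompactT.ext_base {x y : CompactT Λ} (h : x.1.as = y.1.as) : x = y :=
  Prod.ext (Discrete.ext h) rfl

lemma CompactT.arr_ext {a b : Arr (CompactT Λ)} (hx : a.1.1.as = b.1.1.as)
    (h : (show Circle from a.2.2.2) = (show Circle from b.2.2.2)) : a = b := by
  obtain ⟨x, y, f⟩ := a
  obtain ⟨x', y', f'⟩ := b
  obtain rfl : x = x' := CompactT.ext_base hx
  obtain rfl : x = y := CompactT.ext_base (CompactT.base_eq f)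
  obtain rfl : x = y' := CompactT.ext_base (CompactT.base_eq f')
  obtain rfl : f = f' := Prod.ext (Subsingleton.elim _ _) h
  rfl

/-- The automorphism of `x` given by `z ∈ U(1)`. -/
def CompactT.aut (x : CompactT Λ) (z : Circle) : x ⟶ x := (𝟙 _, z)

variable [Module.Free ℤ Λ] [Module.Finite ℤ Λ]

theorem isLieGroupoid_compact : IsLieGroupoid (CompactT Λ) where
  obj_manifold := (hasAtlas_torus.of_equiv (X := CompactT Λ) (Y := Torus Λ)
    ⟨fun x => x.1.as, CompactT.of, fun _ => rfl, fun _ => rfl⟩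
    fun _ _ => isPlot_compact).isSmoothManifold
  arr_manifold := ((hasAtlas_torus.prod hasAtlas_circle).of_equiv (X := Arr (CompactT Λ))
    (Y := Torus Λ × Circle)
    ⟨fun a => (a.1.1.as, a.2.2.2), fun b => ⟨_, _, CompactT.aut (CompactT.of b.1) b.2⟩,
      fun _ => CompactT.arr_ext rfl rfl, fun _ => rfl⟩
    fun _ p => by
      rw [isPlot_prod]
      exact smoothArr_compact (f := fun v => (p v).2.2)).isSmoothManifold
  source := ⟨fun n p hp => isPlot_compact.2 (smoothArr_compact (f := fun v => (p v).2.2).1 hp).1,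
    fun n c v b hc hb => ⟨fun w => ⟨_, _, CompactT.aut (c w) b.2.2.2⟩,
      smoothArr_compact.2 ⟨isPlot_compact.1 hc, isPlot_const⟩,
      CompactT.arr_ext (congrArg (fun x => x.1.as) hb.symm) rfl, .of_forall fun _ => rfl⟩⟩
  target := by
    refine ⟨fun n p hp => isPlot_compact.2 (?_ : IsPlot (fun v => (p v).2.1.1.as)),
      fun n c v b hc hb => ⟨fun w => ⟨_, _, CompactT.aut (c w) b.2.2.2⟩,
      smoothArr_compact.2 ⟨isPlot_compact.1 hc, isPlot_const⟩,
      CompactT.arr_ext ((congrArg (fun x => x.1.as) hb.symm).trans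
        (CompactT.base_eq b.2.2).symm) rfl, .of_forall fun _ => rfl⟩⟩
    have := (smoothArr_compact (f := fun v => (p v).2.2).1 hp).1
    simpa only [fun v => CompactT.base_eq (p v).2.2] using this
  ident n p hp := smoothArr_compact.2 ⟨isPlot_compact.1 hp, isPlot_const (x := (1 : Circle))⟩
  inverse n p hp := by
    have h := smoothArr_compact (f := fun v => (p v).2.2).1 hp
    refine (smoothArr_compact (f := fun v => Groupoid.inv (p v).2.2)).2 ⟨?_, h.2.circle_inv⟩
    simpa only [fun v => CompactT.base_eq (p v).2.2] using h.1
  comp n x y z f g hf hg := by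
    obtain ⟨hx, hz⟩ := smoothArr_compact.1 hf
    exact smoothArr_compact.2 ⟨hx, (smoothArr_compact.1 hg).2.circle_mul hz⟩

/-- On objects p is exp, and on arrows it forgets only the lattice vector, which the endpoints
determine. These properties allow all the structure to descend from the strict 2-group. -/
theorem isSmoothCover_compactProj : IsSmoothCover (compactProj J) where
  submersion := by
    refine ⟨fun n p hp => isPlot_compact.2 (dSmooth_texp _ _ hp), fun n c v b hc hb => ?_⟩
    obtain ⟨c', hc', hv, he⟩ := isSubmersion_texp.2 n _ v b.val.toAdd (isPlot_compact.1 hc)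
      (congrArg (fun x => x.1.as) hb)
    refine ⟨fun w => ⟨Multiplicative.ofAdd (c' w)⟩, hc', CrossedModule.TwoGp.ext hv, ?_⟩
    filter_upwards [he] with w hw
    exact CompactT.ext_base hw
  surj := compactProj_surjective
  bij x y := compactProj_map_bijective x y lattice_injective
  smooth hf := by
    obtain ⟨hx, -, hz⟩ := smoothArr_strict.1 hf
    exact smoothArr_compact.2 ⟨dSmooth_texp _ _ hx, hz⟩
  smooth_lift {n x y f} hx hy hf := by
    -- The lattice part of an arrow is the difference of its smooth endpoints, hence smooth, hence
    -- locally constant.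
    refine smoothArr_strict.2 ⟨hx, isPlot_lattice.1 ?_, (smoothArr_compact.1 hf).2⟩
    have := Diffeology.IsPlot.lieT_sub hy hx
    refine cast (congrArg IsPlot (funext fun v => ?_)) this
    exact (congrArg (· - _) (StrictT.val_eq (f v))).trans (add_sub_cancel_left _ _)

end CompactSmooth


/-! ## The smooth structure of the multiplicative bundle gerbe -/

section LineBundlePlots

variable {Λ : Type} [AddCommGroup Λ] {J : LinearMap.BilinForm ℤ Λ}

lemma LineBundle.mk_surjective : Function.Surjective
    (fun a : ℂ × LieT Λ × LieT Λ => LineBundle.mk J a.1 a.2.1 a.2.2) := by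
  intro q
  induction q using Quotient.inductionOn with
  | h a => exact ⟨a, rfl⟩

lemma LineBundle.exists_of_mk_eq {c c' : ℂ} {x x' y y' : LieT Λ}
    (h : LineBundle.mk J c x y = LineBundle.mk J c' x' y') :
    ∃ m : Λ, c' = c * multiplier J m y ∧ x' = x + lattice Λ m := by
  obtain ⟨m, n, h⟩ := Quotient.exact (s := lineSetoid J) h
  exact ⟨m, congrArg (fun a => a.1) h, congrArg (fun a => a.2.1) h⟩

lemma isPlot_lineBundle {n : ℕ} {q : Euc n → LineBundle J} : IsPlot q ↔
    ∀ v, ∃ p : Euc n → ℂ × LieT Λ × LieT Λ, IsPlot p ∧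
      ∀ᶠ w in 𝓝 v, q w = LineBundle.mk J (p w).1 (p w).2.1 (p w).2.2 :=
  isPlot_coinduced LineBundle.mk_surjective

lemma isPlot_complex {n : ℕ} {c : Euc n → ℂ} : IsPlot c ↔ ContDiff ℝ ∞ c := Iff.rfl

lemma LineBundle.isPlot_proj {n : ℕ} {q : Euc n → LineBundle J} (hq : IsPlot q) :
    IsPlot (fun v => (LineBundle.proj J (q v)).1) ∧ IsPlot (fun v => (LineBundle.proj J (q v)).2) := by
  rw [isPlot_lineBundle] at hq
  constructor
  · refine isPlot_of_eventually fun v => ?_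
    obtain ⟨p, hp, he⟩ := hq v
    refine ⟨fun w => texp (p w).2.1,
      isPlot_coinduced_comp (f := texp) (isPlot_prod.1 (isPlot_prod.1 hp).2).1, ?_⟩
    filter_upwards [he] with w hw
    exact congrArg (fun q => (LineBundle.proj J q).1) hw
  · refine isPlot_of_eventually fun v => ?_
    obtain ⟨p, hp, he⟩ := hq v
    refine ⟨fun w => texp (p w).2.2,
      isPlot_coinduced_comp (f := texp) (isPlot_prod.1 (isPlot_prod.1 hp).2).2, ?_⟩
    filter_upwards [he] with w hw
    exact congrArg (fun q => (LineBundle.proj J q).2) hw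

variable [Module.Free ℤ Λ] [Module.Finite ℤ Λ]

/-- Over smooth lifts x, y the line bundle is trivial, with coordinate c. A local plot representing
the same points has coordinates that differ from c by a multiplier, and the lattice vector entering
it is a difference of smooth lifts, so the multiplier is smooth. -/
lemma isPlot_lineBundle_mk {n : ℕ} {c : Euc n → ℂ} {x y : Euc n → LieT Λ} (hx : IsPlot x)
    (hy : IsPlot y) : IsPlot (fun v => LineBundle.mk J (c v) (x v) (y v)) ↔ IsPlot c := by
  refine ⟨fun h => isPlot_of_local fun v => ?_, fun h => isPlot_coinduced_comp
    (f := fun a : ℂ × LieT Λ × LieT Λ => LineBundle.mk J a.1 a.2.1 a.2.2)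
    (h.prodMk (hx.prodMk hy))⟩
  obtain ⟨p, hp, he⟩ := isPlot_lineBundle.1 h v
  obtain ⟨σ, hσ, hU, hs⟩ := exists_smooth_retract he
  refine ⟨σ, hs, ?_⟩
  -- The lattice vectors are chosen pointwise; they are smooth nevertheless, since they are x minus
  -- the lift of the plot.
  choose m hm hm' using fun w => LineBundle.exists_of_mk_eq (hU w).symm
  obtain ⟨hp1, hp2⟩ := isPlot_prod.1 (isPlot_reparam hp hσ)
  obtain ⟨hp2, hp3⟩ := isPlot_prod.1 hp2
  have hxm : IsPlot (fun w => lattice Λ (m w)) := by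
    have := (isPlot_reparam hx hσ).lieT_sub hp2
    simp only [Function.comp_apply, hm', add_sub_cancel_left] at this
    exact this
  have hmul := isPlot_circle.1 (isPlot_multiplier J (isPlot_lattice.1 hxm) hp3)
  refine isPlot_complex.2 ?_
  have h : c ∘ σ = fun w => (p (σ w)).1 * multiplier J (m w) (p (σ w)).2.2 := funext hm
  rw [h]
  exact (isPlot_complex.1 hp1).mul hmul

end LineBundlePlots

/-! ### The multiplicative bundle gerbe as a model of the strict 2-group -/

section GerbeModel

variable {Λ : Type} [AddCommGroup Λ] {J : LinearMap.BilinForm ℤ Λ}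

lemma fibMk_smul {s t : Torus Λ} (x y : LieT Λ) (hx : texp x = s) (hy : texp y = t) (c z : ℂ) :
    c • fibMk J z x y hx hy = fibMk J (c * z) x y hx hy :=
  (map_smul (fibTriv J x y hx hy).symm c (show ℂ from z)).symm

/-- If f takes [1, x, y] ⊗ 1 ⊗ 1 to w, then by linearity the preimage of 1 is w⁻¹ times that vector.
This is why inverse labels appear in the coordinates of the line bundle. -/
lemma gerbeMulPoint_eq {q : CompactT Λ × CompactT Λ} {r : CompactT Λ}
    (f : (gerbePres J).obj q.1 ⊗ (gerbePres J).obj q.2 ⟶ (gerbePres J).obj r) {x y : LieT Λ}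
    (hx : texp x = q.1.1.as) (hy : texp y = q.2.1.as) {w : ℂ} (hw : w ≠ 0)
    (h : Gerbe.app f (Gerbe.tmk (a := (gerbePres J).obj q.1) (b := (gerbePres J).obj q.2) x y hx hy
      (show ℂ from 1) (show ℂ from 1)) = (show ℂ from w)) :
    gerbeMulPoint J ⟨q, r, f⟩ = LineBundle.mk J w⁻¹ x y := by
  have e : (GerbeHom.iso f).symm (show ℂ from 1) = w⁻¹ •
      (Gerbe.tmk (a := (gerbePres J).obj q.1) (b := (gerbePres J).obj q.2) x y hx hy
      (show ℂ from 1) (show ℂ from 1)) := by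
    refine (LinearIsometryEquiv.symm_apply_eq _).2 ?_
    refine Eq.symm ((Gerbe.app_smul f _ _).trans ((congrArg (w⁻¹ • ·) h).trans ?_))
    exact inv_mul_cancel₀ hw
  have e' : HermLine.ridIso (HermLine.fib J q.1.1.as q.2.1.as)
      (HermLine.tensorIso (.refl ℂ _) (HermLine.lidIso HermLine.std)
        ((GerbeHom.iso f).symm (show ℂ from 1))) = fibMk J w⁻¹ x y hx hy := by
    refine (congrArg (fun u => HermLine.ridIso (HermLine.fib J q.1.1.as q.2.1.as)
      (HermLine.tensorIso (.refl ℂ _) (HermLine.lidIso HermLine.std) u)) e).trans ?_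
    refine (congrArg _ (map_smul _ _ _)).trans ((map_smul _ _ _).trans ?_)
    refine Eq.trans (congrArg (w⁻¹ • ·) ?_) ((fibMk_smul x y hx hy w⁻¹ 1).trans (by rw [mul_one]))
    exact (congrArg (fun c : ℂ => c • fibMk J 1 x y hx hy) (one_mul (1 : ℂ))).trans (one_smul ℂ _)
  exact congrArg (fun u : LineFib J q.1.1.as q.2.1.as => u.1) e'

variable [Module.Free ℤ Λ] [Module.Finite ℤ Λ]

/-- φ sends [1, x, y] ⊗ 1 ⊗ 1 to 1, and F h multiplies by the label of h. -/
lemma gerbeMulPoint_φ {x y z : StrictT J} (h : x ⊗ y ⟶ z) :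
    gerbeMulPoint J ⟨((compactProj J).obj x, (compactProj J).obj y), (compactProj J).obj z,
      gerbeFunctorφ J x y ≫ (gerbeFunctor J).map h⟩ =
      LineBundle.mk J ((CrossedModule.Hom.h h).2⁻¹ : Circle) x.val.toAdd y.val.toAdd := by
  have e := gerbeMulPoint_eq (q := ((compactProj J).obj x, (compactProj J).obj y))
    (r := (compactProj J).obj z) (gerbeFunctorφ J x y ≫ (gerbeFunctor J).map h) (texp_base x)
    (texp_base y) (w := ((CrossedModule.Hom.h h).2 : ℂ)) (Circle.coe_ne_zero _) ?_
  · rw [Circle.coe_inv]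
    exact e
  · refine (congrArg (Gerbe.app ((gerbeFunctor J).map h))
      (app_gerbeFunctorφ_self x y (ha := texp_base x) (hb := texp_base y) rfl rfl 1 1)).trans ?_
    refine (app_gerbeFunctor h _).trans ?_
    exact congrArg (gerbeVec z) (by rw [mul_one, mul_one])

/-- Once both endpoints are smooth, the lattice part is smooth automatically and only the label
remains to be tested. -/
lemma smoothArr_strict_iff {n : ℕ} {x y : Euc n → StrictT J} {f : ∀ v, x v ⟶ y v}
    (hx : IsPlot x) (hy : IsPlot y) :
    SmoothArr f ↔ IsPlot (fun v => (CrossedModule.Hom.h (f v)).2) := by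
  refine ⟨fun h => (smoothArr_strict.1 h).2.2, fun h => ?_⟩
  refine isSmoothCover_compactProj.smooth_lift hx hy (smoothArr_compact.2 ⟨?_, h⟩)
  exact isPlot_compact.1 (isSmoothCover_compactProj.submersion.1 _ _ hx)

lemma isPlot_circle_inv_iff {n : ℕ} {z : Euc n → Circle} :
    IsPlot (fun v => (z v)⁻¹) ↔ IsPlot z :=
  ⟨fun h => by simpa using h.circle_inv, fun h => h.circle_inv⟩

/-- The multiplicative bundle gerbe is a model of the strict 2-group. -/
theorem gerbe_isMonoidalModel : IsMonoidalModel (compactProj J) (gerbePres J) (gerbeFunctorε J)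
    (gerbeFunctorφ J) (inducedDiff (gerbeMulPoint J) inferInstance)
    (inducedDiff (fun b => (show ℂ from (GerbeHom.iso b.2.2) (show ℂ from 1))) inferInstance) where
  cover := isSmoothCover_compactProj
  bij := gerbePres_map_bijective
  monoidal := gerbeFunctor_isMonoidal
  ε_iso := (inferInstance : IsIso (gerbeFunctorε J))
  μ_iso x y := (inferInstance : IsIso (gerbeFunctorφ J x y))
  mul_smooth {n x y z h} hx hy hz := by
    -- The circle bundle records the preimage of 1, so smoothness is compared for the inverse of the
    -- label.
    rw [smoothArr_strict_iff (isPlot_strict_tensor hx hy) hz, ← isPlot_circle_inv_iff]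
    refine Iff.trans ?_ (isPlot_lineBundle_mk (J := J)
      (c := fun v => ((CrossedModule.Hom.h (h v)).2⁻¹ : Circle)) hx hy)
    exact iff_of_eq (congrArg IsPlot (funext fun v => gerbeMulPoint_φ (h v)))
  unit_smooth {n z h} hz := by
    rw [smoothArr_strict_iff isPlot_const hz]
    have key : ∀ v, Gerbe.app (gerbeFunctorε J ≫ (gerbeFunctor J).map (h v)) (Gerbe.unitVec 1) =
        gerbeVec (z v) (CrossedModule.Hom.h (h v)).2 := fun v =>
      (app_gerbeFunctor (h v) 1).trans (congrArg (gerbeVec (z v)) (mul_one _))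
    exact iff_of_eq (congrArg (IsPlot (X := ℂ)) (funext key))
  mul_plots {n x y c} hc := by
    obtain ⟨h1, h2⟩ := LineBundle.isPlot_proj (isPlot_induced.1 hc)
    -- The recorded vector lies in the fibre over the two factors, so projecting 𝐋 to T × T shows
    -- that these are smooth; the target is their sum because arrows of ℐ preserve the base point.
    have key : ∀ v, LineBundle.proj J (gerbeMulPoint J ⟨x v, y v, c v⟩) =
      ((x v).1.1.as, (x v).2.1.as) := fun v =>
      Subtype.property (p := fun q => LineBundle.proj J q = ((x v).1.1.as, (x v).2.1.as)) _
    have key' : ∀ v, (x v).1.1.as + (x v).2.1.as = (y v).1.as := fun v => GerbeHom.base_eq (c v)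
    have hx1 : IsPlot (fun v => (x v).1.1.as) :=
      cast (congrArg IsPlot (funext fun v => congrArg Prod.fst (key v))) h1
    have hx2 : IsPlot (fun v => (x v).2.1.as) :=
      cast (congrArg IsPlot (funext fun v => congrArg Prod.snd (key v))) h2
    exact ⟨isPlot_prod.2 ⟨isPlot_compact.2 hx1, isPlot_compact.2 hx2⟩,
      isPlot_compact.2 (cast (congrArg IsPlot (funext key')) (hx1.torus_add hx2))⟩
  unit_plots {n x y c} _ := by
    have key' : ∀ v, 0 = (y v).1.as := fun v => GerbeHom.base_eq (c v)
    exact isPlot_compact.2 (cast (congrArg IsPlot (funext key')) isPlot_const)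

end GerbeModel


/-! ## Exactness and centrality along covers -/

section Central

variable {A X : Type} [Groupoid.{0} A] [SmoothStr A] [Groupoid.{0} X] [SmoothStr X]

/-- Left and right multiplication with the automorphisms coming from `U(1)` agree. -/
def ActsCentrally (I : Bibundle BU1 X) (M : Bibundle (X × X) X) : Prop :=
  ∀ {k x y : X} (z : SingleObj.star Circle ⟶ SingleObj.star Circle) (κ : k ⟶ k)
    (j : I.Fib (SingleObj.star Circle) k) (a : M.Fib (k, x) y) (b : M.Fib (x, k) y) (l r : y ⟶ y),
    I.act z j (𝟙 k) = I.act (𝟙 _) j κ →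
    M.act (x' := (k, x)) (κ, 𝟙 x) a (𝟙 y) = M.act (𝟙 _) a l →
    M.act (x' := (x, k)) (𝟙 x, κ) b (𝟙 y) = M.act (𝟙 _) b r → l = r

/-- Centrality is a pointwise condition, so all objects, arrows and elements can be lifted along the
cover and compared upstairs. -/
lemma ActsCentrally.of_cover {p : A ⥤ X} (hp : IsSmoothCover p) {I : Bibundle BU1 A}
    {I' : Bibundle BU1 X} {M : Bibundle (A × A) A} {M' : Bibundle (X × X) X}
    (C : BibCover (𝟭 BU1) p I I') (D : BibCover (p.prod p) p M M') (h : ActsCentrally I M) :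
    ActsCentrally I' M' := by
  intro k x y z κ j a b l r h1 h2 h3
  obtain ⟨k, rfl⟩ := hp.surj k
  obtain ⟨x, rfl⟩ := hp.surj x
  obtain ⟨y, rfl⟩ := hp.surj y
  obtain ⟨κ, rfl⟩ := (hp.bij _ _).2 κ
  obtain ⟨l, rfl⟩ := (hp.bij _ _).2 l
  obtain ⟨r, rfl⟩ := (hp.bij _ _).2 r
  obtain ⟨j, rfl⟩ := (C.bij (SingleObj.star Circle) k).2 j
  obtain ⟨a, rfl⟩ := (D.bij (k, x) y).2 a
  obtain ⟨b, rfl⟩ := (D.bij (x, k) y).2 b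
  refine congrArg p.map (h (k := k) (x := x) z κ j a b l r ((C.bij _ _).1 ?_) ((D.bij _ _).1 ?_)
    ((D.bij _ _).1 ?_))
  · rw [C.act, C.act, p.map_id]
    exact h1
  · rw [D.act, D.act, p.map_id, (p.prod p).map_id]
    rw [← p.map_id] at h2
    exact h2
  · rw [D.act, D.act, p.map_id, (p.prod p).map_id]
    rw [← p.map_id x] at h3
    exact h3

end Central

/-! ### Projections to a Lie group as submersions -/

section ToDiscrete

variable {X T : Type} [Groupoid.{0} X] [SmoothStr X] [AddCommGroup T] [DiffeologicalSpace T]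

lemma toDiscrete_total_ext {G : TwoGroupData X} {π : X ⥤ Discrete T} {x : X} {t : Discrete T}
    (f : π.obj x ⟶ t) : (⟨x, π.obj x, 𝟙 _⟩ : (TwoGroupHom.toDiscrete G π).bib.Total) = ⟨x, t, f⟩ := by
  obtain rfl : π.obj x = t := Discrete.ext (Discrete.eq_of_hom f)
  rw [Subsingleton.elim f (𝟙 _)]

/-- An element of this bibundle is determined by its source object, so local sections of π on
objects are local sections of the right anchor. -/
lemma toDiscrete_isSubmersion {G : TwoGroupData X} {π : X ⥤ Discrete T} (hπ : IsSubmersion π.obj) :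
    IsSubmersion (fun b : (TwoGroupHom.toDiscrete G π).bib.Total => b.2.1) := by
  have heq : ∀ {x : X} {t : Discrete T}, (TwoGroupHom.toDiscrete G π).bib.Fib x t → π.obj x = t :=
    fun f => Discrete.ext (Discrete.eq_of_hom f)
  refine ⟨fun n p hp => ?_, fun n c v b hc hb => ?_⟩
  · have h : IsPlot (fun v => π.obj (p v).1) := (isPlot_prod.1 hp).2
    simp only [fun v => heq (p v).2.2] at h
    exact h
  · obtain ⟨x, t, f⟩ := b
    obtain rfl : t = c v := hb
    obtain ⟨x', hx', hv, he⟩ := hπ.2 n c v x hc (heq f)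
    refine ⟨fun w => ⟨x' w, π.obj (x' w), 𝟙 _⟩, isPlot_prod.2 ⟨hx', hπ.1 _ _ hx'⟩, ?_, he⟩
    subst hv
    exact toDiscrete_total_ext f

end ToDiscrete

/-! ### The inclusion of U(1) in the strict 2-group -/

section StrictIncl

variable {Λ : Type} [AddCommGroup Λ] {J : LinearMap.BilinForm ℤ Λ}

lemma strictIncl_h {x y : BU1} (z : x ⟶ y) :
    CrossedModule.Hom.h ((strictIncl J).map z) = (1, (show Circle from z)) := rfl

/-- The Lie algebra acts trivially on U(1) because J(0, x) = 0. This makes the inclusion of pt //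
U(1) monoidal. -/
lemma crossedModule_act_one (z : Circle) (x : Multiplicative (LieT Λ)) :
    (crossedModule J).act x (1, z) = (1, z) :=
  Prod.ext rfl (by
    change z * multiplier J 0 _ = z
    rw [multiplier_zero_left, mul_one])

/-- `1 ⟶ F 1` for the inclusion `F` of `pt // U(1)`. -/
noncomputable def strictInclε : 𝟙_ (StrictT J) ⟶ (strictIncl J).obj (𝟙_ BU1) := 𝟙 _

/-- `F x ⊗ F y ⟶ F (x ⊗ y)` for the inclusion `F` of `pt // U(1)`. -/
noncomputable def strictInclμ (x y : BU1) :
    (strictIncl J).obj x ⊗ (strictIncl J).obj y ⟶ (strictIncl J).obj (x ⊗ y) := (λ_ (𝟙_ _)).hom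

lemma strictInclε_h : CrossedModule.Hom.h (strictInclε (J := J)) = 1 := rfl

lemma strictInclμ_h (x y : BU1) : CrossedModule.Hom.h (strictInclμ (J := J) x y) = 1 :=
  CrossedModule.TwoGp.leftUnitor_h _

open CrossedModule.TwoGp in
lemma strictIncl_isMonoidal :
    IsMonoidalFunctor (strictIncl J) strictInclε strictInclμ where
  natural {x x' y y'} f g := CrossedModule.TwoGp.hom_ext (by
    rw [comp_h, comp_h, strictInclμ_h, strictInclμ_h,
      tensorHom_h, strictIncl_h, strictIncl_h, strictIncl_h,
      crossedModule_act_one, mul_one, one_mul]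
    exact Prod.ext (one_mul _) rfl)
  assoc x y z := CrossedModule.TwoGp.hom_ext (by
    rw [← tensorHom_id, ← id_tensorHom, comp_h, comp_h, comp_h, comp_h, tensorHom_h, tensorHom_h,
      strictInclμ_h, strictInclμ_h, strictInclμ_h, strictInclμ_h, associator_h, id_h, id_h,
      strictIncl_h, map_one, map_one, one_mul, one_mul, one_mul, one_mul, one_mul]
    rfl)
  left_unit x := CrossedModule.TwoGp.hom_ext (by
    rw [← tensorHom_id, comp_h, comp_h, tensorHom_h, strictInclμ_h, strictInclε_h, id_h,
      strictIncl_h, leftUnitor_h, map_one, one_mul, one_mul, one_mul]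
    rfl)
  right_unit x := CrossedModule.TwoGp.hom_ext (by
    rw [← id_tensorHom, comp_h, comp_h, tensorHom_h, strictInclμ_h, strictInclε_h, id_h,
      strictIncl_h, rightUnitor_h, map_one, one_mul, one_mul, one_mul]
    rfl)

lemma StrictT.label_comp {x y z : StrictT J} (f : x ⟶ y) (g : y ⟶ z) :
    (CrossedModule.Hom.h (f ≫ g)).2 = (CrossedModule.Hom.h f).2 * (CrossedModule.Hom.h g).2 := rfl

/-- Automorphisms are determined by their labels. -/
lemma StrictT.lattice_eq {x y : StrictT J} (hΛ : Function.Injective (lattice Λ)) (f g : x ⟶ y) :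
    (CrossedModule.Hom.h f).1 = (CrossedModule.Hom.h g).1 :=
  Multiplicative.toAdd.injective (hΛ (add_left_cancel
    ((StrictT.val_eq f).symm.trans (StrictT.val_eq g))))

lemma StrictT.hom_ext_label {x y : StrictT J} (hΛ : Function.Injective (lattice Λ)) {f g : x ⟶ y}
    (h : (CrossedModule.Hom.h f).2 = (CrossedModule.Hom.h g).2) : f = g :=
  CrossedModule.TwoGp.hom_ext (Prod.ext (StrictT.lattice_eq hΛ f g) h)

/-- An automorphism has lattice part 0, so its label is not twisted by x. Multiplying with κ from
either side therefore multiplies labels by the same element of the commutative group U(1). -/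
lemma StrictT.eq_of_central (hΛ : Function.Injective (lattice Λ)) {k x y : StrictT J} {κ : k ⟶ k}
    {a : k ⊗ x ⟶ y} {b : x ⊗ k ⟶ y}
    {l r : y ⟶ y} (h1 : (κ ⊗ₘ 𝟙 x) ≫ a ≫ 𝟙 y = (𝟙 k ⊗ₘ 𝟙 x) ≫ a ≫ l)
    (h2 : (𝟙 x ⊗ₘ κ) ≫ b ≫ 𝟙 y = (𝟙 x ⊗ₘ 𝟙 k) ≫ b ≫ r) : l = r := by
  have e1 := congrArg (fun f => (CrossedModule.Hom.h f).2) h1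
  have e2 := congrArg (fun f => (CrossedModule.Hom.h f).2) h2
  have hκ : (CrossedModule.Hom.h κ).1 = 1 := StrictT.lattice_eq hΛ κ (𝟙 k)
  simp only [StrictT.label_comp, StrictT.tensorHom_label, CrossedModule.TwoGp.id_h, hκ,
    Prod.fst_one, Prod.snd_one, toAdd_one, multiplier_zero_left, mul_one, one_mul] at e1 e2
  refine StrictT.hom_ext_label hΛ ?_
  exact (mul_left_cancel ((mul_comm _ _).trans e1)).symm.trans
    (mul_left_cancel ((mul_comm _ _).trans e2))

lemma strict_actsCentrally (hΛ : Function.Injective (lattice Λ)) :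
    ActsCentrally (strictExt J).incl.bib (strictExt J).G.mul :=
  fun _ _ _ _ _ _ _ _ h1 h2 => StrictT.eq_of_central hΛ h1 h2

lemma isMonoidalFunctor_id (C : Type*) [Category C] [MonoidalCategory C] :
    IsMonoidalFunctor (𝟭 C) (𝟙 _) (fun _ _ => 𝟙 _) where
  natural f g := by simp
  assoc x y z := by simp
  left_unit x := by simp
  right_unit x := by simp

end StrictIncl


/-! ## The strict extension -/

section StrictExt

variable {Λ : Type} [AddCommGroup Λ] {J : LinearMap.BilinForm ℤ Λ}

lemma texp_eq_zero_iff {x : LieT Λ} : texp x = 0 ↔ ∃ m, x = lattice Λ m := by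
  constructor
  · intro h
    obtain ⟨m, hm⟩ := exists_lattice_of_texp_eq (x := 0) (h.symm : texp 0 = texp x)
    exact ⟨m, hm.trans (zero_add _)⟩
  · rintro ⟨m, rfl⟩
    have := texp_add_lattice (0 : LieT Λ) m
    rwa [zero_add] at this

lemma texp_eq_zero_of_hom {y : StrictT J} (f : 𝟙_ (StrictT J) ⟶ y) : texp y.val.toAdd = 0 :=
  (texp_eq_of_hom J f).symm

/-- The arrow `0 ⟶ m` with label `z`. -/
noncomputable def StrictT.unitArrow (y : StrictT J) (m : Λ) (z : Circle) (h : y.val.toAdd = lattice Λ m) :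
    𝟙_ (StrictT J) ⟶ y :=
  StrictT.arrow _ y m z (h.trans (zero_add _).symm)

lemma strictIncl_smooth {n : ℕ} {x y : Euc n → BU1} {f : ∀ v, x v ⟶ y v} (hf : SmoothArr f) :
    SmoothArr (fun v => (strictIncl J).map (f v)) :=
  smoothArr_strict.2 ⟨isPlot_const (x := (0 : LieT Λ)), @isPlot_const _ (latticeDiff Λ) _ 0,
    smoothArr_bu1.1 hf⟩

variable [Module.Free ℤ Λ] [Module.Finite ℤ Λ]

lemma strictIncl_plots {n : ℕ} {x : Euc n → BU1} {y : Euc n → StrictT J}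
    {b : ∀ v, (strictIncl J).obj (x v) ⟶ y v} :
    @IsPlot _ (inducedDiff (fun b => (⟨_, b.2.1, b.2.2⟩ : Arr (StrictT J))) inferInstance) n
      (fun v => (⟨x v, y v, b v⟩ : Σ x : BU1, Σ y : StrictT J, ((strictIncl J).obj x ⟶ y))) ↔
      IsPlot x ∧ SmoothArr b :=
  ⟨fun h => ⟨isPlot_bu1, h⟩, And.right⟩

theorem strictIncl_isHom : (strictExt J).incl.IsHom :=
  isSmoothMonoidal_bu1.ofMonoidal_isHom isSmoothMonoidal_strict strictIncl_isMonoidal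
    (fun _ _ _ => isPlot_const) strictIncl_smooth
    (fun _ _ => smoothArr_of_label_one (isPlot_const (x := 𝟙_ _ ⊗ 𝟙_ _)) fun _ => strictInclμ_h _ _) strictIncl_plots

/-- The kernel consists of the lattice points, each reached from 0 by an arrow with arbitrary label.
Two arrows with the same target have the same lattice part and so differ by a unique element of
U(1). -/
theorem strictIncl_isLeftPrincipalOver :
    (strictExt J).incl.bib.IsLeftPrincipalOver {y : StrictT J | texp y.val.toAdd = 0} where
  right_mem {x y} b := texp_eq_zero_of_hom b
  right_surjective y hy := by
    obtain ⟨m, hm⟩ := texp_eq_zero_iff.1 hy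
    exact ⟨SingleObj.star Circle, ⟨StrictT.unitArrow y m 1 hm⟩⟩
  right_submersion n c v b hc hS hb := by
    choose m hm using fun w => texp_eq_zero_iff.1 (hS w)
    obtain ⟨⟨⟩, y, f⟩ := b
    obtain rfl : y = c v := hb
    change 𝟙_ (StrictT J) ⟶ c v at f
    -- The section keeps the label of f constant. The lattice vectors m w were chosen pointwise, but
    -- the endpoints determine them, so smoothness is a condition on the label alone.
    refine ⟨fun w => ⟨SingleObj.star Circle, c w,
      StrictT.unitArrow (c w) (m w) (CrossedModule.Hom.h f).2 (hm w)⟩, ?_, ?_,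
      .of_forall fun _ => rfl⟩
    · refine (smoothArr_strict_iff isPlot_const hc).2 isPlot_const
    · have : StrictT.unitArrow (c v) (m v) (CrossedModule.Hom.h f).2 (hm v) = f :=
        StrictT.hom_ext_label lattice_injective rfl
      exact congrArg (fun f : 𝟙_ (StrictT J) ⟶ c v =>
        (⟨SingleObj.star Circle, c v, f⟩ : (strictExt J).incl.bib.Total)) this
  division {x x' y} b b' := by
    change 𝟙_ (StrictT J) ⟶ y at b
    change 𝟙_ (StrictT J) ⟶ y at b'
    have key : ∀ f : Circle, (strictIncl J).map (X := x) (Y := x') f ≫ b' ≫ 𝟙 y = b ↔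
        f = (CrossedModule.Hom.h b).2 * ((CrossedModule.Hom.h b').2)⁻¹ := fun f => by
      rw [eq_mul_inv_iff_mul_eq]
      constructor
      · rintro rfl
        exact congrArg (f * ·) (mul_one _).symm
      · intro h
        exact StrictT.hom_ext_label lattice_injective ((congrArg (f * ·) (mul_one _)).trans h)
    exact ⟨_, (key _).2 rfl, fun f hf => (key f).1 hf⟩
  division_smooth n x x' y b' f hb hf := by
    change ∀ v, 𝟙_ (StrictT J) ⟶ y v at b'
    have h1 : IsPlot (fun v => (CrossedModule.Hom.h (b' v)).2) := (smoothArr_strict.1 hb).2.2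
    have h2 : IsPlot (fun v => (show Circle from f v) * ((CrossedModule.Hom.h (b' v)).2 * 1)) :=
      (smoothArr_strict.1 hf).2.2
    refine smoothArr_bu1.2 ?_
    have := h2.circle_mul h1.circle_inv
    simpa using this

lemma isSubmersion_compactProj_fst :
    IsSubmersion (compactProj J ⋙ CategoryTheory.Prod.fst _ _).obj := by
  refine ⟨fun n p hp => isPlot_coinduced_comp (f := texp) hp, fun n c v b hc hb => ?_⟩
  obtain ⟨c', hc', hv, he⟩ := isSubmersion_texp.2 n _ v b.val.toAdd (isPlot_discrete.1 hc)
    (congrArg Discrete.as hb)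
  refine ⟨fun w => ⟨Multiplicative.ofAdd (c' w)⟩, hc', CrossedModule.TwoGp.ext hv, ?_⟩
  filter_upwards [he] with w hw
  exact Discrete.ext hw

lemma isSubmersion_compact_fst :
    IsSubmersion (CategoryTheory.Prod.fst (Discrete (Torus Λ)) BU1).obj :=
  ⟨fun _ _ hp => (isPlot_prod.1 hp).1, fun n c v b hc hb => ⟨fun w => (c w, b.2),
    isPlot_prod.2 ⟨hc, isPlot_const⟩, Prod.ext hb.symm rfl, .of_forall fun _ => rfl⟩⟩

theorem isSmoothMonoidal_torus : IsSmoothMonoidal (Discrete (Torus Λ)) :=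
  isSmoothMonoidal_discrete hasAtlas_torus IsPlot.torus_add IsPlot.torus_neg

theorem strictExt_isCentralExtension : (strictExt J).IsCentralExtension where
  twoGroup := isSmoothMonoidal_strict.isLieTwoGroup
  incl_hom := strictIncl_isHom
  proj_hom := toDiscrete_isHom isSmoothMonoidal_torus isLieGroupoid_strict
    isSubmersion_compactProj_fst.1 (fun a => texp_eq_of_hom J a) texp_eq_zero_of_hom
  proj_submersion := toDiscrete_isSubmersion isSubmersion_compactProj_fst
  proj_surjective := by
    rintro ⟨t⟩
    exact ⟨⟨Multiplicative.ofAdd (rep t)⟩, ⟨Discrete.eqToHom (texp_rep t)⟩⟩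
  exact := by
    refine cast (congrArg _ (Set.ext fun y => ?_)) (strictIncl_isLeftPrincipalOver (J := J))
    exact ⟨fun h => ⟨Discrete.eqToHom h⟩, fun ⟨f⟩ => Discrete.eq_of_hom f⟩
  central := strict_actsCentrally lattice_injective

end StrictExt


/-! ## The compact model and the multiplicative bundle gerbe as extensions -/

/-- Compatibility of ε with the multiplication of the unit object. It is what makes ε a monoidal
comparison between the two inclusions of pt // U(1) in ℐ. -/
lemma IsMonoidalFunctor.tensor_ε {C D : Type*} [Category C] [Category D] [MonoidalCategory C]
    [MonoidalCategory D] {F : C ⥤ D} {ε : 𝟙_ D ⟶ F.obj (𝟙_ C)}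
    {μ : ∀ x y : C, F.obj x ⊗ F.obj y ⟶ F.obj (x ⊗ y)} (hF : IsMonoidalFunctor F ε μ) :
    (ε ⊗ₘ ε) ≫ μ (𝟙_ C) (𝟙_ C) ≫ F.map (λ_ (𝟙_ C)).hom = (λ_ (𝟙_ D)).hom ≫ ε := by
  rw [MonoidalCategory.tensorHom_def', Category.assoc, hF.left_unit, leftUnitor_naturality]

lemma comp_map_id {C D : Type*} [Category C] [Category D] (F : C ⥤ D) {d : D} {c : C}
    (f : d ⟶ F.obj c) : f ≫ F.map (𝟙 c) = f := by simp

lemma tensor_id_comp_map_id {C D : Type*} [Category C] [Category D] [MonoidalCategory D] (F : C ⥤ D)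
    {x y : D} {c : C} (f : x ⊗ y ⟶ F.obj c) : (𝟙 x ⊗ₘ 𝟙 y) ≫ f ≫ F.map (𝟙 c) = f ≫ 𝟙 _ := by simp

section Extensions

variable {Λ : Type} [AddCommGroup Λ] {J : LinearMap.BilinForm ℤ Λ}

/-- The isomorphism from the inclusion of `pt // U(1)` in `ℐ` to the composite with `F`. -/
noncomputable def gerbeInclIso : gerbeIncl J ⟶ strictIncl J ⋙ compactProj J ⋙ gerbePres J where
  app _ := gerbeFunctorε J
  naturality _ _ z := gerbeIncl_ε z

instance (x : BU1) : IsIso ((gerbeInclIso (J := J)).app x) :=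
  (inferInstance : IsIso (gerbeFunctorε J))

/-- The identity of `F`, factored through the compact model. -/
noncomputable def gerbeFunctorIso : gerbeFunctor J ⟶ 𝟭 _ ⋙ compactProj J ⋙ gerbePres J where
  app _ := 𝟙 _

instance (x : StrictT J) : IsIso ((gerbeFunctorIso (J := J)).app x) :=
  (inferInstance : IsIso (𝟙 ((gerbeFunctor J).obj x)))

variable [Module.Free ℤ Λ] [Module.Finite ℤ Λ]

variable (J) in
/-- The compact model is covered by the strict 2-group. -/
noncomputable def compactCover : TwoGroupCover (compactProj J) (strictTwoGroup J)
    (compactTwoGroup J) :=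
  transportCover isSmoothCover_compactProj isSmoothMonoidal_strict isLieGroupoid_compact

variable (J) in
/-- The multiplicative bundle gerbe is covered by the strict 2-group. -/
noncomputable def gerbeCover : TwoGroupCover (compactProj J) (strictTwoGroup J) (gerbeTwoGroup J) :=
  gerbe_isMonoidalModel.twoGroupCover isLieGroupoid_strict

variable (J) in
noncomputable def compactInclCover : HomCover (TwoGroupCover.refl isSmoothMonoidal_bu1.isLieTwoGroup)
    (compactCover J) (strictExt J).incl (compactExt J).incl :=
  transportHomCover (F := strictIncl J) (ε := 𝟙 _) (μ := fun _ _ => (λ_ _).hom)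
    isSmoothCover_compactProj isSmoothMonoidal_bu1 isSmoothMonoidal_strict
    isLieGroupoid_compact (fun _ _ _ => isPlot_const) strictIncl_plots

-- The inclusion into ℐ starts at (1, ℂ), while F of the strict inclusion starts at F 0. Conjugation
-- by ε identifies them, and `IsMonoidalFunctor.tensor_ε` makes this identification monoidal.
variable (J) in
noncomputable def gerbeInclCover : HomCover (TwoGroupCover.refl isSmoothMonoidal_bu1.isLieTwoGroup)
    (gerbeCover J) (strictExt J).incl (gerbeExt J).incl :=
  gerbe_isMonoidalModel.homCover isLieGroupoid_strict isSmoothMonoidal_bu1 gerbeInclIso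
    ((Category.id_comp _).trans (comp_map_id (gerbeFunctor J) _).symm)
    (fun _ _ => gerbeFunctor_isMonoidal.tensor_ε)
    strictIncl_plots
    (fun {_ _ _ b} _ hy => gerbe_isMonoidalModel.unit_smooth (h := b) hy)
    (fun {_ _ _ b} hb => ⟨isPlot_bu1,
      gerbe_isMonoidalModel.unit_plots (x := fun _ => pt) (c := b) hb⟩)

/-- The smooth structure on the identity bibundle. -/
@[reducible] def idDiff (A : Type) [Groupoid.{0} A] [SmoothStr A] :
    DiffeologicalSpace (Σ x : A, Σ y : A, (x ⟶ y)) :=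
  inducedDiff (fun b => ((b.1, (⟨b.1, b.2.1, b.2.2⟩ : Arr A)) : A × Arr A)) inferInstance

lemma isPlot_idDiff {A : Type} [Groupoid.{0} A] [SmoothStr A] {n : ℕ} {x y : Euc n → A}
    {b : ∀ v, x v ⟶ y v} :
    @IsPlot _ (idDiff A) n (fun v => ⟨x v, y v, b v⟩) ↔ IsPlot x ∧ SmoothArr b := isPlot_prod

/-- The identity 1-morphism of the 2-group of a groupoid with a functorial multiplication. -/
def TwoGroupHom.idStrict (A : Type) [Groupoid.{0} A] [SmoothStr A] [MonoidalCategory A] :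
    TwoGroupHom (TwoGroupData.ofStrict A) (TwoGroupData.ofStrict A) :=
  TwoGroupHom.ofMonoidal (𝟭 A) (𝟭 A) (𝟭 A) (𝟙 _) (fun _ _ => 𝟙 _) (idDiff A)

lemma TwoGroupHom.idStrict_isHom {A : Type} [Groupoid.{0} A] [SmoothStr A] [MonoidalCategory A]
    (hA : IsSmoothMonoidal A) : (TwoGroupHom.idStrict A).IsHom :=
  hA.ofMonoidal_isHom hA (isMonoidalFunctor_id A) (fun _ _ h => h) (fun h => h)
    (fun hx hy => hA.lie.smoothArr_id (hA.tensorObj hx hy)) isPlot_idDiff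

-- Pulling the target back along p turns the 1-morphism p into the identity of the strict 2-group,
-- so its properties reduce to those of the identity.
variable (J) in
noncomputable def strictToCompactCover :
    HomCover (TwoGroupCover.refl isSmoothMonoidal_strict.isLieTwoGroup)
    (compactCover J) (TwoGroupHom.idStrict (StrictT J)) (strictToCompact J) :=
  transportHomCover (F := 𝟭 (StrictT J)) (ε := 𝟙 _) (μ := fun _ _ => 𝟙 _)
    isSmoothCover_compactProj isSmoothMonoidal_strict isSmoothMonoidal_strict
    isLieGroupoid_compact (fun _ _ h => h) isPlot_idDiff

-- The same for F, using that F is p followed by the presentation. The value at 1 of an element of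
-- its bibundle is the label of the corresponding arrow, which matches the smooth structures.
variable (J) in
noncomputable def strictToGerbeCover :
    HomCover (TwoGroupCover.refl isSmoothMonoidal_strict.isLieTwoGroup)
    (gerbeCover J) (TwoGroupHom.idStrict (StrictT J)) (strictToGerbe J) :=
  gerbe_isMonoidalModel.homCover isLieGroupoid_strict isSmoothMonoidal_strict gerbeFunctorIso
    ((Category.comp_id _).trans (comp_map_id (gerbeFunctor J) _).symm)
    (fun x y => tensor_id_comp_map_id (gerbeFunctor J) (gerbeFunctorφ J x y))
    isPlot_idDiff
    (fun {_ _ _ b} hx hy => by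
      rw [smoothArr_strict_iff hx hy]
      exact isPlot_prod.trans ((and_iff_right hx).trans (iff_of_eq (congrArg (IsPlot (X := ℂ))
        (funext fun v => mul_one (M := ℂ) (CrossedModule.Hom.h (b v)).2)))))
    (fun {n x y b} hb => by
      have hx : IsPlot x := (isPlot_prod.1 hb).1
      have h : IsPlot (fun v => texp (x v).val.toAdd) := isPlot_coinduced_comp (f := texp) hx
      have e : ∀ v, texp (x v).val.toAdd = (y v).1.as := fun v => GerbeHom.base_eq (b v)
      exact ⟨hx, isPlot_compact.2 (cast (congrArg IsPlot (funext e)) h)⟩)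

variable (J) in
/-- The 1-morphism from the compact model to the multiplicative bundle gerbe. -/
noncomputable def compactToGerbe : TwoGroupHom (compactTwoGroup J) (gerbeTwoGroup J) :=
  gerbe_isMonoidalModel.fromTransport

variable (J) in
noncomputable def compactToGerbeCover : HomCover (compactCover J) (gerbeCover J)
    (TwoGroupHom.idStrict (StrictT J)) (compactToGerbe J) :=
  gerbe_isMonoidalModel.fromTransportCover isSmoothMonoidal_strict isLieGroupoid_compact
    isPlot_idDiff

end Extensions


/-! ### Cancellation in composites along fully faithful functors -/

section CompositionLemmas

variable {C D E : Type*} [Category C] [Category D] [Category E]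

lemma map_comp_map_eq_iff {F : C ⥤ D}
    (hF : ∀ x y, Function.Bijective (F.map : (x ⟶ y) → (F.obj x ⟶ F.obj y))) {x y z : C}
    (k : x ⟶ y) (l : y ⟶ z) (m : x ⟶ z) : F.map k ≫ F.map l = F.map m ↔ k ≫ l = m := by
  rw [← F.map_comp, (hF x z).1.eq_iff]

lemma comp_map_comp_map_eq_iff {F : C ⥤ D}
    (hF : ∀ x y, Function.Bijective (F.map : (x ⟶ y) → (F.obj x ⟶ F.obj y))) {x y z : C} {d : D}
    (e : d ⟶ F.obj x) (he : IsIso e) (k : x ⟶ y) (l : y ⟶ z) (m : x ⟶ z) :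
    e ≫ F.map k ≫ 𝟙 _ ≫ F.map l = e ≫ F.map m ↔ k ≫ l = m := by
  rw [Category.id_comp, cancel_epi, map_comp_map_eq_iff hF]

lemma comp_map_map_eq_iff {p : C ⥤ D} {j : D ⥤ E}
    (hF : ∀ x y, Function.Bijective ((p ⋙ j).map : (x ⟶ y) → _)) {x y z : C} {d : E}
    (e : d ⟶ (p ⋙ j).obj x) (he : IsIso e) (k : x ⟶ y) (l : y ⟶ z) (m : x ⟶ z) :
    e ≫ j.map (p.map k ≫ p.map l) = e ≫ (p ⋙ j).map m ↔ k ≫ l = m := by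
  rw [cancel_epi, ← p.map_comp, ← Functor.comp_map, (hF x z).1.eq_iff]

end CompositionLemmas

/-! ### The three central extensions and their equivalences -/

section MainTheorem

variable {Λ : Type} [AddCommGroup Λ] [Module.Free ℤ Λ] [Module.Finite ℤ Λ]
  {J : LinearMap.BilinForm ℤ Λ}

theorem compactExt_isCentralExtension : (compactExt J).IsCentralExtension where
  twoGroup := (compactCover J).isLieTwoGroup isSmoothCover_compactProj
    isSmoothMonoidal_strict.isLieTwoGroup isLieGroupoid_compact
  incl_hom := (compactInclCover J).isHom .refl isSmoothCover_compactProj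
    isLieGroupoid_bu1.hasSmoothEnds isLieGroupoid_compact.hasSmoothEnds strictIncl_isHom
  proj_hom := toDiscrete_isHom isSmoothMonoidal_torus isLieGroupoid_compact
    isSubmersion_compact_fst.1
    -- That a class of zig-zags over (s, t; r) forces s + t = r is read off from its image, an arrow
    -- of ℐ.
    (fun a => GerbeHom.base_eq ((gerbe_isMonoidalModel (J := J)).ofZigzag a))
    (fun a => (CompactT.base_eq a).symm)
  proj_submersion := toDiscrete_isSubmersion isSubmersion_compact_fst
  proj_surjective t := ⟨(t, SingleObj.star Circle), ⟨𝟙 _⟩⟩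
  -- The preimage under p of the kernel is the kernel of the strict extension, so exactness
  -- descends.
  exact := (compactInclCover J).bib.isLeftPrincipalOver .refl isSmoothCover_compactProj
    (strictExt_isCentralExtension (J := J)).exact
  central := ActsCentrally.of_cover isSmoothCover_compactProj
    (compactInclCover J).bib (compactCover J).mulCover
    (strict_actsCentrally lattice_injective)

theorem gerbeExt_isCentralExtension : (gerbeExt J).IsCentralExtension where
  twoGroup := (gerbeCover J).isLieTwoGroup isSmoothCover_compactProj
    isSmoothMonoidal_strict.isLieTwoGroup isLieGroupoid_compact
  incl_hom := (gerbeInclCover J).isHom .refl isSmoothCover_compactProj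
    isLieGroupoid_bu1.hasSmoothEnds isLieGroupoid_compact.hasSmoothEnds strictIncl_isHom
  proj_hom := toDiscrete_isHom isSmoothMonoidal_torus isLieGroupoid_compact
    isSubmersion_compact_fst.1 (fun a => GerbeHom.base_eq a) (fun a => (GerbeHom.base_eq a).symm)
  proj_submersion := toDiscrete_isSubmersion isSubmersion_compact_fst
  proj_surjective t := ⟨(t, SingleObj.star Circle), ⟨𝟙 _⟩⟩
  exact := (gerbeInclCover J).bib.isLeftPrincipalOver .refl isSmoothCover_compactProj
    (strictExt_isCentralExtension (J := J)).exact
  central := ActsCentrally.of_cover isSmoothCover_compactProj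
    (gerbeInclCover J).bib (gerbeCover J).mulCover
    (strict_actsCentrally lattice_injective)

lemma idStrict_isInvertible :
    (TwoGroupHom.idStrict (StrictT J)).bib.IsInvertible :=
  isInvertible_id isLieGroupoid_strict isPlot_idDiff

lemma gerbeFunctor_bijective (x y : StrictT J) :
    Function.Bijective ((compactProj J ⋙ gerbePres J).map : (x ⟶ y) → _) :=
  gerbe_isMonoidalModel.comp_bij x y

theorem strictToCompact_isHom : (strictToCompact J).IsHom :=
  (strictToCompactCover J).isHom .refl isSmoothCover_compactProj
    isLieGroupoid_strict.hasSmoothEnds isLieGroupoid_compact.hasSmoothEnds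
    (TwoGroupHom.idStrict_isHom isSmoothMonoidal_strict)

theorem strictToGerbe_isHom : (strictToGerbe J).IsHom :=
  (strictToGerbeCover J).isHom .refl isSmoothCover_compactProj
    isLieGroupoid_strict.hasSmoothEnds isLieGroupoid_compact.hasSmoothEnds
    (TwoGroupHom.idStrict_isHom isSmoothMonoidal_strict)

theorem compactToGerbe_isHom : (compactToGerbe J).IsHom :=
  (compactToGerbeCover J).isHom isSmoothCover_compactProj isSmoothCover_compactProj
    isLieGroupoid_compact.hasSmoothEnds isLieGroupoid_compact.hasSmoothEnds
    (TwoGroupHom.idStrict_isHom isSmoothMonoidal_strict)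

lemma strict_isCompIso_id :
    TwoGroupHom.IsCompIso (strictExt J).incl (TwoGroupHom.idStrict (StrictT J)) (strictExt J).incl
      (fun {x y z} (k : (strictIncl J).obj x ⟶ y) (l : y ⟶ z) (r : (strictIncl J).obj x ⟶ z) =>
        k ≫ l = r) :=
  isCompIso_id (S := strictIncl J) (ε := 𝟙 _) (μ := fun _ _ => (λ_ _).hom)
    isSmoothMonoidal_strict strictIncl_plots isPlot_idDiff

/-- Invertibility and compatibility with the inclusions descend from the identity of the strict
2-group; compatibility with the projections holds because p preserves the point of T. -/
theorem strictToCompact_isEquivalence :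
    (strictExt J).IsEquivalence (compactExt J) (strictToCompact J) where
  hom := strictToCompact_isHom
  invertible := (strictToCompactCover J).bib.isInvertible .refl isSmoothCover_compactProj
    idStrict_isInvertible
  incl := ⟨fun {x y z} (k : (strictIncl J).obj x ⟶ y) (l : (compactProj J).obj y ⟶ z)
      (m : (compactProj J).obj ((strictIncl J).obj x) ⟶ z) => (compactProj J).map k ≫ l = m,
    strict_isCompIso_id.of_cover
      (HomCover.refl isSmoothMonoidal_bu1.isLieTwoGroup isSmoothMonoidal_strict.isLieTwoGroup
        strictIncl_isHom.bibundle)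
      (strictToCompactCover J) (compactInclCover J) .refl .refl isSmoothCover_compactProj _
      fun {x y z} k l m => map_comp_map_eq_iff (fun x y => isSmoothCover_compactProj.bij x y)
        (x := (strictIncl J).obj x) (y := y) (z := z) k l m⟩
  proj := ⟨fun _ _ _ => True, isCompIso_toDiscrete isSubmersion_compactProj_fst.1
    strictToCompact_isHom.bibundle
    (fun f => Discrete.ext (CompactT.base_eq f))⟩

theorem strictToGerbe_isEquivalence :
    (strictExt J).IsEquivalence (gerbeExt J) (strictToGerbe J) where
  hom := strictToGerbe_isHom
  invertible := (strictToGerbeCover J).bib.isInvertible .refl isSmoothCover_compactProj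
    idStrict_isInvertible
  incl := ⟨fun {x y z} (k : (strictIncl J).obj x ⟶ y)
      (l : (gerbeFunctor J).obj y ⟶ (gerbePres J).obj z)
      (m : (gerbeIncl J).obj x ⟶ (gerbePres J).obj z) =>
      -- The factor ε bridges the unit object (1, ℂ), where the inclusion into ℐ starts, and F 0,
      -- where the composite starts.
      gerbeFunctorε J ≫ (gerbeFunctor J).map k ≫ l = m,
    strict_isCompIso_id.of_cover
      (HomCover.refl isSmoothMonoidal_bu1.isLieTwoGroup isSmoothMonoidal_strict.isLieTwoGroup
        strictIncl_isHom.bibundle)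
      (strictToGerbeCover J) (gerbeInclCover J) .refl .refl isSmoothCover_compactProj _
      fun {x y z} k l m => comp_map_comp_map_eq_iff gerbeFunctor_bijective (gerbeFunctorε J)
        (inferInstance : IsIso (gerbeFunctorε J)) (x := (strictIncl J).obj x) (y := y) (z := z) k l m⟩
  proj := ⟨fun _ _ _ => True, isCompIso_toDiscrete isSubmersion_compactProj_fst.1
    strictToGerbe_isHom.bibundle
    (fun f => Discrete.ext (GerbeHom.base_eq f))⟩

lemma compactToGerbe_isInvertible : (compactToGerbe J).bib.IsInvertible :=
  (compactToGerbeCover J).bib.isInvertible isSmoothCover_compactProj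
    isSmoothCover_compactProj idStrict_isInvertible

/-- On lifted elements the comparison between the inclusions reads as plain composition in the
strict groupoid, since ε is invertible and F is faithful. -/
lemma compactToGerbe_incl_iff {x : BU1} {y z : StrictT J} (k : (strictIncl J).obj x ⟶ y)
    (l : y ⟶ z) (m : (strictIncl J).obj x ⟶ z) :
    gerbeFunctorε J ≫ (gerbePres J).map ((compactInclCover J).bib.θ (a := x) k ≫
      (compactToGerbeCover J).bib.θ (a := y) (b := z) l) =
      (gerbeInclCover J).bib.θ (a := x) (b := z) m ↔ k ≫ l = m :=
  comp_map_map_eq_iff (p := compactProj J) (j := gerbePres J) gerbeFunctor_bijective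
    (gerbeFunctorε J) (inferInstance : IsIso (gerbeFunctorε J)) (x := (strictIncl J).obj x) k l m

lemma compactToGerbe_incl :
    TwoGroupHom.IsCompIso (compactExt J).incl (compactToGerbe J) (gerbeExt J).incl
      (fun {x y z} (k : (compactProj J).obj ((strictIncl J).obj x) ⟶ y) (l : y ⟶ z)
        (m : (gerbeIncl J).obj x ⟶ (gerbePres J).obj z) =>
        gerbeFunctorε J ≫ (gerbePres J).map (k ≫ l) = m) :=
  strict_isCompIso_id.of_cover (compactInclCover J) (compactToGerbeCover J) (gerbeInclCover J)
    .refl isSmoothCover_compactProj isSmoothCover_compactProj _ compactToGerbe_incl_iff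

lemma compactToGerbe_proj :
    TwoGroupHom.IsCompIso (compactToGerbe J) (gerbeExt J).proj (compactExt J).proj
      (fun _ _ _ => True) :=
  isCompIso_toDiscrete isSubmersion_compact_fst.1 compactToGerbe_isHom.bibundle
    (fun f => Discrete.ext (CompactT.base_eq f))

theorem compactToGerbe_isEquivalence :
    (compactExt J).IsEquivalence (gerbeExt J) (compactToGerbe J) where
  hom := compactToGerbe_isHom
  invertible := compactToGerbe_isInvertible
  incl := ⟨_, compactToGerbe_incl⟩
  proj := ⟨_, compactToGerbe_proj⟩

end MainTheorem

theorem mainTheorem3 (Λ : Type) [AddCommGroup Λ] [Module.Free ℤ Λ] [Module.Finite ℤ Λ]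
    (J : LinearMap.BilinForm ℤ Λ) :
    (bu1.IsLieTwoGroup ∧ (discreteTwoGroup (Torus Λ)).IsLieTwoGroup) ∧
    ((strictExt J).IsCentralExtension ∧ (compactExt J).IsCentralExtension ∧
      (gerbeExt J).IsCentralExtension) ∧
    (strictExt J).IsEquivalence (compactExt J) (strictToCompact J) ∧
    (strictExt J).IsEquivalence (gerbeExt J) (strictToGerbe J) ∧
    (∃ H : TwoGroupHom (compactExt J).G (gerbeExt J).G,
      (compactExt J).IsEquivalence (gerbeExt J) H) ∧
    IsMonoidalEquivalence (gerbeFunctor J) (gerbeFunctorε J) (gerbeFunctorφ J) ∧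
    gerbeFunctor J ⋙ gerbeBase J = compactProj J ⋙ CategoryTheory.Prod.fst _ _ ∧
    (∀ z : SingleObj.star Circle ⟶ SingleObj.star Circle,
      (gerbeIncl J).map z ≫ gerbeFunctorε J =
        gerbeFunctorε J ≫ (gerbeFunctor J).map ((strictIncl J).map z)) ∧
    (gerbePres J).IsEquivalence :=
  ⟨⟨isSmoothMonoidal_bu1.isLieTwoGroup, isSmoothMonoidal_torus.isLieTwoGroup⟩,
    ⟨strictExt_isCentralExtension, compactExt_isCentralExtension, gerbeExt_isCentralExtension⟩,
    strictToCompact_isEquivalence, strictToGerbe_isEquivalence,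
    ⟨compactToGerbe J, compactToGerbe_isEquivalence⟩,
    gerbeFunctor_isMonoidalEquivalence lattice_injective, gerbeFunctor_gerbeBase, gerbeIncl_ε,
    gerbePres_isEquivalence⟩
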